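/- Notation. Let $N\ge 1$, let $t=(t_1>t_2>\dots>t_N)$ be integers, and write $(y)_k=y(y+1)\cdots(y+k-1)$. For integers $x_1,x_2$ and $1\le n_1,n_2<N$ the correlation kernel (due to Petrov) of the uniformly random Gelfand--Tsetlin pattern with top row $t$ is $$K(x_1,n_1;x_2,n_2)=-\mathbf 1_{n_2<n_1}\mathbf 1_{x_2\le x_1}\frac{(x_1-x_2+1)_{n_1-n_2-1}}{(n_1-n_2-1)!}+\frac{(N-n_1)!}{(N-n_2-1)!}\,\frac1{(2\pi\mathbf i)^2}\oint dz\oint dw\,\frac{(z-x_2+1)_{N-n_2-1}}{(w-x_1)_{N-n_1+1}}\,\frac1{w-z}\prod_{r=1}^N\frac{w-t_r}{z-t_r},$$ where both contours are positively oriented, the $z$-contour encloses the integers $x_2,x_2+1,\dots,t_1$ and no other integers (the integral is $0$ if $x_2>t_1$), and the $w$-contour is a large circle enclosing the $z$-contour and all the points $x_1,x_1-1,\dots,x_1-(N-n_1)$. For $\kappa=1,2$ let $\tau_\kappa$ denote a critical point in the upper half-plane of $G_\kappa(z)=\sum_{a=1}^{N-n_\kappa}\ln(z-x_\kappa+a)-\sum_{r=1}^N\ln(z-t_r)$,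 i.e. a solution with $\Im\tau_\kappa>0$ of $$\sum_{a=1}^{N-n_\kappa}\frac1{z-x_\kappa+a}=\sum_{r=1}^N\frac1{z-t_r}.$$ Theorem. Fix a real $D>0$. For every $\varepsilon>0$ there is $N_0=N_0(D,\varepsilon)$ such that the following holds for all $N\ge N_0$, all integers $t_1>\dots>t_N$, all integers $x_1,x_2$ and all integers $1\le n_1,n_2<N$. Suppose that $$\sum_{i=1}^N\ln^{1+1/D}\bigl(1+|t_i|/N\bigr)<DN,\qquad |x_1-x_2|+|n_1-n_2|<D,\qquad n_1>N/D,$$ and that $\tau_1,\tau_2$ as above exist and satisfy $\Im\tau_\kappa>N/D$ and $|\tau_\kappa|<DN$ for $\kappa=1,2$. Then $$\left|K(x_1,n_1;x_2,n_2)-\frac{(1-n_1/N)^{1+n_2-n_1}}{2\pi\mathbf i}\int_{\bar\tau_1/N}^{\tau_1/N}\frac{(u-x_1/N)^{x_2-x_1-1}}{(u-x_1/N+1-n_1/N)^{x_2-x_1+n_2-n_1+1}}\,du\right|<\varepsilon,$$ where the integration contour crosses the real axis exactly once, at a point to the right of $x_1/N$ when $n_2\ge n_1$, and at a point of the interval $\bigl(\tfrac{x_1+n_1-N}{N},\tfrac{x_1}{N}\bigr)$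 when $n_2<n_1$. Equivalently, in terms of the incomplete Beta kernel, $$\left|K(x_1,n_1;x_2,n_2)-\frac1{2\pi\mathbf i}\int_{\bar\xi}^{\xi}w^{x_2-x_1-1}(1-w)^{n_2-n_1}\,dw\right|<\varepsilon,\qquad \xi=\frac{\tau_1/N-x_1/N}{\tau_1/N-x_1/N+1-n_1/N},$$ where the integration contour crosses the real axis exactly once, at a point of $(0,1)$ when $n_2\ge n_1$ and at a point of $(-\infty,0)$ when $n_2<n_1$. -/

import Mathlib

noncomputable section

namespace GTBulk

open scoped BigOperators

/-- The first (largest) entry `t_1` of the top row `t_1 > t_2 > ... > t_N`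
is `t 0`; the row is indexed by `Fin N`, so `t_r` is `t (r - 1)`. -/
abbrev TopRow (N : ℕ) : Type := Fin N → ℤ

/-- The ascending Pochhammer symbol `(y)_k = y (y + 1) ... (y + k - 1)`. -/
def poch (y : ℂ) (k : ℕ) : ℂ := ∏ i ∈ Finset.range k, (y + (i : ℂ))

/-- The integrand of the double contour integral in the correlation kernel. -/
def kernelIntegrand (N : ℕ) (t : TopRow N) (x₁ : ℤ) (n₁ : ℕ) (x₂ : ℤ) (n₂ : ℕ) (z w : ℂ) : ℂ :=
  poch (z - (x₂ : ℂ) + 1) (N - n₂ - 1) / poch (w - (x₁ : ℂ)) (N - n₁ + 1) * (1 / (w - z)) *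
    ∏ r : Fin N, (w - (t r : ℂ)) / (z - (t r : ℂ))

/-- Centre of the circle which is the `z`-contour: the circle meets the real axis at
`x₂ - 1/2` and `t_1 + 1/2`. -/
def zCenter {N : ℕ} [NeZero N] (t : TopRow N) (x₂ : ℤ) : ℝ := ((x₂ : ℝ) + (t 0 : ℝ)) / 2

/-- Radius of the `z`-contour. The circle encloses exactly the integers
`x₂, x₂ + 1, ..., t_1`; it degenerates to a point (and the integral vanishes) if there are none. -/
def zRadius {N : ℕ} [NeZero N] (t : TopRow N) (x₂ : ℤ) : ℝ :=
  max 0 (((t 0 : ℝ) - (x₂ : ℝ) + 1) / 2)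

/-- The circle of radius `R` around `0` is large enough to be the `w`-contour: it encloses
the `z`-contour and the zeros `x₁, x₁ - 1, ..., x₁ - (N - n₁)` of the denominator in `w`. -/
def IsLargeRadius (N : ℕ) [NeZero N] (t : TopRow N) (x₁ : ℤ) (n₁ : ℕ) (x₂ : ℤ) (R : ℝ) : Prop :=
  (∀ z ∈ Metric.closedBall ((zCenter t x₂ : ℝ) : ℂ) (zRadius t x₂), ‖z‖ < R) ∧
    ∀ j ∈ Finset.range (N - n₁ + 1), |(x₁ : ℝ) - (j : ℝ)| < R

/-- The correlation kernel `K(x₁, n₁; x₂, n₂)` of uniformly random Gelfand-Tsetlin patterns with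
top row `t` (for `n₁, n₂ < N`), the `w`-contour being the circle of radius `R` around `0`.
Both contours are positively oriented. -/
def petrovKernel (N : ℕ) [NeZero N] (t : TopRow N) (x₁ : ℤ) (n₁ : ℕ) (x₂ : ℤ) (n₂ : ℕ)
    (R : ℝ) : ℂ :=
  -(if n₂ < n₁ ∧ x₂ ≤ x₁ then
      poch ((x₁ : ℂ) - (x₂ : ℂ) + 1) (n₁ - n₂ - 1) / ((n₁ - n₂ - 1).factorial : ℂ) else 0) +
    ((N - n₁).factorial : ℂ) / ((N - n₂ - 1).factorial : ℂ) *
      (1 / (2 * (Real.pi : ℂ) * Complex.I) ^ 2 *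
        ∮ z in C(((zCenter t x₂ : ℝ) : ℂ), zRadius t x₂), ∮ w in C((0 : ℂ), R),
          kernelIntegrand N t x₁ n₁ x₂ n₂ z w)

/-- `τ` is a critical point of
`G(z) = ∑_{a=1}^{N-n} ln (z - x + a) - ∑_{r=1}^N ln (z - t_r)` in the open upper half-plane. -/
def IsUpperCriticalPoint (N : ℕ) (t : TopRow N) (x : ℤ) (n : ℕ) (τ : ℂ) : Prop :=
  0 < τ.im ∧
    ∑ a ∈ Finset.Icc 1 (N - n), 1 / (τ - (x : ℂ) + (a : ℂ)) = ∑ r : Fin N, 1 / (τ - (t r : ℂ))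

/-- The integral of `f` along the straight segment from `a` to `b`. -/
def segmentIntegral (f : ℂ → ℂ) (a b : ℂ) : ℂ :=
  ∫ s in (0 : ℝ)..1, f (a + (s : ℂ) * (b - a)) * (b - a)

/-- The integral of `f` from `conj b` to `b` along the broken line through the real point `c`;
for `b` non-real, `c` is the only point where this contour meets the real axis. -/
def crossingIntegral (f : ℂ → ℂ) (b : ℂ) (c : ℝ) : ℂ :=
  segmentIntegral f ((starRingEnd ℂ) b) (c : ℂ) + segmentIntegral f (c : ℂ) b

/-- The leading term of the kernel, as a single integral from `conj τ / N` to `τ / N` along a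
contour which crosses the real axis at `c`. -/
def bulkTerm (N : ℕ) (x₁ : ℤ) (n₁ : ℕ) (x₂ : ℤ) (n₂ : ℕ) (τ : ℂ) (c : ℝ) : ℂ :=
  (1 - (n₁ : ℂ) / (N : ℂ)) ^ (1 + (n₂ : ℤ) - (n₁ : ℤ)) / (2 * (Real.pi : ℂ) * Complex.I) *
    crossingIntegral
      (fun u => (u - (x₁ : ℂ) / (N : ℂ)) ^ (x₂ - x₁ - 1) /
        (u - (x₁ : ℂ) / (N : ℂ) + 1 - (n₁ : ℂ) / (N : ℂ)) ^ (x₂ - x₁ + (n₂ : ℤ) - (n₁ : ℤ) + 1))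
      (τ / (N : ℂ)) c

/-- The incomplete Beta kernel with parameter `ξ`, the contour crossing the real axis at `c`. -/
def incompleteBeta (ξ : ℂ) (x₁ : ℤ) (n₁ : ℕ) (x₂ : ℤ) (n₂ : ℕ) (c : ℝ) : ℂ :=
  1 / (2 * (Real.pi : ℂ) * Complex.I) *
    crossingIntegral (fun w => w ^ (x₂ - x₁ - 1) * (1 - w) ^ ((n₂ : ℤ) - (n₁ : ℤ))) ξ c

/-- The parameter `ξ` determined by the critical point `τ`. -/
def complexSlope (N : ℕ) (x : ℤ) (n : ℕ) (τ : ℂ) : ℂ :=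
  (τ / (N : ℂ) - (x : ℂ) / (N : ℂ)) /
    (τ / (N : ℂ) - (x : ℂ) / (N : ℂ) + 1 - (n : ℂ) / (N : ℂ))

end GTBulk

end

noncomputable section

namespace GTBulk

open Complex MeasureTheory Set
open scoped BigOperators ComplexConjugate

/-- A parametrized arc in the plane, continuously differentiable inside its parameter interval,
with integrable velocity. -/
structure Arc where
  lo : ℝ
  hi : ℝ
  le : lo ≤ hi
  fn : ℝ → ℂ
  dfn : ℝ → ℂ
  cont : ContinuousOn fn (Icc lo hi)
  der : ∀ v ∈ Ioo lo hi, HasDerivAt fn (dfn v) v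
  int : IntervalIntegrable dfn volume lo hi

namespace Arc

/-- The integral of `f` along the arc. -/
def integral (A : Arc) (f : ℂ → ℂ) : ℂ := ∫ v in A.lo..A.hi, f (A.fn v) * A.dfn v

/-- The image of the arc. -/
def support (A : Arc) : Set ℂ := A.fn '' Icc A.lo A.hi

/-- The complex conjugate of an arc. -/
def bar (A : Arc) : Arc where
  lo := A.lo
  hi := A.hi
  le := A.le
  fn v := (starRingEnd ℂ) (A.fn v)
  dfn v := (starRingEnd ℂ) (A.dfn v)
  cont := Complex.continuous_conj.comp_continuousOn A.cont
  der v hv := by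
    have h := (A.der v hv).hasFDerivAt
    have h2 := (Complex.conjCLE.toContinuousLinearMap.hasFDerivAt (x := A.fn v)).comp v h
    have := h2.hasDerivAt
    simpa [Function.comp_def] using this
  int := by
    have := A.int
    rw [intervalIntegrable_iff] at this ⊢
    exact Complex.conjCLE.toContinuousLinearMap.integrable_comp this

/-- The straight segment from `a` to `b`. -/
def seg (a b : ℂ) : Arc where
  lo := 0
  hi := 1
  le := zero_le_one
  fn s := a + (s : ℂ) * (b - a)
  dfn _ := b - a
  cont := by fun_prop
  der v _ := by
    have h : HasDerivAt (fun s : ℝ => (s : ℂ)) 1 v := by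
      simpa using (hasDerivAt_id v).ofReal_comp
    simpa using (h.mul_const (b - a)).const_add a
  int := by simp

lemma isCompact_support (A : Arc) : IsCompact A.support := isCompact_Icc.image_of_continuousOn A.cont

lemma intervalIntegrable_mul (A : Arc) {f : ℂ → ℂ} (hf : ContinuousOn f A.support) :
    IntervalIntegrable (fun v => f (A.fn v) * A.dfn v) volume A.lo A.hi := by
  refine IntervalIntegrable.continuousOn_mul A.int ?_
  rw [uIcc_of_le A.le]
  exact hf.comp A.cont (mapsTo_image _ _)

lemma integral_eq_sub (A : Arc) {f F : ℂ → ℂ} (hf : ContinuousOn f A.support)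
    (hF : ∀ z ∈ A.support, HasDerivAt F (f z) z) :
    A.integral f = F (A.fn A.hi) - F (A.fn A.lo) := by
  have key := intervalIntegral.integral_eq_sub_of_hasDerivAt_of_le (f := fun v => F (A.fn v))
    (f' := fun v => f (A.fn v) * A.dfn v) A.le ?_ ?_ (A.intervalIntegrable_mul hf)
  · exact key
  · have : ContinuousOn F A.support := fun z hz => (hF z hz).continuousAt.continuousWithinAt
    exact this.comp A.cont (mapsTo_image _ _)
  · intro v hv
    exact (hF _ (mem_image_of_mem _ (Ioo_subset_Icc_self hv))).comp v (A.der v hv)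

lemma integral_congr (A : Arc) {f g : ℂ → ℂ} (h : ∀ v ∈ Ioo A.lo A.hi, f (A.fn v) = g (A.fn v)) :
    A.integral f = A.integral g := by
  unfold integral
  rw [intervalIntegral.integral_of_le A.le, intervalIntegral.integral_of_le A.le,
    integral_Ioc_eq_integral_Ioo, integral_Ioc_eq_integral_Ioo]
  exact setIntegral_congr_fun measurableSet_Ioo fun v hv => by simp only [h v hv]

lemma integral_add (A : Arc) {f g : ℂ → ℂ} (hf : ContinuousOn f A.support)
    (hg : ContinuousOn g A.support) :
    A.integral (fun z => f z + g z) = A.integral f + A.integral g := by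
  unfold integral
  rw [← intervalIntegral.integral_add (A.intervalIntegrable_mul hf) (A.intervalIntegrable_mul hg)]
  simp only [add_mul]

lemma integral_const_mul (A : Arc) (c : ℂ) (f : ℂ → ℂ) :
    A.integral (fun z => c * f z) = c * A.integral f := by
  unfold integral
  rw [← intervalIntegral.integral_const_mul]
  simp only [mul_assoc]

lemma norm_integral_le (A : Arc) {f : ℂ → ℂ} {m : ℝ → ℝ}
    (hm : IntervalIntegrable m volume A.lo A.hi)
    (h : ∀ v ∈ Ioo A.lo A.hi, ‖f (A.fn v)‖ * ‖A.dfn v‖ ≤ m v) :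
    ‖A.integral f‖ ≤ ∫ v in A.lo..A.hi, m v := by
  unfold integral
  refine intervalIntegral.norm_integral_le_of_norm_le A.le ?_ hm
  have : ∀ᵐ v ∂(volume : Measure ℝ), v ≠ A.hi := by
    simp [ae_iff, measure_singleton]
  filter_upwards [this] with v hv hv2
  rw [norm_mul]
  exact h v ⟨hv2.1, lt_of_le_of_ne hv2.2 hv⟩

lemma mem_support_bar {A : Arc} {z : ℂ} : z ∈ A.bar.support ↔ conj z ∈ A.support := by
  simp only [support, bar, mem_image]
  constructor
  · rintro ⟨v, hv, rfl⟩; exact ⟨v, hv, by simp⟩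
  · rintro ⟨v, hv, h⟩; exact ⟨v, hv, by rw [h]; simp⟩

end Arc

/-- A path in the closed upper half-plane from `b` to the real point `c`, which avoids
the integers. -/
structure UPath (b : ℂ) (c : ℝ) where
  arcs : List Arc
  chain : ∀ F : ℂ → ℂ, (arcs.map fun A => F (A.fn A.hi) - F (A.fn A.lo)).sum = F c - F b
  im_nonneg : ∀ A ∈ arcs, ∀ z ∈ A.support, 0 ≤ z.im
  not_int : ∀ A ∈ arcs, ∀ z ∈ A.support, ∀ k : ℤ, z ≠ k

lemma sum_map_sub_list {α : Type*} (l : List α) (f g : α → ℂ) :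
    (l.map fun i => f i - g i).sum = (l.map f).sum - (l.map g).sum := by
  induction l with
  | nil => simp
  | cons a l ih => simp only [List.map_cons, List.sum_cons, ih]; ring

namespace UPath

variable {b : ℂ} {c : ℝ}

/-- The union of the images of the arcs and of their complex conjugates. -/
def support (P : UPath b c) : Set ℂ := {z | ∃ A ∈ P.arcs, z ∈ A.support ∨ z ∈ A.bar.support}

/-- The integral of `f` from `conj b` to `b` along the conjugate path followed by the reversed
path; this contour crosses the real axis at `c`. -/
def cross (P : UPath b c) (f : ℂ → ℂ) : ℂ :=
  (P.arcs.map fun A => A.bar.integral f - A.integral f).sum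

lemma subset_support (P : UPath b c) {A : Arc} (hA : A ∈ P.arcs) : A.support ⊆ P.support :=
  fun _ hz => ⟨A, hA, Or.inl hz⟩

lemma bar_subset_support (P : UPath b c) {A : Arc} (hA : A ∈ P.arcs) :
    A.bar.support ⊆ P.support :=
  fun _ hz => ⟨A, hA, Or.inr hz⟩

lemma conj_mem_support (P : UPath b c) {z : ℂ} : conj z ∈ P.support ↔ z ∈ P.support := by
  simp only [support, mem_ofPred_eq, Arc.mem_support_bar, Complex.conj_conj]
  constructor <;> rintro ⟨A, hA, h⟩ <;> exact ⟨A, hA, h.symm⟩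

lemma isClosed_support (P : UPath b c) : IsClosed P.support := by
  have h : P.support = ⋃ A ∈ {A | A ∈ P.arcs}, (A.support ∪ A.bar.support) := by
    ext z; simp [support]
  rw [h]
  exact (List.finite_toSet P.arcs).isClosed_biUnion fun A _ =>
    A.isCompact_support.isClosed.union A.bar.isCompact_support.isClosed

lemma not_int_support (P : UPath b c) {z : ℂ} (hz : z ∈ P.support) (k : ℤ) : z ≠ k := by
  obtain ⟨A, hA, h | h⟩ := hz
  · exact P.not_int A hA z h k
  · intro h2
    exact P.not_int A hA _ (Arc.mem_support_bar.1 h) k (by rw [h2]; simp)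

lemma cross_congr (P : UPath b c) {f g : ℂ → ℂ}
    (h : ∀ A ∈ P.arcs, ∀ v ∈ Ioo A.lo A.hi, f (A.fn v) = g (A.fn v) ∧
      f (conj (A.fn v)) = g (conj (A.fn v))) : P.cross f = P.cross g := by
  unfold cross
  congr 1
  refine List.map_congr_left fun A hA => ?_
  rw [A.integral_congr (fun v hv => (h A hA v hv).1),
    A.bar.integral_congr (f := f) (g := g) (fun v hv => (h A hA v hv).2)]

lemma cross_congr_support (P : UPath b c) {f g : ℂ → ℂ}
    (h : ∀ z ∈ P.support, f z = g z) : P.cross f = P.cross g :=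
  P.cross_congr fun _ hA v hv =>
    ⟨h _ (P.subset_support hA (mem_image_of_mem _ (Ioo_subset_Icc_self hv))),
      h _ (P.bar_subset_support hA ⟨v, Ioo_subset_Icc_self hv, rfl⟩)⟩

lemma cross_add (P : UPath b c) {f g : ℂ → ℂ} (hf : ContinuousOn f P.support)
    (hg : ContinuousOn g P.support) :
    P.cross (fun z => f z + g z) = P.cross f + P.cross g := by
  unfold cross
  rw [← List.sum_map_add]
  congr 1
  refine List.map_congr_left fun A hA => ?_
  rw [A.integral_add (hf.mono (P.subset_support hA)) (hg.mono (P.subset_support hA)),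
    A.bar.integral_add (hf.mono (P.bar_subset_support hA)) (hg.mono (P.bar_subset_support hA))]
  ring

lemma cross_const_mul (P : UPath b c) (a : ℂ) (f : ℂ → ℂ) :
    P.cross (fun z => a * f z) = a * P.cross f := by
  unfold cross
  rw [← List.sum_map_mul_left]
  congr 1
  refine List.map_congr_left fun A hA => ?_
  rw [A.integral_const_mul, A.bar.integral_const_mul, mul_sub]

lemma cross_finsetSum {ι : Type*} (P : UPath b c) (s : Finset ι) (f : ι → ℂ → ℂ)
    (hf : ∀ i ∈ s, ContinuousOn (f i) P.support) :
    P.cross (fun z => ∑ i ∈ s, f i z) = ∑ i ∈ s, P.cross (f i) := by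
  classical
  induction s using Finset.induction_on with
  | empty => simpa using P.cross_const_mul 0 (fun _ => 0)
  | insert i s hi ih =>
    simp only [Finset.sum_insert hi]
    rw [P.cross_add (hf i (by simp)) ?_, ih fun j hj => hf j (by simp [hj])]
    exact continuousOn_finsetSum s fun j hj => hf j (by simp [hj])

/-- The fundamental theorem of calculus for the crossing integral, with primitives in the closed
upper and lower half-planes. -/
lemma cross_eq_sub (P : UPath b c) {f F G : ℂ → ℂ} (hf : ContinuousOn f P.support)
    (hF : ∀ z ∈ P.support, 0 ≤ z.im → HasDerivAt F (f z) z)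
    (hG : ∀ z ∈ P.support, z.im ≤ 0 → HasDerivAt G (f z) z) :
    P.cross f = (G c - G (conj b)) - (F c - F b) := by
  have h1 := P.chain F
  have h2 := P.chain (fun z => G (conj z))
  simp only [Complex.conj_ofReal] at h2
  rw [← h1, ← h2, ← sum_map_sub_list]
  unfold cross
  congr 1
  refine List.map_congr_left fun A hA => ?_
  rw [A.integral_eq_sub (hf.mono (P.subset_support hA))
      (fun z hz => hF z (P.subset_support hA hz) (P.im_nonneg A hA z hz)),
    A.bar.integral_eq_sub (hf.mono (P.bar_subset_support hA)) (F := G)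
      (fun z hz => hG z (P.bar_subset_support hA hz) ?_)]
  · rfl
  · have := P.im_nonneg A hA _ (Arc.mem_support_bar.1 hz)
    simpa using this

end UPath

end GTBulk

end

noncomputable section

namespace GTBulk

open Complex MeasureTheory Set
open scoped BigOperators ComplexConjugate

lemma hasDerivAt_log_upper {z : ℂ} {k : ℝ} (hz : 0 ≤ z.im) (hk : z ≠ k) :
    HasDerivAt (fun w : ℂ => Complex.log (-I * (w - k))) (1 / (z - k)) z := by
  have h0 : z - k ≠ 0 := sub_ne_zero.2 hk
  have h : -I * (z - k) ∈ slitPlane := by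
    rw [mem_slitPlane_iff]
    simp only [mul_re, neg_re, I_re, sub_re, ofReal_re, neg_im, I_im, sub_im, ofReal_im, mul_im]
    rcases hz.lt_or_eq with h | h
    · left; linarith
    · right
      intro h2
      apply hk
      apply Complex.ext
      · simp; linarith
      · simp [← h]
  have := (((hasDerivAt_id' z).sub_const (k : ℂ)).const_mul (-I)).clog h
  convert this using 1
  field_simp

lemma hasDerivAt_log_lower {z : ℂ} {k : ℝ} (hz : z.im ≤ 0) (hk : z ≠ k) :
    HasDerivAt (fun w : ℂ => Complex.log (I * (w - k))) (1 / (z - k)) z := by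
  have h0 : z - k ≠ 0 := sub_ne_zero.2 hk
  have h : I * (z - k) ∈ slitPlane := by
    rw [mem_slitPlane_iff]
    simp only [mul_re, I_re, sub_re, ofReal_re, I_im, sub_im, ofReal_im, mul_im]
    rcases hz.lt_or_eq with h | h
    · left; linarith
    · right
      intro h2
      apply hk
      apply Complex.ext
      · simp; linarith
      · simp [h]
  have := (((hasDerivAt_id' z).sub_const (k : ℂ)).const_mul I).clog h
  convert this using 1
  field_simp

lemma log_jump_right {c k : ℝ} (h : k < c) :
    Complex.log (I * ((c : ℂ) - k)) - Complex.log (-I * ((c : ℂ) - k)) = Real.pi * I := by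
  have h1 : I * ((c : ℂ) - k) = ((c - k : ℝ) : ℂ) * I := by push_cast; ring
  have h2 : -I * ((c : ℂ) - k) = ((c - k : ℝ) : ℂ) * (-I) := by push_cast; ring
  rw [h1, h2, Complex.log_ofReal_mul (by linarith) (by simp),
    Complex.log_ofReal_mul (by linarith) (by simp), log_I, log_neg_I]
  ring

lemma log_jump_left {c k : ℝ} (h : c < k) :
    Complex.log (I * ((c : ℂ) - k)) - Complex.log (-I * ((c : ℂ) - k)) = -(Real.pi * I) := by
  have h1 : I * ((c : ℂ) - k) = ((k - c : ℝ) : ℂ) * (-I) := by push_cast; ring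
  have h2 : -I * ((c : ℂ) - k) = ((k - c : ℝ) : ℂ) * I := by push_cast; ring
  rw [h1, h2, Complex.log_ofReal_mul (by linarith) (by simp),
    Complex.log_ofReal_mul (by linarith) (by simp), log_I, log_neg_I]
  ring

namespace UPath

variable {b : ℂ} {c c₁ c₂ : ℝ}

lemma continuousOn_inv_sub (P : UPath b c) {z : ℂ} (hz : z ∉ P.support) :
    ContinuousOn (fun w => 1 / (w - z)) P.support :=
  continuousOn_const.div (continuousOn_id.sub continuousOn_const) fun w hw =>
    sub_ne_zero.2 fun h => hz (by rwa [← h])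

lemma intCast_notMem (P : UPath b c) (k : ℤ) : (k : ℂ) ∉ P.support :=
  fun h => P.not_int_support h k rfl

lemma cross_inv_sub (P : UPath b c) {k : ℝ} (hk : (k : ℂ) ∉ P.support) :
    P.cross (fun w => 1 / (w - k)) = Complex.log (I * ((c : ℂ) - k)) -
      Complex.log (-I * ((c : ℂ) - k)) + (Complex.log (-I * (b - k)) -
      Complex.log (I * ((starRingEnd ℂ) b - k))) := by
  have hne : ∀ z ∈ P.support, z ≠ k := fun z hz h => hk (by rwa [← h])
  rw [P.cross_eq_sub (P.continuousOn_inv_sub hk)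
    (fun z hz him => hasDerivAt_log_upper him (hne z hz))
    (fun z hz him => hasDerivAt_log_lower him (hne z hz))]
  ring

/-- The closed contour which crosses the real axis at `c₂` (upwards, on the right) and at `c₁`. -/
def loop (P : UPath b c₂) (Q : UPath b c₁) (f : ℂ → ℂ) : ℂ := P.cross f - Q.cross f

lemma loop_inv_sub (P : UPath b c₂) (Q : UPath b c₁) (h : c₁ ≤ c₂) {k : ℝ}
    (hP : (k : ℂ) ∉ P.support) (hQ : (k : ℂ) ∉ Q.support) (h1 : c₁ ≠ k) (h2 : c₂ ≠ k) :
    loop P Q (fun w => 1 / (w - k)) = if c₁ < k ∧ k < c₂ then 2 * Real.pi * I else 0 := by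
  unfold loop
  rw [P.cross_inv_sub hP, Q.cross_inv_sub hQ]
  rcases lt_or_gt_of_ne h1 with h1 | h1
  · rcases lt_or_gt_of_ne h2 with h2 | h2
    · rw [log_jump_left h1, log_jump_left h2, if_neg (by intro h; linarith [h.2])]; ring
    · rw [log_jump_left h1, log_jump_right h2, if_pos ⟨h1, h2⟩]; ring
  · rw [log_jump_right h1, log_jump_right (by linarith : k < c₂),
      if_neg (by intro h; linarith [h.1])]
    ring

lemma cross_of_differentiable {f : ℂ → ℂ} (hf : Differentiable ℂ f) :
    ∃ F : ℂ → ℂ, ∀ (c' : ℝ) (P : UPath b c'), P.cross f = F b - F (conj b) := by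
  obtain ⟨F, hF⟩ := (convex_univ (𝕜 := ℝ) (E := ℂ)).exists_forall_hasDerivWithinAt
    (f := f) hf.differentiableOn
  refine ⟨F, fun c' P => ?_⟩
  have h : ∀ z, HasDerivAt F (f z) z := fun z => by simpa using hF z (mem_univ z)
  rw [P.cross_eq_sub hf.continuous.continuousOn (fun z _ _ => h z) (fun z _ _ => h z)]
  ring

lemma loop_of_differentiable (P : UPath b c₂) (Q : UPath b c₁) {f : ℂ → ℂ}
    (hf : Differentiable ℂ f) : loop P Q f = 0 := by
  obtain ⟨F, hF⟩ := cross_of_differentiable (b := b) hf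
  unfold loop
  rw [hF, hF, sub_self]

lemma loop_add (P : UPath b c₂) (Q : UPath b c₁) {f g : ℂ → ℂ}
    (hf : ContinuousOn f (P.support ∪ Q.support)) (hg : ContinuousOn g (P.support ∪ Q.support)) :
    loop P Q (fun z => f z + g z) = loop P Q f + loop P Q g := by
  unfold loop
  rw [P.cross_add (hf.mono subset_union_left) (hg.mono subset_union_left),
    Q.cross_add (hf.mono subset_union_right) (hg.mono subset_union_right)]
  ring

lemma loop_const_mul (P : UPath b c₂) (Q : UPath b c₁) (a : ℂ) (f : ℂ → ℂ) :
    loop P Q (fun z => a * f z) = a * loop P Q f := by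
  unfold loop
  rw [P.cross_const_mul, Q.cross_const_mul, mul_sub]

lemma loop_finsetSum {ι : Type*} (P : UPath b c₂) (Q : UPath b c₁) (s : Finset ι)
    (f : ι → ℂ → ℂ) (hf : ∀ i ∈ s, ContinuousOn (f i) (P.support ∪ Q.support)) :
    loop P Q (fun z => ∑ i ∈ s, f i z) = ∑ i ∈ s, loop P Q (f i) := by
  unfold loop
  rw [P.cross_finsetSum s f fun i hi => (hf i hi).mono subset_union_left,
    Q.cross_finsetSum s f fun i hi => (hf i hi).mono subset_union_right, Finset.sum_sub_distrib]

lemma loop_congr (P : UPath b c₂) (Q : UPath b c₁) {f g : ℂ → ℂ}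
    (h : ∀ z ∈ P.support ∪ Q.support, f z = g z) : loop P Q f = loop P Q g := by
  unfold loop
  rw [P.cross_congr_support fun z hz => h z (Or.inl hz),
    Q.cross_congr_support fun z hz => h z (Or.inr hz)]

lemma end_mem_support (P : UPath b c) (hbc : b ≠ c) : (c : ℂ) ∈ P.support := by
  classical
  by_contra hc
  have h1 := P.chain (fun z => if z = c then 1 else 0)
  have h2 : ∀ A ∈ P.arcs, A.fn A.hi ≠ c ∧ A.fn A.lo ≠ c := fun A hA =>
    ⟨fun h => hc (P.subset_support hA ⟨A.hi, right_mem_Icc.2 A.le, h⟩),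
      fun h => hc (P.subset_support hA ⟨A.lo, left_mem_Icc.2 A.le, h⟩)⟩
  rw [if_pos rfl, if_neg hbc, List.map_congr_left (g := fun _ => (0 : ℂ))] at h1
  · simp at h1
  · intro A hA
    simp [(h2 A hA).1, (h2 A hA).2]

lemma loop_inv_sub_int (P : UPath b c₂) (Q : UPath b c₁) (h : c₁ ≤ c₂) (hb : b.im ≠ 0) (k : ℤ) :
    loop P Q (fun w => 1 / (w - k)) = if c₁ < k ∧ (k : ℝ) < c₂ then 2 * Real.pi * I else 0 := by
  have hne : ∀ c : ℝ, b ≠ c := fun c h => hb (by rw [h]; simp)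
  have hP := P.intCast_notMem k
  have hQ := Q.intCast_notMem k
  have := loop_inv_sub P Q h (k := (k : ℝ)) (by simpa using hP) (by simpa using hQ)
    (fun h => hQ (by have := Q.end_mem_support (hne c₁); rwa [show (c₁ : ℂ) = k by simp [h]] at this))
    (fun h => hP (by have := P.end_mem_support (hne c₂); rwa [show (c₂ : ℂ) = k by simp [h]] at this))
  simpa using this

/-- The residue theorem for rational functions with simple poles at integers. -/
lemma loop_rational (P : UPath b c₂) (Q : UPath b c₁) (h : c₁ ≤ c₂) (hb : b.im ≠ 0)
    {f p : ℂ → ℂ} (S : Finset ℤ) (r : ℤ → ℂ) (hp : Differentiable ℂ p)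
    (hf : ∀ z : ℂ, (∀ k ∈ S, z ≠ k) → f z = p z + ∑ k ∈ S, r k * (1 / (z - k))) :
    loop P Q f = 2 * Real.pi * I * ∑ k ∈ S with c₁ < ((k : ℤ) : ℝ) ∧ ((k : ℤ) : ℝ) < c₂, r k := by
  have hn : ∀ z ∈ P.support ∪ Q.support, ∀ k : ℤ, z ≠ k := fun z hz k =>
    hz.elim (fun h => P.not_int_support h k) (fun h => Q.not_int_support h k)
  have hc : ∀ k : ℤ, ContinuousOn (fun z : ℂ => r k * (1 / (z - k))) (P.support ∪ Q.support) :=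
    fun k => continuousOn_const.mul (continuousOn_const.div
      (continuousOn_id.sub continuousOn_const) fun w hw => sub_ne_zero.2 (hn w hw k))
  rw [loop_congr P Q fun z hz => hf z fun k _ => hn z hz k,
    loop_add P Q hp.continuous.continuousOn (continuousOn_finsetSum S fun k _ => hc k),
    loop_of_differentiable P Q hp, loop_finsetSum P Q S _ fun k _ => hc k, Finset.sum_filter,
    Finset.mul_sum, zero_add]
  refine Finset.sum_congr rfl fun k _ => ?_
  rw [loop_const_mul, loop_inv_sub_int P Q h hb]
  split_ifs <;> ring

/-- The integral of `1 / (w - z)` over the closed contour, i.e. `2 π i` times the winding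
number. -/
def wind (P : UPath b c₂) (Q : UPath b c₁) (z : ℂ) : ℂ := loop P Q (fun w => 1 / (w - z))

lemma cross_inv_sub_congr (P : UPath b c) {z z' : ℂ}
    (h : ∀ w ∈ P.support, ‖z' - z‖ < ‖w - z‖) :
    P.cross (fun w => 1 / (w - z')) - P.cross (fun w => 1 / (w - z)) =
      Complex.log ((b - z') / (b - z)) - Complex.log ((conj b - z') / (conj b - z)) := by
  have hz : ∀ w ∈ P.support, w - z ≠ 0 := fun w hw h0 => by
    have := h w hw
    rw [h0, norm_zero] at this
    exact absurd this (not_lt.2 (norm_nonneg _))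
  have hz' : ∀ w ∈ P.support, w - z' ≠ 0 := fun w hw h0 => by
    have := h w hw
    rw [← sub_eq_zero.1 h0] at this
    exact lt_irrefl _ this
  have hs : ∀ w ∈ P.support, (w - z') / (w - z) ∈ slitPlane := fun w hw => by
    have h1 : (w - z') / (w - z) = 1 - (z' - z) / (w - z) := by
      field_simp [hz w hw]; ring
    have h2 : ‖(z' - z) / (w - z)‖ < 1 := by
      rw [norm_div, div_lt_one (norm_pos_iff.2 (hz w hw))]
      exact h w hw
    rw [h1, mem_slitPlane_iff]
    left
    have := (abs_le.1 (Complex.abs_re_le_norm ((z' - z) / (w - z)))).2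
    simp only [sub_re, one_re]
    linarith
  have hd : ∀ w ∈ P.support, HasDerivAt (fun w => Complex.log ((w - z') / (w - z)))
      (1 / (w - z') + (-1) * (1 / (w - z))) w := fun w hw => by
    have h1 : HasDerivAt (fun w => (w - z') / (w - z))
        ((1 * (w - z) - (w - z') * 1) / (w - z) ^ 2) w :=
      ((hasDerivAt_id' w).sub_const z').div ((hasDerivAt_id' w).sub_const z) (hz w hw)
    convert h1.clog (hs w hw) using 1
    have h2 := hz w hw
    have h3 := hz' w hw
    field_simp
    ring
  have hc : ContinuousOn (fun w => 1 / (w - z')) P.support :=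
    continuousOn_const.div (continuousOn_id.sub continuousOn_const) hz'
  have hc2 : ContinuousOn (fun w => 1 / (w - z)) P.support :=
    continuousOn_const.div (continuousOn_id.sub continuousOn_const) hz
  have := P.cross_eq_sub (f := fun w => 1 / (w - z') + (-1) * (1 / (w - z)))
    (hc.add (continuousOn_const.mul hc2)) (fun w hw _ => hd w hw)
    (fun w hw _ => hd w hw)
  rw [P.cross_add hc (g := fun w => (-1) * (1 / (w - z))) (continuousOn_const.mul hc2),
    P.cross_const_mul] at this
  linear_combination this

lemma wind_locally_const (P : UPath b c₂) (Q : UPath b c₁) {z z' : ℂ}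
    (h : ∀ w ∈ P.support ∪ Q.support, ‖z' - z‖ < ‖w - z‖) : wind P Q z' = wind P Q z := by
  have h1 := P.cross_inv_sub_congr fun w hw => h w (Or.inl hw)
  have h2 := Q.cross_inv_sub_congr fun w hw => h w (Or.inr hw)
  unfold wind loop
  linear_combination h1 - h2

lemma wind_eq_of_isPreconnected (P : UPath b c₂) (Q : UPath b c₁) {S : Set ℂ}
    (hS : IsPreconnected S) (hd : Disjoint S (P.support ∪ Q.support)) {z z' : ℂ} (hz : z ∈ S)
    (hz' : z' ∈ S) : wind P Q z = wind P Q z' := by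
  have hcl : IsClosed (P.support ∪ Q.support) := P.isClosed_support.union Q.isClosed_support
  have key : ∀ x ∈ S, ∀ᶠ y in nhdsWithin x S, wind P Q y = wind P Q x := by
    intro x hx
    have hx2 : x ∈ (P.support ∪ Q.support)ᶜ := disjoint_left.1 hd hx
    obtain ⟨ε, hε, hball⟩ := Metric.isOpen_iff.1 hcl.isOpen_compl x hx2
    refine nhdsWithin_le_nhds ?_
    filter_upwards [Metric.ball_mem_nhds x hε] with y hy
    refine wind_locally_const P Q fun w hw => ?_
    rw [Metric.mem_ball, dist_eq_norm] at hy
    by_contra hlt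
    push Not at hlt
    have : w ∈ Metric.ball x ε := by
      rw [Metric.mem_ball, dist_eq_norm]; linarith
    exact hball this hw
  exact hS.induction₂ (fun x y => wind P Q x = wind P Q y)
    (fun x hx => (key x hx).mono fun y hy => hy.symm) (fun _ _ _ _ _ _ h1 h2 => h1.trans h2)
    (fun _ _ _ _ h => h.symm) hz hz'

end UPath

end GTBulk

end

noncomputable section

namespace GTBulk

open Complex MeasureTheory Set
open scoped BigOperators ComplexConjugate

lemma partial_fractions (num : Polynomial ℂ) (S : Finset ℤ) : ∃ p : Polynomial ℂ, ∀ z : ℂ,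
    (∀ k ∈ S, z ≠ k) → num.eval z / ∏ k ∈ S, (z - k) =
      p.eval z + ∑ k ∈ S, (num.eval (k : ℂ) / ∏ j ∈ S.erase k, ((k : ℂ) - j)) * (1 / (z - k)) := by
  classical
  set v : ℤ → ℂ := fun k => (k : ℂ) with hv
  have hinj : Set.InjOn v S := fun a _ b _ h => by simpa [hv] using h
  set nd := Lagrange.nodal S v with hnd
  have hmon : nd.Monic := Lagrange.nodal_monic
  have hmod : num %ₘ nd = Lagrange.interpolate S v (fun k => num.eval (k : ℂ)) := by
    refine Lagrange.eq_interpolate_of_eval_eq _ hinj ?_ ?_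
    · have := Polynomial.degree_modByMonic_lt num hmon
      rwa [hnd, Lagrange.degree_nodal] at this
    · intro k hk
      have h := congrArg (Polynomial.eval (v k)) (Polynomial.modByMonic_add_div num nd)
      rw [Polynomial.eval_add, Polynomial.eval_mul, hnd, Lagrange.eval_nodal_at_node hk, zero_mul,
        add_zero] at h
      exact h
  refine ⟨num /ₘ nd, fun z hz => ?_⟩
  have h := congrArg (Polynomial.eval z) (Polynomial.modByMonic_add_div num nd)
  have hnz : Polynomial.eval z nd = ∏ k ∈ S, (z - k) := Lagrange.eval_nodal
  have hne : ∏ k ∈ S, (z - (k : ℂ)) ≠ 0 :=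
    Finset.prod_ne_zero_iff.2 fun k hk => sub_ne_zero.2 (hz k hk)
  rw [Polynomial.eval_add, Polynomial.eval_mul, hmod,
    Lagrange.eval_interpolate_not_at_node _ hz, hnz] at h
  rw [div_eq_iff hne, ← h]
  have : ∑ k ∈ S, Lagrange.nodalWeight S v k * (z - v k)⁻¹ * Polynomial.eval (k : ℂ) num =
      ∑ k ∈ S, (num.eval (k : ℂ) / ∏ j ∈ S.erase k, ((k : ℂ) - j)) * (1 / (z - k)) := by
    refine Finset.sum_congr rfl fun k _ => ?_
    rw [Lagrange.nodalWeight, Finset.prod_inv_distrib]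
    ring
  rw [this]
  ring

/-- The `z`-dependent factor of the kernel integrand. -/
def zFactor (N : ℕ) (t : TopRow N) (x₂ : ℤ) (n₂ : ℕ) (z : ℂ) : ℂ :=
  poch (z - (x₂ : ℂ) + 1) (N - n₂ - 1) / ∏ r : Fin N, (z - (t r : ℂ))

/-- The `w`-dependent factor of the kernel integrand. -/
def wFactor (N : ℕ) (t : TopRow N) (x₁ : ℤ) (n₁ : ℕ) (w : ℂ) : ℂ :=
  (∏ r : Fin N, (w - (t r : ℂ))) / poch (w - (x₁ : ℂ)) (N - n₁ + 1)

lemma kernelIntegrand_eq (N : ℕ) (t : TopRow N) (x₁ : ℤ) (n₁ : ℕ) (x₂ : ℤ) (n₂ : ℕ) (z w : ℂ) :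
    kernelIntegrand N t x₁ n₁ x₂ n₂ z w =
      zFactor N t x₂ n₂ z * (wFactor N t x₁ n₁ w * (1 / (w - z))) := by
  unfold kernelIntegrand zFactor wFactor
  rw [Finset.prod_div_distrib]
  ring

/-- The monic polynomial with roots `x, x - 1, ..., x - m + 1`. -/
def pochPoly (x : ℤ) (m : ℕ) : Polynomial ℂ :=
  ∏ i ∈ Finset.range m, (Polynomial.X - Polynomial.C ((x : ℂ) - i))

lemma eval_pochPoly (x : ℤ) (m : ℕ) (z : ℂ) : (pochPoly x m).eval z = poch (z - x) m := by
  unfold pochPoly poch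
  rw [Polynomial.eval_prod]
  refine Finset.prod_congr rfl fun i _ => ?_
  simp; ring

/-- The set `{x, x - 1, ..., x - m + 1}`. -/
def pochRoots (x : ℤ) (m : ℕ) : Finset ℤ := Finset.Ioc (x - m) x

lemma poch_eq_prod (x : ℤ) (m : ℕ) (z : ℂ) : poch (z - x) m = ∏ k ∈ pochRoots x m, (z - k) := by
  classical
  unfold poch pochRoots
  refine Finset.prod_bij (fun i _ => x - (i : ℤ)) ?_ ?_ ?_ ?_
  · intro i hi; simp at hi ⊢; omega
  · intro i _ j _ h; simpa using h
  · intro k hk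
    simp at hk
    exact ⟨(x - k).toNat, by simp; omega, by simp; omega⟩
  · intro i _; push_cast; ring

/-- The numerator polynomial `∏ (X - t_r)`. -/
def rowPoly {N : ℕ} (t : TopRow N) : Polynomial ℂ :=
  ∏ r : Fin N, (Polynomial.X - Polynomial.C (t r : ℂ))

lemma eval_rowPoly {N : ℕ} (t : TopRow N) (z : ℂ) :
    (rowPoly t).eval z = ∏ r : Fin N, (z - (t r : ℂ)) := by
  simp [rowPoly, Polynomial.eval_prod]

/-- The set of entries of the top row. -/
def rowSet {N : ℕ} (t : TopRow N) : Finset ℤ := Finset.univ.image t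

lemma prod_rowSet {N : ℕ} {t : TopRow N} (ht : StrictAnti t) (z : ℂ) :
    ∏ r : Fin N, (z - (t r : ℂ)) = ∏ k ∈ rowSet t, (z - (k : ℂ)) := by
  unfold rowSet
  rw [Finset.prod_image fun a _ b _ h => ht.injective h]

lemma zFactor_partial_fractions {N : ℕ} {t : TopRow N} (ht : StrictAnti t) (x₂ : ℤ) (n₂ : ℕ)
    (q : Polynomial ℂ) :
    ∃ p : Polynomial ℂ, ∃ r : ℤ → ℂ, (∀ k, k < x₂ → x₂ - (N - n₂ - 1 : ℕ) ≤ k → r k = 0) ∧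
      ∀ z : ℂ, (∀ k ∈ rowSet t, z ≠ k) → zFactor N t x₂ n₂ z * q.eval z =
        p.eval z + ∑ k ∈ rowSet t, r k * (1 / (z - k)) := by
  obtain ⟨p, hp⟩ := partial_fractions (pochPoly (x₂ - 1) (N - n₂ - 1) * q) (rowSet t)
  refine ⟨p, fun k => (pochPoly (x₂ - 1) (N - n₂ - 1) * q).eval (k : ℂ) /
    ∏ j ∈ (rowSet t).erase k, ((k : ℂ) - j), ?_, fun z hz => ?_⟩
  rotate_left
  · rw [← hp z hz, Polynomial.eval_mul, eval_pochPoly, zFactor, prod_rowSet ht]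
    push_cast
    rw [sub_sub_eq_add_sub, add_sub_right_comm]
    ring
  · intro k hk1 hk2
    simp only [Polynomial.eval_mul, eval_pochPoly, poch_eq_prod]
    rw [Finset.prod_eq_zero (i := k)]
    · simp
    · simp [pochRoots]; omega
    · simp

lemma wFactor_partial_fractions {N : ℕ} (t : TopRow N) (x₁ : ℤ) (n₁ : ℕ) :
    ∃ p : Polynomial ℂ, ∃ r : ℤ → ℂ,
      ∀ z : ℂ, (∀ k ∈ pochRoots x₁ (N - n₁ + 1), z ≠ k) → wFactor N t x₁ n₁ z =
        p.eval z + ∑ k ∈ pochRoots x₁ (N - n₁ + 1), r k * (1 / (z - k)) := by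
  obtain ⟨p, hp⟩ := partial_fractions (rowPoly t) (pochRoots x₁ (N - n₁ + 1))
  refine ⟨p, fun k => (rowPoly t).eval (k : ℂ) /
    ∏ j ∈ (pochRoots x₁ (N - n₁ + 1)).erase k, ((k : ℂ) - j), fun z hz => ?_⟩
  rw [← hp z hz, eval_rowPoly, wFactor, poch_eq_prod]

lemma inv_mul_inv_sub {w z k : ℂ} (hwk : w ≠ k) (hzk : z ≠ k) (hwz : w ≠ z) :
    1 / (w - k) * (1 / (w - z)) = 1 / (z - k) * (1 / (w - z) + (-1) * (1 / (w - k))) := by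
  have h1 := sub_ne_zero.2 hwk
  have h2 := sub_ne_zero.2 hzk
  have h3 := sub_ne_zero.2 hwz
  field_simp
  ring

lemma cauchy_kernel_decomp {f : ℂ → ℂ} {p q : Polynomial ℂ} {S : Finset ℤ} {r : ℤ → ℂ} {z w : ℂ}
    (hq : p - Polynomial.C (p.eval z) = (Polynomial.X - Polynomial.C z) * q)
    (hf : ∀ z : ℂ, (∀ k ∈ S, z ≠ k) → f z = p.eval z + ∑ k ∈ S, r k * (1 / (z - k)))
    (hzS : ∀ k ∈ S, z ≠ k) (hwS : ∀ k ∈ S, w ≠ k) (hwz : w ≠ z) :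
    f w * (1 / (w - z)) = q.eval w + (p.eval z * (1 / (w - z)) +
        ∑ k ∈ S, r k * (1 / (z - k)) * (1 / (w - z) + (-1) * (1 / (w - k)))) := by
  rw [hf w hwS, add_mul, Finset.sum_mul]
  have hpq := congrArg (Polynomial.eval w) hq
  simp only [Polynomial.eval_sub, Polynomial.eval_C, Polynomial.eval_mul, Polynomial.eval_X] at hpq
  have h0 := sub_ne_zero.2 hwz
  rw [← add_assoc]
  congr 1
  · rw [show q.eval w = (p.eval w - p.eval z) / (w - z) by rw [hpq]; field_simp]
    ring
  · refine Finset.sum_congr rfl fun k hk => ?_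
    rw [mul_assoc, inv_mul_inv_sub (hwS k hk) (hzS k hk) hwz]
    ring

namespace UPath

variable {b : ℂ} {c c₁ c₂ : ℝ}

/-- The Cauchy transform of a rational function with simple poles at integers inside a closed
contour. -/
lemma loop_cauchy (P : UPath b c₂) (Q : UPath b c₁) (h : c₁ ≤ c₂) (hb : b.im ≠ 0)
    {f : ℂ → ℂ} (p : Polynomial ℂ) (S : Finset ℤ) (r : ℤ → ℂ)
    (hf : ∀ z : ℂ, (∀ k ∈ S, z ≠ k) → f z = p.eval z + ∑ k ∈ S, r k * (1 / (z - k)))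
    (hS : ∀ k ∈ S, c₁ < k ∧ (k : ℝ) < c₂) {z : ℂ} (hzS : ∀ k ∈ S, z ≠ k)
    (hz : z ∉ P.support ∪ Q.support) :
    loop P Q (fun w => f w * (1 / (w - z))) =
      2 * Real.pi * I * p.eval z + (wind P Q z - 2 * Real.pi * I) * f z := by
  obtain ⟨q, hq⟩ := Polynomial.X_sub_C_dvd_sub_C_eval (a := z) (p := p)
  have hn : ∀ w ∈ P.support ∪ Q.support, ∀ k : ℤ, w ≠ k := fun w hw k =>
    hw.elim (fun h => P.not_int_support h k) (fun h => Q.not_int_support h k)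
  have hwz : ∀ w ∈ P.support ∪ Q.support, w ≠ z := fun w hw h => hz (h ▸ hw)
  have hc : ∀ u : ℂ, (∀ w ∈ P.support ∪ Q.support, w ≠ u) →
      ContinuousOn (fun w : ℂ => 1 / (w - u)) (P.support ∪ Q.support) :=
    fun u hu => continuousOn_const.div
      (continuousOn_id.sub continuousOn_const) fun w hw => sub_ne_zero.2 (hu w hw)
  have h1 : loop P Q (fun w => f w * (1 / (w - z))) = loop P Q (fun w => q.eval w +
      (p.eval z * (1 / (w - z)) +
        ∑ k ∈ S, r k * (1 / (z - k)) * (1 / (w - z) + (-1) * (1 / (w - k))))) :=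
    loop_congr P Q fun w hw => cauchy_kernel_decomp hq hf hzS (fun k _ => hn w hw k) (hwz w hw)
  have hck : ∀ k : ℤ, ContinuousOn (fun w : ℂ => 1 / (w - z) + (-1) * (1 / (w - k)))
      (P.support ∪ Q.support) := fun k =>
    (hc z hwz).add (continuousOn_const.mul (hc k fun w hw => hn w hw k))
  have hcs : ContinuousOn (fun w => ∑ k ∈ S, r k * (1 / (z - k)) *
      (1 / (w - z) + (-1) * (1 / (w - k)))) (P.support ∪ Q.support) :=
    continuousOn_finsetSum S fun k _ => continuousOn_const.mul (hck k)
  have hcz : ContinuousOn (fun w => p.eval z * (1 / (w - z))) (P.support ∪ Q.support) :=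
    continuousOn_const.mul (hc z hwz)
  have hcn : ∀ k : ℤ, ContinuousOn (fun w : ℂ => (-1) * (1 / (w - (k : ℂ))))
      (P.support ∪ Q.support) := fun k => continuousOn_const.mul (hc k fun w hw => hn w hw k)
  have hcsum : ContinuousOn (fun w => p.eval z * (1 / (w - z)) + ∑ k ∈ S, r k * (1 / (z - k)) *
      (1 / (w - z) + (-1) * (1 / (w - k)))) (P.support ∪ Q.support) := hcz.add hcs
  rw [h1, loop_add P Q q.continuous.continuousOn hcsum,
    loop_of_differentiable P Q q.differentiable, loop_add P Q hcz hcs, loop_const_mul,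
    loop_finsetSum P Q S (fun k w => r k * (1 / (z - k)) * (1 / (w - z) + (-1) * (1 / (w - k))))
      fun k _ => continuousOn_const.mul (hck k), hf z hzS]
  have h2 : ∀ k ∈ S, loop P Q (fun w => r k * (1 / (z - k)) *
      (1 / (w - z) + (-1) * (1 / (w - k)))) =
      (wind P Q z - 2 * Real.pi * I) * (r k * (1 / (z - k))) := fun k hk => by
    rw [loop_const_mul, loop_add P Q (hc z hwz) (hcn k),
      loop_const_mul, loop_inv_sub_int P Q h hb, if_pos (hS k hk)]
    unfold wind
    ring
  rw [Finset.sum_congr rfl h2, ← Finset.mul_sum]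
  unfold wind
  ring

end UPath

end GTBulk

end

noncomputable section

namespace GTBulk

open Complex MeasureTheory Set
open scoped BigOperators ComplexConjugate

lemma circleIntegrable_inv_sub {c u : ℂ} {R : ℝ} (hR : 0 ≤ R) (h : ∀ w ∈ Metric.sphere c R, w ≠ u) :
    CircleIntegrable (fun w => 1 / (w - u)) c R :=
  (continuousOn_const.div (continuousOn_id.sub continuousOn_const)
    fun w hw => sub_ne_zero.2 (h w hw)).circleIntegrable hR

lemma circleIntegrable_const_mul {f : ℂ → ℂ} {c : ℂ} {R : ℝ} (h : CircleIntegrable f c R) (a : ℂ) :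
    CircleIntegrable (fun w => a * f w) c R :=
  IntervalIntegrable.const_mul h a

lemma circleIntegral_poly (p : Polynomial ℂ) (c : ℂ) {R : ℝ} (hR : 0 ≤ R) :
    (∮ w in C(c, R), p.eval w) = 0 :=
  Complex.circleIntegral_eq_zero_of_differentiable_on_off_countable hR countable_empty
    p.continuous.continuousOn fun z _ => p.differentiable z

lemma circleIntegral_finsetSum {ι : Type*} (s : Finset ι) (f : ι → ℂ → ℂ) (c : ℂ) (R : ℝ)
    (hf : ∀ i ∈ s, CircleIntegrable (f i) c R) :
    (∮ w in C(c, R), ∑ i ∈ s, f i w) = ∑ i ∈ s, ∮ w in C(c, R), f i w := by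
  unfold circleIntegral
  simp only [Finset.smul_sum]
  exact intervalIntegral.integral_finsetSum fun i hi => (hf i hi).out

/-- The Cauchy transform of a rational function along a circle enclosing its poles. -/
lemma circleIntegral_cauchy {R : ℝ} {f : ℂ → ℂ} (p : Polynomial ℂ) (S : Finset ℤ) (r : ℤ → ℂ)
    (hf : ∀ z : ℂ, (∀ k ∈ S, z ≠ k) → f z = p.eval z + ∑ k ∈ S, r k * (1 / (z - k)))
    (hS : ∀ k ∈ S, |(k : ℝ)| < R) {z : ℂ} (hzS : ∀ k ∈ S, z ≠ k) (hz : ‖z‖ < R) :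
    (∮ w in C((0 : ℂ), R), f w * (1 / (w - z))) = 2 * Real.pi * I * p.eval z := by
  have hR : 0 ≤ R := (norm_nonneg z).trans hz.le
  obtain ⟨q, hq⟩ := Polynomial.X_sub_C_dvd_sub_C_eval (a := z) (p := p)
  have hsp : ∀ u : ℂ, ‖u‖ < R → ∀ w ∈ Metric.sphere (0 : ℂ) R, w ≠ u := fun u hu w hw h => by
    rw [mem_sphere_zero_iff_norm] at hw
    rw [h] at hw; linarith
  have hk : ∀ k ∈ S, ‖(k : ℂ)‖ < R := fun k hk => by
    rw [Complex.norm_intCast]; exact hS k hk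
  have hint : ∀ u : ℂ, ‖u‖ < R → CircleIntegrable (fun w => 1 / (w - u)) 0 R := fun u hu =>
    circleIntegrable_inv_sub hR (hsp u hu)
  have hval : ∀ u : ℂ, ‖u‖ < R → (∮ w in C((0 : ℂ), R), 1 / (w - u)) = 2 * Real.pi * I :=
    fun u hu => by
      simp only [one_div]
      exact circleIntegral.integral_sub_inv_of_mem_ball (by simpa using hu)
  have e1 : (∮ w in C((0 : ℂ), R), f w * (1 / (w - z))) = ∮ w in C((0 : ℂ), R), (q.eval w +
      (p.eval z * (1 / (w - z)) +
        ∑ k ∈ S, r k * (1 / (z - k)) * (1 / (w - z) + (-1) * (1 / (w - k))))) :=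
    circleIntegral.integral_congr hR fun w hw =>
      cauchy_kernel_decomp hq hf hzS (fun k hkS => hsp k (hk k hkS) w hw) (hsp z hz w hw)
  have i1 : ∀ (a : ℂ) (k : ℤ), k ∈ S → CircleIntegrable
      (fun w => a * (1 / (w - z) + (-1) * (1 / (w - k)))) 0 R := fun a k hkS =>
    circleIntegrable_const_mul
      ((hint z hz).add (circleIntegrable_const_mul (hint k (hk k hkS)) (-1))) a
  have i2 : CircleIntegrable (fun w => ∑ k ∈ S, r k * (1 / (z - k)) *
      (1 / (w - z) + (-1) * (1 / (w - k)))) 0 R := by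
    have := CircleIntegrable.sum S (fun k hkS => i1 (r k * (1 / (z - k))) k hkS)
    convert this using 1
    ext w; simp
  have i3 : CircleIntegrable (fun w => p.eval z * (1 / (w - z))) 0 R :=
    circleIntegrable_const_mul (hint z hz) _
  have i4 : CircleIntegrable (fun w => p.eval z * (1 / (w - z)) + ∑ k ∈ S, r k * (1 / (z - k)) *
      (1 / (w - z) + (-1) * (1 / (w - k)))) 0 R := i3.add i2
  rw [e1, circleIntegral.integral_add (q.continuous.continuousOn.circleIntegrable hR)
    i4, circleIntegral_poly _ _ hR, circleIntegral.integral_add i3 i2, circleIntegral.integral_const_mul,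
    hval z hz, circleIntegral_finsetSum S (fun k w => r k * (1 / (z - k)) *
      (1 / (w - z) + (-1) * (1 / (w - k)))) _ _ fun k hkS => i1 _ k hkS, Finset.sum_eq_zero]
  · ring
  · intro k hkS
    rw [circleIntegral.integral_const_mul, circleIntegral.integral_add (hint z hz)
      (circleIntegrable_const_mul (hint k (hk k hkS)) (-1)), circleIntegral.integral_const_mul, hval z hz,
      hval k (hk k hkS)]
    ring

/-- The residue theorem for circles with centre and radius in the half-integers. -/
lemma circleIntegral_rational {u v : ℤ} {f : ℂ → ℂ} (p : Polynomial ℂ) (S : Finset ℤ) (r : ℤ → ℂ)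
    (hf : ∀ z : ℂ, (∀ k ∈ S, z ≠ k) → f z = p.eval z + ∑ k ∈ S, r k * (1 / (z - k)))
    (huv : u ≤ v) :
    (∮ z in C(((((u : ℝ) + v) / 2 : ℝ) : ℂ), ((v : ℝ) - u + 1) / 2), f z) =
      2 * Real.pi * I * ∑ k ∈ S with u ≤ k ∧ k ≤ v, r k := by
  have huv' : (u : ℝ) ≤ v := by exact_mod_cast huv
  set c : ℂ := ((((u : ℝ) + v) / 2 : ℝ) : ℂ) with hc
  set R : ℝ := ((v : ℝ) - u + 1) / 2 with hRdef
  have hR : 0 ≤ R := by rw [hRdef]; linarith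
  have hdist : ∀ k : ℤ, dist (k : ℂ) c = |(k : ℝ) - ((u : ℝ) + v) / 2| := fun k => by
    rw [hc, dist_eq_norm, ← Complex.ofReal_intCast, ← Complex.ofReal_sub, Complex.norm_real,
      Real.norm_eq_abs]
  have hne : ∀ k : ℤ, ∀ w ∈ Metric.sphere c R, w ≠ k := by
    intro k w hw h
    rw [Metric.mem_sphere, h, hdist, hRdef] at hw
    rcases abs_eq (by linarith) |>.1 hw with h | h
    · have h2 : ((2 * k : ℤ) : ℝ) = ((2 * v + 1 : ℤ) : ℝ) := by push_cast; linarith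
      have := Int.cast_injective h2; omega
    · have h2 : ((2 * k : ℤ) : ℝ) = ((2 * u - 1 : ℤ) : ℝ) := by push_cast; linarith
      have := Int.cast_injective h2; omega
  have hint : ∀ k : ℤ, CircleIntegrable (fun w : ℂ => r k * (1 / (w - k))) c R := fun k =>
    circleIntegrable_const_mul (circleIntegrable_inv_sub hR (hne k)) _
  have hval : ∀ k : ℤ, (∮ w in C(c, R), 1 / (w - k)) =
      if u ≤ k ∧ k ≤ v then 2 * Real.pi * I else 0 := by
    intro k
    split_ifs with h
    · simp only [one_div]
      refine circleIntegral.integral_sub_inv_of_mem_ball ?_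
      rw [Metric.mem_ball, hdist, hRdef, abs_lt]
      have h1 : (u : ℝ) ≤ k := by exact_mod_cast h.1
      have h2 : (k : ℝ) ≤ v := by exact_mod_cast h.2
      constructor <;> linarith
    · have hout : ∀ w ∈ Metric.closedBall c R, w ≠ k := by
        intro w hw hwk
        rw [Metric.mem_closedBall, hwk, hdist, hRdef, abs_le] at hw
        apply h
        have h1 : (u : ℝ) - 1 < k := by linarith [hw.1]
        have h2 : (k : ℝ) < v + 1 := by linarith [hw.2]
        have h3 : u - 1 < k := by exact_mod_cast h1
        have h4 : k < v + 1 := by exact_mod_cast h2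
        omega
      refine Complex.circleIntegral_eq_zero_of_differentiable_on_off_countable hR countable_empty
        (continuousOn_const.div (continuousOn_id.sub continuousOn_const)
          fun w hw => sub_ne_zero.2 (hout w hw)) fun z hz => ?_
      have hz2 := sub_ne_zero.2 (hout z (Metric.ball_subset_closedBall hz.1))
      exact (differentiableAt_const _).div (differentiableAt_id.sub_const _) hz2
  have e1 : (∮ z in C(c, R), f z) = ∮ z in C(c, R), (p.eval z + ∑ k ∈ S, r k * (1 / (z - k))) :=
    circleIntegral.integral_congr hR fun w hw => hf w fun k _ => hne k w hw
  have i2 : CircleIntegrable (fun w : ℂ => ∑ k ∈ S, r k * (1 / (w - k))) c R := by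
    have := CircleIntegrable.sum S (fun k _ => hint k)
    convert this using 1
    ext w; simp
  rw [e1, circleIntegral.integral_add (p.continuous.continuousOn.circleIntegrable hR) i2,
    circleIntegral_poly _ _ hR, circleIntegral_finsetSum _ _ _ _ fun k _ => hint k,
    Finset.sum_filter, Finset.mul_sum, zero_add]
  refine Finset.sum_congr rfl fun k _ => ?_
  rw [circleIntegral.integral_const_mul, hval]
  split_ifs <;> ring

end GTBulk

end

noncomputable section

namespace GTBulk

open Complex MeasureTheory Set
open scoped BigOperators ComplexConjugate

/-- The double contour integral in the kernel as a single integral over the `z`-contour. -/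
lemma doubleIntegral_eq_single {N : ℕ} [NeZero N] {t : TopRow N} (ht : StrictAnti t)
    (x₁ : ℤ) (n₁ : ℕ) (x₂ : ℤ) (n₂ : ℕ) {R : ℝ} (hR : IsLargeRadius N t x₁ n₁ x₂ R)
    (p : Polynomial ℂ) (r : ℤ → ℂ)
    (hf : ∀ z : ℂ, (∀ k ∈ pochRoots x₁ (N - n₁ + 1), z ≠ k) → wFactor N t x₁ n₁ z =
        p.eval z + ∑ k ∈ pochRoots x₁ (N - n₁ + 1), r k * (1 / (z - k)))
    (p' : Polynomial ℂ) (r' : ℤ → ℂ)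
    (hg : ∀ z : ℂ, (∀ k ∈ rowSet t, z ≠ k) → zFactor N t x₂ n₂ z * p.eval z =
        p'.eval z + ∑ k ∈ rowSet t, r' k * (1 / (z - k))) :
    (∮ z in C(((zCenter t x₂ : ℝ) : ℂ), zRadius t x₂), ∮ w in C((0 : ℂ), R),
          kernelIntegrand N t x₁ n₁ x₂ n₂ z w) =
      2 * Real.pi * I * (2 * Real.pi * I * ∑ k ∈ rowSet t with x₂ ≤ k, r' k) := by
  have hle : ∀ k ∈ rowSet t, k ≤ t 0 := by
    intro k hk
    simp only [rowSet, Finset.mem_image, Finset.mem_univ, true_and] at hk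
    obtain ⟨i, rfl⟩ := hk
    exact ht.antitone (Fin.zero_le i)
  by_cases hlt : t 0 < x₂
  · have h0 : zRadius t x₂ = 0 := by
      have : (t 0 : ℝ) + 1 ≤ x₂ := by exact_mod_cast hlt
      exact max_eq_left (by linarith)
    rw [h0, circleIntegral.integral_radius_zero, Finset.filter_eq_empty_iff.2]
    · simp
    · intro k hk; have := hle k hk; omega
  push Not at hlt
  have hlt' : (x₂ : ℝ) ≤ t 0 := by exact_mod_cast hlt
  have hrad : zRadius t x₂ = ((t 0 : ℝ) - x₂ + 1) / 2 := max_eq_right (by linarith)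
  have hcen : zCenter t x₂ = ((x₂ : ℝ) + t 0) / 2 := rfl
  have hinner : ∀ z ∈ Metric.sphere ((zCenter t x₂ : ℝ) : ℂ) (zRadius t x₂),
      (∮ w in C((0 : ℂ), R), kernelIntegrand N t x₁ n₁ x₂ n₂ z w) =
        2 * Real.pi * I * (zFactor N t x₂ n₂ z * p.eval z) := by
    intro z hz
    have hzint : ∀ k : ℤ, z ≠ k := by
      intro k h
      rw [Metric.mem_sphere, h, dist_eq_norm, ← Complex.ofReal_intCast, ← Complex.ofReal_sub,
        Complex.norm_real, Real.norm_eq_abs, hrad, hcen] at hz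
      rcases abs_eq (by linarith) |>.1 hz with h | h
      · have h2 : ((2 * k : ℤ) : ℝ) = ((2 * t 0 + 1 : ℤ) : ℝ) := by push_cast; linarith
        have := Int.cast_injective h2; omega
      · have h2 : ((2 * k : ℤ) : ℝ) = ((2 * x₂ - 1 : ℤ) : ℝ) := by push_cast; linarith
        have := Int.cast_injective h2; omega
    simp only [kernelIntegrand_eq]
    rw [circleIntegral.integral_const_mul, circleIntegral_cauchy p _ r hf ?_ (fun k _ => hzint k)
      (hR.1 z (Metric.sphere_subset_closedBall hz))]
    · ring
    · intro k hk
      simp only [pochRoots, Finset.mem_Ioc] at hk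
      have := hR.2 (x₁ - k).toNat (by simp; omega)
      have h2 : (((x₁ - k).toNat : ℕ) : ℝ) = x₁ - k := by
        have : (((x₁ - k).toNat : ℤ)) = x₁ - k := Int.toNat_of_nonneg (by omega)
        exact_mod_cast congrArg (Int.cast : ℤ → ℝ) this
      rw [h2] at this
      simpa using this
  have hR0 : 0 ≤ zRadius t x₂ := le_max_left _ _
  rw [circleIntegral.integral_congr hR0 hinner, circleIntegral.integral_const_mul, hrad, hcen,
    circleIntegral_rational p' (rowSet t) r' hg hlt]
  congr 3
  ext k
  simp only [Finset.mem_filter, and_congr_right_iff]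
  intro hk
  simp [hle k hk]

/-- Deformation of the contours in the kernel: both contours pass through `b`, and the residue at
`w = z` contributes a single integral. -/
theorem doubleIntegral_deform {N : ℕ} [NeZero N] {t : TopRow N} (ht : StrictAnti t)
    (x₁ : ℤ) (n₁ : ℕ) (x₂ : ℤ) (n₂ : ℕ) {R : ℝ} (hR : IsLargeRadius N t x₁ n₁ x₂ R)
    {b : ℂ} (hb : b.im ≠ 0) {cT c₀ cL cR : ℝ} (PT : UPath b cT) (P0 : UPath b c₀)
    (QR : UPath b cR) (QL : UPath b cL)
    (hT : (t 0 : ℝ) < cT) (h0T : c₀ ≤ cT) (hc0 : c₀ < x₂) (hc0' : (x₂ : ℝ) - (N - n₂ - 1 : ℕ) - 1 < c₀)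
    (hcL : cL < (x₁ : ℝ) - (N - n₁ : ℕ)) (hcR : (x₁ : ℝ) < cR)
    (hwT : ∀ A ∈ PT.arcs, ∀ v ∈ Ioo A.lo A.hi, A.fn v ∉ QR.support ∪ QL.support ∧
      UPath.wind QR QL (A.fn v) = 0 ∧ UPath.wind QR QL (conj (A.fn v)) = 0)
    (hw0 : ∀ A ∈ P0.arcs, ∀ v ∈ Ioo A.lo A.hi, A.fn v ∉ QR.support ∪ QL.support ∧
      UPath.wind QR QL (A.fn v) = 2 * Real.pi * I ∧
      UPath.wind QR QL (conj (A.fn v)) = 2 * Real.pi * I) :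
    (∮ z in C(((zCenter t x₂ : ℝ) : ℂ), zRadius t x₂), ∮ w in C((0 : ℂ), R),
          kernelIntegrand N t x₁ n₁ x₂ n₂ z w) =
      PT.cross (fun z => zFactor N t x₂ n₂ z *
        UPath.loop QR QL (fun w => wFactor N t x₁ n₁ w * (1 / (w - z)))) -
      P0.cross (fun z => zFactor N t x₂ n₂ z *
        UPath.loop QR QL (fun w => wFactor N t x₁ n₁ w * (1 / (w - z)))) +
      2 * Real.pi * I * PT.cross (fun z => zFactor N t x₂ n₂ z * wFactor N t x₁ n₁ z) := by
  obtain ⟨p, r, hf⟩ := wFactor_partial_fractions t x₁ n₁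
  obtain ⟨p', r', hr', hg⟩ := zFactor_partial_fractions ht x₂ n₂ p
  rw [doubleIntegral_eq_single ht x₁ n₁ x₂ n₂ hR p r hf p' r' hg]
  have hle : ∀ k ∈ rowSet t, k ≤ t 0 := by
    intro k hk
    simp only [rowSet, Finset.mem_image, Finset.mem_univ, true_and] at hk
    obtain ⟨i, rfl⟩ := hk
    exact ht.antitone (Fin.zero_le i)
  have hloop := UPath.loop_rational PT P0 h0T hb (rowSet t) r' p'.differentiable hg
  have hsum : ∑ k ∈ rowSet t with c₀ < ((k : ℤ) : ℝ) ∧ ((k : ℤ) : ℝ) < cT, r' k =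
      ∑ k ∈ rowSet t with x₂ ≤ k, r' k := by
    rw [Finset.sum_filter, Finset.sum_filter]
    refine Finset.sum_congr rfl fun k hk => ?_
    have h1 : (k : ℝ) < cT := lt_of_le_of_lt (by exact_mod_cast hle k hk) hT
    by_cases h2 : x₂ ≤ k
    · have h3 : (x₂ : ℝ) ≤ k := by exact_mod_cast h2
      rw [if_pos ⟨by linarith, h1⟩, if_pos h2]
    · rw [if_neg h2]
      split_ifs with h3
      · refine hr' k (by omega) ?_
        have h4 : ((x₂ - (N - n₂ - 1 : ℕ) - 1 : ℤ) : ℝ) < k := by push_cast; linarith [h3.1]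
        have h5 : x₂ - (N - n₂ - 1 : ℕ) - 1 < k := by exact_mod_cast h4
        omega
      · rfl
  rw [← hsum, ← hloop]
  have hpoles : ∀ k ∈ pochRoots x₁ (N - n₁ + 1), cL < k ∧ (k : ℝ) < cR := by
    intro k hk
    simp only [pochRoots, Finset.mem_Ioc] at hk
    have h1 : (k : ℝ) ≤ x₁ := by exact_mod_cast hk.2
    have h2 : ((x₁ - (N - n₁ : ℕ) : ℤ) : ℝ) ≤ k := by
      exact_mod_cast (by omega : x₁ - (N - n₁ : ℕ) ≤ k)
    push_cast at h2
    constructor <;> linarith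
  have hLR : cL ≤ cR := by
    have : (0 : ℝ) ≤ (N - n₁ : ℕ) := Nat.cast_nonneg _
    linarith
  have key : ∀ z : ℂ, (∀ k : ℤ, z ≠ k) → z ∉ QR.support ∪ QL.support →
      UPath.loop QR QL (fun w => wFactor N t x₁ n₁ w * (1 / (w - z))) =
      2 * Real.pi * I * p.eval z + (UPath.wind QR QL z - 2 * Real.pi * I) * wFactor N t x₁ n₁ z :=
    fun z hz hzs => UPath.loop_cauchy QR QL hLR hb p _ r hf hpoles (fun k _ => hz k) hzs
  have hbar : ∀ z : ℂ, z ∉ QR.support ∪ QL.support → conj z ∉ QR.support ∪ QL.support := by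
    intro z hz h
    apply hz
    exact h.imp QR.conj_mem_support.1 QL.conj_mem_support.1
  have hint : ∀ {c : ℝ} (P : UPath b c), ∀ A ∈ P.arcs, ∀ v ∈ Ioo A.lo A.hi,
      (∀ k : ℤ, A.fn v ≠ k) ∧ (∀ k : ℤ, conj (A.fn v) ≠ k) := fun P A hA v hv =>
    ⟨fun k => P.not_int_support (P.subset_support hA ⟨v, Ioo_subset_Icc_self hv, rfl⟩) k,
      fun k => P.not_int_support (P.bar_subset_support hA ⟨v, Ioo_subset_Icc_self hv, rfl⟩) k⟩
  have e0 : P0.cross (fun z => zFactor N t x₂ n₂ z *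
        UPath.loop QR QL (fun w => wFactor N t x₁ n₁ w * (1 / (w - z)))) =
      P0.cross (fun z => 2 * Real.pi * I * (zFactor N t x₂ n₂ z * p.eval z)) := by
    refine P0.cross_congr fun A hA v hv => ?_
    obtain ⟨h1, h2, h3⟩ := hw0 A hA v hv
    obtain ⟨h4, h5⟩ := hint P0 A hA v hv
    rw [key _ h4 h1, key _ h5 (hbar _ h1), h2, h3]
    constructor <;> ring
  have eT : PT.cross (fun z => zFactor N t x₂ n₂ z *
        UPath.loop QR QL (fun w => wFactor N t x₁ n₁ w * (1 / (w - z)))) =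
      PT.cross (fun z => 2 * Real.pi * I * (zFactor N t x₂ n₂ z * p.eval z) +
        (-(2 * Real.pi * I)) * (zFactor N t x₂ n₂ z * wFactor N t x₁ n₁ z)) := by
    refine PT.cross_congr fun A hA v hv => ?_
    obtain ⟨h1, h2, h3⟩ := hwT A hA v hv
    obtain ⟨h4, h5⟩ := hint PT A hA v hv
    rw [key _ h4 h1, key _ h5 (hbar _ h1), h2, h3]
    constructor <;> ring
  have hzc : ContinuousOn (zFactor N t x₂ n₂) PT.support := by
    unfold zFactor poch
    refine ContinuousOn.div (by fun_prop) (by fun_prop) fun z hz => ?_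
    exact Finset.prod_ne_zero_iff.2 fun r _ => sub_ne_zero.2 (PT.not_int_support hz _)
  have hwc : ContinuousOn (wFactor N t x₁ n₁) PT.support := by
    unfold wFactor
    refine ContinuousOn.div (by fun_prop) (by unfold poch; fun_prop) fun z hz => ?_
    rw [poch_eq_prod]
    exact Finset.prod_ne_zero_iff.2 fun r _ => sub_ne_zero.2 (PT.not_int_support hz _)
  have c1 : ContinuousOn (fun z => 2 * Real.pi * I * (zFactor N t x₂ n₂ z * p.eval z))
      PT.support := continuousOn_const.mul (hzc.mul p.continuous.continuousOn)
  have c2 : ContinuousOn (fun z => (-(2 * Real.pi * I)) *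
      (zFactor N t x₂ n₂ z * wFactor N t x₁ n₁ z)) PT.support :=
    continuousOn_const.mul (hzc.mul hwc)
  rw [e0, eT, PT.cross_add c1 c2, PT.cross_const_mul, PT.cross_const_mul, P0.cross_const_mul]
  unfold UPath.loop
  ring

end GTBulk

end

noncomputable section

namespace GTBulk

open MeasureTheory Set

/-- The function `e ^ α - 1 - α`, made odd. -/
def oddExp (α : ℝ) : ℝ := if 0 ≤ α then Real.exp α - 1 - α else -(Real.exp α - 1 - α)

lemma oddExp_of_nonneg {α : ℝ} (h : 0 ≤ α) : oddExp α = Real.exp α - 1 - α := if_pos h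

lemma oddExp_of_nonpos {α : ℝ} (h : α ≤ 0) : oddExp α = -(Real.exp α - 1 - α) := by
  rcases h.lt_or_eq with h | rfl
  · exact if_neg (not_le.2 h)
  · simp [oddExp]

lemma hasDerivAt_exp_sub (α : ℝ) :
    HasDerivAt (fun α => Real.exp α - 1 - α) (Real.exp α - 1) α :=
  ((Real.hasDerivAt_exp α).sub_const 1).sub (hasDerivAt_id' α)

lemma hasDerivAt_oddExp {α : ℝ} (h : α ≠ 0) : HasDerivAt oddExp |Real.exp α - 1| α := by
  rcases lt_or_gt_of_ne h with h | h
  · have h1 : Real.exp α - 1 < 0 := by linarith [Real.exp_zero ▸ Real.exp_lt_exp.2 h]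
    rw [abs_of_neg h1]
    refine (hasDerivAt_exp_sub α).neg.congr_of_eventuallyEq ?_
    filter_upwards [Iio_mem_nhds h] with x hx using oddExp_of_nonpos (le_of_lt hx)
  · have h1 : 0 < Real.exp α - 1 := by linarith [Real.one_lt_exp_iff.2 h]
    rw [abs_of_pos h1]
    refine (hasDerivAt_exp_sub α).congr_of_eventuallyEq ?_
    filter_upwards [Ioi_mem_nhds h] with x hx using oddExp_of_nonneg (le_of_lt hx)

lemma continuous_oddExp : Continuous oddExp := by
  unfold oddExp
  refine Continuous.if_le (by fun_prop) (by fun_prop) continuous_const continuous_id ?_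
  intro x hx
  simp [← hx]

lemma strictMono_oddExp : StrictMono oddExp := by
  have h1 : StrictMonoOn oddExp (Ici 0) := by
    refine strictMonoOn_of_deriv_pos (convex_Ici 0) continuous_oddExp.continuousOn fun x hx => ?_
    rw [interior_Ici] at hx
    rw [(hasDerivAt_oddExp (ne_of_gt hx)).deriv]
    have : 0 < Real.exp x - 1 := by linarith [Real.one_lt_exp_iff.2 hx]
    exact abs_pos.2 this.ne'
  have h2 : StrictMonoOn oddExp (Iic 0) := by
    refine strictMonoOn_of_deriv_pos (convex_Iic 0) continuous_oddExp.continuousOn fun x hx => ?_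
    rw [interior_Iic] at hx
    rw [(hasDerivAt_oddExp (ne_of_lt hx)).deriv]
    have : Real.exp x - 1 < 0 := by linarith [Real.exp_zero ▸ Real.exp_lt_exp.2 (mem_Iio.1 hx)]
    exact abs_pos.2 this.ne
  exact h2.Iic_union_Ici h1

lemma surjective_oddExp : Function.Surjective oddExp := by
  refine continuous_oddExp.surjective ?_ ?_
  · have h : ∀ᶠ x : ℝ in Filter.atTop, x ≤ oddExp (x + 2) := by
      filter_upwards [Filter.eventually_ge_atTop 0] with x hx
      rw [oddExp_of_nonneg (by linarith)]
      have := Real.quadratic_le_exp_of_nonneg (by linarith : 0 ≤ x + 2)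
      nlinarith
    have h2 := Filter.tendsto_atTop_mono' _ h Filter.tendsto_id
    have h3 := h2.comp (Filter.tendsto_atTop_add_const_right Filter.atTop (-2) Filter.tendsto_id)
    refine h3.congr fun x => by simp
  · have h : ∀ᶠ x : ℝ in Filter.atBot, oddExp x ≤ x + 1 := by
      filter_upwards [Filter.eventually_le_atBot 0] with x hx
      rw [oddExp_of_nonpos hx]
      linarith [Real.exp_pos x]
    exact Filter.tendsto_atBot_mono' _ h
      (Filter.tendsto_atBot_add_const_right _ _ Filter.tendsto_id)

/-- The order isomorphism given by `oddExp`. -/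
def oddExpIso : ℝ ≃o ℝ := strictMono_oddExp.orderIsoOfSurjective oddExp surjective_oddExp

/-- The inverse function of `oddExp`. -/
def oddLog (y : ℝ) : ℝ := oddExpIso.symm y

lemma oddExp_oddLog (y : ℝ) : oddExp (oddLog y) = y := oddExpIso.apply_symm_apply y

lemma continuous_oddLog : Continuous oddLog := oddExpIso.symm.continuous

lemma oddLog_nonneg {y : ℝ} : 0 ≤ oddLog y ↔ 0 ≤ y := by
  have h0 : oddExp 0 = 0 := by simp [oddExp]
  rw [← strictMono_oddExp.le_iff_le, oddExp_oddLog, h0]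

lemma oddLog_nonpos {y : ℝ} : oddLog y ≤ 0 ↔ y ≤ 0 := by
  have h0 : oddExp 0 = 0 := by simp [oddExp]
  rw [← strictMono_oddExp.le_iff_le, oddExp_oddLog, h0]

lemma oddLog_zero : oddLog 0 = 0 := le_antisymm (oddLog_nonpos.2 le_rfl) (oddLog_nonneg.2 le_rfl)

lemma hasDerivAt_oddLog {y : ℝ} (hy : y ≠ 0) :
    HasDerivAt oddLog |Real.exp (oddLog y) - 1|⁻¹ y := by
  have h0 : oddLog y ≠ 0 := fun h => hy (by
    have := oddExp_oddLog y
    rw [h] at this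
    rw [← this]; simp [oddExp])
  refine HasDerivAt.of_local_left_inverse continuous_oddLog.continuousAt (hasDerivAt_oddExp h0) ?_
    (Filter.Eventually.of_forall oddExp_oddLog)
  rw [abs_ne_zero, sub_ne_zero]
  exact fun h => h0 (Real.exp_eq_one_iff _ |>.1 h)

/-- For `e = ± 1` the solution `p` of `p - P - P log (p / P) = v` with `e (p - P) ≥ 0`. -/
def branch (P e v : ℝ) : ℝ := P * Real.exp (oddLog (e * v / P))

section Branch

variable {P e v : ℝ}

lemma branch_zero (P e : ℝ) : branch P e 0 = P := by simp [branch, oddLog_zero]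

lemma branch_pos (hP : 0 < P) : 0 < branch P e v := by unfold branch; positivity

lemma continuous_branch (P e : ℝ) : Continuous (branch P e) := by
  unfold branch
  exact continuous_const.mul (Real.continuous_exp.comp (continuous_oddLog.comp (by fun_prop)))

lemma log_branch (hP : 0 < P) : Real.log (branch P e v / P) = oddLog (e * v / P) := by
  unfold branch
  rw [mul_div_cancel_left₀ _ hP.ne', Real.log_exp]

lemma branch_eq (hP : 0 < P) (he : e = 1 ∨ e = -1) (hv : 0 ≤ v) :
    branch P e v - P - P * Real.log (branch P e v / P) = v := by
  have h := oddExp_oddLog (e * v / P)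
  rw [log_branch hP]
  unfold branch
  rcases he with rfl | rfl
  · rw [oddExp_of_nonneg (oddLog_nonneg.2 (by positivity))] at h
    generalize oddLog (1 * v / P) = α at h ⊢
    have h2 : P * (Real.exp α - 1 - α) = v := by rw [h]; field_simp
    linarith
  · rw [oddExp_of_nonpos (oddLog_nonpos.2 (by
      rw [neg_one_mul, neg_div]; linarith [div_nonneg hv hP.le]))] at h
    generalize oddLog (-1 * v / P) = α at h ⊢
    have h2 : P * -(Real.exp α - 1 - α) = -v := by rw [h]; field_simp
    linarith

lemma branch_ne (hP : 0 < P) (he : e = 1 ∨ e = -1) (hv : 0 < v) : branch P e v ≠ P := by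
  intro h
  have := branch_eq hP he hv.le
  rw [h, div_self hP.ne'] at this
  simp at this
  linarith

lemma le_branch (hP : 0 < P) (hv : 0 ≤ v) : P ≤ branch P 1 v := by
  unfold branch
  have : 0 ≤ oddLog (1 * v / P) := oddLog_nonneg.2 (by positivity)
  nlinarith [Real.one_le_exp this]

lemma branch_le (hP : 0 < P) (hv : 0 ≤ v) : branch P (-1) v ≤ P := by
  unfold branch
  have : oddLog (-1 * v / P) ≤ 0 := oddLog_nonpos.2 (by
      rw [neg_one_mul, neg_div]; linarith [div_nonneg hv hP.le])
  nlinarith [Real.exp_le_one_iff.2 this]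

lemma branch_sign (hP : 0 < P) (he : e = 1 ∨ e = -1) (hv : 0 < v) : 0 < e * (branch P e v - P) := by
  have h := branch_ne hP he hv
  rcases he with rfl | rfl
  · have := lt_of_le_of_ne (le_branch hP hv.le) h.symm; linarith
  · have := lt_of_le_of_ne (branch_le hP hv.le) h; linarith

lemma hasDerivAt_branch (hP : 0 < P) (he : e = 1 ∨ e = -1) (hv : 0 < v) :
    HasDerivAt (branch P e) (branch P e v / (branch P e v - P)) v := by
  have hne : e * v / P ≠ 0 := by
    rcases he with rfl | rfl
    · positivity
    · rw [neg_one_mul, neg_div]; exact (neg_lt_zero.2 (by positivity)).ne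
  have h1 : HasDerivAt (fun v => e * v / P) (e / P) v := by
    simpa using ((hasDerivAt_id' v).const_mul e).div_const P
  have h2 := (((hasDerivAt_oddLog hne).comp v h1).exp).const_mul P
  refine h2.congr_deriv ?_
  have hs := branch_sign hP he hv
  have hb : branch P e v = P * Real.exp (oddLog (e * v / P)) := rfl
  set E := Real.exp (oddLog (e * v / P)) with hE
  rw [hb] at hs ⊢
  simp only [Function.comp_apply, ← hE]
  have hs2 : 0 < e * (E - 1) := by
    have : e * (P * E - P) = P * (e * (E - 1)) := by ring
    rw [this] at hs
    exact pos_of_mul_pos_right hs hP.le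
  have hne2 : E - 1 ≠ 0 := fun h => by rw [h] at hs2; simp at hs2
  have h4 : P * E - P ≠ 0 := by
    rw [show P * E - P = P * (E - 1) by ring]; exact mul_ne_zero hP.ne' hne2
  rcases he with rfl | rfl
  · rw [abs_of_pos (by linarith)]
    field_simp
  · rw [abs_of_neg (by linarith)]
    field_simp

lemma mul_branch_le_sq (hP : 0 < P) (he : e = 1 ∨ e = -1) (hv : 0 ≤ v) :
    v * branch P e v ≤ (branch P e v - P) ^ 2 := by
  have h := branch_eq hP he hv
  set p := branch P e v with hp
  have hp0 : 0 < p := branch_pos hP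
  have h1 := Real.one_sub_inv_le_log_of_pos (div_pos hp0 hP)
  rw [inv_div] at h1
  have h2 : v ≤ p - P - P * (1 - P / p) := by nlinarith
  calc v * p ≤ (p - P - P * (1 - P / p)) * p := by nlinarith
    _ = (p - P) ^ 2 := by field_simp; try ring

lemma add_le_branch (hP : 0 < P) (hv : 0 ≤ v) : P + v ≤ branch P 1 v := by
  have h := branch_eq hP (Or.inl rfl) hv
  have h1 : 0 ≤ Real.log (branch P 1 v / P) :=
    Real.log_nonneg ((one_le_div hP).2 (le_branch hP hv))
  nlinarith

lemma branch_le_two_mul (hP : 0 < P) (hv : 0 ≤ v) : branch P 1 v ≤ 2 * (P + v) := by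
  have h := branch_eq hP (Or.inl rfl) hv
  set p := branch P 1 v with hp
  have hp0 : 0 < p := branch_pos hP
  have h1 : Real.log (p / P) ≤ p / P / 2 := by
    have h2 := Real.add_one_le_exp (p / P / 2 - 1)
    have h3 := Real.log_le_sub_one_of_pos (x := p / P / 2) (by positivity)
    rw [Real.log_div (by positivity) (by norm_num)] at h3
    have h4 := Real.log_two_lt_d9
    linarith
  have h2 : P * (p / P / 2) = p / 2 := by field_simp
  nlinarith

lemma exp_le_branch (hP : 0 < P) (hv : 0 ≤ v) :
    P * Real.exp (-1 - v / P) ≤ branch P (-1) v := by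
  have h := branch_eq hP (Or.inr rfl) hv
  have hp0 : 0 < branch P (-1) v := branch_pos hP
  rw [log_branch hP] at h
  have : -1 - v / P ≤ oddLog (-1 * v / P) := by
    rw [← sub_nonneg]
    have h2 : P * (oddLog (-1 * v / P) - (-1 - v / P)) = branch P (-1) v := by
      have h3 : P * (v / P) = v := by field_simp
      linarith
    exact nonneg_of_mul_nonneg_right (by rw [h2]; exact hp0.le) hP
  unfold branch
  gcongr

lemma branch_le_exp (hP : 0 < P) (hv : 0 ≤ v) :
    branch P (-1) v ≤ P * Real.exp (-(v / P)) := by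
  have h := branch_eq hP (Or.inr rfl) hv
  have hp0 := branch_le hP hv
  rw [log_branch hP] at h
  have : oddLog (-1 * v / P) ≤ -(v / P) := by
    rw [← sub_nonneg]
    have h2 : P * (-(v / P) - oddLog (-1 * v / P)) = P - branch P (-1) v := by
      have h3 : P * (v / P) = v := by field_simp
      linarith
    exact nonneg_of_mul_nonneg_right (by rw [h2]; linarith) hP
  unfold branch
  gcongr

end Branch

end GTBulk

end

noncomputable section

namespace GTBulk

open MeasureTheory Set

/-- Real part of the point at squared distances `p`, `q` from the real points `a`, `b`. -/
def ptRe (a b p q : ℝ) : ℝ := a + (p - q + (b - a) ^ 2) / (2 * (b - a))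

/-- Square of the imaginary part of the point at squared distances `p`, `q` from `a`, `b`. -/
def ptImSq (a b p q : ℝ) : ℝ := p - (ptRe a b p q - a) ^ 2

/-- The point in the upper half-plane at squared distances `p`, `q` from `a`, `b`. -/
def pt (a b p q : ℝ) : ℂ := ⟨ptRe a b p q, √(ptImSq a b p q)⟩

/-- The squared distance of `pt a b p q` from the real point `s`. -/
def dsq (a b p q s : ℝ) : ℝ :=
  ((b - s) * p + (s - a) * q) / (b - a) + (s - a) * (s - b)

section Pt

variable {a b p q s : ℝ}

lemma normSq_pt_sub (hab : a < b) (h : 0 ≤ ptImSq a b p q) (s : ℝ) :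
    Complex.normSq (pt a b p q - s) = dsq a b p q s := by
  have hL : b - a ≠ 0 := (sub_pos.2 hab).ne'
  rw [Complex.normSq_apply]
  simp only [pt, Complex.sub_re, Complex.ofReal_re, Complex.sub_im, Complex.ofReal_im, sub_zero]
  rw [Real.mul_self_sqrt h, ptImSq, ptRe, dsq]
  field_simp
  ring

lemma dsq_left (hab : a < b) : dsq a b p q a = p := by
  have hL : b - a ≠ 0 := (sub_pos.2 hab).ne'
  simp [dsq]; field_simp

lemma dsq_right (hab : a < b) : dsq a b p q b = q := by
  have hL : b - a ≠ 0 := (sub_pos.2 hab).ne'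
  simp [dsq]; field_simp

lemma normSq_sub_eq_dsq (hab : a < b) (z : ℂ) (s : ℝ) : Complex.normSq (z - s) =
    dsq a b (Complex.normSq (z - a)) (Complex.normSq (z - b)) s := by
  have hL : b - a ≠ 0 := (sub_pos.2 hab).ne'
  simp only [Complex.normSq_apply, dsq, Complex.sub_re, Complex.ofReal_re, Complex.sub_im,
    Complex.ofReal_im, sub_zero]
  field_simp
  ring

lemma ptRe_normSq (hab : a < b) (z : ℂ) :
    ptRe a b (Complex.normSq (z - a)) (Complex.normSq (z - b)) = z.re := by
  have hL : b - a ≠ 0 := (sub_pos.2 hab).ne'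
  simp only [Complex.normSq_apply, ptRe, Complex.sub_re, Complex.ofReal_re, Complex.sub_im,
    Complex.ofReal_im, sub_zero]
  field_simp
  ring

lemma ptImSq_normSq (hab : a < b) (z : ℂ) :
    ptImSq a b (Complex.normSq (z - a)) (Complex.normSq (z - b)) = z.im ^ 2 := by
  rw [ptImSq, ptRe_normSq hab]
  simp only [Complex.normSq_apply, Complex.sub_re, Complex.ofReal_re, Complex.sub_im,
    Complex.ofReal_im, sub_zero]
  ring

lemma pt_normSq (hab : a < b) {z : ℂ} (hz : 0 ≤ z.im) :
    pt a b (Complex.normSq (z - a)) (Complex.normSq (z - b)) = z := by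
  rw [pt, ptRe_normSq hab, ptImSq_normSq hab, Real.sqrt_sq hz]

lemma ptImSq_eq_right (hab : a < b) : ptImSq a b p q = q - (ptRe a b p q - b) ^ 2 := by
  have hL : b - a ≠ 0 := (sub_pos.2 hab).ne'
  rw [ptImSq, ptRe]
  field_simp
  ring

lemma ptImSq_le_left : ptImSq a b p q ≤ p := by
  rw [ptImSq]; nlinarith [sq_nonneg (ptRe a b p q - a)]

lemma ptImSq_le_right (hab : a < b) : ptImSq a b p q ≤ q := by
  rw [ptImSq_eq_right hab]; nlinarith [sq_nonneg (ptRe a b p q - b)]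

lemma dsq_pos (hab : a < b) (h : 0 < ptImSq a b p q) (s : ℝ) : 0 < dsq a b p q s := by
  rw [← normSq_pt_sub hab h.le, Complex.normSq_pos]
  intro h0
  have := congrArg Complex.im h0
  simp only [pt, Complex.sub_im, Complex.ofReal_im, sub_zero, Complex.zero_im] at this
  exact (Real.sqrt_pos.2 h).ne' this

lemma heron (hab : a < b) : 4 * p * q - (p + q - (b - a) ^ 2) ^ 2 =
    4 * (b - a) ^ 2 * ptImSq a b p q := by
  have hL : b - a ≠ 0 := (sub_pos.2 hab).ne'
  rw [ptImSq, ptRe]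
  field_simp
  ring

end Pt

/-- The definite quadratic form governing the decay along the level curves. -/
lemma quadratic_form_lower {L P Q Y u w : ℝ} (hP : 0 < P) (hQ : 0 < Q)
    (hY : 4 * P * Q - (P + Q - L ^ 2) ^ 2 = 4 * L ^ 2 * Y) (hY0 : 0 ≤ Y) :
    L ^ 2 * Y / (P + Q) * |u * w| ≤ Q * u ^ 2 - (P + Q - L ^ 2) * (u * w) + P * w ^ 2 := by
  set κ := L ^ 2 * Y / (P + Q) with hκ
  set k := P + Q - L ^ 2 with hk
  have hPQ : 0 < P + Q := by linarith
  have hκ0 : 0 ≤ κ := by positivity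
  have hκm : κ * (P + Q) = L ^ 2 * Y := by rw [hκ]; field_simp
  have hLY : 0 ≤ L ^ 2 * Y := by positivity
  have hk1 : |k| ≤ P + Q := by
    refine abs_le_of_sq_le_sq ?_ hPQ.le
    nlinarith [sq_nonneg (P - Q)]
  have hκ2 : κ ≤ (P + Q) / 4 := by
    have h1 : L ^ 2 * Y ≤ (P + Q) ^ 2 / 4 := by nlinarith [sq_nonneg (P - Q), sq_nonneg k]
    rw [hκ, div_le_iff₀ hPQ]; nlinarith
  have hM : (|k| + κ) ^ 2 ≤ 4 * P * Q := by
    have h2 : κ ^ 2 ≤ κ * (P + Q) / 4 := by nlinarith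
    have h3 : |k| * κ ≤ (P + Q) * κ := by nlinarith
    nlinarith [sq_abs k]
  have h4 : (|k| + κ) * |u * w| ≤ Q * u ^ 2 + P * w ^ 2 := by
    refine le_of_sq_le_sq ?_ (by positivity)
    have h5 : ((|k| + κ) * |u * w|) ^ 2 ≤ 4 * P * Q * (u * w) ^ 2 := by
      rw [mul_pow, sq_abs]; exact mul_le_mul_of_nonneg_right hM (sq_nonneg _)
    nlinarith [sq_nonneg (Q * u ^ 2 - P * w ^ 2)]
  have h6 : k * (u * w) ≤ |k| * |u * w| := by
    rw [← abs_mul]; exact le_abs_self _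
  linarith

/-- Uniform bounds on the geometric data: the critical point `τ` and the interval `[a, b]`. -/
structure Geo (K : ℝ) (τ : ℂ) (a b : ℝ) : Prop where
  one_le : 1 ≤ K
  im : 1 / K ≤ τ.im
  norm : ‖τ‖ ≤ K
  len : 1 / K ≤ b - a
  left : |a| ≤ K
  right : |b| ≤ K

/-- Squared distance of `b` from the branch of the level curve with sign `e`, at time `v`. -/
def sqd (τ : ℂ) (a : ℝ) (e v : ℝ) : ℝ := branch (Complex.normSq (τ - a)) e v

/-- The level curve through `τ` with signs `e₁`, `e₂`. -/
def curve (τ : ℂ) (a b e₁ e₂ v : ℝ) : ℂ := pt a b (sqd τ a e₁ v) (sqd τ b e₂ v)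

/-- The squared imaginary part along the level curve. -/
def curveImSq (τ : ℂ) (a b e₁ e₂ v : ℝ) : ℝ := ptImSq a b (sqd τ a e₁ v) (sqd τ b e₂ v)

section Curve

variable {τ : ℂ} {a b e₁ e₂ v : ℝ}

lemma sqd_zero : sqd τ a e₁ 0 = Complex.normSq (τ - a) := branch_zero _ _

lemma continuous_sqd : Continuous (sqd τ a e₁) := continuous_branch _ _

lemma curve_zero (hab : a < b) (hτ : 0 ≤ τ.im) : curve τ a b e₁ e₂ 0 = τ := by
  rw [curve, sqd_zero, sqd_zero, pt_normSq hab hτ]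

lemma curveImSq_zero (hab : a < b) : curveImSq τ a b e₁ e₂ 0 = τ.im ^ 2 := by
  rw [curveImSq, sqd_zero, sqd_zero, ptImSq_normSq hab]

lemma continuous_curveImSq : Continuous (curveImSq τ a b e₁ e₂) := by
  unfold curveImSq ptImSq ptRe
  have h1 := continuous_sqd (τ := τ) (a := a) (e₁ := e₁)
  have h2 := continuous_sqd (τ := τ) (a := b) (e₁ := e₂)
  fun_prop

lemma continuous_curve : Continuous (curve τ a b e₁ e₂) := by
  have h1 := continuous_sqd (τ := τ) (a := a) (e₁ := e₁)
  have h2 := continuous_sqd (τ := τ) (a := b) (e₁ := e₂)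
  have h3 : curve τ a b e₁ e₂ = fun v => ((ptRe a b (sqd τ a e₁ v) (sqd τ b e₂ v) : ℝ) : ℂ) +
      ((√(curveImSq τ a b e₁ e₂ v) : ℝ) : ℂ) * Complex.I := by
    ext v
    apply Complex.ext <;> simp [curve, pt, curveImSq]
  rw [h3]
  have h4 : Continuous (fun v => ptRe a b (sqd τ a e₁ v) (sqd τ b e₂ v)) := by
    unfold ptRe; fun_prop
  exact (Complex.continuous_ofReal.comp h4).add ((Complex.continuous_ofReal.comp
    (Real.continuous_sqrt.comp continuous_curveImSq)).mul continuous_const)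

lemma normSq_sub_pos (hτ : 0 < τ.im) (s : ℝ) : 0 < Complex.normSq (τ - s) := by
  rw [Complex.normSq_pos]
  intro h
  have := congrArg Complex.im h
  simp at this
  exact hτ.ne' this

lemma sqd_pos (hτ : 0 < τ.im) : 0 < sqd τ a e₁ v := branch_pos (normSq_sub_pos hτ a)

lemma curve_im (τ : ℂ) (a b e₁ e₂ v : ℝ) :
    (curve τ a b e₁ e₂ v).im = √(curveImSq τ a b e₁ e₂ v) := rfl

lemma normSq_curve_sub (hab : a < b) (h : 0 ≤ curveImSq τ a b e₁ e₂ v) (s : ℝ) :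
    Complex.normSq (curve τ a b e₁ e₂ v - s) = dsq a b (sqd τ a e₁ v) (sqd τ b e₂ v) s :=
  normSq_pt_sub hab h s

lemma normSq_curve_sub_left (hab : a < b) (h : 0 ≤ curveImSq τ a b e₁ e₂ v) :
    Complex.normSq (curve τ a b e₁ e₂ v - a) = sqd τ a e₁ v := by
  rw [normSq_curve_sub hab h, dsq_left hab]

lemma normSq_curve_sub_right (hab : a < b) (h : 0 ≤ curveImSq τ a b e₁ e₂ v) :
    Complex.normSq (curve τ a b e₁ e₂ v - b) = sqd τ b e₂ v := by
  rw [normSq_curve_sub hab h, dsq_right hab]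

/-- The speed of `sqd`. -/
def sqdDeriv (τ : ℂ) (a e v : ℝ) : ℝ := sqd τ a e v / (sqd τ a e v - Complex.normSq (τ - a))

lemma hasDerivAt_sqd (hτ : 0 < τ.im) (he : e₁ = 1 ∨ e₁ = -1) (hv : 0 < v) :
    HasDerivAt (sqd τ a e₁) (sqdDeriv τ a e₁ v) v :=
  hasDerivAt_branch (normSq_sub_pos hτ a) he hv

/-- The velocity of the level curve. -/
def curveDeriv (τ : ℂ) (a b e₁ e₂ v : ℝ) : ℂ :=
  let r := (sqdDeriv τ a e₁ v - sqdDeriv τ b e₂ v) / (2 * (b - a))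
  ⟨r, (sqdDeriv τ a e₁ v - 2 * (ptRe a b (sqd τ a e₁ v) (sqd τ b e₂ v) - a) * r) /
    (2 * √(curveImSq τ a b e₁ e₂ v))⟩

lemma hasDerivAt_curve (hτ : 0 < τ.im) (he₁ : e₁ = 1 ∨ e₁ = -1) (he₂ : e₂ = 1 ∨ e₂ = -1)
    (hv : 0 < v) (h : 0 < curveImSq τ a b e₁ e₂ v) :
    HasDerivAt (curve τ a b e₁ e₂) (curveDeriv τ a b e₁ e₂ v) v := by
  have h1 := hasDerivAt_sqd (a := a) hτ he₁ hv
  have h2 := hasDerivAt_sqd (a := b) hτ he₂ hv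
  have hre : HasDerivAt (fun v => ptRe a b (sqd τ a e₁ v) (sqd τ b e₂ v))
      ((sqdDeriv τ a e₁ v - sqdDeriv τ b e₂ v) / (2 * (b - a))) v :=
    (((h1.sub h2).add_const _).div_const _).const_add a
  have him : HasDerivAt (curveImSq τ a b e₁ e₂) (sqdDeriv τ a e₁ v -
      2 * (ptRe a b (sqd τ a e₁ v) (sqd τ b e₂ v) - a) *
        ((sqdDeriv τ a e₁ v - sqdDeriv τ b e₂ v) / (2 * (b - a)))) v := by
    have := h1.sub ((hre.sub_const a).pow 2)
    refine this.congr_deriv ?_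
    simp
  have hs := him.sqrt h.ne'
  have h3 : curve τ a b e₁ e₂ = fun v => ((ptRe a b (sqd τ a e₁ v) (sqd τ b e₂ v) : ℝ) : ℂ) +
      ((√(curveImSq τ a b e₁ e₂ v) : ℝ) : ℂ) * Complex.I := by
    ext v
    apply Complex.ext <;> simp [curve, pt, curveImSq]
  rw [h3]
  refine (hre.ofReal_comp.add (hs.ofReal_comp.mul_const Complex.I)).congr_deriv ?_
  exact (Complex.mk_eq_add_mul_I _ _).symm

end Curve

end GTBulk

end

noncomputable section

namespace GTBulk

open MeasureTheory Set

lemma level_deriv_identity {a b p q P Q s : ℝ} (hab : a < b) (hu : p - P ≠ 0) (hw : q - Q ≠ 0)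
    (hd : dsq a b p q s ≠ 0) (hd0 : dsq a b P Q s ≠ 0) :
    ((b - s) * (p / (p - P)) + (s - a) * (q / (q - Q))) / (b - a) / dsq a b p q s -
      ((b - s) * (P / (p - P)) + (s - a) * (Q / (q - Q))) / (b - a) / dsq a b P Q s =
    (Q * (p - P) ^ 2 - (P + Q - (b - a) ^ 2) * ((p - P) * (q - Q)) + P * (q - Q) ^ 2) *
      ((s - a) * (s - b)) /
        ((b - a) ^ 2 * dsq a b p q s * dsq a b P Q s * ((p - P) * (q - Q))) := by
  have hL : b - a ≠ 0 := (sub_pos.2 hab).ne'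
  have h1 : (b - a) * dsq a b p q s = (b - s) * p + (s - a) * q + (b - a) * ((s - a) * (s - b)) := by
    unfold dsq; field_simp
  have h2 : (b - a) * dsq a b P Q s = (b - s) * P + (s - a) * Q + (b - a) * ((s - a) * (s - b)) := by
    unfold dsq; field_simp
  generalize dsq a b p q s = d at *
  generalize dsq a b P Q s = d0 at *
  have h3 : ((b - s) * (p * (q - Q)) + (s - a) * (q * (p - P))) * ((b - a) * d0) -
      ((b - s) * (P * (q - Q)) + (s - a) * (Q * (p - P))) * ((b - a) * d) =
      (Q * (p - P) ^ 2 - (P + Q - (b - a) ^ 2) * ((p - P) * (q - Q)) + P * (q - Q) ^ 2) *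
      ((s - a) * (s - b)) := by
    rw [h1, h2]; ring
  rw [← h3]
  field_simp

section Level

variable {τ : ℂ} {a b e₁ e₂ : ℝ}

/-- The linear part of the logarithm of the distance ratio along the level curve. -/
def linPart (τ : ℂ) (a b e₁ e₂ v s : ℝ) : ℝ :=
  ((b - s) * (Complex.normSq (τ - a) * Real.log (sqd τ a e₁ v / Complex.normSq (τ - a))) +
    (s - a) * (Complex.normSq (τ - b) * Real.log (sqd τ b e₂ v / Complex.normSq (τ - b)))) / (b - a)

/-- The logarithm of the distance ratio with the linear part removed. -/
def levelFn (τ : ℂ) (a b e₁ e₂ s v : ℝ) : ℝ :=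
  Real.log (Complex.normSq (curve τ a b e₁ e₂ v - s) / Complex.normSq (τ - s)) -
    linPart τ a b e₁ e₂ v s / Complex.normSq (τ - s)

/-- The rate of decay along the level curves. -/
def rate (τ : ℂ) (a b : ℝ) : ℝ :=
  τ.im ^ 2 / (Complex.normSq (τ - a) + Complex.normSq (τ - b))

lemma levelFn_bounds (hab : a < b) (hτ : 0 < τ.im) (he₁ : e₁ = 1 ∨ e₁ = -1)
    (he₂ : e₂ = 1 ∨ e₂ = -1) {V : ℝ} (hV : 0 ≤ V)
    (hpos : ∀ v ∈ Icc 0 V, 0 < curveImSq τ a b e₁ e₂ v) (s : ℝ) :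
    ((s - a) * (s - b) ≤ 0 → e₁ * e₂ * levelFn τ a b e₁ e₂ s V ≤ 0) ∧
    ∀ d : ℝ, 0 < d → (∀ v ∈ Icc 0 V, Complex.normSq (curve τ a b e₁ e₂ v - s) ≤ d) →
      0 ≤ (s - a) * (s - b) →
      rate τ a b * ((s - a) * (s - b)) / (d * Complex.normSq (τ - s)) * V ≤
        e₁ * e₂ * levelFn τ a b e₁ e₂ s V := by
  set P := Complex.normSq (τ - a) with hP
  set Q := Complex.normSq (τ - b) with hQ
  have hP0 : 0 < P := normSq_sub_pos hτ a
  have hQ0 : 0 < Q := normSq_sub_pos hτ b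
  have hL : 0 < b - a := sub_pos.2 hab
  set d0 := Complex.normSq (τ - s) with hd0
  have hd00 : 0 < d0 := normSq_sub_pos hτ s
  have hd0' : d0 = dsq a b P Q s := normSq_sub_eq_dsq hab τ s
  set D : ℝ → ℝ := fun v => dsq a b (sqd τ a e₁ v) (sqd τ b e₂ v) s with hD
  have hDpos : ∀ v ∈ Icc 0 V, 0 < D v := fun v hv => dsq_pos hab (hpos v hv) s
  have hDeq : ∀ v ∈ Icc 0 V, Complex.normSq (curve τ a b e₁ e₂ v - s) = D v := fun v hv =>
    normSq_curve_sub hab (hpos v hv).le s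
  have hσ : e₁ * e₂ = 1 ∨ e₁ * e₂ = -1 := by
    rcases he₁ with rfl | rfl <;> rcases he₂ with rfl | rfl <;> norm_num
  set F : ℝ → ℝ := fun v => e₁ * e₂ * (Real.log (D v / d0) - linPart τ a b e₁ e₂ v s / d0) with hF
  have hFeq : ∀ v ∈ Icc 0 V, e₁ * e₂ * levelFn τ a b e₁ e₂ s v = F v := fun v hv => by
    rw [hF, levelFn, hDeq v hv]
  have hcont : ContinuousOn F (Icc 0 V) := by
    have h1 := continuous_sqd (τ := τ) (a := a) (e₁ := e₁)
    have h2 := continuous_sqd (τ := τ) (a := b) (e₁ := e₂)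
    refine continuousOn_const.mul (ContinuousOn.sub ?_ ?_)
    · refine ContinuousOn.log ?_ fun v hv => (div_pos (hDpos v hv) hd00).ne'
      simp only [hD, dsq]
      fun_prop
    · unfold linPart
      refine ContinuousOn.div_const (ContinuousOn.div_const (ContinuousOn.add ?_ ?_) _) _
      · refine continuousOn_const.mul (continuousOn_const.mul (ContinuousOn.log (by fun_prop) ?_))
        exact fun v _ => (div_pos (sqd_pos hτ) hP0).ne'
      · refine continuousOn_const.mul (continuousOn_const.mul (ContinuousOn.log (by fun_prop) ?_))
        exact fun v _ => (div_pos (sqd_pos hτ) hQ0).ne'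
  have hF0 : F 0 = 0 := by
    have : D 0 = d0 := by rw [hD, hd0']; simp only [sqd_zero]; rfl
    simp only [hF, this, linPart, sqd_zero]
    rw [div_self hd00.ne', div_self hP0.ne', div_self hQ0.ne']
    simp
  set C : ℝ → ℝ := fun v => Q * (sqd τ a e₁ v - P) ^ 2 - (P + Q - (b - a) ^ 2) *
    ((sqd τ a e₁ v - P) * (sqd τ b e₂ v - Q)) + P * (sqd τ b e₂ v - Q) ^ 2 with hC
  have hder : ∀ v ∈ Ioo 0 V, HasDerivAt F (e₁ * e₂ * (C v * ((s - a) * (s - b)) /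
      ((b - a) ^ 2 * D v * d0 * ((sqd τ a e₁ v - P) * (sqd τ b e₂ v - Q))))) v := by
    intro v hv
    have h1 := hasDerivAt_sqd (a := a) hτ he₁ hv.1
    have h2 := hasDerivAt_sqd (a := b) hτ he₂ hv.1
    have hu : sqd τ a e₁ v - P ≠ 0 := sub_ne_zero.2 (branch_ne hP0 he₁ hv.1)
    have hw : sqd τ b e₂ v - Q ≠ 0 := sub_ne_zero.2 (branch_ne hQ0 he₂ hv.1)
    have hpv : sqd τ a e₁ v ≠ 0 := (sqd_pos hτ).ne'
    have hqv : sqd τ b e₂ v ≠ 0 := (sqd_pos hτ).ne'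
    have hDv := hDpos v (Ioo_subset_Icc_self hv)
    have hdD : HasDerivAt D (((b - s) * sqdDeriv τ a e₁ v + (s - a) * sqdDeriv τ b e₂ v) / (b - a))
        v := (((h1.const_mul (b - s)).add (h2.const_mul (s - a))).div_const (b - a)).add_const _
    have hl1 : HasDerivAt (fun v => Real.log (D v / d0))
        (((b - s) * sqdDeriv τ a e₁ v + (s - a) * sqdDeriv τ b e₂ v) / (b - a) / D v) v := by
      refine ((hdD.div_const d0).log (div_pos hDv hd00).ne').congr_deriv ?_
      field_simp
    have hl2 : HasDerivAt (fun v => P * Real.log (sqd τ a e₁ v / P))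
        (P / (sqd τ a e₁ v - P)) v := by
      refine (((h1.div_const P).log (div_pos (sqd_pos hτ) hP0).ne').const_mul P).congr_deriv ?_
      unfold sqdDeriv
      rw [← hP]
      field_simp
    have hl3 : HasDerivAt (fun v => Q * Real.log (sqd τ b e₂ v / Q))
        (Q / (sqd τ b e₂ v - Q)) v := by
      refine (((h2.div_const Q).log (div_pos (sqd_pos hτ) hQ0).ne').const_mul Q).congr_deriv ?_
      unfold sqdDeriv
      rw [← hQ]
      field_simp
    have hlin : HasDerivAt (fun v => linPart τ a b e₁ e₂ v s)
        (((b - s) * (P / (sqd τ a e₁ v - P)) + (s - a) * (Q / (sqd τ b e₂ v - Q))) / (b - a)) v :=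
      ((hl2.const_mul (b - s)).add (hl3.const_mul (s - a))).div_const (b - a)
    refine ((hl1.sub (hlin.div_const d0)).const_mul (e₁ * e₂)).congr_deriv ?_
    congr 1
    have := level_deriv_identity (s := s) hab hu hw hDv.ne' (hd0' ▸ hd00.ne')
    rw [← hd0'] at this
    exact this
  have hsign : ∀ v ∈ Ioo 0 V, e₁ * e₂ * ((sqd τ a e₁ v - P) * (sqd τ b e₂ v - Q)) =
      |(sqd τ a e₁ v - P) * (sqd τ b e₂ v - Q)| ∧
      0 < |(sqd τ a e₁ v - P) * (sqd τ b e₂ v - Q)| := by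
    intro v hv
    have h1 := branch_sign hP0 he₁ hv.1
    have h2 := branch_sign hQ0 he₂ hv.1
    have h3 : 0 < e₁ * e₂ * ((sqd τ a e₁ v - P) * (sqd τ b e₂ v - Q)) := by
      have := mul_pos h1 h2
      unfold sqd; linarith [this]
    have h4 : e₁ * e₂ * ((sqd τ a e₁ v - P) * (sqd τ b e₂ v - Q)) =
      |(sqd τ a e₁ v - P) * (sqd τ b e₂ v - Q)| := by
      rcases hσ with h | h <;> rw [h] at h3 ⊢
      · rw [abs_of_pos (by linarith)]; ring
      · rw [abs_of_neg (by linarith)]; ring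
    exact ⟨h4, h4 ▸ h3⟩
  have hderiv2 : ∀ v ∈ Ioo 0 V, e₁ * e₂ * (C v * ((s - a) * (s - b)) /
      ((b - a) ^ 2 * D v * d0 * ((sqd τ a e₁ v - P) * (sqd τ b e₂ v - Q)))) =
      C v / |(sqd τ a e₁ v - P) * (sqd τ b e₂ v - Q)| * ((s - a) * (s - b)) /
        ((b - a) ^ 2 * D v * d0) := by
    intro v hv
    obtain ⟨h1, h2⟩ := hsign v hv
    have hDv := hDpos v (Ioo_subset_Icc_self hv)
    have hne : (sqd τ a e₁ v - P) * (sqd τ b e₂ v - Q) ≠ 0 := abs_pos.1 h2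
    rw [← h1]
    generalize (sqd τ a e₁ v - P) * (sqd τ b e₂ v - Q) = x at *
    rcases hσ with h | h <;> rw [h] <;> field_simp
  have hheron : 4 * P * Q - (P + Q - (b - a) ^ 2) ^ 2 = 4 * (b - a) ^ 2 * τ.im ^ 2 := by
    rw [heron hab, ptImSq_normSq hab]
  have hClow : ∀ v ∈ Ioo 0 V, (b - a) ^ 2 * rate τ a b ≤
      C v / |(sqd τ a e₁ v - P) * (sqd τ b e₂ v - Q)| := by
    intro v hv
    rw [le_div_iff₀ (hsign v hv).2]
    have := quadratic_form_lower (u := sqd τ a e₁ v - P) (w := sqd τ b e₂ v - Q) hP0 hQ0 hheron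
      (sq_nonneg _)
    unfold rate
    rw [← hP, ← hQ, ← mul_div_assoc]
    exact this
  have hrate : 0 < rate τ a b := by unfold rate; rw [← hP, ← hQ]; positivity
  have hV' : V ∈ Icc 0 V := right_mem_Icc.2 hV
  have h0' : (0 : ℝ) ∈ Icc 0 V := left_mem_Icc.2 hV
  constructor
  · intro hs
    rw [hFeq V hV', ← hF0]
    refine antitoneOn_of_deriv_nonpos (convex_Icc 0 V) hcont ?_ ?_ h0' hV' hV
    · intro v hv
      rw [interior_Icc] at hv
      exact (hder v hv).differentiableAt.differentiableWithinAt
    · intro v hv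
      rw [interior_Icc] at hv
      rw [(hder v hv).deriv, hderiv2 v hv]
      have h1 := hClow v hv
      have hDv := hDpos v (Ioo_subset_Icc_self hv)
      refine div_nonpos_of_nonpos_of_nonneg (mul_nonpos_of_nonneg_of_nonpos ?_ hs) (by positivity)
      exact le_trans (by positivity) h1
  · intro d hd hdle hs
    rw [hFeq V hV']
    set c := rate τ a b * ((s - a) * (s - b)) / (d * d0) with hc
    have hdd : ∀ v ∈ Ioo 0 V, HasDerivAt (fun v => F v - c * v) _ v := fun v hv =>
      (hder v hv).sub ((hasDerivAt_id' v).const_mul c)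
    have hmono : MonotoneOn (fun v => F v - c * v) (Icc 0 V) := by
      refine monotoneOn_of_deriv_nonneg (convex_Icc 0 V)
        (hcont.sub (by fun_prop)) ?_ ?_
      · intro v hv
        rw [interior_Icc] at hv
        exact (hdd v hv).differentiableAt.differentiableWithinAt
      · intro v hv
        rw [interior_Icc] at hv
        rw [(hdd v hv).deriv, hderiv2 v hv, mul_one, sub_nonneg, hc]
        have h1 := hClow v hv
        have hDv := hDpos v (Ioo_subset_Icc_self hv)
        have hDd : D v ≤ d := by
          rw [← hDeq v (Ioo_subset_Icc_self hv)]; exact hdle v (Ioo_subset_Icc_self hv)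
        calc rate τ a b * ((s - a) * (s - b)) / (d * d0) ≤
            rate τ a b * ((s - a) * (s - b)) / (D v * d0) := by gcongr
          _ = (b - a) ^ 2 * rate τ a b * ((s - a) * (s - b)) / ((b - a) ^ 2 * D v * d0) := by
              field_simp
          _ ≤ _ := by gcongr
    have := hmono h0' hV' hV
    simp only [mul_zero, sub_zero, hF0] at this
    linarith

end Level

end GTBulk

end

noncomputable section

namespace GTBulk

open MeasureTheory Set

lemma sqrt_branch_sub_sq_le {P e v : ℝ} (hP : 0 < P) (he : e = 1 ∨ e = -1) (hv : 0 ≤ v) :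
    (√(branch P e v) - √P) ^ 2 ≤ v := by
  have h := branch_eq hP he hv
  have hp : 0 < branch P e v := branch_pos hP
  set p := branch P e v
  have h1 : Real.log (p / P) ≤ 2 * (√(p / P) - 1) := by
    have h2 := Real.log_le_sub_one_of_pos (Real.sqrt_pos.2 (div_pos hp hP))
    rw [Real.log_sqrt (div_pos hp hP).le] at h2
    linarith
  have h3 : P * √(p / P) = √p * √P := by
    rw [Real.sqrt_div hp.le]
    have := Real.mul_self_sqrt hP.le
    have h4 : √P ≠ 0 := (Real.sqrt_pos.2 hP).ne'
    field_simp
    nlinarith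
  nlinarith [Real.mul_self_sqrt hP.le, Real.mul_self_sqrt hp.le]

section Bounds

variable {K : ℝ} {τ : ℂ} {a b : ℝ}

lemma Geo.lt (h : Geo K τ a b) : a < b := by
  have h1 := h.len
  have h2 : 0 < 1 / K := by have := h.one_le; positivity
  linarith

lemma Geo.im_pos (h : Geo K τ a b) : 0 < τ.im := by
  have h1 := h.im
  have h2 : 0 < 1 / K := by have := h.one_le; positivity
  linarith

lemma Geo.len_le (h : Geo K τ a b) : b - a ≤ 2 * K := by
  have h1 := abs_le.1 h.left
  have h2 := abs_le.1 h.right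
  linarith

lemma normSq_bounds {s : ℝ} (hK : 1 ≤ K) (him : 1 / K ≤ τ.im) (hn : ‖τ‖ ≤ K) (hs : |s| ≤ K) :
    1 / K ^ 2 ≤ Complex.normSq (τ - s) ∧ Complex.normSq (τ - s) ≤ 4 * K ^ 2 := by
  have hK0 : 0 < 1 / K := by positivity
  constructor
  · rw [Complex.normSq_apply]
    simp only [Complex.sub_re, Complex.ofReal_re, Complex.sub_im, Complex.ofReal_im, sub_zero]
    have : 1 / K ^ 2 = (1 / K) * (1 / K) := by field_simp
    rw [this]
    nlinarith [mul_self_nonneg (τ.re - s)]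
  · rw [Complex.normSq_eq_norm_sq]
    have h1 : ‖τ - s‖ ≤ 2 * K := by
      have := norm_sub_le τ (s : ℂ)
      rw [Complex.norm_real, Real.norm_eq_abs] at this
      linarith
    nlinarith [norm_nonneg (τ - s)]

lemma Geo.normSq_left (h : Geo K τ a b) :
    1 / K ^ 2 ≤ Complex.normSq (τ - a) ∧ Complex.normSq (τ - a) ≤ 4 * K ^ 2 :=
  normSq_bounds h.one_le h.im h.norm h.left

lemma Geo.normSq_right (h : Geo K τ a b) :
    1 / K ^ 2 ≤ Complex.normSq (τ - b) ∧ Complex.normSq (τ - b) ≤ 4 * K ^ 2 :=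
  normSq_bounds h.one_le h.im h.norm h.right

/-- Lower bound for the squared distances from the end points along the level curves which reach
the real axis. -/
def minDist (K : ℝ) : ℝ := Real.exp (-1 - 64 * K ^ 8) / K ^ 2

lemma minDist_pos (hK : 1 ≤ K) : 0 < minDist K := by unfold minDist; positivity

lemma dist_relations {a b p q : ℝ} (hab : a < b) (h : 0 ≤ ptImSq a b p q) :
    q ≤ 2 * p + 2 * (b - a) ^ 2 ∧ p ≤ 2 * q + 2 * (b - a) ^ 2 ∧
      (b - a) ^ 2 ≤ 2 * p + 2 * q := by
  have h1 := ptImSq_eq_right (p := p) (q := q) hab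
  have h2 : ptImSq a b p q = p - (ptRe a b p q - a) ^ 2 := rfl
  set x := ptRe a b p q
  refine ⟨?_, ?_, ?_⟩
  · nlinarith [sq_nonneg ((x - a) + (b - a))]
  · nlinarith [sq_nonneg ((x - b) - (b - a))]
  · nlinarith [sq_nonneg ((x - a) + (x - b))]

lemma branch_lower {P e v : ℝ} (hK : 1 ≤ K) (hP : 1 / K ^ 2 ≤ P) (he : e = 1 ∨ e = -1)
    (hv : 0 ≤ v) (hv2 : v ≤ 64 * K ^ 6) : minDist K ≤ branch P e v := by
  have hK2 : 0 < 1 / K ^ 2 := by positivity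
  have hP0 : 0 < P := by linarith
  have h1 : minDist K = 1 / K ^ 2 * Real.exp (-1 - 64 * K ^ 8) := by unfold minDist; ring
  rw [h1]
  rcases he with rfl | rfl
  · refine le_trans ?_ (le_branch hP0 hv)
    have : Real.exp (-1 - 64 * K ^ 8) ≤ 1 := Real.exp_le_one_iff.2 (by nlinarith [pow_pos (by linarith : 0 < K) 8])
    nlinarith
  · refine le_trans ?_ (exp_le_branch hP0 hv)
    have : v / P ≤ 64 * K ^ 8 := by
      rw [div_le_iff₀ hP0]
      calc v ≤ 64 * K ^ 6 := hv2
        _ = 64 * K ^ 8 * (1 / K ^ 2) := by field_simp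
        _ ≤ 64 * K ^ 8 * P := by gcongr
    gcongr

lemma time_le_of_minus {P v : ℝ} (hK : 1 ≤ K) (hP : 1 / K ^ 2 ≤ P) (hP4 : P ≤ 4 * K ^ 2)
    (hv : 0 ≤ v) (h : 1 / (4 * K ^ 2) ≤ branch P (-1) v) : v ≤ 64 * K ^ 6 := by
  have hK2 : 0 < 1 / K ^ 2 := by positivity
  have hP0 : 0 < P := by linarith
  have h1 := h.trans (branch_le_exp hP0 hv)
  have h2 : v / P ≤ Real.exp (v / P) := by linarith [Real.add_one_le_exp (v / P)]
  have h3 : Real.exp (v / P) ≤ 16 * K ^ 4 := by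
    rw [Real.exp_neg, ← div_eq_mul_inv, le_div_iff₀ (Real.exp_pos _)] at h1
    have h4 : Real.exp (v / P) = 4 * K ^ 2 * (1 / (4 * K ^ 2) * Real.exp (v / P)) := by field_simp
    rw [h4]
    calc 4 * K ^ 2 * (1 / (4 * K ^ 2) * Real.exp (v / P)) ≤ 4 * K ^ 2 * (4 * K ^ 2) := by
          exact mul_le_mul_of_nonneg_left (h1.trans hP4) (by positivity)
      _ = 16 * K ^ 4 := by ring
  calc v = P * (v / P) := by field_simp
    _ ≤ (4 * K ^ 2) * (16 * K ^ 4) := by gcongr; linarith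
    _ = 64 * K ^ 6 := by ring

lemma curve_minus_bounds (h : Geo K τ a b) {e₁ e₂ v : ℝ} (he₁ : e₁ = 1 ∨ e₁ = -1)
    (he₂ : e₂ = 1 ∨ e₂ = -1) (hm : e₁ = -1 ∨ e₂ = -1) (hv : 0 ≤ v)
    (hY : 0 ≤ curveImSq τ a b e₁ e₂ v) :
    v ≤ 64 * K ^ 6 ∧ minDist K ≤ sqd τ a e₁ v ∧ sqd τ a e₁ v ≤ 16 * K ^ 2 ∧
      minDist K ≤ sqd τ b e₂ v ∧ sqd τ b e₂ v ≤ 16 * K ^ 2 := by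
  obtain ⟨hP1, hP2⟩ := h.normSq_left
  obtain ⟨hQ1, hQ2⟩ := h.normSq_right
  have hK := h.one_le
  have hK2 : 0 < 1 / K ^ 2 := by positivity
  have hP0 : 0 < Complex.normSq (τ - a) := by linarith
  have hQ0 : 0 < Complex.normSq (τ - b) := by linarith
  obtain ⟨r1, r2, r3⟩ := dist_relations h.lt hY
  have hL2 : (b - a) ^ 2 ≤ 4 * K ^ 2 := by nlinarith [h.lt, h.len_le]
  have hL3 : 1 / K ^ 2 ≤ (b - a) ^ 2 := by
    have : 1 / K ^ 2 = (1 / K) ^ 2 := by field_simp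
    rw [this]
    exact pow_le_pow_left₀ (by positivity) h.len 2
  have hpK : e₁ = -1 → sqd τ a e₁ v ≤ 4 * K ^ 2 := fun h => by
    subst h; exact (branch_le hP0 hv).trans hP2
  have hqK : e₂ = -1 → sqd τ b e₂ v ≤ 4 * K ^ 2 := fun h => by
    subst h; exact (branch_le hQ0 hv).trans hQ2
  have hp16 : sqd τ a e₁ v ≤ 16 * K ^ 2 := by
    rcases hm with h | h
    · have := hpK h; nlinarith
    · have := hqK h; linarith
  have hq16 : sqd τ b e₂ v ≤ 16 * K ^ 2 := by
    rcases hm with h | h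
    · have := hpK h; linarith
    · have := hqK h; nlinarith
  have hK26 : 16 * K ^ 2 ≤ 64 * K ^ 6 := by
    have : K ^ 2 ≤ K ^ 6 := pow_le_pow_right₀ hK (by norm_num)
    nlinarith
  have hvb : v ≤ 64 * K ^ 6 := by
    rcases he₁ with rfl | rfl
    · have := add_le_branch hP0 hv
      unfold sqd at hp16
      linarith
    · rcases he₂ with rfl | rfl
      · have := add_le_branch hQ0 hv
        unfold sqd at hq16
        linarith
      · have h4 : 1 / (4 * K ^ 2) = 1 / K ^ 2 / 4 := by field_simp
        by_cases hc : 1 / (4 * K ^ 2) ≤ branch (Complex.normSq (τ - a)) (-1) v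
        · exact time_le_of_minus hK hP1 hP2 hv hc
        · refine time_le_of_minus hK hQ1 hQ2 hv ?_
          push Not at hc
          rw [h4] at hc ⊢
          unfold sqd at r3
          linarith
  exact ⟨hvb, branch_lower hK hP1 he₁ hv hvb, hp16, branch_lower hK hQ1 he₂ hv hvb, hq16⟩

lemma exists_curve_end (h : Geo K τ a b) {e₁ e₂ δ : ℝ} (hm : e₁ = -1 ∨ e₂ = -1) (hδ : 0 < δ)
    (hδK : δ < 1 / K) :
    ∃ V, 0 < V ∧ curveImSq τ a b e₁ e₂ V = δ ^ 2 ∧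
      ∀ v ∈ Icc 0 V, δ ^ 2 ≤ curveImSq τ a b e₁ e₂ v := by
  have hP0 := normSq_sub_pos h.im_pos a
  have hQ0 := normSq_sub_pos h.im_pos b
  have hcont := continuous_curveImSq (τ := τ) (a := a) (b := b) (e₁ := e₁) (e₂ := e₂)
  have h0 : δ ^ 2 < curveImSq τ a b e₁ e₂ 0 := by
    rw [curveImSq_zero h.lt]
    exact pow_lt_pow_left₀ (by linarith [h.im]) hδ.le (by norm_num)
  have hlim : ∀ P : ℝ, 0 < P → ∃ v, 0 ≤ v ∧ branch P (-1) v ≤ δ ^ 2 := by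
    intro P hP
    have ht : Filter.Tendsto (fun v : ℝ => P * Real.exp (-(v / P))) Filter.atTop (nhds (P * 0)) :=
      (Real.tendsto_exp_neg_atTop_nhds_zero.comp
        (Filter.tendsto_id.atTop_div_const hP)).const_mul P
    rw [mul_zero] at ht
    obtain ⟨v, hv1, hv2⟩ := ((ht.eventually_le_const (pow_pos hδ 2)).and
      (Filter.eventually_ge_atTop 0)).exists
    exact ⟨v, hv2, (branch_le_exp hP hv2).trans hv1⟩
  have hex : ∃ v, 0 ≤ v ∧ curveImSq τ a b e₁ e₂ v ≤ δ ^ 2 := by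
    rcases hm with rfl | rfl
    · obtain ⟨v, hv, hv2⟩ := hlim _ hP0
      exact ⟨v, hv, ptImSq_le_left.trans hv2⟩
    · obtain ⟨v, hv, hv2⟩ := hlim _ hQ0
      exact ⟨v, hv, (ptImSq_le_right h.lt).trans hv2⟩
  set S := {v : ℝ | 0 ≤ v ∧ curveImSq τ a b e₁ e₂ v ≤ δ ^ 2} with hS
  have hScl : IsClosed S := (isClosed_le continuous_const continuous_id).inter
    (isClosed_le hcont continuous_const)
  have hSb : BddBelow S := ⟨0, fun v hv => hv.1⟩
  have hmem : sInf S ∈ S := hScl.csInf_mem hex hSb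
  have hpos : 0 < sInf S := by
    refine lt_of_le_of_ne hmem.1 fun h1 => ?_
    have := hmem.2
    rw [← h1] at this
    linarith
  have hlt : ∀ v ∈ Ico 0 (sInf S), δ ^ 2 < curveImSq τ a b e₁ e₂ v := by
    intro v hv
    by_contra hc
    push Not at hc
    have : sInf S ≤ v := csInf_le hSb ⟨hv.1, hc⟩
    linarith [hv.2]
  have hle : δ ^ 2 ≤ curveImSq τ a b e₁ e₂ (sInf S) := by
    have hcl : sInf S ∈ closure (Ico 0 (sInf S)) := by
      rw [closure_Ico hpos.ne]; exact right_mem_Icc.2 hpos.le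
    exact closure_minimal (fun v hv => (hlt v hv).le)
      (isClosed_le continuous_const hcont) hcl
  refine ⟨sInf S, hpos, le_antisymm hmem.2 hle, fun v hv => ?_⟩
  rcases hv.2.lt_or_eq with h1 | h1
  · exact (hlt v ⟨hv.1, h1⟩).le
  · rw [h1]; exact hle

/-- A level curve which descends to height at most `τ.im / 2` needs time bounded below. -/
lemma time_lower (h : Geo K τ a b) {e₁ e₂ V δ : ℝ} (he₁ : e₁ = 1 ∨ e₁ = -1)
    (he₂ : e₂ = 1 ∨ e₂ = -1) (hm : e₁ = -1 ∨ e₂ = -1) (hV : 0 < V) (hδ : 0 ≤ δ)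
    (hδK : δ ≤ 1 / (2 * K)) (hY : curveImSq τ a b e₁ e₂ V = δ ^ 2) :
    1 / (10000 * K ^ 10) ≤ V := by
  have hK := h.one_le
  obtain ⟨-, -, hp16, -, hq16⟩ := curve_minus_bounds h he₁ he₂ hm hV.le (by rw [hY]; positivity)
  have hP0 := normSq_sub_pos h.im_pos a
  have hQ0 := normSq_sub_pos h.im_pos b
  have aux : ∀ {P e : ℝ}, 0 < P → P ≤ 4 * K ^ 2 → (e = 1 ∨ e = -1) → branch P e V ≤ 16 * K ^ 2 →
      |branch P e V - P| ≤ 6 * K * √V := by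
    intro P e hP hP4 he hb
    have h1 := sqrt_branch_sub_sq_le hP he hV.le
    have h2 : |√(branch P e V) - √P| ≤ √V := Real.abs_le_sqrt h1
    have h3 : √(branch P e V) ≤ 4 * K := Real.sqrt_le_iff.2 ⟨by positivity, by nlinarith⟩
    have h4 : √P ≤ 2 * K := Real.sqrt_le_iff.2 ⟨by positivity, by nlinarith⟩
    have h5 : branch P e V - P = (√(branch P e V) - √P) * (√(branch P e V) + √P) := by
      have := Real.mul_self_sqrt hP.le
      have := Real.mul_self_sqrt (branch_pos (e := e) (v := V) hP).le
      nlinarith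
    rw [h5, abs_mul, abs_of_nonneg (a := √(branch P e V) + √P) (by positivity)]
    nlinarith [Real.sqrt_nonneg V, Real.sqrt_nonneg P, Real.sqrt_nonneg (branch P e V)]
  have hp := aux hP0 h.normSq_left.2 he₁ hp16
  have hq := aux hQ0 h.normSq_right.2 he₂ hq16
  have hx0 := ptRe_normSq h.lt τ
  have hy0 := ptImSq_normSq h.lt τ
  change |sqd τ a e₁ V - _| ≤ _ at hp
  change |sqd τ b e₂ V - _| ≤ _ at hq
  have hP4 := h.normSq_left.2
  rw [curveImSq] at hY
  set p := sqd τ a e₁ V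
  set q := sqd τ b e₂ V
  set P := Complex.normSq (τ - a)
  set Q := Complex.normSq (τ - b)
  have hL := h.lt
  have hdx : |ptRe a b p q - τ.re| ≤ 6 * K ^ 2 * √V := by
    have h1 : ptRe a b p q - τ.re = ((p - P) - (q - Q)) / (2 * (b - a)) := by
      rw [← hx0, ptRe, ptRe]; ring
    rw [h1, abs_div, abs_of_pos (a := 2 * (b - a)) (by linarith), div_le_iff₀ (by linarith)]
    have h2 := abs_sub (p - P) (q - Q)
    have h3 : 1 ≤ K * (b - a) := by
      have := h.len
      rw [div_le_iff₀ (by linarith)] at this; linarith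
    calc |(p - P) - (q - Q)| ≤ 12 * K * √V := by linarith
      _ = 12 * K * √V * 1 := by ring
      _ ≤ 12 * K * √V * (K * (b - a)) := by gcongr
      _ = _ := by ring
  have hxa : |ptRe a b p q - a| ≤ 4 * K := by
    refine abs_le_of_sq_le_sq ?_ (by positivity)
    have : (ptRe a b p q - a) ^ 2 = p - δ ^ 2 := by rw [← hY, ptImSq]; ring
    nlinarith [sq_nonneg δ]
  have hxa0 : |τ.re - a| ≤ 2 * K := by
    refine abs_le_of_sq_le_sq ?_ (by positivity)
    have : (τ.re - a) ^ 2 = P - τ.im ^ 2 := by rw [← hy0, ptImSq, hx0]; ring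
    nlinarith [sq_nonneg τ.im]
  have hmain : τ.im ^ 2 - δ ^ 2 ≤ 42 * K ^ 3 * √V := by
    have h1 : τ.im ^ 2 - δ ^ 2 = -(p - P) + (ptRe a b p q - τ.re) *
        ((ptRe a b p q - a) + (τ.re - a)) := by
      rw [← hY, ← hy0, ptImSq, ptImSq, hx0]; ring
    have h2 : |(ptRe a b p q - τ.re) * ((ptRe a b p q - a) + (τ.re - a))| ≤
        6 * K ^ 2 * √V * (6 * K) := by
      rw [abs_mul]
      refine mul_le_mul hdx ?_ (abs_nonneg _) (by positivity)
      exact (abs_add_le _ _).trans (by linarith)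
    have h3 : 6 * K * √V ≤ 6 * K ^ 3 * √V := by
      have : K ≤ K ^ 3 := by nlinarith [sq_nonneg K, mul_nonneg (by linarith : 0 ≤ K) (by nlinarith : 0 ≤ K ^ 2 - 1)]
      gcongr
    rw [h1]
    have h4 := abs_le.1 hp
    have h5 := abs_le.1 h2
    nlinarith
  have h3 : 3 / (4 * K ^ 2) ≤ τ.im ^ 2 - δ ^ 2 := by
    have h1 : (1 / K) ^ 2 ≤ τ.im ^ 2 := pow_le_pow_left₀ (by positivity) h.im 2
    have h2 : δ ^ 2 ≤ (1 / (2 * K)) ^ 2 := pow_le_pow_left₀ hδ hδK 2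
    have h4 : (1 / K) ^ 2 - (1 / (2 * K)) ^ 2 = 3 / (4 * K ^ 2) := by field_simp; norm_num
    linarith
  have h4 : 1 / (100 * K ^ 5) ≤ √V := by
    rw [div_le_iff₀ (by positivity)]
    have h5 : 3 / (4 * K ^ 2) * K ^ 2 ≤ 42 * K ^ 3 * √V * K ^ 2 := by
      gcongr; linarith
    have h6 : 3 / (4 * K ^ 2) * K ^ 2 = 3 / 4 := by field_simp
    rw [h6] at h5
    nlinarith [Real.sqrt_nonneg V, pow_pos (by linarith : 0 < K) 5]
  calc 1 / (10000 * K ^ 10) = (1 / (100 * K ^ 5)) ^ 2 := by field_simp; norm_num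
    _ ≤ √V ^ 2 := pow_le_pow_left₀ (by positivity) h4 2
    _ = V := Real.sq_sqrt hV.le

end Bounds

end GTBulk

end

noncomputable section

namespace GTBulk

open MeasureTheory Set

/-- The difference of the two level functions at the real point `s`. -/
def levelGap (a b P Q s : ℝ) : ℝ :=
  ((s - a) ^ 2 - P - P * Real.log ((s - a) ^ 2 / P)) -
    ((s - b) ^ 2 - Q - Q * Real.log ((s - b) ^ 2 / Q))

section LevelGap

variable {a b P Q x₀ y₀ s : ℝ}

lemma hasDerivAt_levelGap (hP0 : 0 < P) (hQ0 : 0 < Q) (hP : P = (x₀ - a) ^ 2 + y₀ ^ 2)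
    (hQ : Q = (x₀ - b) ^ 2 + y₀ ^ 2) (ha : s - a ≠ 0) (hb : s - b ≠ 0) :
    HasDerivAt (levelGap a b P Q)
      (2 * (b - a) * ((s - x₀) ^ 2 + y₀ ^ 2) / ((s - a) * (s - b))) s := by
  have aux : ∀ c R : ℝ, 0 < R → s - c ≠ 0 →
      HasDerivAt (fun s => (s - c) ^ 2 - R - R * Real.log ((s - c) ^ 2 / R))
        (2 * (s - c) - R * (2 * (s - c) / R / ((s - c) ^ 2 / R))) s := by
    intro c R hR hc
    have h1 : HasDerivAt (fun s : ℝ => (s - c) ^ 2) (2 * (s - c)) s := by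
      exact (((hasDerivAt_id' s).sub_const c).pow 2).congr_deriv (by simp)
    exact (h1.sub_const R).sub (((h1.div_const R).log (by positivity)).const_mul R)
  refine ((aux a P hP0 ha).sub (aux b Q hQ0 hb)).congr_deriv ?_
  field_simp
  rw [hP, hQ]
  ring

lemma strictMonoOn_levelGap (hab : a < b) (hy : 0 < y₀) (hP : P = (x₀ - a) ^ 2 + y₀ ^ 2)
    (hQ : Q = (x₀ - b) ^ 2 + y₀ ^ 2) : StrictMonoOn (levelGap a b P Q) (Ioi b) := by
  have hP0 : 0 < P := by rw [hP]; positivity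
  have hQ0 : 0 < Q := by rw [hQ]; positivity
  have hd : ∀ s ∈ Ioi b, HasDerivAt (levelGap a b P Q)
      (2 * (b - a) * ((s - x₀) ^ 2 + y₀ ^ 2) / ((s - a) * (s - b))) s := fun s hs =>
    hasDerivAt_levelGap hP0 hQ0 hP hQ (by linarith [mem_Ioi.1 hs] : (0 : ℝ) < s - a).ne'
      (sub_pos.2 hs).ne'
  refine strictMonoOn_of_deriv_pos (convex_Ioi b)
    (fun s hs => (hd s hs).continuousAt.continuousWithinAt) fun s hs => ?_
  rw [interior_Ioi] at hs
  rw [(hd s hs).deriv]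
  have h1 : 0 < s - b := sub_pos.2 hs
  have h2 : 0 < b - a := sub_pos.2 hab
  have h3 : 0 < s - a := by linarith
  positivity

lemma strictAntiOn_levelGap (hab : a < b) (hy : 0 < y₀) (hP : P = (x₀ - a) ^ 2 + y₀ ^ 2)
    (hQ : Q = (x₀ - b) ^ 2 + y₀ ^ 2) : StrictAntiOn (levelGap a b P Q) (Ioo a b) := by
  have hP0 : 0 < P := by rw [hP]; positivity
  have hQ0 : 0 < Q := by rw [hQ]; positivity
  have hd : ∀ s ∈ Ioo a b, HasDerivAt (levelGap a b P Q)
      (2 * (b - a) * ((s - x₀) ^ 2 + y₀ ^ 2) / ((s - a) * (s - b))) s := fun s hs =>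
    hasDerivAt_levelGap hP0 hQ0 hP hQ (sub_pos.2 hs.1).ne' (sub_neg.2 hs.2).ne
  refine strictAntiOn_of_deriv_neg (convex_Ioo a b)
    (fun s hs => (hd s hs).continuousAt.continuousWithinAt) fun s hs => ?_
  rw [interior_Ioo] at hs
  rw [(hd s hs).deriv]
  have h1 : s - b < 0 := sub_neg.2 hs.2
  have h2 : 0 < b - a := sub_pos.2 hab
  have h3 : 0 < s - a := sub_pos.2 hs.1
  exact div_neg_of_pos_of_neg (by positivity) (mul_neg_of_pos_of_neg h3 h1)

lemma levelTerm_nonneg {p : ℝ} (hp : 0 < p) (hP : 0 < P) : 0 ≤ p - P - P * Real.log (p / P) := by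
  have h := Real.log_le_sub_one_of_pos (div_pos hp hP)
  have : P * Real.log (p / P) ≤ P * (p / P - 1) := mul_le_mul_of_nonneg_left h hP.le
  have h2 : P * (p / P - 1) = p - P := by field_simp
  linarith

lemma levelGap_left_nonpos {e : ℝ} (he : e ^ 2 = P) (hP : 0 < P) (hQ : 0 < Q) (hb : a + e ≠ b) :
    levelGap a b P Q (a + e) ≤ 0 := by
  have hne := sub_ne_zero.2 hb
  have h0 : 0 < (a + e - b) ^ 2 := by positivity
  have := levelTerm_nonneg h0 hQ
  have h2 : (a + e - a) ^ 2 = P := by rw [← he]; ring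
  rw [levelGap, h2, div_self hP.ne', Real.log_one]
  linarith

lemma levelGap_right_nonneg {e : ℝ} (he : e ^ 2 = Q) (hP : 0 < P) (hQ : 0 < Q) (hb : b + e ≠ a) :
    0 ≤ levelGap a b P Q (b + e) := by
  have hne := sub_ne_zero.2 hb
  have h0 : 0 < (b + e - a) ^ 2 := by positivity
  have := levelTerm_nonneg h0 hP
  have h2 : (b + e - b) ^ 2 = Q := by rw [← he]; ring
  rw [levelGap, h2, div_self hQ.ne', Real.log_one]
  linarith

lemma real_level_right (hab : a < b) (hy : 0 < y₀) (hP : P = (x₀ - a) ^ 2 + y₀ ^ 2)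
    (hQ : Q = (x₀ - b) ^ 2 + y₀ ^ 2) (hs : b < s) (hg : levelGap a b P Q s = 0)
    (hpP : (s - a) ^ 2 ≠ P) (hqQ : (s - b) ^ 2 ≠ Q) : P < (s - a) ^ 2 ∧ (s - b) ^ 2 < Q := by
  have hP0 : 0 < P := by rw [hP]; positivity
  have hQ0 : 0 < Q := by rw [hQ]; positivity
  have hm := strictMonoOn_levelGap hab hy hP hQ
  constructor
  · by_contra hc
    have hlt : (s - a) ^ 2 < P := lt_of_le_of_ne (not_lt.1 hc) hpP
    have h1 : s - a < √P := Real.lt_sqrt_of_sq_lt hlt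
    have h2 := hm (mem_Ioi.2 hs) (mem_Ioi.2 (by linarith : b < a + √P)) (by linarith)
    have h3 := levelGap_left_nonpos (a := a) (b := b) (Real.sq_sqrt hP0.le) hP0 hQ0 (by linarith)
    linarith
  · by_contra hc
    have hlt : Q < (s - b) ^ 2 := lt_of_le_of_ne (not_lt.1 hc) hqQ.symm
    have h1 : √Q < s - b := (Real.sqrt_lt' (by linarith)).2 hlt
    have h4 := Real.sqrt_pos.2 hQ0
    have h2 := hm (mem_Ioi.2 (by linarith : b < b + √Q)) (mem_Ioi.2 hs) (by linarith)
    have h3 := levelGap_right_nonneg (a := a) (b := b) (Real.sq_sqrt hQ0.le) hP0 hQ0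
      (by linarith)
    linarith

lemma real_level_mid (hab : a < b) (hy : 0 < y₀) (hP : P = (x₀ - a) ^ 2 + y₀ ^ 2)
    (hQ : Q = (x₀ - b) ^ 2 + y₀ ^ 2) (hsa : a < s) (hs : s < b) (hg : levelGap a b P Q s = 0)
    (hpP : (s - a) ^ 2 ≠ P) (hqQ : (s - b) ^ 2 ≠ Q) : (s - a) ^ 2 < P ∧ (s - b) ^ 2 < Q := by
  have hP0 : 0 < P := by rw [hP]; positivity
  have hQ0 : 0 < Q := by rw [hQ]; positivity
  have hm := strictAntiOn_levelGap hab hy hP hQ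
  have hP1 := Real.sqrt_pos.2 hP0
  have hQ1 := Real.sqrt_pos.2 hQ0
  constructor
  · by_contra hc
    have hlt : P < (s - a) ^ 2 := lt_of_le_of_ne (not_lt.1 hc) hpP.symm
    have h1 : √P < s - a := (Real.sqrt_lt' (by linarith)).2 hlt
    have h2 := hm (⟨by linarith, by linarith⟩ : a + √P ∈ Ioo a b) ⟨hsa, hs⟩ (by linarith)
    have h3 := levelGap_left_nonpos (a := a) (b := b) (Real.sq_sqrt hP0.le) hP0 hQ0 (by linarith)
    linarith
  · by_contra hc
    have hlt : Q < (s - b) ^ 2 := lt_of_le_of_ne (not_lt.1 hc) hqQ.symm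
    have h1 : √Q < b - s := (Real.sqrt_lt' (by linarith)).2 (by nlinarith)
    have h2 := hm ⟨hsa, hs⟩ (⟨by linarith, by linarith⟩ : b + -√Q ∈ Ioo a b) (by linarith)
    have h3 := levelGap_right_nonneg (a := a) (b := b) (e := -√Q)
      (by rw [neg_sq, Real.sq_sqrt hQ0.le]) hP0 hQ0 (by linarith)
    linarith

lemma levelGap_reflect : levelGap (-b) (-a) Q P (-s) = -levelGap a b P Q s := by
  unfold levelGap
  rw [show (-s - -b) ^ 2 = (s - b) ^ 2 by ring, show (-s - -a) ^ 2 = (s - a) ^ 2 by ring]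
  ring

lemma real_level_left (hab : a < b) (hy : 0 < y₀) (hP : P = (x₀ - a) ^ 2 + y₀ ^ 2)
    (hQ : Q = (x₀ - b) ^ 2 + y₀ ^ 2) (hs : s < a) (hg : levelGap a b P Q s = 0)
    (hpP : (s - a) ^ 2 ≠ P) (hqQ : (s - b) ^ 2 ≠ Q) : (s - a) ^ 2 < P ∧ Q < (s - b) ^ 2 := by
  have h := real_level_right (a := -b) (b := -a) (P := Q) (Q := P) (x₀ := -x₀) (y₀ := y₀)
    (s := -s) (by linarith) hy (by rw [hQ]; ring) (by rw [hP]; ring) (by linarith)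
    (by rw [levelGap_reflect, hg, neg_zero]) (by rwa [show (-s - -b) ^ 2 = (s - b) ^ 2 by ring])
    (by rwa [show (-s - -a) ^ 2 = (s - a) ^ 2 by ring])
  rw [show (-s - -b) ^ 2 = (s - b) ^ 2 by ring, show (-s - -a) ^ 2 = (s - a) ^ 2 by ring] at h
  exact h.symm

end LevelGap

/-- The real part along the level curve. -/
def curveRe (τ : ℂ) (a b e₁ e₂ v : ℝ) : ℝ := ptRe a b (sqd τ a e₁ v) (sqd τ b e₂ v)

section Location

variable {K : ℝ} {τ : ℂ} {a b e₁ e₂ v : ℝ}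

/-- Where the level curves meet the real axis. -/
lemma location_of_curveImSq_eq_zero (h : Geo K τ a b) (he₁ : e₁ = 1 ∨ e₁ = -1)
    (he₂ : e₂ = 1 ∨ e₂ = -1) (hv : 0 ≤ v) (hY : curveImSq τ a b e₁ e₂ v = 0) :
    (b < curveRe τ a b e₁ e₂ v ∧ e₁ = 1 ∧ e₂ = -1) ∨
    (curveRe τ a b e₁ e₂ v < a ∧ e₁ = -1 ∧ e₂ = 1) ∨
    (a < curveRe τ a b e₁ e₂ v ∧ curveRe τ a b e₁ e₂ v < b ∧ e₁ = -1 ∧ e₂ = -1) := by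
  have hab := h.lt
  have hy := h.im_pos
  have hP0 := normSq_sub_pos hy a
  have hQ0 := normSq_sub_pos hy b
  have hv0 : 0 < v := by
    refine lt_of_le_of_ne hv fun h0 => ?_
    rw [← h0, curveImSq_zero hab] at hY
    exact hy.ne' (pow_eq_zero_iff (two_ne_zero) |>.1 hY)
  have hp : (curveRe τ a b e₁ e₂ v - a) ^ 2 = sqd τ a e₁ v := by
    have : curveImSq τ a b e₁ e₂ v = sqd τ a e₁ v - (curveRe τ a b e₁ e₂ v - a) ^ 2 := rfl
    linarith
  have hq : (curveRe τ a b e₁ e₂ v - b) ^ 2 = sqd τ b e₂ v := by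
    have : curveImSq τ a b e₁ e₂ v = sqd τ b e₂ v - (curveRe τ a b e₁ e₂ v - b) ^ 2 :=
      ptImSq_eq_right hab
    linarith
  have hp1 := branch_ne hP0 he₁ hv0
  have hq1 := branch_ne hQ0 he₂ hv0
  have hp2 := branch_sign hP0 he₁ hv0
  have hq2 := branch_sign hQ0 he₂ hv0
  change sqd τ a e₁ v ≠ _ at hp1
  change sqd τ b e₂ v ≠ _ at hq1
  change 0 < e₁ * (sqd τ a e₁ v - _) at hp2
  change 0 < e₂ * (sqd τ b e₂ v - _) at hq2
  have hg : levelGap a b (Complex.normSq (τ - a)) (Complex.normSq (τ - b))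
      (curveRe τ a b e₁ e₂ v) = 0 := by
    rw [levelGap, hp, hq]
    have h1 := branch_eq hP0 he₁ hv
    have h2 := branch_eq hQ0 he₂ hv
    unfold sqd
    linarith
  have hPe : Complex.normSq (τ - a) = (τ.re - a) ^ 2 + τ.im ^ 2 := by
    rw [Complex.normSq_apply]; simp; ring
  have hQe : Complex.normSq (τ - b) = (τ.re - b) ^ 2 + τ.im ^ 2 := by
    rw [Complex.normSq_apply]; simp; ring
  have hpp : 0 < sqd τ a e₁ v := sqd_pos hy
  have hqp : 0 < sqd τ b e₂ v := sqd_pos hy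
  have hsign1 : ∀ {e u : ℝ}, (e = 1 ∨ e = -1) → 0 < e * u → 0 < u → e = 1 := by
    rintro e u (rfl | rfl) h1 h2
    · rfl
    · linarith
  have hsign2 : ∀ {e u : ℝ}, (e = 1 ∨ e = -1) → 0 < e * u → u < 0 → e = -1 := by
    rintro e u (rfl | rfl) h1 h2
    · linarith
    · rfl
  rw [← hp] at hp1 hp2 hpp
  rw [← hq] at hq1 hq2 hqp
  rcases lt_trichotomy (curveRe τ a b e₁ e₂ v) a with h1 | h1 | h1
  · obtain ⟨h2, h3⟩ := real_level_left hab hy hPe hQe h1 hg hp1 hq1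
    exact Or.inr (Or.inl ⟨h1, hsign2 he₁ hp2 (by linarith), hsign1 he₂ hq2 (by linarith)⟩)
  · rw [h1] at hpp; simp at hpp
  · rcases lt_trichotomy (curveRe τ a b e₁ e₂ v) b with h4 | h4 | h4
    · obtain ⟨h2, h3⟩ := real_level_mid hab hy hPe hQe h1 h4 hg hp1 hq1
      exact Or.inr (Or.inr ⟨h1, h4, hsign2 he₁ hp2 (by linarith), hsign2 he₂ hq2 (by linarith)⟩)
    · rw [h4] at hqp; simp at hqp
    · obtain ⟨h2, h3⟩ := real_level_right hab hy hPe hQe h4 hg hp1 hq1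
      exact Or.inl ⟨h4, hsign1 he₁ hp2 (by linarith), hsign2 he₂ hq2 (by linarith)⟩

lemma curveImSq_plus_pos (h : Geo K τ a b) (hv : 0 ≤ v) : 0 < curveImSq τ a b 1 1 v := by
  by_contra hc
  have h0 : 0 < curveImSq τ a b 1 1 0 := by
    rw [curveImSq_zero h.lt]; exact pow_pos h.im_pos 2
  obtain ⟨u, hu, hu2⟩ := intermediate_value_Icc' hv
    (continuous_curveImSq (τ := τ) (a := a) (b := b) (e₁ := 1) (e₂ := 1)).continuousOn
    (⟨not_lt.1 hc, h0.le⟩ : (0 : ℝ) ∈ Icc _ _)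
  rcases location_of_curveImSq_eq_zero h (Or.inl rfl) (Or.inl rfl) hu.1 hu2 with
    ⟨-, -, h1⟩ | ⟨-, h1, -⟩ | ⟨-, -, h1, -⟩ <;> norm_num at h1

/-- The compact set of parameters with times at most `V`. -/
def geoSet (K V : ℝ) : Set (ℂ × ℝ × ℝ × ℝ) :=
  {x | Geo K x.1 x.2.1 x.2.2.1 ∧ 0 ≤ x.2.2.2 ∧ x.2.2.2 ≤ V}

lemma isCompact_geoSet (K V : ℝ) : IsCompact (geoSet K V) := by
  by_cases hK : 1 ≤ K
  swap
  · have : geoSet K V = ∅ := by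
      ext x; simp only [geoSet, mem_ofPred_eq, mem_empty_iff_false, iff_false]
      exact fun h => hK h.1.one_le
    rw [this]; exact isCompact_empty
  have hsub : geoSet K V ⊆ Metric.closedBall 0 K ×ˢ (Icc (-K) K ×ˢ (Icc (-K) K ×ˢ Icc 0 V)) := by
    rintro ⟨τ, a, b, v⟩ ⟨h, h1, h2⟩
    exact ⟨by simpa using h.norm, abs_le.1 h.left, abs_le.1 h.right, h1, h2⟩
  refine IsCompact.of_isClosed_subset ((isCompact_closedBall 0 K).prod
    (isCompact_Icc.prod (isCompact_Icc.prod isCompact_Icc))) ?_ hsub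
  have heq : geoSet K V = {x | 1 / K ≤ x.1.im} ∩ {x | ‖x.1‖ ≤ K} ∩ {x | 1 / K ≤ x.2.2.1 - x.2.1} ∩
      {x | |x.2.1| ≤ K} ∩ {x | |x.2.2.1| ≤ K} ∩ {x | 0 ≤ x.2.2.2} ∩ {x | x.2.2.2 ≤ V} := by
    ext ⟨τ, a, b, v⟩
    simp only [geoSet, mem_ofPred_eq, mem_inter_iff]
    constructor
    · rintro ⟨h, h1, h2⟩
      exact ⟨⟨⟨⟨⟨⟨h.im, h.norm⟩, h.len⟩, h.left⟩, h.right⟩, h1⟩, h2⟩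
    · rintro ⟨⟨⟨⟨⟨⟨h1, h2⟩, h3⟩, h4⟩, h5⟩, h6⟩, h7⟩
      exact ⟨⟨hK, h1, h2, h3, h4, h5⟩, h6, h7⟩
  rw [heq]
  refine IsClosed.inter (IsClosed.inter (IsClosed.inter (IsClosed.inter (IsClosed.inter
    (IsClosed.inter ?_ ?_) ?_) ?_) ?_) ?_) ?_
  · exact isClosed_le continuous_const (Complex.continuous_im.comp continuous_fst)
  · exact isClosed_le (by fun_prop) continuous_const
  · exact isClosed_le continuous_const (by fun_prop)
  · exact isClosed_le (by fun_prop) continuous_const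
  · exact isClosed_le (by fun_prop) continuous_const
  · exact isClosed_le continuous_const (by fun_prop)
  · exact isClosed_le (by fun_prop) continuous_const

lemma continuousOn_branch_comp {X : Type*} [TopologicalSpace X] {S : Set X} {f g : X → ℝ} (e : ℝ)
    (hf : ContinuousOn f S) (hg : ContinuousOn g S) (h0 : ∀ x ∈ S, f x ≠ 0) :
    ContinuousOn (fun x => branch (f x) e (g x)) S := by
  unfold branch
  exact hf.mul (Real.continuous_exp.comp_continuousOn (continuous_oddLog.comp_continuousOn
    ((continuousOn_const.mul hg).div hf h0)))

lemma continuousOn_sqd_left (K V e : ℝ) :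
    ContinuousOn (fun x : ℂ × ℝ × ℝ × ℝ => sqd x.1 x.2.1 e x.2.2.2) (geoSet K V) := by
  refine continuousOn_branch_comp e ?_ (by fun_prop) fun x hx =>
    (normSq_sub_pos hx.1.im_pos _).ne'
  exact (Complex.continuous_normSq.comp (continuous_fst.sub
    (Complex.continuous_ofReal.comp (continuous_fst.comp continuous_snd)))).continuousOn

lemma continuousOn_sqd_right (K V e : ℝ) :
    ContinuousOn (fun x : ℂ × ℝ × ℝ × ℝ => sqd x.1 x.2.2.1 e x.2.2.2) (geoSet K V) := by
  refine continuousOn_branch_comp e ?_ (by fun_prop) fun x hx =>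
    (normSq_sub_pos hx.1.im_pos _).ne'
  exact (Complex.continuous_normSq.comp (continuous_fst.sub
    (Complex.continuous_ofReal.comp (continuous_fst.comp (continuous_snd.comp
      continuous_snd))))).continuousOn

lemma continuousOn_curveRe (K V e₁ e₂ : ℝ) :
    ContinuousOn (fun x : ℂ × ℝ × ℝ × ℝ => curveRe x.1 x.2.1 x.2.2.1 e₁ e₂ x.2.2.2)
      (geoSet K V) := by
  unfold curveRe ptRe
  have h1 := continuousOn_sqd_left K V e₁
  have h2 := continuousOn_sqd_right K V e₂
  refine ContinuousOn.add (by fun_prop) (ContinuousOn.div ((h1.sub h2).add (by fun_prop))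
    (by fun_prop) fun x hx => ?_)
  have := hx.1.lt
  linarith

lemma continuousOn_curveImSq (K V e₁ e₂ : ℝ) :
    ContinuousOn (fun x : ℂ × ℝ × ℝ × ℝ => curveImSq x.1 x.2.1 x.2.2.1 e₁ e₂ x.2.2.2)
      (geoSet K V) := by
  have h1 := continuousOn_sqd_left K V e₁
  have h2 := continuousOn_curveRe K V e₁ e₂
  exact h1.sub ((h2.sub (by fun_prop)).pow 2)

/-- If a continuous quantity is negative wherever the level curve meets the real axis, it is
negative wherever the level curve is sufficiently close to the real axis. -/
lemma exists_height_of_location (K V e₁ e₂ : ℝ) (f : ℂ × ℝ × ℝ × ℝ → ℝ)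
    (hf : ContinuousOn f (geoSet K V))
    (h : ∀ x ∈ geoSet K V, curveImSq x.1 x.2.1 x.2.2.1 e₁ e₂ x.2.2.2 = 0 → f x < 0) :
    ∃ δ, 0 < δ ∧ ∀ x ∈ geoSet K V, 0 ≤ curveImSq x.1 x.2.1 x.2.2.1 e₁ e₂ x.2.2.2 →
      curveImSq x.1 x.2.1 x.2.2.1 e₁ e₂ x.2.2.2 < δ ^ 2 → f x < 0 := by
  set Y := fun x : ℂ × ℝ × ℝ × ℝ => curveImSq x.1 x.2.1 x.2.2.1 e₁ e₂ x.2.2.2 with hY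
  have hYc : ContinuousOn Y (geoSet K V) := continuousOn_curveImSq K V e₁ e₂
  have hcl := (isCompact_geoSet K V).isClosed
  set S := (geoSet K V ∩ f ⁻¹' Ici 0) ∩ (geoSet K V ∩ Y ⁻¹' Ici 0) with hS
  have hSc : IsCompact S := (isCompact_geoSet K V).of_isClosed_subset
    ((hf.preimage_isClosed_of_isClosed hcl isClosed_Ici).inter
      (hYc.preimage_isClosed_of_isClosed hcl isClosed_Ici)) (fun x hx => hx.1.1)
  rcases S.eq_empty_or_nonempty with he | hne
  · refine ⟨1, one_pos, fun x hx h1 _ => ?_⟩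
    by_contra hc
    have : x ∈ S := ⟨⟨hx, not_lt.1 hc⟩, hx, h1⟩
    rw [he] at this
    exact this
  · obtain ⟨x₀, hx₀, hmin⟩ := hSc.exists_isMinOn hne (hYc.mono fun x hx => hx.1.1)
    have h0 : 0 < Y x₀ := by
      refine lt_of_le_of_ne hx₀.2.2 fun h1 => ?_
      have := h x₀ hx₀.1.1 h1.symm
      have h2 : 0 ≤ f x₀ := hx₀.1.2
      linarith
    refine ⟨√(Y x₀), Real.sqrt_pos.2 h0, fun x hx h1 h2 => ?_⟩
    by_contra hc
    have h3 : x ∈ S := ⟨⟨hx, not_lt.1 hc⟩, hx, h1⟩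
    have h4 : Y x₀ ≤ Y x := hmin h3
    rw [Real.sq_sqrt h0.le] at h2
    linarith

lemma exists_plus_height (K V : ℝ) : ∃ δ, 0 < δ ∧ ∀ τ a b v, Geo K τ a b → 0 ≤ v → v ≤ V →
    δ ^ 2 ≤ curveImSq τ a b 1 1 v := by
  obtain ⟨δ, hδ, h⟩ := exists_height_of_location K V 1 1 (fun _ => 1) continuousOn_const
    (fun x hx h0 => absurd h0 (curveImSq_plus_pos hx.1 hx.2.1).ne')
  refine ⟨δ, hδ, fun τ a b v hg h1 h2 => ?_⟩
  by_contra hc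
  have := h (τ, a, b, v) ⟨hg, h1, h2⟩ (curveImSq_plus_pos hg h1).le (not_le.1 hc)
  norm_num at this

/-- Near the real axis the level curves reaching it have the expected position. -/
lemma exists_location_height (K : ℝ) : ∃ δ, 0 < δ ∧ ∀ τ a b v, Geo K τ a b → 0 ≤ v →
    (∀ {e₁ e₂ : ℝ}, e₁ = -1 → e₂ = -1 → 0 ≤ curveImSq τ a b e₁ e₂ v →
      curveImSq τ a b e₁ e₂ v < δ ^ 2 →
      a < curveRe τ a b e₁ e₂ v ∧ curveRe τ a b e₁ e₂ v < b) ∧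
    (∀ {e₁ e₂ : ℝ}, e₁ = -1 → e₂ = 1 → 0 ≤ curveImSq τ a b e₁ e₂ v →
      curveImSq τ a b e₁ e₂ v < δ ^ 2 → curveRe τ a b e₁ e₂ v < a) ∧
    (∀ {e₁ e₂ : ℝ}, e₁ = 1 → e₂ = -1 → 0 ≤ curveImSq τ a b e₁ e₂ v →
      curveImSq τ a b e₁ e₂ v < δ ^ 2 → b < curveRe τ a b e₁ e₂ v) := by
  have hc := continuousOn_curveRe K (64 * K ^ 6)
  obtain ⟨δ₁, h1, H1⟩ := exists_height_of_location K (64 * K ^ 6) (-1) (-1)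
    (fun x => max (x.2.1 - curveRe x.1 x.2.1 x.2.2.1 (-1) (-1) x.2.2.2)
      (curveRe x.1 x.2.1 x.2.2.1 (-1) (-1) x.2.2.2 - x.2.2.1))
    (ContinuousOn.sup (ContinuousOn.sub (by fun_prop) (hc _ _))
      ((hc _ _).sub (by fun_prop))) (by
      intro x hx h0
      rcases location_of_curveImSq_eq_zero hx.1 (Or.inr rfl) (Or.inr rfl) hx.2.1 h0 with
        ⟨-, h, -⟩ | ⟨-, -, h⟩ | ⟨h, h', -⟩
      · norm_num at h
      · norm_num at h
      · exact max_lt (by linarith) (by linarith))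
  obtain ⟨δ₂, h2, H2⟩ := exists_height_of_location K (64 * K ^ 6) (-1) 1
    (fun x => curveRe x.1 x.2.1 x.2.2.1 (-1) 1 x.2.2.2 - x.2.1)
    ((hc _ _).sub (by fun_prop)) (by
      intro x hx h0
      rcases location_of_curveImSq_eq_zero hx.1 (Or.inr rfl) (Or.inl rfl) hx.2.1 h0 with
        ⟨-, h, -⟩ | ⟨h, -⟩ | ⟨-, -, -, h⟩
      · norm_num at h
      · linarith
      · norm_num at h)
  obtain ⟨δ₃, h3, H3⟩ := exists_height_of_location K (64 * K ^ 6) 1 (-1)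
    (fun x => x.2.2.1 - curveRe x.1 x.2.1 x.2.2.1 1 (-1) x.2.2.2)
    (ContinuousOn.sub (by fun_prop) (hc _ _)) (by
      intro x hx h0
      rcases location_of_curveImSq_eq_zero hx.1 (Or.inl rfl) (Or.inr rfl) hx.2.1 h0 with
        ⟨h, -, -⟩ | ⟨-, h, -⟩ | ⟨-, -, h, -⟩
      · linarith
      · norm_num at h
      · norm_num at h)
  have hle : ∀ {d}, 0 < d → min δ₁ (min δ₂ δ₃) ≤ d → min δ₁ (min δ₂ δ₃) ^ 2 ≤ d ^ 2 :=
    fun hd h => pow_le_pow_left₀ (by positivity) h 2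
  refine ⟨min δ₁ (min δ₂ δ₃), by positivity, fun τ a b v hg hv => ⟨?_, ?_, ?_⟩⟩
  · rintro _ _ rfl rfl hY hY2
    have hb := (curve_minus_bounds hg (Or.inr rfl) (Or.inr rfl) (Or.inl rfl) hv hY).1
    have := H1 (τ, a, b, v) ⟨hg, hv, hb⟩ hY (hY2.trans_le (hle h1 (min_le_left _ _)))
    rw [max_lt_iff] at this
    exact ⟨by linarith [this.1], by linarith [this.2]⟩
  · rintro _ _ rfl rfl hY hY2
    have hb := (curve_minus_bounds hg (Or.inr rfl) (Or.inl rfl) (Or.inl rfl) hv hY).1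
    have := H2 (τ, a, b, v) ⟨hg, hv, hb⟩ hY
      (hY2.trans_le (hle h2 ((min_le_right _ _).trans (min_le_left _ _))))
    linarith
  · rintro _ _ rfl rfl hY hY2
    have hb := (curve_minus_bounds hg (Or.inl rfl) (Or.inr rfl) (Or.inr rfl) hv hY).1
    have := H3 (τ, a, b, v) ⟨hg, hv, hb⟩ hY
      (hY2.trans_le (hle h3 ((min_le_right _ _).trans (min_le_right _ _))))
    linarith

end Location

end GTBulk

end

noncomputable section

namespace GTBulk

open MeasureTheory Set Filter
open scoped ComplexConjugate

/-- The point `z` lies on the side of sign `e₁` of the circle around `a` through `τ`, and on the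
side of sign `e₂` of the circle around `b` through `τ`, with margin `s`. -/
def Sided (τ : ℂ) (a b e₁ e₂ s : ℝ) (z : ℂ) : Prop :=
  s ≤ e₁ * (‖z - a‖ - ‖τ - a‖) ∧ s ≤ e₂ * (‖z - b‖ - ‖τ - b‖)

namespace Sided

variable {τ z w : ℂ} {a b e₁ e₂ s : ℝ}

lemma mono (h : Sided τ a b e₁ e₂ s z) {s' : ℝ} (hs : s' ≤ s) : Sided τ a b e₁ e₂ s' z :=
  ⟨hs.trans h.1, hs.trans h.2⟩

lemma norm_conj_sub (z : ℂ) (a : ℝ) : ‖conj z - a‖ = ‖z - a‖ := by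
  rw [← Complex.norm_conj (z - a), map_sub, Complex.conj_ofReal]

lemma star (h : Sided τ a b e₁ e₂ s z) : Sided τ a b e₁ e₂ s (conj z) := by
  unfold Sided
  rw [norm_conj_sub, norm_conj_sub]
  exact h

lemma near (h : Sided τ a b e₁ e₂ s z) (he₁ : e₁ = 1 ∨ e₁ = -1) (he₂ : e₂ = 1 ∨ e₂ = -1)
    {ε : ℝ} (hw : ‖w - z‖ ≤ ε) : Sided τ a b e₁ e₂ (s - ε) w := by
  have aux : ∀ {e c : ℝ}, (e = 1 ∨ e = -1) → s ≤ e * (‖z - c‖ - ‖τ - c‖) →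
      s - ε ≤ e * (‖w - c‖ - ‖τ - c‖) := by
    intro e c he hs
    have h1 : |‖w - c‖ - ‖z - c‖| ≤ ε := by
      refine (abs_norm_sub_norm_le _ _).trans ?_
      rwa [sub_sub_sub_cancel_right]
    have h2 := abs_le.1 h1
    rcases he with rfl | rfl <;> linarith
  exact ⟨aux he₁ h.1, aux he₂ h.2⟩

lemma sep {e₁' e₂' s' : ℝ} (h : Sided τ a b e₁ e₂ s z) (h' : Sided τ a b e₁' e₂' s' w)
    (he₁ : e₁ = 1 ∨ e₁ = -1) (he₁' : e₁' = 1 ∨ e₁' = -1)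
    (hz : e₁ * e₂ = 1) (hw : e₁' * e₂' = -1) : s + s' ≤ ‖z - w‖ := by
  have h1 := abs_norm_sub_norm_le (z - a) (w - a)
  have h2 := abs_norm_sub_norm_le (z - b) (w - b)
  rw [sub_sub_sub_cancel_right] at h1 h2
  have h3 := abs_le.1 h1
  have h4 := abs_le.1 h2
  obtain ⟨h5, h6⟩ := h
  obtain ⟨h7, h8⟩ := h'
  rcases he₁ with rfl | rfl <;> rcases he₁' with rfl | rfl
  · obtain rfl : e₂ = 1 := by linarith
    obtain rfl : e₂' = -1 := by linarith
    linarith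
  · obtain rfl : e₂ = 1 := by linarith
    obtain rfl : e₂' = 1 := by linarith
    linarith
  · obtain rfl : e₂ = -1 := by linarith
    obtain rfl : e₂' = -1 := by linarith
    linarith
  · obtain rfl : e₂ = -1 := by linarith
    obtain rfl : e₂' = 1 := by linarith
    linarith

lemma scale (h : Sided τ a b e₁ e₂ s z) {N : ℝ} (hN : 0 ≤ N) :
    Sided (N * τ) (N * a) (N * b) e₁ e₂ (N * s) (N * z) := by
  have aux : ∀ (u : ℂ) (c : ℝ), ‖(N : ℂ) * u - (N * c : ℝ)‖ = N * ‖u - c‖ := by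
    intro u c
    rw [Complex.ofReal_mul, ← mul_sub, norm_mul, Complex.norm_real, Real.norm_of_nonneg hN]
  unfold Sided
  rw [aux, aux, aux, aux]
  constructor
  · have := mul_le_mul_of_nonneg_left h.1 hN; linarith
  · have := mul_le_mul_of_nonneg_left h.2 hN; linarith

end Sided

/-- A portion of a level curve on which height and distances to the end points are controlled. -/
structure CurveReg (K ρ B δ : ℝ) (τ : ℂ) (a b e₁ e₂ V : ℝ) : Prop where
  geo : Geo K τ a b
  sign₁ : e₁ = 1 ∨ e₁ = -1
  sign₂ : e₂ = 1 ∨ e₂ = -1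
  rho : 0 < ρ
  del : 0 < δ
  len : 0 < V
  high : ∀ v ∈ Icc 0 V, δ ^ 2 ≤ curveImSq τ a b e₁ e₂ v
  left : ∀ v ∈ Icc 0 V, ρ ≤ sqd τ a e₁ v ∧ sqd τ a e₁ v ≤ B
  right : ∀ v ∈ Icc 0 V, ρ ≤ sqd τ b e₂ v ∧ sqd τ b e₂ v ≤ B

/-- The margin constant of level curves. -/
def margin (K ρ B : ℝ) : ℝ := √ρ / (√B + 2 * K)

/-- The speed constant of level curves. -/
def speed (K B δ : ℝ) : ℝ := K * √B + (√B + 2 * √B * (K * √B)) / (2 * δ)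

lemma measurable_curveDeriv (τ : ℂ) (a b e₁ e₂ : ℝ) : Measurable (curveDeriv τ a b e₁ e₂) := by
  have h1 : Measurable (sqd τ a e₁) := continuous_sqd.measurable
  have h2 : Measurable (sqd τ b e₂) := continuous_sqd.measurable
  have h3 : Measurable (sqdDeriv τ a e₁) := h1.div (h1.sub_const _)
  have h4 : Measurable (sqdDeriv τ b e₂) := h2.div (h2.sub_const _)
  have h5 : Measurable (fun v => ptRe a b (sqd τ a e₁ v) (sqd τ b e₂ v)) := by
    unfold ptRe; fun_prop
  have h6 : Measurable (curveImSq τ a b e₁ e₂) := continuous_curveImSq.measurable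
  have h7 : Measurable (fun v => (sqdDeriv τ a e₁ v - sqdDeriv τ b e₂ v) / (2 * (b - a))) :=
    (h3.sub h4).div_const _
  have h8 : Measurable (fun v => (sqdDeriv τ a e₁ v -
      2 * (ptRe a b (sqd τ a e₁ v) (sqd τ b e₂ v) - a) *
        ((sqdDeriv τ a e₁ v - sqdDeriv τ b e₂ v) / (2 * (b - a)))) /
      (2 * √(curveImSq τ a b e₁ e₂ v))) :=
    (h3.sub (((h5.sub_const a).const_mul 2).mul h7)).div ((h6.sqrt).const_mul 2)
  have : curveDeriv τ a b e₁ e₂ = fun v =>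
      (((sqdDeriv τ a e₁ v - sqdDeriv τ b e₂ v) / (2 * (b - a)) : ℝ) : ℂ) +
      (((sqdDeriv τ a e₁ v -
      2 * (ptRe a b (sqd τ a e₁ v) (sqd τ b e₂ v) - a) *
        ((sqdDeriv τ a e₁ v - sqdDeriv τ b e₂ v) / (2 * (b - a)))) /
      (2 * √(curveImSq τ a b e₁ e₂ v)) : ℝ) : ℂ) * Complex.I := by
    ext v
    exact Complex.mk_eq_add_mul_I _ _
  rw [this]
  exact (Complex.measurable_ofReal.comp h7).add
    ((Complex.measurable_ofReal.comp h8).mul_const _)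

namespace CurveReg

variable {K ρ B δ : ℝ} {τ : ℂ} {a b e₁ e₂ V v : ℝ}

lemma im_pos (h : CurveReg K ρ B δ τ a b e₁ e₂ V) (hv : v ∈ Icc 0 V) :
    0 < curveImSq τ a b e₁ e₂ v := (pow_pos h.del 2).trans_le (h.high v hv)

lemma margin_pos (h : CurveReg K ρ B δ τ a b e₁ e₂ V) : 0 < margin K ρ B := by
  have h1 := Real.sqrt_pos.2 h.rho
  have h2 := h.geo.one_le
  unfold margin
  positivity

lemma sided (h : CurveReg K ρ B δ τ a b e₁ e₂ V) (hv : v ∈ Icc 0 V) :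
    Sided τ a b e₁ e₂ (margin K ρ B * √v) (curve τ a b e₁ e₂ v) := by
  have hK := h.geo.one_le
  have hY := (h.im_pos hv).le
  have hab := h.geo.lt
  have aux : ∀ {P e : ℝ}, 0 < P → P ≤ 4 * K ^ 2 → (e = 1 ∨ e = -1) → ρ ≤ branch P e v →
      branch P e v ≤ B → margin K ρ B * √v ≤ e * (√(branch P e v) - √P) := by
    intro P e hP hP4 he h1 h2
    have h3 := mul_branch_le_sq hP he hv.1
    have hp : 0 < branch P e v := branch_pos hP
    have h4 : √v * √(branch P e v) ≤ e * (branch P e v - P) := by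
      rw [← Real.sqrt_mul hv.1]
      refine (Real.sqrt_le_sqrt h3).trans ?_
      rw [Real.sqrt_sq_eq_abs]
      rcases he with rfl | rfl
      · have := le_branch hP hv.1
        rw [abs_of_nonneg (by linarith)]; linarith
      · have := branch_le hP hv.1
        rw [abs_of_nonpos (by linarith)]; linarith
    have h5 : √P ≤ 2 * K := Real.sqrt_le_iff.2 ⟨by positivity, by nlinarith⟩
    have h6 : √(branch P e v) ≤ √B := Real.sqrt_le_sqrt h2
    have h7 : √ρ ≤ √(branch P e v) := Real.sqrt_le_sqrt h1
    have h8 : 0 < √P := Real.sqrt_pos.2 hP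
    have h9 : (e * (√(branch P e v) - √P)) * (√(branch P e v) + √P) = e * (branch P e v - P) := by
      have e1 := Real.mul_self_sqrt hP.le
      have e2 := Real.mul_self_sqrt hp.le
      linear_combination e * e2 - e * e1
    have h10 : 0 ≤ e * (√(branch P e v) - √P) := by
      by_contra hc
      have h11 : (e * (√(branch P e v) - √P)) * (√(branch P e v) + √P) < 0 :=
        mul_neg_of_neg_of_pos (not_le.1 hc) (by positivity)
      have : 0 ≤ √v * √(branch P e v) := by positivity
      linarith
    unfold margin
    rw [div_mul_eq_mul_div, div_le_iff₀ (by positivity)]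
    calc √ρ * √v ≤ √v * √(branch P e v) := by
          rw [mul_comm]; gcongr
      _ ≤ (e * (√(branch P e v) - √P)) * (√(branch P e v) + √P) := by rw [h9]; exact h4
      _ ≤ _ := by gcongr
  have hn : ∀ (z : ℂ), ‖z‖ = √(Complex.normSq z) := fun z => by
    rw [Complex.normSq_eq_norm_sq, Real.sqrt_sq (norm_nonneg _)]
  constructor
  · rw [hn, hn, normSq_curve_sub_left hab hY]
    exact aux (normSq_sub_pos h.geo.im_pos a) h.geo.normSq_left.2 h.sign₁ (h.left v hv).1
      (h.left v hv).2
  · rw [hn, hn, normSq_curve_sub_right hab hY]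
    exact aux (normSq_sub_pos h.geo.im_pos b) h.geo.normSq_right.2 h.sign₂ (h.right v hv).1
      (h.right v hv).2

lemma speed_nonneg (h : CurveReg K ρ B δ τ a b e₁ e₂ V) : 0 ≤ speed K B δ := by
  have h1 := h.geo.one_le
  have h2 := h.del
  unfold speed
  positivity

lemma norm_curveDeriv_le (h : CurveReg K ρ B δ τ a b e₁ e₂ V) (hv : v ∈ Ioc 0 V) :
    ‖curveDeriv τ a b e₁ e₂ v‖ ≤ speed K B δ * v ^ (-(1 / 2) : ℝ) := by
  have hK := h.geo.one_le
  have hab := h.geo.lt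
  have hv' : v ∈ Icc 0 V := ⟨hv.1.le, hv.2⟩
  have hs : 0 < √v := Real.sqrt_pos.2 hv.1
  have hrp : v ^ (-(1 / 2) : ℝ) = 1 / √v := by
    rw [Real.rpow_neg hv.1.le, Real.sqrt_eq_rpow, one_div (v ^ _)]
  rw [hrp]
  have aux : ∀ {c e : ℝ}, (e = 1 ∨ e = -1) → sqd τ c e v ≤ B →
      |sqdDeriv τ c e v| ≤ √B * (1 / √v) := by
    intro c e he h2
    have hP := normSq_sub_pos h.geo.im_pos c
    have h3 := mul_branch_le_sq hP he hv.1.le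
    change v * sqd τ c e v ≤ (sqd τ c e v - _) ^ 2 at h3
    have hp : 0 < sqd τ c e v := branch_pos hP
    have hne : sqd τ c e v - Complex.normSq (τ - c) ≠ 0 := sub_ne_zero.2 (branch_ne hP he hv.1)
    have h4 : √v * √(sqd τ c e v) ≤ |sqd τ c e v - Complex.normSq (τ - c)| := by
      rw [← Real.sqrt_mul hv.1.le, ← Real.sqrt_sq_eq_abs]
      exact Real.sqrt_le_sqrt h3
    rw [sqdDeriv, abs_div, abs_of_pos hp, div_le_iff₀ (abs_pos.2 hne)]
    have h5 : √(sqd τ c e v) ≤ √B := Real.sqrt_le_sqrt h2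
    calc sqd τ c e v = √(sqd τ c e v) * √(sqd τ c e v) := (Real.mul_self_sqrt hp.le).symm
      _ = √(sqd τ c e v) * (1 / √v) * (√v * √(sqd τ c e v)) := by field_simp
      _ ≤ √B * (1 / √v) * |sqd τ c e v - Complex.normSq (τ - c)| := by gcongr
  have h1 := aux h.sign₁ (h.left v hv').2
  have h2 := aux h.sign₂ (h.right v hv').2
  set r := (sqdDeriv τ a e₁ v - sqdDeriv τ b e₂ v) / (2 * (b - a)) with hr
  have hrb : |r| ≤ K * √B * (1 / √v) := by
    rw [hr, abs_div, abs_of_pos (a := 2 * (b - a)) (by linarith), div_le_iff₀ (by linarith)]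
    have h3 : 1 ≤ K * (b - a) := by
      have := h.geo.len
      rw [div_le_iff₀ (by linarith)] at this; linarith
    have h4 := abs_sub (sqdDeriv τ a e₁ v) (sqdDeriv τ b e₂ v)
    calc |sqdDeriv τ a e₁ v - sqdDeriv τ b e₂ v| ≤ 2 * (√B * (1 / √v)) * 1 := by linarith
      _ ≤ 2 * (√B * (1 / √v)) * (K * (b - a)) := by gcongr
      _ = _ := by ring
  have hδ : δ ≤ √(curveImSq τ a b e₁ e₂ v) := Real.le_sqrt_of_sq_le (h.high v hv')
  have hδ0 := h.del
  set x := ptRe a b (sqd τ a e₁ v) (sqd τ b e₂ v) with hx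
  have hxa : |x - a| ≤ √B := by
    refine Real.abs_le_sqrt ?_
    have h5 : curveImSq τ a b e₁ e₂ v = sqd τ a e₁ v - (x - a) ^ 2 := rfl
    linarith [h.im_pos hv', (h.left v hv').2]
  have him : |(sqdDeriv τ a e₁ v - 2 * (x - a) * r) / (2 * √(curveImSq τ a b e₁ e₂ v))| ≤
      (√B + 2 * √B * (K * √B)) / (2 * δ) * (1 / √v) := by
    rw [abs_div, abs_of_pos (a := 2 * √(curveImSq τ a b e₁ e₂ v)) (by linarith)]
    rw [div_mul_eq_mul_div]
    have h6 : |2 * (x - a) * r| ≤ 2 * √B * (K * √B * (1 / √v)) := by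
      rw [abs_mul, abs_mul, abs_two]; gcongr
    have h7 := abs_sub (sqdDeriv τ a e₁ v) (2 * (x - a) * r)
    gcongr
    calc _ ≤ _ := h7
      _ ≤ √B * (1 / √v) + 2 * √B * (K * √B * (1 / √v)) := add_le_add h1 h6
      _ = _ := by ring
  refine (Complex.norm_le_abs_re_add_abs_im _).trans ?_
  change |r| + |_| ≤ _
  refine (add_le_add hrb him).trans (le_of_eq ?_)
  unfold speed
  ring

lemma intervalIntegrable_deriv (h : CurveReg K ρ B δ τ a b e₁ e₂ V) :
    IntervalIntegrable (curveDeriv τ a b e₁ e₂) volume 0 V := by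
  have h1 : IntervalIntegrable (fun v : ℝ => speed K B δ * v ^ (-(1 / 2) : ℝ)) volume 0 V :=
    (intervalIntegral.intervalIntegrable_rpow' (by norm_num)).const_mul _
  refine h1.mono_fun (measurable_curveDeriv _ _ _ _ _).aestronglyMeasurable ?_
  rw [uIoc_of_le h.len.le]
  filter_upwards [ae_restrict_mem measurableSet_Ioc] with v hv
  exact (h.norm_curveDeriv_le hv).trans (le_abs_self _)

/-- The level curve dilated by the factor `N`. -/
def arc (h : CurveReg K ρ B δ τ a b e₁ e₂ V) (N : ℝ) : Arc where
  lo := 0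
  hi := V
  le := h.len.le
  fn v := N * curve τ a b e₁ e₂ v
  dfn v := N * curveDeriv τ a b e₁ e₂ v
  cont := (continuous_const.mul continuous_curve).continuousOn
  der _ hv := (hasDerivAt_curve h.geo.im_pos h.sign₁ h.sign₂ hv.1
    (h.im_pos ⟨hv.1.le, hv.2.le⟩)).const_mul _
  int := h.intervalIntegrable_deriv.const_mul _

end CurveReg

section Construct

variable {K : ℝ} {τ : ℂ} {a b : ℝ}

lemma curveReg_minus (h : Geo K τ a b) {e₁ e₂ δ V : ℝ} (he₁ : e₁ = 1 ∨ e₁ = -1)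
    (he₂ : e₂ = 1 ∨ e₂ = -1) (hm : e₁ = -1 ∨ e₂ = -1) (hδ : 0 < δ) (hV : 0 < V)
    (hY : ∀ v ∈ Icc 0 V, δ ^ 2 ≤ curveImSq τ a b e₁ e₂ v) :
    CurveReg K (minDist K) (16 * K ^ 2) δ τ a b e₁ e₂ V where
  geo := h
  sign₁ := he₁
  sign₂ := he₂
  rho := minDist_pos h.one_le
  del := hδ
  len := hV
  high := hY
  left v hv := by
    have := curve_minus_bounds h he₁ he₂ hm hv.1 ((pow_pos hδ 2).le.trans (hY v hv))
    exact ⟨this.2.1, this.2.2.1⟩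
  right v hv := by
    have := curve_minus_bounds h he₁ he₂ hm hv.1 ((pow_pos hδ 2).le.trans (hY v hv))
    exact ⟨this.2.2.2.1, this.2.2.2.2⟩

lemma curveReg_plus (h : Geo K τ a b) {δ V : ℝ} (hδ : 0 < δ) (hV : 0 < V)
    (hY : ∀ v ∈ Icc 0 V, δ ^ 2 ≤ curveImSq τ a b 1 1 v) :
    CurveReg K (1 / K ^ 2) (2 * (4 * K ^ 2 + V)) δ τ a b 1 1 V where
  geo := h
  sign₁ := Or.inl rfl
  sign₂ := Or.inl rfl
  rho := by have := h.one_le; positivity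
  del := hδ
  len := hV
  high := hY
  left v hv := by
    have hP := normSq_sub_pos h.im_pos a
    refine ⟨h.normSq_left.1.trans (le_branch hP hv.1), (branch_le_two_mul hP hv.1).trans ?_⟩
    linarith [h.normSq_left.2, hv.2]
  right v hv := by
    have hP := normSq_sub_pos h.im_pos b
    refine ⟨h.normSq_right.1.trans (le_branch hP hv.1), (branch_le_two_mul hP hv.1).trans ?_⟩
    linarith [h.normSq_right.2, hv.2]

lemma abs_curveRe_plus_le (h : Geo K τ a b) {v : ℝ} (hv : 0 ≤ v) :
    |curveRe τ a b 1 1 v| ≤ K + 2 * K ^ 3 * Real.log (2 + 2 * K ^ 2 * v) := by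
  have hK := h.one_le
  have hab := h.lt
  have aux : ∀ {P : ℝ}, 0 < P → 1 / K ^ 2 ≤ P → P ≤ 4 * K ^ 2 →
      0 ≤ branch P 1 v - P - v ∧
      branch P 1 v - P - v ≤ 4 * K ^ 2 * Real.log (2 + 2 * K ^ 2 * v) := by
    intro P hP h1 h2
    have h3 := branch_eq hP (Or.inl rfl) hv
    have h4 := branch_le_two_mul hP hv
    have hp : 0 < branch P 1 v := branch_pos hP
    refine ⟨by linarith [add_le_branch hP hv], ?_⟩
    have h5 : branch P 1 v / P ≤ 2 + 2 * K ^ 2 * v := by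
      rw [div_le_iff₀ hP]
      have h6 : 1 ≤ K ^ 2 * P := by
        rw [div_le_iff₀ (by positivity)] at h1; linarith
      nlinarith
    have h7 : Real.log (branch P 1 v / P) ≤ Real.log (2 + 2 * K ^ 2 * v) :=
      Real.log_le_log (by positivity) h5
    have h8 : 0 ≤ Real.log (branch P 1 v / P) :=
      Real.log_nonneg ((one_le_div hP).2 (le_branch hP hv))
    calc branch P 1 v - P - v = P * Real.log (branch P 1 v / P) := by linarith
      _ ≤ _ := by gcongr
  have h1 := aux (normSq_sub_pos h.im_pos a) h.normSq_left.1 h.normSq_left.2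
  have h2 := aux (normSq_sub_pos h.im_pos b) h.normSq_right.1 h.normSq_right.2
  change 0 ≤ sqd τ a 1 v - _ - v ∧ sqd τ a 1 v - _ - v ≤ _ at h1
  change 0 ≤ sqd τ b 1 v - _ - v ∧ sqd τ b 1 v - _ - v ≤ _ at h2
  have hx0 := ptRe_normSq h.lt τ
  have h3 : curveRe τ a b 1 1 v - τ.re = ((sqd τ a 1 v - Complex.normSq (τ - a) - v) -
      (sqd τ b 1 v - Complex.normSq (τ - b) - v)) / (2 * (b - a)) := by
    rw [← hx0, curveRe, ptRe, ptRe]; ring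
  set ℓ := Real.log (2 + 2 * K ^ 2 * v)
  have h4 : |curveRe τ a b 1 1 v - τ.re| ≤ 2 * K ^ 3 * ℓ := by
    rw [h3, abs_div, abs_of_pos (a := 2 * (b - a)) (by linarith), div_le_iff₀ (by linarith)]
    have h5 : 1 ≤ K * (b - a) := by
      have := h.len
      rw [div_le_iff₀ (by linarith)] at this; linarith
    have h6 : 0 ≤ 4 * K ^ 2 * ℓ := h1.1.trans h1.2
    calc _ ≤ 4 * K ^ 2 * ℓ * 1 := abs_le.2 ⟨by linarith [h1.1, h2.2], by linarith [h1.2, h2.1]⟩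
      _ ≤ 4 * K ^ 2 * ℓ * (K * (b - a)) := by gcongr
      _ = _ := by ring
  have h7 := (Complex.abs_re_le_norm τ).trans h.norm
  have h8 := abs_sub_abs_le_abs_sub (curveRe τ a b 1 1 v) τ.re
  linarith

/-- Far out, the level curve going to infinity is nearly vertical. -/
lemma exists_far_time (K B η : ℝ) (hK : 1 ≤ K) (hη : 0 < η) : ∃ V, 0 < V ∧
    ∀ τ a b, Geo K τ a b →
      |curveRe τ a b 1 1 V| + B ≤ η * √(curveImSq τ a b 1 1 V) := by
  set ε := √(η ^ 2 / (4 * K ^ 2 * (1 + η ^ 2))) with hε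
  have hε0 : 0 < ε := Real.sqrt_pos.2 (by positivity)
  have h1 : (fun y : ℝ => (2 * K + |B|) + 2 * K ^ 3 * Real.log y) =o[atTop]
      fun y : ℝ => y ^ (1 / 2 : ℝ) :=
    ((Asymptotics.isLittleO_const_left).2 (Or.inr
      (tendsto_norm_atTop_atTop.comp (tendsto_rpow_atTop (by norm_num))))).add
      ((isLittleO_log_rpow_atTop (by norm_num)).const_mul_left _)
  obtain ⟨y, hy1, hy4⟩ := ((h1.def hε0).and (eventually_ge_atTop 4)).exists
  refine ⟨(y - 2) / (2 * K ^ 2), by have : 0 < y - 2 := by linarith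
                                    positivity, fun τ a b h => ?_⟩
  set V := (y - 2) / (2 * K ^ 2) with hV
  have hV0 : 0 ≤ V := by
    have : 0 ≤ y - 2 := by linarith
    positivity
  have hyV : 2 + 2 * K ^ 2 * V = y := by rw [hV]; field_simp; ring
  have hx := abs_curveRe_plus_le h hV0
  rw [hyV] at hx
  set W := (2 * K + |B|) + 2 * K ^ 3 * Real.log y with hW
  have hW0 : 0 ≤ W := by
    have := Real.log_nonneg (by linarith : (1 : ℝ) ≤ y)
    positivity
  rw [Real.norm_of_nonneg hW0, Real.norm_of_nonneg (by positivity), ← Real.sqrt_eq_rpow] at hy1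
  have hW2 : W ^ 2 * (1 + η ^ 2) ≤ η ^ 2 * V := by
    have h2 : W ^ 2 ≤ ε ^ 2 * y := by
      calc W ^ 2 ≤ (ε * √y) ^ 2 := pow_le_pow_left₀ hW0 hy1 2
        _ = ε ^ 2 * y := by rw [mul_pow, Real.sq_sqrt (by linarith : (0 : ℝ) ≤ y)]
    rw [hε, Real.sq_sqrt (by positivity)] at h2
    calc W ^ 2 * (1 + η ^ 2) ≤ η ^ 2 / (4 * K ^ 2 * (1 + η ^ 2)) * y * (1 + η ^ 2) := by gcongr
      _ = η ^ 2 * (y / 2 / (2 * K ^ 2)) := by field_simp; norm_num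
      _ ≤ η ^ 2 * V := by rw [hV]; gcongr; linarith
  have hp : V ≤ sqd τ a 1 V := by
    have := add_le_branch (normSq_sub_pos h.im_pos a) hV0
    have h3 := normSq_sub_pos h.im_pos a
    unfold sqd
    linarith
  have hxW : |curveRe τ a b 1 1 V| + B ≤ W := by
    have := le_abs_self B; linarith
  have hxa : (curveRe τ a b 1 1 V - a) ^ 2 ≤ W ^ 2 := by
    rw [← sq_abs]
    refine pow_le_pow_left₀ (abs_nonneg _) ?_ 2
    have h4 := abs_sub (curveRe τ a b 1 1 V) a
    have h5 := h.left
    have h6 := abs_nonneg B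
    linarith
  have hY : curveImSq τ a b 1 1 V = sqd τ a 1 V - (curveRe τ a b 1 1 V - a) ^ 2 := rfl
  have h6 : W ≤ η * √(curveImSq τ a b 1 1 V) := by
    refine le_of_sq_le_sq ?_ (by positivity)
    rw [mul_pow, Real.sq_sqrt (curveImSq_plus_pos h hV0).le]
    nlinarith [sq_nonneg η]
  linarith

end Construct

end GTBulk

end

noncomputable section

namespace GTBulk

open Set
open scoped BigOperators

/-- The absolute value of `∏_{k ∈ A} (z - k) / ∏_{k ∈ B} (z - k)`. -/
def ratio (A B : Finset ℤ) (z : ℂ) : ℝ := (∏ k ∈ A, ‖z - k‖) / ∏ k ∈ B, ‖z - k‖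

lemma ratio_nonneg (A B : Finset ℤ) (z : ℂ) : 0 ≤ ratio A B z := by unfold ratio; positivity

lemma norm_sub_int_pos {z : ℂ} (hz : z.im ≠ 0) (k : ℤ) : 0 < ‖z - k‖ := by
  rw [norm_pos_iff, sub_ne_zero]
  rintro rfl
  simp at hz

lemma ratio_pos {A B : Finset ℤ} {z : ℂ} (hz : z.im ≠ 0) : 0 < ratio A B z :=
  div_pos (Finset.prod_pos fun k _ => norm_sub_int_pos hz k)
    (Finset.prod_pos fun k _ => norm_sub_int_pos hz k)

lemma ratio_inv (A B : Finset ℤ) (z : ℂ) : (ratio A B z)⁻¹ = ratio B A z := inv_div _ _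

lemma log_ratio_div {A B : Finset ℤ} {z z₀ : ℂ} (hz : z.im ≠ 0) (hz₀ : z₀.im ≠ 0) :
    2 * Real.log (ratio A B z / ratio A B z₀) =
      ∑ k ∈ A, Real.log (Complex.normSq (z - k) / Complex.normSq (z₀ - k)) -
        ∑ k ∈ B, Real.log (Complex.normSq (z - k) / Complex.normSq (z₀ - k)) := by
  have h1 := norm_sub_int_pos hz
  have h2 := norm_sub_int_pos hz₀
  have aux : ∀ S : Finset ℤ, ∑ k ∈ S, Real.log (Complex.normSq (z - k) /
      Complex.normSq (z₀ - k)) =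
      2 * Real.log (∏ k ∈ S, ‖z - k‖) - 2 * Real.log (∏ k ∈ S, ‖z₀ - k‖) := by
    intro S
    rw [Real.log_prod (fun k _ => (h1 k).ne'), Real.log_prod (fun k _ => (h2 k).ne'),
      Finset.mul_sum, Finset.mul_sum, ← Finset.sum_sub_distrib]
    refine Finset.sum_congr rfl fun k _ => ?_
    rw [Complex.normSq_eq_norm_sq, Complex.normSq_eq_norm_sq,
      Real.log_div (pow_pos (h1 k) 2).ne' (pow_pos (h2 k) 2).ne', Real.log_pow, Real.log_pow]
    push_cast; ring
  have hp : ∀ S : Finset ℤ, (∏ k ∈ S, ‖z - k‖) ≠ 0 := fun S =>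
    (Finset.prod_pos fun k _ => h1 k).ne'
  have hp₀ : ∀ S : Finset ℤ, (∏ k ∈ S, ‖z₀ - k‖) ≠ 0 := fun S =>
    (Finset.prod_pos fun k _ => h2 k).ne'
  rw [aux, aux, Real.log_div (ratio_pos hz).ne' (ratio_pos hz₀).ne', ratio, ratio,
    Real.log_div (hp A) (hp B), Real.log_div (hp₀ A) (hp₀ B)]
  ring

lemma normSq_scale (N : ℝ) (hN : N ≠ 0) (z : ℂ) (k : ℤ) :
    Complex.normSq (N * z - k) = N ^ 2 * Complex.normSq (z - (k / N : ℝ)) := by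
  have : (N : ℂ) * z - k = N * (z - (k / N : ℝ)) := by
    push_cast
    have : (N : ℂ) ≠ 0 := by exact_mod_cast hN
    field_simp
  rw [this, Complex.normSq_mul, Complex.normSq_ofReal]
  ring

lemma sum_inv_normSq_eq {A B : Finset ℤ} {τ : ℂ} {N : ℝ} (hN : 0 < N) (hτ : 0 < τ.im)
    (hcrit : ∑ k ∈ A, 1 / ((N : ℂ) * τ - k) = ∑ k ∈ B, 1 / ((N : ℂ) * τ - k)) :
    ∑ k ∈ A, 1 / Complex.normSq (τ - (k / N : ℝ)) =
        ∑ k ∈ B, 1 / Complex.normSq (τ - (k / N : ℝ)) ∧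
      ∑ k ∈ A, (k / N) / Complex.normSq (τ - (k / N : ℝ)) =
        ∑ k ∈ B, (k / N) / Complex.normSq (τ - (k / N : ℝ)) := by
  have hre : ∀ k : ℤ, (1 / ((N : ℂ) * τ - k)).re =
      (1 / N) * ((τ.re - k / N) / Complex.normSq (τ - (k / N : ℝ))) := by
    intro k
    have h0 := (normSq_sub_pos hτ (k / N)).ne'
    rw [one_div, Complex.inv_re, normSq_scale N hN.ne']
    simp
    field_simp
  have him : ∀ k : ℤ, (1 / ((N : ℂ) * τ - k)).im =
      (-τ.im / N) * (1 / Complex.normSq (τ - (k / N : ℝ))) := by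
    intro k
    have h0 := (normSq_sub_pos hτ (k / N)).ne'
    rw [one_div, Complex.inv_im, normSq_scale N hN.ne']
    simp
    field_simp
  have h1 := congrArg Complex.im hcrit
  have h2 := congrArg Complex.re hcrit
  rw [Complex.im_sum, Complex.im_sum] at h1
  rw [Complex.re_sum, Complex.re_sum] at h2
  simp only [him, hre, ← Finset.mul_sum] at h1 h2
  have h3 := mul_left_cancel₀ (div_ne_zero (neg_ne_zero.2 hτ.ne') hN.ne') h1
  have h4 := mul_left_cancel₀ (one_div_ne_zero hN.ne') h2
  refine ⟨h3, ?_⟩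
  have h5 : ∀ S : Finset ℤ, ∑ k ∈ S, (τ.re - k / N) / Complex.normSq (τ - (k / N : ℝ)) =
      τ.re * ∑ k ∈ S, 1 / Complex.normSq (τ - (k / N : ℝ)) -
        ∑ k ∈ S, (k / N) / Complex.normSq (τ - (k / N : ℝ)) := by
    intro S
    rw [Finset.mul_sum, ← Finset.sum_sub_distrib]
    refine Finset.sum_congr rfl fun k _ => ?_
    ring
  rw [h5, h5, h3] at h4
  linarith

lemma log_ratio_curve {A B : Finset ℤ} {τ : ℂ} {a b e₁ e₂ v N : ℝ} (hN : 0 < N)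
    (hab : a < b) (hτ : 0 < τ.im)
    (hcrit : ∑ k ∈ A, 1 / ((N : ℂ) * τ - k) = ∑ k ∈ B, 1 / ((N : ℂ) * τ - k))
    (hY : 0 < curveImSq τ a b e₁ e₂ v) :
    2 * Real.log (ratio A B (N * curve τ a b e₁ e₂ v) / ratio A B (N * τ)) =
      ∑ k ∈ A, levelFn τ a b e₁ e₂ (k / N) v - ∑ k ∈ B, levelFn τ a b e₁ e₂ (k / N) v := by
  have hz : ((N : ℂ) * curve τ a b e₁ e₂ v).im ≠ 0 := by
    rw [Complex.im_ofReal_mul, curve_im]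
    exact (mul_pos hN (Real.sqrt_pos.2 hY)).ne'
  have hz₀ : ((N : ℂ) * τ).im ≠ 0 := by
    rw [Complex.im_ofReal_mul]; exact (mul_pos hN hτ).ne'
  rw [log_ratio_div hz hz₀]
  obtain ⟨h1, h2⟩ := sum_inv_normSq_eq hN hτ hcrit
  set α := (b * (Complex.normSq (τ - a) * Real.log (sqd τ a e₁ v / Complex.normSq (τ - a))) -
    a * (Complex.normSq (τ - b) * Real.log (sqd τ b e₂ v / Complex.normSq (τ - b)))) / (b - a)
  set β := (-(Complex.normSq (τ - a) * Real.log (sqd τ a e₁ v / Complex.normSq (τ - a))) +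
    Complex.normSq (τ - b) * Real.log (sqd τ b e₂ v / Complex.normSq (τ - b))) / (b - a)
  have hlin : ∀ s, linPart τ a b e₁ e₂ v s = α + β * s := by
    intro s
    have : b - a ≠ 0 := (sub_pos.2 hab).ne'
    simp only [linPart, α, β]
    field_simp
    ring
  have hS : ∀ S : Finset ℤ, ∑ k ∈ S, Real.log (Complex.normSq (N * curve τ a b e₁ e₂ v - k) /
      Complex.normSq (N * τ - k)) = ∑ k ∈ S, levelFn τ a b e₁ e₂ (k / N) v +
      (α * ∑ k ∈ S, 1 / Complex.normSq (τ - (k / N : ℝ)) +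
        β * ∑ k ∈ S, (k / N) / Complex.normSq (τ - (k / N : ℝ))) := by
    intro S
    rw [Finset.mul_sum, Finset.mul_sum, ← Finset.sum_add_distrib, ← Finset.sum_add_distrib]
    refine Finset.sum_congr rfl fun k _ => ?_
    rw [normSq_scale N hN.ne', normSq_scale N hN.ne', levelFn, hlin,
      mul_div_mul_left _ _ (pow_ne_zero 2 hN.ne')]
    ring
  rw [hS, hS, h1, h2]
  ring

/-- Decay (or growth) of the ratio along level curves. -/
lemma log_ratio_curve_le {A B G : Finset ℤ} {K : ℝ} {τ : ℂ} {a b e₁ e₂ v N η d m : ℝ} (hN : 0 < N)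
    (hg : Geo K τ a b) (he₁ : e₁ = 1 ∨ e₁ = -1) (he₂ : e₂ = 1 ∨ e₂ = -1)
    (hcrit : ∑ k ∈ A, 1 / ((N : ℂ) * τ - k) = ∑ k ∈ B, 1 / ((N : ℂ) * τ - k))
    (hv : 0 ≤ v) (hY : ∀ u ∈ Icc 0 v, 0 < curveImSq τ a b e₁ e₂ u)
    (hA : ∀ k ∈ A, ((k : ℝ) / N - a) * (k / N - b) ≤ 0)
    (hB : ∀ k ∈ B, 0 ≤ ((k : ℝ) / N - a) * (k / N - b))
    (hGB : G ⊆ B) (hG : ∀ k ∈ G, η ≤ ((k : ℝ) / N - a) * (k / N - b)) (hη : 0 ≤ η)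
    (hd : 0 < d) (hdG : ∀ k ∈ G, ∀ u ∈ Icc 0 v,
      Complex.normSq (curve τ a b e₁ e₂ u - (k / N : ℝ)) ≤ d) (hm : m * N ≤ G.card) :
    e₁ * e₂ * Real.log (ratio A B (N * curve τ a b e₁ e₂ v) / ratio A B (N * τ)) ≤
      -(m * η / (16 * K ^ 4 * d ^ 2)) * (N * v) := by
  have hK := hg.one_le
  have hab := hg.lt
  have hτ := hg.im_pos
  have h1 := log_ratio_curve hN hab hτ hcrit (hY v ⟨hv, le_rfl⟩)
  have hb := levelFn_bounds hab hτ he₁ he₂ hv hY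
  have hrate : 1 / (8 * K ^ 4) ≤ rate τ a b := by
    have h2 : (1 / K) ^ 2 ≤ τ.im ^ 2 := pow_le_pow_left₀ (by positivity) hg.im 2
    have h3 := hg.normSq_left
    have h4 := hg.normSq_right
    have h5 := normSq_sub_pos hτ a
    have h6 := normSq_sub_pos hτ b
    unfold rate
    calc 1 / (8 * K ^ 4) = (1 / K) ^ 2 / (8 * K ^ 2) := by field_simp
      _ ≤ τ.im ^ 2 / (8 * K ^ 2) := by gcongr
      _ ≤ _ := by gcongr; linarith
  have hr0 : 0 ≤ rate τ a b := le_trans (by positivity) hrate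
  have hSA : ∑ k ∈ A, e₁ * e₂ * levelFn τ a b e₁ e₂ (k / N) v ≤ 0 :=
    Finset.sum_nonpos fun k hk => (hb _).1 (hA k hk)
  have hBnn : ∀ k ∈ B, 0 ≤ e₁ * e₂ * levelFn τ a b e₁ e₂ (k / N) v := by
    intro k hk
    have hcont : ContinuousOn (fun u => Complex.normSq (curve τ a b e₁ e₂ u - (k / N : ℝ)))
        (Icc 0 v) :=
      (Complex.continuous_normSq.comp (continuous_curve.sub continuous_const)).continuousOn
    obtain ⟨C, hC⟩ := isCompact_Icc.exists_bound_of_continuousOn hcont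
    refine le_trans ?_ ((hb _).2 (max C 1) (by positivity) (fun u hu =>
      (le_abs_self _).trans ((hC u hu).trans (le_max_left _ _))) (hB k hk))
    have := hB k hk
    have h7 := Complex.normSq_nonneg (τ - (k / N : ℝ))
    have : 0 < max C 1 := by positivity
    positivity
  have hSG : m * N * (η / (8 * K ^ 4 * d ^ 2) * v) ≤
      ∑ k ∈ G, e₁ * e₂ * levelFn τ a b e₁ e₂ (k / N) v := by
    have h8 : ∀ k ∈ G, η / (8 * K ^ 4 * d ^ 2) * v ≤
        e₁ * e₂ * levelFn τ a b e₁ e₂ (k / N) v := by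
      intro k hk
      refine le_trans ?_ ((hb _).2 d hd (hdG k hk) (hB k (hGB hk)))
      have h9 : Complex.normSq (τ - (k / N : ℝ)) ≤ d := by
        have := hdG k hk 0 ⟨le_rfl, hv⟩
        rwa [curve_zero hab hτ.le] at this
      have h10 := normSq_sub_pos hτ (k / N)
      refine mul_le_mul_of_nonneg_right ?_ hv
      calc η / (8 * K ^ 4 * d ^ 2) = 1 / (8 * K ^ 4) * η / (d * d) := by field_simp
        _ ≤ rate τ a b * ((k / N - a) * (k / N - b)) / (d * Complex.normSq (τ - (k / N : ℝ))) := by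
          have := hG k hk
          gcongr
          exact mul_nonneg hr0 (hB k (hGB hk))
    have h11 := Finset.card_nsmul_le_sum G _ _ h8
    rw [nsmul_eq_mul] at h11
    exact (mul_le_mul_of_nonneg_right hm (by positivity)).trans h11
  have hSB : ∑ k ∈ G, e₁ * e₂ * levelFn τ a b e₁ e₂ (k / N) v ≤
      ∑ k ∈ B, e₁ * e₂ * levelFn τ a b e₁ e₂ (k / N) v :=
    Finset.sum_le_sum_of_subset_of_nonneg hGB fun k hk _ => hBnn k hk
  rw [← Finset.mul_sum] at hSA
  rw [← Finset.mul_sum, ← Finset.mul_sum] at hSB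
  have h12 : -(m * η / (16 * K ^ 4 * d ^ 2)) * (N * v) =
      -(m * N * (η / (8 * K ^ 4 * d ^ 2) * v)) / 2 := by
    field_simp; ring
  rw [h12]
  have h13 : e₁ * e₂ * Real.log (ratio A B (N * curve τ a b e₁ e₂ v) / ratio A B (N * τ)) =
      (e₁ * e₂ * ∑ k ∈ A, levelFn τ a b e₁ e₂ (k / N) v -
        e₁ * e₂ * ∑ k ∈ B, levelFn τ a b e₁ e₂ (k / N) v) / 2 := by
    linear_combination (e₁ * e₂ / 2) * h1
  rw [h13]
  have h14 : m * N * (η / (8 * K ^ 4 * d ^ 2) * v) ≤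
      e₁ * e₂ * ∑ k ∈ B, levelFn τ a b e₁ e₂ (k / N) v := by
    refine le_trans hSG ?_
    rw [← Finset.mul_sum]; exact hSB
  linarith

/-- The ratio changes little on descending from height `h` to the real axis. -/
lemma ratio_tail_le {A B : Finset ℤ} {z z₀ : ℂ} {h c : ℝ} (hre : |z.re - z₀.re| ≤ 1 / 2)
    (him0 : 0 ≤ z.im) (him : z.im ≤ h) (hz₀ : z₀.im = h) (h1 : 1 ≤ h) (hc : 1 ≤ c)
    (hB : ∀ k ∈ B, c ≤ |z.re - k|) :
    ratio A B z ≤ Real.exp (A.card / h + B.card * (2 / c + h ^ 2 / c ^ 2)) * ratio A B z₀ := by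
  have hn : ∀ (w : ℂ) (k : ℤ), ‖w - k‖ ^ 2 = (w.re - k) ^ 2 + w.im ^ 2 := by
    intro w k
    rw [← Complex.normSq_eq_norm_sq, Complex.normSq_apply]; simp; ring
  have hA1 : ∀ k ∈ A, ‖z - k‖ ≤ Real.exp (1 / h) * ‖z₀ - k‖ := by
    intro k _
    refine le_of_sq_le_sq ?_ (by positivity)
    rw [mul_pow, hn, hn, hz₀]
    have h2 : 1 + 1 / h ≤ Real.exp (1 / h) ^ 2 := by
      have h3 := Real.add_one_le_exp (1 / h)
      have h4 : 0 < 1 / h := by positivity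
      nlinarith
    have h5 : (z.re - k) ^ 2 + z.im ^ 2 ≤ (1 + 1 / h) * ((z₀.re - k) ^ 2 + h ^ 2) := by
      have h6 := abs_le.1 hre
      have h7 : 1 / h * ((z₀.re - k) ^ 2 + h ^ 2) = (z₀.re - k) ^ 2 / h + h := by field_simp
      have h8 : |z₀.re - k| + 1 / 4 ≤ (z₀.re - k) ^ 2 / h + h := by
        have h9 : 0 ≤ (|z₀.re - k| - h / 2) ^ 2 / h := by positivity
        have h10 : (|z₀.re - k| - h / 2) ^ 2 / h =
            (z₀.re - k) ^ 2 / h - |z₀.re - k| + h / 4 := by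
          rw [← sq_abs (z₀.re - k)]; field_simp; ring
        linarith
      have h11 : (z.re - k) ^ 2 ≤ (|z₀.re - k| + 1 / 2) ^ 2 := by
        rw [← sq_abs (z.re - k)]
        refine pow_le_pow_left₀ (abs_nonneg _) ?_ 2
        have := abs_add_le (z.re - z₀.re) (z₀.re - k)
        rw [sub_add_sub_cancel] at this
        linarith
      rw [add_mul, h7, one_mul]
      have := sq_abs (z₀.re - k)
      nlinarith
    exact h5.trans (by gcongr)
  have hB1 : ∀ k ∈ B, ‖z₀ - k‖ ≤ Real.exp (2 / c + h ^ 2 / c ^ 2) * ‖z - k‖ := by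
    intro k hk
    have hck := hB k hk
    refine le_of_sq_le_sq ?_ (by positivity)
    rw [mul_pow, hn, hn, hz₀]
    set w := |z.re - k| with hw
    have hw2 : (z.re - k) ^ 2 = w ^ 2 := (sq_abs _).symm
    have h2 : 1 + (2 / c + h ^ 2 / c ^ 2) ≤ Real.exp (2 / c + h ^ 2 / c ^ 2) ^ 2 := by
      have h3 := Real.add_one_le_exp (2 / c + h ^ 2 / c ^ 2)
      have h4 : 0 < 2 / c + h ^ 2 / c ^ 2 := by positivity
      nlinarith
    have h11 : (z₀.re - k) ^ 2 ≤ (w + 1 / 2) ^ 2 := by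
      rw [← sq_abs (z₀.re - k)]
      refine pow_le_pow_left₀ (abs_nonneg _) ?_ 2
      have := abs_add_le (z₀.re - z.re) (z.re - k)
      rw [sub_add_sub_cancel, abs_sub_comm z₀.re z.re] at this
      linarith
    have h12 : w + 1 / 4 ≤ 2 / c * w ^ 2 := by
      rw [div_mul_eq_mul_div, le_div_iff₀ (by linarith)]
      nlinarith
    have h13 : h ^ 2 ≤ h ^ 2 / c ^ 2 * w ^ 2 := by
      rw [div_mul_eq_mul_div, le_div_iff₀ (by positivity)]
      gcongr
    calc (z₀.re - k) ^ 2 + h ^ 2 ≤ (1 + (2 / c + h ^ 2 / c ^ 2)) * w ^ 2 := by nlinarith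
      _ ≤ Real.exp (2 / c + h ^ 2 / c ^ 2) ^ 2 * w ^ 2 := by gcongr
      _ ≤ Real.exp (2 / c + h ^ 2 / c ^ 2) ^ 2 * ((z.re - k) ^ 2 + z.im ^ 2) := by
        rw [hw2]; gcongr; nlinarith
  have hz0im : z₀.im ≠ 0 := by rw [hz₀]; linarith
  have hPA : ∏ k ∈ A, ‖z - k‖ ≤ Real.exp (1 / h) ^ A.card * ∏ k ∈ A, ‖z₀ - k‖ := by
    rw [← Finset.prod_const, ← Finset.prod_mul_distrib]
    exact Finset.prod_le_prod (fun k _ => norm_nonneg _) hA1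
  have hPB : ∏ k ∈ B, ‖z₀ - k‖ ≤
      Real.exp (2 / c + h ^ 2 / c ^ 2) ^ B.card * ∏ k ∈ B, ‖z - k‖ := by
    rw [← Finset.prod_const, ← Finset.prod_mul_distrib]
    exact Finset.prod_le_prod (fun k _ => norm_nonneg _) hB1
  have hB0 : 0 < ∏ k ∈ B, ‖z₀ - k‖ := Finset.prod_pos fun k _ => norm_sub_int_pos hz0im k
  have hBz : 0 < ∏ k ∈ B, ‖z - k‖ := by
    refine Finset.prod_pos fun k hk => ?_
    have h3 := hB k hk
    have h4 := Complex.abs_re_le_norm (z - k)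
    simp only [Complex.sub_re, Complex.intCast_re] at h4
    linarith
  have hexp : Real.exp (A.card / h + B.card * (2 / c + h ^ 2 / c ^ 2)) =
      Real.exp (1 / h) ^ A.card * Real.exp (2 / c + h ^ 2 / c ^ 2) ^ B.card := by
    rw [← Real.exp_nat_mul, ← Real.exp_nat_mul, ← Real.exp_add]
    congr 1; ring
  rw [hexp, ratio, ratio, div_le_iff₀ hBz]
  calc ∏ k ∈ A, ‖z - k‖ ≤ Real.exp (1 / h) ^ A.card * ∏ k ∈ A, ‖z₀ - k‖ := hPA
    _ = Real.exp (1 / h) ^ A.card * ((∏ k ∈ A, ‖z₀ - k‖) / ∏ k ∈ B, ‖z₀ - k‖) *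
        ∏ k ∈ B, ‖z₀ - k‖ := by field_simp
    _ ≤ Real.exp (1 / h) ^ A.card * ((∏ k ∈ A, ‖z₀ - k‖) / ∏ k ∈ B, ‖z₀ - k‖) *
        (Real.exp (2 / c + h ^ 2 / c ^ 2) ^ B.card * ∏ k ∈ B, ‖z - k‖) := by gcongr
    _ = _ := by ring

/-- Decay of the ratio along vertical rays. -/
lemma ratio_ray_le {A B G : Finset ℤ} {z z₀ : ℂ} {y η m : ℝ} (hre : z.re = z₀.re)
    (hy : 0 < z₀.im) (hz : z.im = y * z₀.im) (hy1 : 1 ≤ y)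
    (hGB : G ⊆ B) (hG : ∀ k ∈ G, |z₀.re - k| ≤ η * z₀.im)
    (hm : A.card - (1 - η ^ 2) * G.card ≤ -m) :
    ratio A B z ≤ y ^ (-m) * ratio A B z₀ := by
  have hn : ∀ (w : ℂ) (k : ℤ), ‖w - k‖ ^ 2 = (w.re - k) ^ 2 + w.im ^ 2 := by
    intro w k
    rw [← Complex.normSq_eq_norm_sq, Complex.normSq_apply]; simp; ring
  have hy0 : 0 < y := by linarith
  have hzim : z.im ≠ 0 := by rw [hz]; positivity
  have hA1 : ∀ k ∈ A, ‖z - k‖ ≤ y * ‖z₀ - k‖ := by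
    intro k _
    refine le_of_sq_le_sq ?_ (by positivity)
    rw [mul_pow, hn, hn, hre, hz]
    nlinarith [sq_nonneg (z₀.re - k), mul_le_mul hy1 hy1 zero_le_one hy0.le]
  have hB1 : ∀ k : ℤ, ‖z₀ - k‖ ≤ ‖z - k‖ := by
    intro k
    refine le_of_sq_le_sq ?_ (by positivity)
    rw [hn, hn, hre, hz]
    nlinarith [sq_nonneg z₀.im, mul_le_mul hy1 hy1 zero_le_one hy0.le]
  have hG1 : ∀ k ∈ G, y ^ (1 - η ^ 2) * ‖z₀ - k‖ ≤ ‖z - k‖ := by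
    intro k hk
    refine le_of_sq_le_sq ?_ (by positivity)
    have hX : (z₀.re - k) ^ 2 ≤ η ^ 2 * z₀.im ^ 2 := by
      rw [← sq_abs, ← mul_pow]
      exact pow_le_pow_left₀ (abs_nonneg _) (hG k hk) 2
    rw [mul_pow, hn, hn, hre, hz]
    set X := (z₀.re - k) ^ 2
    have hX0 : 0 ≤ X := sq_nonneg _
    have hY0 : 0 < z₀.im ^ 2 := by positivity
    set ℓ := z₀.im ^ 2 / (X + z₀.im ^ 2) with hℓ
    have hℓ1 : 1 - η ^ 2 ≤ ℓ := by
      rw [hℓ, le_div_iff₀ (by positivity)]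
      nlinarith [sq_nonneg η, mul_nonneg (sq_nonneg η) hX0]
    have hℓ0 : 0 ≤ ℓ := by positivity
    have hℓ2 : ℓ ≤ 1 := by rw [hℓ, div_le_one (by positivity)]; linarith
    have h1 := Real.geom_mean_le_arith_mean2_weighted (w₁ := 1 - ℓ) (w₂ := ℓ) (p₁ := 1)
      (p₂ := y ^ 2) (by linarith) hℓ0 zero_le_one (sq_nonneg y) (by ring)
    rw [Real.one_rpow, one_mul, mul_one] at h1
    have h2 : (y ^ (1 - η ^ 2)) ^ 2 ≤ (y ^ 2) ^ ℓ := by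
      rw [← Real.rpow_natCast (y ^ (1 - η ^ 2)), ← Real.rpow_mul hy0.le,
        ← Real.rpow_natCast y 2, ← Real.rpow_mul hy0.le]
      refine Real.rpow_le_rpow_of_exponent_le hy1 ?_
      push_cast; linarith
    calc (y ^ (1 - η ^ 2)) ^ 2 * (X + z₀.im ^ 2) ≤ (1 - ℓ + ℓ * y ^ 2) * (X + z₀.im ^ 2) := by
          gcongr; exact h2.trans h1
      _ = X + (y * z₀.im) ^ 2 := by rw [hℓ]; field_simp; ring
  have hPA : ∏ k ∈ A, ‖z - k‖ ≤ y ^ A.card * ∏ k ∈ A, ‖z₀ - k‖ := by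
    rw [← Finset.prod_const, ← Finset.prod_mul_distrib]
    exact Finset.prod_le_prod (fun k _ => norm_nonneg _) hA1
  have hPG : (y ^ (1 - η ^ 2)) ^ G.card * ∏ k ∈ G, ‖z₀ - k‖ ≤ ∏ k ∈ G, ‖z - k‖ := by
    rw [← Finset.prod_const, ← Finset.prod_mul_distrib]
    exact Finset.prod_le_prod (fun k _ => by positivity) hG1
  have hPB : (y ^ (1 - η ^ 2)) ^ G.card * ∏ k ∈ B, ‖z₀ - k‖ ≤ ∏ k ∈ B, ‖z - k‖ := by
    rw [← Finset.prod_sdiff hGB, ← Finset.prod_sdiff hGB, mul_left_comm]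
    exact mul_le_mul (Finset.prod_le_prod (fun k _ => norm_nonneg _) fun k _ => hB1 k) hPG
      (by positivity) (by positivity)
  have hB0 : 0 < ∏ k ∈ B, ‖z₀ - k‖ := Finset.prod_pos fun k _ => norm_sub_int_pos hy.ne' k
  have hpow : y ^ A.card ≤ y ^ (-m) * (y ^ (1 - η ^ 2)) ^ G.card := by
    rw [← Real.rpow_natCast y, ← Real.rpow_natCast (y ^ _), ← Real.rpow_mul hy0.le,
      ← Real.rpow_add hy0]
    exact Real.rpow_le_rpow_of_exponent_le hy1 (by linarith)
  have hBz : 0 < ∏ k ∈ B, ‖z - k‖ := Finset.prod_pos fun k _ => norm_sub_int_pos hzim k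
  rw [ratio, ratio, div_le_iff₀ hBz]
  calc ∏ k ∈ A, ‖z - k‖ ≤ y ^ A.card * ∏ k ∈ A, ‖z₀ - k‖ := hPA
    _ ≤ (y ^ (-m) * (y ^ (1 - η ^ 2)) ^ G.card) * ∏ k ∈ A, ‖z₀ - k‖ := by gcongr
    _ = y ^ (-m) * ((∏ k ∈ A, ‖z₀ - k‖) / ∏ k ∈ B, ‖z₀ - k‖) *
        ((y ^ (1 - η ^ 2)) ^ G.card * ∏ k ∈ B, ‖z₀ - k‖) := by field_simp
    _ ≤ _ := by gcongr

end GTBulk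

end

noncomputable section

namespace GTBulk

open Set
open scoped BigOperators

/-- Scaled positions beyond this bound are taken by few entries of the top row. -/
def cutoff (D : ℝ) : ℝ := Real.exp (4 * D ^ 2 + 1)

lemma card_filter_cutoff_le {D : ℝ} (hD : 1 < D) {N : ℕ} (hN : 0 < N) {t : TopRow N}
    (ht : StrictAnti t)
    (hlog : ∑ i : Fin N, Real.log (1 + |(t i : ℝ)| / (N : ℝ)) ^ (1 + 1 / D) < D * (N : ℝ)) :
    (((rowSet t).filter fun k : ℤ => cutoff D * N < |(k : ℝ)|).card : ℝ) ≤ N / (4 * D) := by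
  have hN' : (0 : ℝ) < N := by exact_mod_cast hN
  have hinj : Function.Injective t := ht.injective
  have hsum : ∑ i : Fin N, Real.log (1 + |(t i : ℝ)| / (N : ℝ)) ^ (1 + 1 / D) =
      ∑ k ∈ rowSet t, Real.log (1 + |(k : ℝ)| / (N : ℝ)) ^ (1 + 1 / D) := by
    unfold rowSet
    rw [Finset.sum_image (fun i _ j _ h => hinj h)]
  rw [hsum] at hlog
  have hnn : ∀ k : ℤ, 0 ≤ Real.log (1 + |(k : ℝ)| / (N : ℝ)) := fun k =>
    Real.log_nonneg (by have := abs_nonneg (k : ℝ); have : 0 ≤ |(k : ℝ)| / N := by positivity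
                        linarith)
  have h1 : ∀ k ∈ (rowSet t).filter fun k : ℤ => cutoff D * N < |(k : ℝ)|,
      4 * D ^ 2 ≤ Real.log (1 + |(k : ℝ)| / (N : ℝ)) ^ (1 + 1 / D) := by
    intro k hk
    rw [Finset.mem_filter] at hk
    have h2 : cutoff D ≤ 1 + |(k : ℝ)| / N := by
      have := (lt_div_iff₀ hN').2 hk.2
      linarith
    have h3 : 4 * D ^ 2 + 1 ≤ Real.log (1 + |(k : ℝ)| / N) := by
      rw [Real.le_log_iff_exp_le (by have := Real.exp_pos (4 * D ^ 2 + 1); unfold cutoff at h2; linarith)]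
      exact h2
    have h4 : 1 ≤ Real.log (1 + |(k : ℝ)| / N) := by nlinarith
    have h5 := Real.rpow_le_rpow_of_exponent_le h4
      (by have : 0 < 1 / D := by positivity
          linarith : (1 : ℝ) ≤ 1 + 1 / D)
    rw [Real.rpow_one] at h5
    linarith
  have h2 := Finset.card_nsmul_le_sum _ _ _ h1
  have h3 := Finset.sum_le_sum_of_subset_of_nonneg (Finset.filter_subset
    (fun k : ℤ => cutoff D * N < |(k : ℝ)|) (rowSet t))
    (f := fun k : ℤ => Real.log (1 + |(k : ℝ)| / (N : ℝ)) ^ (1 + 1 / D))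
    (fun k _ _ => Real.rpow_nonneg (hnn k) _)
  rw [nsmul_eq_mul] at h2
  rw [le_div_iff₀ (by linarith)]
  have h4 := (h2.trans h3).trans hlog.le
  have hD0 : 0 < D := by linarith
  refine le_of_mul_le_mul_right ?_ hD0
  nlinarith

/-- The roots of the numerator polynomial: `x - M, …, x - 1`. -/
def block (x : ℤ) (M : ℕ) : Finset ℤ := pochRoots (x - 1) M

lemma card_block (x : ℤ) (M : ℕ) : (block x M).card = M := by
  simp [block, pochRoots]

lemma mem_block {x : ℤ} {M : ℕ} {k : ℤ} : k ∈ block x M ↔ x - M ≤ k ∧ k ≤ x - 1 := by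
  simp only [block, pochRoots, Finset.mem_Ioc]; omega

/-- Left end of the scaled block. -/
def blockL (N : ℕ) (x : ℤ) (M : ℕ) : ℝ := (x - M - 1 / 2) / N

/-- Right end of the scaled block. -/
def blockR (N : ℕ) (x : ℤ) : ℝ := (x - 1 / 2) / N

/-- The hypotheses of the theorem in scaled form. -/
structure Bulk (D : ℝ) (N : ℕ) (T : Finset ℤ) (x : ℤ) (M : ℕ) (σ : ℂ) : Prop where
  one_lt : 1 < D
  large : 32 * D ≤ N
  card : T.card = N
  few : ((T.filter fun k : ℤ => cutoff D * N < |(k : ℝ)|).card : ℝ) ≤ N / (4 * D)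
  le : (M : ℝ) ≤ N - N / D
  crit : ∑ k ∈ block x M, 1 / ((N : ℂ) * σ - k) = ∑ k ∈ T, 1 / ((N : ℂ) * σ - k)
  im : 1 / D < σ.im
  norm : ‖σ‖ < D

/-- The geometric bound corresponding to `D`. -/
def geoK (D : ℝ) : ℝ := 2 * D ^ 2 * (D + cutoff D) ^ 2 + 3 * (D + cutoff D) + 5

namespace Bulk

variable {D : ℝ} {N : ℕ} {T : Finset ℤ} {x : ℤ} {M : ℕ} {σ : ℂ}

lemma N_pos (h : Bulk D N T x M σ) : (0 : ℝ) < N := by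
  have := h.large; have := h.one_lt; linarith

lemma im_pos (h : Bulk D N T x M σ) : 0 < σ.im := by
  have h1 : 0 < 1 / D := by have := h.one_lt; positivity
  exact h1.trans h.im

lemma crit_sdiff (h : Bulk D N T x M σ) :
    ∑ k ∈ block x M \ T, 1 / ((N : ℂ) * σ - k) = ∑ k ∈ T \ block x M, 1 / ((N : ℂ) * σ - k) := by
  have h1 := h.crit
  rw [← Finset.sum_inter_add_sum_sdiff (block x M) T, ← Finset.sum_inter_add_sum_sdiff T (block x M),
    Finset.inter_comm T] at h1
  exact add_left_cancel h1

lemma cutoff_pos (D : ℝ) : 0 < cutoff D := Real.exp_pos _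

lemma card_filter_le_cutoff (h : Bulk D N T x M σ) :
    (N : ℝ) - N / (4 * D) ≤ ((T.filter fun k : ℤ => |(k : ℝ)| ≤ cutoff D * N).card : ℝ) := by
  have h1 := Finset.card_filter_add_card_filter_not (s := T) (fun k : ℤ => |(k : ℝ)| ≤ cutoff D * N)
  simp only [not_le] at h1
  rw [h.card] at h1
  have h2 := congrArg (Nat.cast : ℕ → ℝ) h1
  have := h.few
  push_cast at h2
  linarith

/-- A lower bound for the common value of the two sums of inverse squared distances. -/
lemma sum_lower (h : Bulk D N T x M σ) :
    1 / (2 * (D + cutoff D) ^ 2) * N ≤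
      ∑ k ∈ block x M, 1 / Complex.normSq (σ - (k / N : ℝ)) := by
  have hD := h.one_lt
  have hN := h.N_pos
  have hc := cutoff_pos D
  rw [(sum_inv_normSq_eq (N := (N : ℝ)) hN h.im_pos (by exact_mod_cast h.crit)).1]
  have hnn : ∀ k : ℤ, 0 ≤ 1 / Complex.normSq (σ - (k / N : ℝ)) := fun k => by
    have := Complex.normSq_nonneg (σ - (k / N : ℝ)); positivity
  have h1 : ∀ k ∈ T.filter (fun k : ℤ => |(k : ℝ)| ≤ cutoff D * N), 1 / (D + cutoff D) ^ 2 ≤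
      1 / Complex.normSq (σ - (k / N : ℝ)) := by
    intro k hk
    rw [Finset.mem_filter] at hk
    refine one_div_le_one_div_of_le (normSq_sub_pos h.im_pos _) ?_
    rw [Complex.normSq_eq_norm_sq]
    refine pow_le_pow_left₀ (norm_nonneg _) ?_ 2
    refine (norm_sub_le _ _).trans (add_le_add h.norm.le ?_)
    rw [Complex.norm_real, Real.norm_eq_abs, abs_div, abs_of_pos hN, div_le_iff₀ hN]
    exact hk.2
  have h2 := Finset.card_nsmul_le_sum _ _ _ h1
  rw [nsmul_eq_mul] at h2
  refine le_trans ?_ (h2.trans (Finset.sum_le_sum_of_subset_of_nonneg (Finset.filter_subset _ _)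
    fun k _ _ => hnn k))
  have h3 := h.card_filter_le_cutoff
  have h4 : (N : ℝ) / (4 * D) ≤ N / 2 := by
    gcongr; linarith
  calc 1 / (2 * (D + cutoff D) ^ 2) * N = (N / 2) * (1 / (D + cutoff D) ^ 2) := by
        field_simp
    _ ≤ _ := by gcongr; linarith

lemma le_M (h : Bulk D N T x M σ) : 1 / (2 * D ^ 2 * (D + cutoff D) ^ 2) * N ≤ M := by
  have hD := h.one_lt
  have hc := cutoff_pos D
  have h1 : ∀ k ∈ block x M, 1 / Complex.normSq (σ - (k / N : ℝ)) ≤ D ^ 2 := by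
    intro k _
    rw [div_le_iff₀ (normSq_sub_pos h.im_pos _), Complex.normSq_apply]
    simp only [Complex.sub_re, Complex.ofReal_re, Complex.sub_im, Complex.ofReal_im, sub_zero]
    have h2 : 1 < D * σ.im := by
      have := h.im
      rw [div_lt_iff₀ (by linarith)] at this; linarith
    nlinarith [mul_nonneg (sq_nonneg D) (mul_self_nonneg (σ.re - k / N)), h.im_pos]
  have h2 := Finset.sum_le_card_nsmul _ _ _ h1
  rw [nsmul_eq_mul, card_block] at h2
  have h3 := h.sum_lower.trans h2
  calc 1 / (2 * D ^ 2 * (D + cutoff D) ^ 2) * N = (1 / (2 * (D + cutoff D) ^ 2) * N) / D ^ 2 := by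
        field_simp
    _ ≤ _ := by rw [div_le_iff₀ (by positivity)]; exact h3

lemma abs_x_le (h : Bulk D N T x M σ) : |(x : ℝ)| ≤ (3 * (D + cutoff D) + 1) * N + 1 := by
  have hD := h.one_lt
  have hN := h.N_pos
  have hc := cutoff_pos D
  have hMN : (M : ℝ) ≤ N := by
    have : 0 ≤ (N : ℝ) / D := by positivity
    linarith [h.le]
  obtain ⟨k, hk, hk2⟩ : ∃ k ∈ block x M, Complex.normSq (σ - (k / N : ℝ)) ≤
      (2 * (D + cutoff D)) ^ 2 := by
    by_contra hcon
    push Not at hcon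
    have h1 : ∀ k ∈ block x M, 1 / Complex.normSq (σ - (k / N : ℝ)) ≤
        1 / (2 * (D + cutoff D)) ^ 2 := fun k hk =>
      one_div_le_one_div_of_le (by positivity) (hcon k hk).le
    have h2 := Finset.sum_le_card_nsmul _ _ _ h1
    rw [nsmul_eq_mul, card_block] at h2
    have h3 := h.sum_lower.trans h2
    have h4 : (M : ℝ) * (1 / (2 * (D + cutoff D)) ^ 2) ≤ N * (1 / (2 * (D + cutoff D)) ^ 2) := by
      gcongr
    have h5 : 1 / (2 * (D + cutoff D) ^ 2) * N = 2 * (N * (1 / (2 * (D + cutoff D)) ^ 2)) := by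
      field_simp
    have : 0 < N * (1 / (2 * (D + cutoff D)) ^ 2) := by positivity
    linarith
  have h1 : ‖σ - (k / N : ℝ)‖ ≤ 2 * (D + cutoff D) := by
    rw [Complex.normSq_eq_norm_sq] at hk2
    exact le_of_sq_le_sq hk2 (by positivity)
  have h2 : |(k : ℝ) / N| ≤ 3 * (D + cutoff D) := by
    have h3 := norm_sub_norm_le (((k / N : ℝ) : ℂ)) σ
    rw [norm_sub_rev, Complex.norm_real, Real.norm_eq_abs] at h3
    linarith [h.norm]
  rw [abs_div, abs_of_pos hN, div_le_iff₀ hN] at h2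
  rw [mem_block] at hk
  have h4 : (x : ℝ) - M ≤ k := by exact_mod_cast hk.1
  have h5 : (k : ℝ) ≤ x - 1 := by exact_mod_cast hk.2
  have h6 := abs_le.1 h2
  rw [abs_le]
  constructor <;> nlinarith

lemma len_eq (h : Bulk D N T x M σ) : blockR N x - blockL N x M = M / N := by
  have hN := h.N_pos
  unfold blockL blockR
  field_simp
  ring

lemma geo (h : Bulk D N T x M σ) : Geo (geoK D) σ (blockL N x M) (blockR N x) := by
  have hD := h.one_lt
  have hN := h.N_pos
  have hc := cutoff_pos D
  have hx := h.abs_x_le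
  have hN32 := h.large
  have hMN : (M : ℝ) ≤ N := by
    have : 0 ≤ (N : ℝ) / D := by positivity
    linarith [h.le]
  have hP : 0 ≤ 2 * D ^ 2 * (D + cutoff D) ^ 2 := by positivity
  have hKD : D ≤ geoK D := by unfold geoK; nlinarith
  have hK : geoK D = 2 * D ^ 2 * (D + cutoff D) ^ 2 + 3 * (D + cutoff D) + 5 := rfl
  have h6 := abs_le.1 hx
  refine ⟨by linarith, ?_, h.norm.le.trans hKD, ?_, ?_, ?_⟩
  · exact (one_div_le_one_div_of_le (by linarith) hKD).trans h.im.le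
  · rw [h.len_eq, le_div_iff₀ hN]
    refine le_trans ?_ h.le_M
    gcongr
    linarith
  · unfold blockL
    rw [abs_div, abs_of_pos hN, div_le_iff₀ hN, abs_le]
    constructor <;> nlinarith [Nat.cast_nonneg (α := ℝ) M]
  · unfold blockR
    rw [abs_div, abs_of_pos hN, div_le_iff₀ hN, abs_le]
    constructor <;> nlinarith

lemma sub_mul_sub (h : Bulk D N T x M σ) (k : ℤ) :
    ((k : ℝ) / N - blockL N x M) * (k / N - blockR N x) =
      ((k : ℝ) - (x - M - 1 / 2)) * (k - (x - 1 / 2)) / N ^ 2 := by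
  have hN := h.N_pos
  unfold blockL blockR
  field_simp

lemma sign_block (h : Bulk D N T x M σ) {k : ℤ} (hk : k ∈ block x M \ T) :
    ((k : ℝ) / N - blockL N x M) * (k / N - blockR N x) ≤ 0 := by
  rw [Finset.mem_sdiff, mem_block] at hk
  have h4 : (x : ℝ) - M ≤ k := by exact_mod_cast hk.1.1
  have h5 : (k : ℝ) ≤ x - 1 := by exact_mod_cast hk.1.2
  rw [h.sub_mul_sub]
  exact div_nonpos_of_nonpos_of_nonneg
    (mul_nonpos_of_nonneg_of_nonpos (by linarith) (by linarith)) (by positivity)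

lemma notMem_block {k : ℤ} (hk : k ∉ block x M) : (k : ℝ) ≤ x - M - 1 ∨ (x : ℝ) ≤ k := by
  rw [mem_block, not_and_or, not_le, not_le] at hk
  rcases hk with hk | hk
  · left
    have : k ≤ x - M - 1 := by omega
    exact_mod_cast this
  · right
    have : x ≤ k := by omega
    exact_mod_cast this

lemma sign_sdiff (h : Bulk D N T x M σ) {k : ℤ} (hk : k ∈ T \ block x M) :
    0 ≤ ((k : ℝ) / N - blockL N x M) * (k / N - blockR N x) := by
  rw [Finset.mem_sdiff] at hk
  have hM : (0 : ℝ) ≤ M := Nat.cast_nonneg M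
  rw [h.sub_mul_sub]
  refine div_nonneg ?_ (by positivity)
  rcases notMem_block hk.2 with h1 | h1
  · exact mul_nonneg_of_nonpos_of_nonpos (by linarith) (by linarith)
  · exact mul_nonneg (by linarith) (by linarith)

/-- The entries of the top row outside the block which are not too large. -/
def outer (T : Finset ℤ) (x : ℤ) (M : ℕ) (R : ℝ) : Finset ℤ :=
  (T \ block x M).filter fun k : ℤ => |(k : ℝ)| ≤ R

lemma card_outer (h : Bulk D N T x M σ) :
    (N : ℝ) - N / (4 * D) ≤ (outer T x M (cutoff D * N)).card + ((block x M) ∩ T).card := by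
  refine h.card_filter_le_cutoff.trans ?_
  have : T.filter (fun k : ℤ => |(k : ℝ)| ≤ cutoff D * N) ⊆
      outer T x M (cutoff D * N) ∪ (block x M) ∩ T := by
    intro k hk
    simp only [outer, Finset.mem_union, Finset.mem_filter, Finset.mem_sdiff, Finset.mem_inter] at hk ⊢
    tauto
  have h2 := (Finset.card_le_card this).trans (Finset.card_union_le _ _)
  exact_mod_cast h2

lemma card_block_sdiff (x : ℤ) (M : ℕ) (T : Finset ℤ) :
    ((block x M \ T).card : ℝ) = M - ((block x M) ∩ T).card := by
  have h1 := Finset.card_sdiff_add_card_inter (block x M) T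
  rw [card_block] at h1
  have h2 : (((block x M \ T).card + (block x M ∩ T).card : ℕ) : ℝ) = M := by exact_mod_cast h1
  push_cast at h2
  linarith

lemma ray_exponent (h : Bulk D N T x M σ) {η : ℝ} (hη : η ^ 2 ≤ 1 / (2 * D)) :
    ((block x M \ T).card : ℝ) - (1 - η ^ 2) * (outer T x M (cutoff D * N)).card ≤
      -(N / (4 * D)) := by
  have hD := h.one_lt
  have hN := h.N_pos
  have h1 := h.card_outer
  have h2 := h.le
  rw [card_block_sdiff]
  have hη1 : η ^ 2 ≤ 1 := hη.trans (by rw [div_le_one (by linarith)]; linarith)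
  have h3 : (0 : ℝ) ≤ ((block x M) ∩ T).card := Nat.cast_nonneg _
  have h4 : η ^ 2 * N ≤ 1 / (2 * D) * N := by gcongr
  have h5 : 1 / (2 * D) * N = N / D / 2 := by field_simp
  have h6 : (N : ℝ) / (4 * D) = N / D / 4 := by field_simp
  have h7 : 0 ≤ η ^ 2 * (N / D) := by positivity
  have h8 := mul_le_mul_of_nonneg_left h1 (by linarith : 0 ≤ 1 - η ^ 2)
  have h9 := mul_nonneg (sq_nonneg η) h3
  rw [h6] at h8 ⊢
  rw [h5] at h4
  nlinarith

/-- Many entries of the top row lie outside the block, at a distance from it. -/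
lemma exists_good (h : Bulk D N T x M σ) : ∃ G ⊆ T \ block x M,
    (∀ k ∈ G, |(k : ℝ) / N| ≤ cutoff D) ∧
    (∀ k ∈ G, (1 / (16 * D)) ^ 2 ≤ ((k : ℝ) / N - blockL N x M) * (k / N - blockR N x)) ∧
    1 / (2 * D) * N ≤ G.card := by
  have hD := h.one_lt
  have hN := h.N_pos
  have hM : (0 : ℝ) ≤ M := Nat.cast_nonneg M
  set m := ⌊(N : ℝ) / (16 * D)⌋₊ with hm
  have hm1 : (m : ℝ) ≤ N / (16 * D) := Nat.floor_le (by positivity)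
  have hm2 : (N : ℝ) / (16 * D) < m + 1 := Nat.lt_floor_add_one _
  set F : Finset ℤ := Finset.Icc (x - M - 1 - m) (x - M - 1) ∪ Finset.Icc x (x + m) with hF
  have hFc : (F.card : ℝ) ≤ 2 * (m + 1) := by
    have h1 := Finset.card_union_le (Finset.Icc (x - M - 1 - m) (x - M - 1)) (Finset.Icc x (x + m))
    rw [Int.card_Icc, Int.card_Icc] at h1
    have h2 : F.card ≤ 2 * (m + 1) := h1.trans (by omega)
    exact_mod_cast h2
  refine ⟨outer T x M (cutoff D * N) \ F, ?_, ?_, ?_, ?_⟩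
  · exact Finset.sdiff_subset.trans (Finset.filter_subset _ _)
  · intro k hk
    rw [Finset.mem_sdiff, outer, Finset.mem_filter] at hk
    rw [abs_div, abs_of_pos hN, div_le_iff₀ hN]
    exact hk.1.2
  · intro k hk
    rw [Finset.mem_sdiff, outer, Finset.mem_filter, Finset.mem_sdiff, hF, Finset.mem_union,
      Finset.mem_Icc, Finset.mem_Icc] at hk
    rw [h.sub_mul_sub, le_div_iff₀ (by positivity)]
    have h1 : (1 / (16 * D)) ^ 2 * (N : ℝ) ^ 2 = (N / (16 * D)) * (N / (16 * D)) := by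
      field_simp
    have h0 : 0 ≤ (N : ℝ) / (16 * D) := by positivity
    rw [h1]
    rcases lt_or_ge k x with hkx | hkx
    · have h2 : k ≤ x - M - 1 := by
        by_contra hc
        apply hk.1.1.2
        rw [mem_block]; omega
      have h3 : k ≤ x - M - 1 - m - 1 := by omega
      have h4 : (k : ℝ) ≤ x - M - 1 - m - 1 := by exact_mod_cast h3
      calc (N : ℝ) / (16 * D) * (N / (16 * D)) ≤
            -((k : ℝ) - (x - M - 1 / 2)) * -(k - (x - 1 / 2)) :=
          mul_le_mul (by linarith) (by linarith) h0 (by linarith)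
        _ = _ := neg_mul_neg _ _
    · have h3 : x + m + 1 ≤ k := by omega
      have h4 : (x : ℝ) + m + 1 ≤ k := by exact_mod_cast h3
      exact mul_le_mul (by linarith) (by linarith) h0 (by linarith)
  · have h1 := h.card_outer
    have h2 : (outer T x M (cutoff D * N)).card ≤
        (outer T x M (cutoff D * N) \ F).card + F.card := by
      have := Finset.le_card_sdiff F (outer T x M (cutoff D * N))
      omega
    have h3 : ((outer T x M (cutoff D * N)).card : ℝ) ≤
        (outer T x M (cutoff D * N) \ F).card + F.card := by exact_mod_cast h2
    have h4 : (((block x M) ∩ T).card : ℝ) ≤ M := by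
      have := Finset.card_le_card (Finset.inter_subset_left (s₁ := block x M) (s₂ := T))
      rw [card_block] at this
      exact_mod_cast this
    have h5 := h.le
    have h6 : (2 : ℝ) ≤ N / (16 * D) := by
      rw [le_div_iff₀ (by linarith)]; linarith [h.large]
    have e1 : (N : ℝ) / (4 * D) = N / D / 4 := by field_simp
    have e2 : (N : ℝ) / (16 * D) = N / D / 16 := by field_simp
    have e3 : 1 / (2 * D) * N = (N : ℝ) / D / 2 := by field_simp
    rw [e1] at h1
    rw [e2] at hm1 hm2 h6
    rw [e3]
    linarith

end Bulk

end GTBulk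

end

noncomputable section

namespace GTBulk

open Set
open scoped BigOperators

/-- The product of `f` over the integers in `(u, v]`, inverted if `v < u`. -/
def signedProd (f : ℤ → ℂ) (u v : ℤ) : ℂ :=
  (∏ k ∈ Finset.Ioc u v, f k) / ∏ k ∈ Finset.Ioc v u, f k

lemma prod_Ioc_eq_signedProd {f : ℤ → ℂ} {l₁ l₂ u₁ u₂ m : ℤ} (h₁ : l₁ ≤ m) (h₂ : l₂ ≤ m)
    (h₃ : m ≤ u₁) (h₄ : m ≤ u₂) (hu : ∀ k ∈ Finset.Ioc u₂ u₁, f k ≠ 0)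
    (hl : ∀ k ∈ Finset.Ioc l₁ l₂, f k ≠ 0) :
    ∏ k ∈ Finset.Ioc l₂ u₂, f k =
      (∏ k ∈ Finset.Ioc l₁ u₁, f k) * signedProd f u₁ u₂ * (signedProd f l₁ l₂)⁻¹ := by
  have split : ∀ {l m u : ℤ}, l ≤ m → m ≤ u →
      ∏ k ∈ Finset.Ioc l u, f k = (∏ k ∈ Finset.Ioc l m, f k) * ∏ k ∈ Finset.Ioc m u, f k := by
    intro l m u h h'
    rw [← Finset.Ioc_union_Ioc_eq_Ioc h h', Finset.prod_union]
    exact Finset.Ioc_disjoint_Ioc_of_le le_rfl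
  have hup : ∏ k ∈ Finset.Ioc m u₂, f k = (∏ k ∈ Finset.Ioc m u₁, f k) * signedProd f u₁ u₂ := by
    unfold signedProd
    rcases le_total u₁ u₂ with h | h
    · rw [Finset.Ioc_eq_empty_of_le h, Finset.prod_empty, div_one, split h₃ h]
    · rw [Finset.Ioc_eq_empty_of_le h, Finset.prod_empty, split h₄ h]
      have := Finset.prod_ne_zero_iff.2 hu
      field_simp
  have hlo : ∏ k ∈ Finset.Ioc l₂ m, f k =
      (∏ k ∈ Finset.Ioc l₁ m, f k) * (signedProd f l₁ l₂)⁻¹ := by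
    unfold signedProd
    rcases le_total l₁ l₂ with h | h
    · rw [Finset.Ioc_eq_empty_of_le h, Finset.prod_empty, div_one, split h h₂]
      have := Finset.prod_ne_zero_iff.2 hl
      field_simp
    · rw [Finset.Ioc_eq_empty_of_le h, Finset.prod_empty, split h h₁]
      simp [mul_comm]
  rw [split h₂ h₄, split h₁ h₃, hup, hlo]
  ring

lemma abs_prod_div_sub_one_le {ι : Type*} (S : Finset ι) (g : ι → ℂ) {ε : ℝ} {d : ℕ}
    (hd : S.card ≤ d) (hε : 0 ≤ ε) (hdε : d * ε ≤ 1) (h : ∀ i ∈ S, ‖g i - 1‖ ≤ ε) :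
    ‖∏ i ∈ S, g i - 1‖ ≤ 2 * d * ε := by
  have h1 := Finset.norm_prod_one_add_sub_one_le S (fun i => g i - 1)
  simp only [add_sub_cancel] at h1
  have h2 : ∑ i ∈ S, ‖g i - 1‖ ≤ d * ε := by
    refine (Finset.sum_le_card_nsmul S _ ε h).trans ?_
    rw [nsmul_eq_mul]
    have : (S.card : ℝ) ≤ d := by exact_mod_cast hd
    gcongr
  have h3 : 0 ≤ ∑ i ∈ S, ‖g i - 1‖ := Finset.sum_nonneg fun i _ => norm_nonneg _
  have h4 := Real.abs_exp_sub_one_le (x := ∑ i ∈ S, ‖g i - 1‖)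
    (by rw [abs_of_nonneg h3]; exact h2.trans hdε)
  rw [abs_of_nonneg h3] at h4
  linarith [le_abs_self (Real.exp (∑ i ∈ S, ‖g i - 1‖) - 1)]

lemma signedProd_approx {f : ℤ → ℂ} {u v : ℤ} {y : ℂ} {ε : ℝ} {d : ℕ} (hy : y ≠ 0)
    (hd : |v - u| ≤ d) (hε : 0 ≤ ε) (hdε : 2 * (d + 1) * ε ≤ 1)
    (h : ∀ k : ℤ, |k - u| ≤ d → ‖f k - y‖ ≤ ε * ‖y‖) :
    ∃ θ : ℂ, ‖θ‖ ≤ 4 * d * ε ∧ signedProd f u v = y ^ (v - u) * (1 + θ) := by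
  have hy0 : 0 < ‖y‖ := norm_pos_iff.2 hy
  have hε2 : ε ≤ 1 / 2 := by
    have : (0 : ℝ) ≤ d * ε := by positivity
    linarith
  have h1 : ∀ k : ℤ, |k - u| ≤ d → ‖f k / y - 1‖ ≤ ε := by
    intro k hk
    rw [div_sub_one hy, norm_div, div_le_iff₀ hy0]
    exact h k hk
  have h2 : ∀ k : ℤ, |k - u| ≤ d → f k ≠ 0 := by
    intro k hk h0
    have := h1 k hk
    rw [h0, zero_div, zero_sub, norm_neg, norm_one] at this
    linarith
  have h3 : ∀ k : ℤ, |k - u| ≤ d → ‖y / f k - 1‖ ≤ 2 * ε := by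
    intro k hk
    have hf := h2 k hk
    have h4 : ‖y‖ / 2 ≤ ‖f k‖ := by
      have h5 := norm_sub_norm_le y (f k)
      rw [norm_sub_rev] at h5
      have h6 := h k hk
      nlinarith
    rw [div_sub_one hf, norm_div, div_le_iff₀ (norm_pos_iff.2 hf), norm_sub_rev]
    have := h k hk
    nlinarith
  refine ⟨signedProd f u v / y ^ (v - u) - 1, ?_, ?_⟩
  swap
  · have := zpow_ne_zero (v - u) hy
    field_simp
    ring
  rcases le_total u v with huv | huv
  · have hcard : (Finset.Ioc u v).card = (v - u).toNat := by simp
    have hz : y ^ (v - u) = y ^ (Finset.Ioc u v).card := by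
      rw [hcard, ← zpow_natCast, Int.toNat_of_nonneg (by omega)]
    have hS : signedProd f u v / y ^ (v - u) = ∏ k ∈ Finset.Ioc u v, (f k / y) := by
      rw [hz, signedProd, Finset.Ioc_eq_empty_of_le huv, Finset.prod_empty, div_one,
        Finset.prod_div_distrib, Finset.prod_const]
    rw [hS]
    refine (abs_prod_div_sub_one_le (d := d) _ _ ?_ hε ?_ fun k hk => ?_).trans ?_
    · rw [hcard]; rw [abs_le] at hd; omega
    · nlinarith
    · rw [Finset.mem_Ioc] at hk
      refine h1 k ?_
      rw [abs_le] at hd ⊢; omega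
    · have : (0 : ℝ) ≤ d * ε := by positivity
      linarith
  · have hcard : (Finset.Ioc v u).card = (u - v).toNat := by simp
    have hz : y ^ (v - u) = (y ^ (Finset.Ioc v u).card)⁻¹ := by
      rw [hcard, ← zpow_natCast, Int.toNat_of_nonneg (by omega), ← zpow_neg]
      congr 1; omega
    have hS : signedProd f u v / y ^ (v - u) = ∏ k ∈ Finset.Ioc v u, (y / f k) := by
      rw [hz, signedProd, Finset.Ioc_eq_empty_of_le huv, Finset.prod_empty,
        Finset.prod_div_distrib, Finset.prod_const]
      field_simp
    rw [hS]
    refine (abs_prod_div_sub_one_le (d := d) (ε := 2 * ε) _ _ ?_ (by linarith) ?_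
      fun k hk => ?_).trans ?_
    · rw [hcard]; rw [abs_le] at hd; omega
    · nlinarith
    · rw [Finset.mem_Ioc] at hk
      refine h3 k ?_
      rw [abs_le] at hd ⊢; omega
    · linarith

lemma factorial_eq_prod (m : ℕ) : ((m.factorial : ℕ) : ℂ) = ∏ k ∈ Finset.Ioc (0 : ℤ) m, (k : ℂ) := by
  induction m with
  | zero => simp
  | succ m ih =>
    have h : Finset.Ioc (0 : ℤ) ((m + 1 : ℕ) : ℤ) =
        insert (((m + 1 : ℕ) : ℤ)) (Finset.Ioc (0 : ℤ) m) := by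
      ext k; simp only [Finset.mem_Ioc, Finset.mem_insert]; push_cast; omega
    rw [h, Finset.prod_insert (by simp), Nat.factorial_succ, ← ih]
    push_cast; ring

/-- The factorial prefactor of the kernel. -/
lemma factorial_ratio_approx {m m₂ d : ℕ} (hm : 0 < m) (hd : |(m : ℤ) - m₂| ≤ d)
    (hmd : 2 * (d + 1) * (2 * d) ≤ m) :
    ∃ θ : ℂ, ‖θ‖ ≤ 8 * d ^ 2 / m ∧
      ((m.factorial : ℂ) / (m₂.factorial : ℂ)) = (m : ℂ) ^ ((m : ℤ) - m₂) * (1 + θ) := by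
  have hm0 : (0 : ℝ) < m := by exact_mod_cast hm
  have hmc : (m : ℂ) ≠ 0 := by exact_mod_cast hm.ne'
  obtain ⟨θ, h1, h2⟩ := signedProd_approx (f := fun k : ℤ => (k : ℂ)) (u := m₂) (v := m)
    (y := (m : ℂ)) (ε := 2 * d / m) (d := d) hmc hd (by positivity) (by
      rw [← mul_div_assoc, div_le_one hm0]
      exact_mod_cast hmd) (by
      intro k hk
      have h3 : (k : ℂ) - m = ((k - m : ℤ) : ℂ) := by push_cast; ring
      rw [h3, Complex.norm_intCast, Complex.norm_natCast, div_mul_cancel₀ _ hm0.ne']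
      have h4 : |k - (m : ℤ)| ≤ 2 * d := by
        rw [abs_le] at hk hd ⊢; omega
      exact_mod_cast h4)
  refine ⟨θ, h1.trans (le_of_eq (by ring)), ?_⟩
  rw [← h2, factorial_eq_prod, factorial_eq_prod]
  have h5 := prod_Ioc_eq_signedProd (f := fun k : ℤ => (k : ℂ)) (l₁ := 0) (l₂ := 0) (u₁ := m₂)
    (u₂ := m) (m := 0) le_rfl le_rfl (by positivity) (by positivity) (by
      intro k hk
      rw [Finset.mem_Ioc] at hk
      have : 0 < k := by omega
      exact_mod_cast this.ne') (by simp)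
  have h6 : ∏ k ∈ Finset.Ioc (0 : ℤ) m₂, (k : ℂ) ≠ 0 := by
    rw [← factorial_eq_prod]; exact_mod_cast (Nat.factorial_pos _).ne'
  have h7 : signedProd (fun k : ℤ => (k : ℂ)) 0 0 = 1 := by simp [signedProd]
  rw [h5, h7]
  field_simp

end GTBulk

end

noncomputable section

namespace GTBulk

open Complex MeasureTheory Set
open scoped BigOperators ComplexConjugate

/-- Control of a function along an arc, weighted with the distance to the other family of level
curves. -/
def ArcCtl (τ : ℂ) (a b e₁ e₂ : ℝ) (F : ℂ → ℂ) (A : Arc) (β : ℝ) : Prop :=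
  ∃ m s : ℝ → ℝ, IntervalIntegrable m volume A.lo A.hi ∧ ∫ v in A.lo..A.hi, m v ≤ β ∧
    ∀ v ∈ Ioo A.lo A.hi, 0 < s v ∧ Sided τ a b e₁ e₂ (s v) (A.fn v) ∧
      ‖F (A.fn v)‖ * ‖A.dfn v‖ ≤ √(s v) * m v ∧
      ‖F (conj (A.fn v))‖ * ‖A.dfn v‖ ≤ √(s v) * m v

/-- Control of a function along a path. -/
structure PathCtl (τ : ℂ) (a b e₁ e₂ : ℝ) (F : ℂ → ℂ) (β : ℝ) {p : ℂ} {c : ℝ} (P : UPath p c) :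
    Prop where
  sign₁ : e₁ = 1 ∨ e₁ = -1
  ctl : ∃ βs : Arc → ℝ, (∀ A ∈ P.arcs, ArcCtl τ a b e₁ e₂ F A (βs A)) ∧
    (P.arcs.map βs).sum ≤ β
  closed : ∀ A ∈ P.arcs, ∀ z ∈ A.support, Sided τ a b e₁ e₂ 0 z
  tail : ∃ S : Set ℂ, IsPreconnected S ∧ (c : ℂ) ∈ S ∧
    (∀ A ∈ P.arcs, ∀ v ∈ Ioo A.lo A.hi, A.fn v ∈ S) ∧
    ∀ z ∈ S, ∃ s, 0 < s ∧ Sided τ a b e₁ e₂ s z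

lemma Arc.norm_integral_cauchy_le {τ z : ℂ} {a b e₁ e₂ e₁' e₂' s β : ℝ} {G : ℂ → ℂ} {A : Arc}
    (hA : ArcCtl τ a b e₁' e₂' G A β) (hz : Sided τ a b e₁ e₂ s z) (hs : 0 < s)
    (he₁ : e₁ = 1 ∨ e₁ = -1) (he₁' : e₁' = 1 ∨ e₁' = -1) (he : e₁ * e₂ = 1)
    (he' : e₁' * e₂' = -1) :
    ‖A.integral (fun w => G w * (1 / (w - z)))‖ ≤ β / (2 * √s) ∧
      ‖A.bar.integral (fun w => G w * (1 / (w - z)))‖ ≤ β / (2 * √s) := by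
  obtain ⟨m, s', hm, hβ, h⟩ := hA
  have hsq := Real.sqrt_pos.2 hs
  have aux : ∀ {w : ℂ} {g n σ μ : ℝ}, 0 < σ → Sided τ a b e₁' e₂' σ w → 0 ≤ g → 0 ≤ n →
      g * n ≤ √σ * μ → g * ‖1 / (w - z)‖ * n ≤ μ * (1 / (2 * √s)) := by
    intro w g n σ μ hσ hw hg hn hgn
    have h1 := hz.sep hw he₁ he₁' he he'
    rw [norm_sub_rev] at h1
    have hσq := Real.sqrt_pos.2 hσ
    have h2 : 2 * √s * √σ ≤ ‖w - z‖ := by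
      refine le_trans ?_ h1
      nlinarith [sq_nonneg (√s - √σ), Real.mul_self_sqrt hs.le, Real.mul_self_sqrt hσ.le]
    have h3 : ‖1 / (w - z)‖ ≤ 1 / (2 * √s * √σ) := by
      rw [norm_div, norm_one]
      exact one_div_le_one_div_of_le (by positivity) h2
    calc g * ‖1 / (w - z)‖ * n = g * n * ‖1 / (w - z)‖ := by ring
      _ ≤ (√σ * μ) * (1 / (2 * √s * √σ)) := by
        have : 0 ≤ g * n := by positivity
        exact mul_le_mul hgn h3 (norm_nonneg _) (this.trans hgn)
      _ = μ * (1 / (2 * √s)) := by field_simp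
  have hint : ∫ v in A.lo..A.hi, m v * (1 / (2 * √s)) ≤ β / (2 * √s) := by
    rw [intervalIntegral.integral_mul_const, div_eq_mul_one_div β]
    gcongr
  constructor
  · refine (A.norm_integral_le (hm.mul_const _) fun v hv => ?_).trans hint
    obtain ⟨h1, h2, h3, h4⟩ := h v hv
    rw [norm_mul]
    exact aux h1 h2 (norm_nonneg _) (norm_nonneg _) h3
  · refine (A.bar.norm_integral_le (hm.mul_const _) fun v hv => ?_).trans hint
    obtain ⟨h1, h2, h3, h4⟩ := h v hv
    change ‖G (conj (A.fn v)) * (1 / (conj (A.fn v) - z))‖ * ‖conj (A.dfn v)‖ ≤ _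
    rw [norm_mul, Complex.norm_conj]
    exact aux h1 h2.star (norm_nonneg _) (norm_nonneg _) h4

lemma norm_list_sum_le {α : Type*} (l : List α) (f : α → ℂ) (g : α → ℝ)
    (h : ∀ i ∈ l, ‖f i‖ ≤ g i) : ‖(l.map f).sum‖ ≤ (l.map g).sum := by
  induction l with
  | nil => simp
  | cons i l ih =>
    simp only [List.map_cons, List.sum_cons]
    exact (norm_add_le _ _).trans (add_le_add (h i (by simp)) (ih fun j hj => h j (by simp [hj])))

namespace PathCtl

variable {τ p : ℂ} {a b e₁ e₂ e₁' e₂' β βR βL c cR cL : ℝ} {F G : ℂ → ℂ}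
  {P : UPath p c} {QR : UPath p cR} {QL : UPath p cL}

lemma norm_cross_cauchy_le (hQ : PathCtl τ a b e₁' e₂' G βR QR) {z : ℂ} {s : ℝ}
    (hz : Sided τ a b e₁ e₂ s z) (hs : 0 < s) (he₁ : e₁ = 1 ∨ e₁ = -1) (he : e₁ * e₂ = 1)
    (he' : e₁' * e₂' = -1) :
    ‖QR.cross (fun w => G w * (1 / (w - z)))‖ ≤ βR / √s := by
  obtain ⟨βs, h1, h2⟩ := hQ.ctl
  have hsq := Real.sqrt_pos.2 hs
  refine (norm_list_sum_le _ _ (fun A => βs A * (1 / √s)) fun A hA => ?_).trans ?_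
  · have h3 := Arc.norm_integral_cauchy_le (h1 A hA) hz hs he₁ hQ.sign₁ he he'
    refine (norm_sub_le _ _).trans ((add_le_add h3.2 h3.1).trans (le_of_eq ?_))
    field_simp; ring
  · rw [List.sum_map_mul_right, div_eq_mul_one_div βR]
    gcongr

/-- The basic estimate of the double integral. -/
lemma norm_cross_loop_le (hP : PathCtl τ a b e₁ e₂ F β P) {e₁'' e₂'' : ℝ}
    (hR : PathCtl τ a b e₁' e₂' G βR QR) (hL : PathCtl τ a b e₁'' e₂'' G βL QL)
    (he : e₁ * e₂ = 1) (he' : e₁' * e₂' = -1) (he'' : e₁'' * e₂'' = -1) (h0 : 0 ≤ βR + βL) :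
    ‖P.cross (fun z => F z * UPath.loop QR QL (fun w => G w * (1 / (w - z))))‖ ≤
      2 * β * (βR + βL) := by
  obtain ⟨βs, h1, h2⟩ := hP.ctl
  have hloop : ∀ {z : ℂ} {s : ℝ}, Sided τ a b e₁ e₂ s z → 0 < s →
      ‖UPath.loop QR QL (fun w => G w * (1 / (w - z)))‖ ≤ (βR + βL) / √s := by
    intro z s hz hs
    refine (norm_sub_le _ _).trans ?_
    rw [add_div]
    exact add_le_add (hR.norm_cross_cauchy_le hz hs hP.sign₁ he he')
      (hL.norm_cross_cauchy_le hz hs hP.sign₁ he he'')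
  refine (norm_list_sum_le _ _ (fun A => 2 * (βs A * (βR + βL))) fun A hA => ?_).trans ?_
  · obtain ⟨m, s, hm, hβ, h⟩ := h1 A hA
    have hint : ∫ v in A.lo..A.hi, m v * (βR + βL) ≤ βs A * (βR + βL) := by
      rw [intervalIntegral.integral_mul_const]
      gcongr
    have aux : ∀ {z : ℂ} {n σ μ : ℝ}, 0 < σ → Sided τ a b e₁ e₂ σ z → 0 ≤ n →
        ‖F z‖ * n ≤ √σ * μ →
        ‖F z * UPath.loop QR QL (fun w => G w * (1 / (w - z)))‖ * n ≤ μ * (βR + βL) := by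
      intro z n σ μ hσ hz hn h3
      have hσq := Real.sqrt_pos.2 hσ
      rw [norm_mul]
      calc ‖F z‖ * ‖UPath.loop QR QL (fun w => G w * (1 / (w - z)))‖ * n =
            (‖F z‖ * n) * ‖UPath.loop QR QL (fun w => G w * (1 / (w - z)))‖ := by ring
        _ ≤ (√σ * μ) * ((βR + βL) / √σ) := by
          have : 0 ≤ ‖F z‖ * n := by positivity
          exact mul_le_mul h3 (hloop hz hσ) (norm_nonneg _) (this.trans h3)
        _ = μ * (βR + βL) := by field_simp
    have b1 : ‖A.integral (fun z => F z * UPath.loop QR QL (fun w => G w * (1 / (w - z))))‖ ≤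
        βs A * (βR + βL) := by
      refine (A.norm_integral_le (hm.mul_const _) fun v hv => ?_).trans hint
      obtain ⟨h3, h4, h5, h6⟩ := h v hv
      exact aux h3 h4 (norm_nonneg _) h5
    have b2 : ‖A.bar.integral (fun z => F z * UPath.loop QR QL (fun w => G w * (1 / (w - z))))‖ ≤
        βs A * (βR + βL) := by
      refine (A.bar.norm_integral_le (hm.mul_const _) fun v hv => ?_).trans hint
      obtain ⟨h3, h4, h5, h6⟩ := h v hv
      change _ * ‖conj (A.dfn v)‖ ≤ _
      rw [Complex.norm_conj]
      exact aux h3 h4.star (norm_nonneg _) h6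
    refine (norm_sub_le _ _).trans ((add_le_add b2 b1).trans (le_of_eq (by ring)))
  · rw [List.sum_map_mul_left, List.sum_map_mul_right, ← mul_assoc]
    gcongr

lemma closed_support (hQ : PathCtl τ a b e₁' e₂' G βR QR) {w : ℂ} (hw : w ∈ QR.support) :
    Sided τ a b e₁' e₂' 0 w := by
  obtain ⟨A, hA, h | h⟩ := hw
  · exact hQ.closed A hA w h
  · have := (hQ.closed A hA _ (Arc.mem_support_bar.1 h)).star
    rwa [Complex.conj_conj] at this

lemma notMem_support (hQ : PathCtl τ a b e₁' e₂' G βR QR) {z : ℂ} {s : ℝ}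
    (hz : Sided τ a b e₁ e₂ s z) (hs : 0 < s) (he₁ : e₁ = 1 ∨ e₁ = -1) (he : e₁ * e₂ = 1)
    (he' : e₁' * e₂' = -1) : z ∉ QR.support := by
  intro h
  have := hz.sep (hQ.closed_support h) he₁ hQ.sign₁ he he'
  rw [sub_self, norm_zero] at this
  linarith

/-- The path does not meet the other two, and the winding number along it is constant. -/
lemma wind_eq (hP : PathCtl τ a b e₁ e₂ F β P) {e₁'' e₂'' : ℝ}
    (hR : PathCtl τ a b e₁' e₂' G βR QR) (hL : PathCtl τ a b e₁'' e₂'' G βL QL)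
    (he : e₁ * e₂ = 1) (he' : e₁' * e₂' = -1) (he'' : e₁'' * e₂'' = -1) :
    (c : ℂ) ∉ QR.support ∧ (c : ℂ) ∉ QL.support ∧
    ∀ A ∈ P.arcs, ∀ v ∈ Ioo A.lo A.hi, A.fn v ∉ QR.support ∪ QL.support ∧
      UPath.wind QR QL (A.fn v) = UPath.wind QR QL c ∧
      UPath.wind QR QL (conj (A.fn v)) = UPath.wind QR QL c := by
  obtain ⟨S, hS, hc, hA, hs⟩ := hP.tail
  have hn : ∀ z ∈ S, z ∉ QR.support ∧ z ∉ QL.support := by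
    intro z hz
    obtain ⟨s, h1, h2⟩ := hs z hz
    exact ⟨hR.notMem_support h2 h1 hP.sign₁ he he', hL.notMem_support h2 h1 hP.sign₁ he he''⟩
  have hd : Disjoint S (QR.support ∪ QL.support) :=
    Set.disjoint_left.2 fun z hz h => h.elim (hn z hz).1 (hn z hz).2
  have hd2 : Disjoint ((starRingEnd ℂ) '' S) (QR.support ∪ QL.support) := by
    refine Set.disjoint_left.2 ?_
    rintro _ ⟨z, hz, rfl⟩ h
    exact h.elim (fun h => (hn z hz).1 (QR.conj_mem_support.1 h))
      (fun h => (hn z hz).2 (QL.conj_mem_support.1 h))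
  have hS2 : IsPreconnected ((starRingEnd ℂ) '' S) :=
    hS.image _ Complex.continuous_conj.continuousOn
  refine ⟨(hn _ hc).1, (hn _ hc).2, fun A hAm v hv => ⟨?_, ?_, ?_⟩⟩
  · have := hn _ (hA A hAm v hv)
    exact fun h => h.elim this.1 this.2
  · exact UPath.wind_eq_of_isPreconnected QR QL hS hd (hA A hAm v hv) hc
  · refine UPath.wind_eq_of_isPreconnected QR QL hS2 hd2 (mem_image_of_mem _ (hA A hAm v hv)) ?_
    exact ⟨c, hc, Complex.conj_ofReal c⟩

end PathCtl

end GTBulk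

end

noncomputable section

namespace GTBulk

open MeasureTheory Set
open scoped BigOperators ComplexConjugate

/-- The ratio which decays along the level curves with product of signs `s`. -/
def Dual (A T : Finset ℤ) (s : ℝ) (X Y : Finset ℤ) : Prop :=
  (s = 1 ∧ X = A \ T ∧ Y = T \ A) ∨ (s = -1 ∧ X = T \ A ∧ Y = A \ T)

/-- The decay constant along level curves. -/
def decay (D B : ℝ) : ℝ :=
  1 / (2 * D) * (1 / (16 * D)) ^ 2 /
    (16 * geoK D ^ 4 * ((√B + geoK D + cutoff D) ^ 2) ^ 2)

lemma ratio_conj (A B : Finset ℤ) (z : ℂ) : ratio A B (conj z) = ratio A B z := by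
  have h : ∀ k : ℤ, ‖conj z - k‖ = ‖z - k‖ := fun k => by
    have := Sided.norm_conj_sub z (k : ℝ)
    simpa using this
  simp only [ratio, h]

section Decay

variable {D ρ B δ : ℝ} {N : ℕ} {T : Finset ℤ} {x : ℤ} {M : ℕ} {σ : ℂ} {e₁ e₂ V v : ℝ}

lemma geoK_ge_one (hD : 1 < D) : 1 ≤ geoK D := by
  have := Bulk.cutoff_pos D
  unfold geoK
  have : 0 ≤ 2 * D ^ 2 * (D + cutoff D) ^ 2 := by positivity
  linarith

lemma decay_pos (hD : 1 < D) : 0 < decay D B := by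
  have h1 := geoK_ge_one hD
  have h2 := Bulk.cutoff_pos D
  have h3 := Real.sqrt_nonneg B
  unfold decay
  positivity

lemma Bulk.ratio_curve_le (h : Bulk D N T x M σ)
    (hr : CurveReg (geoK D) ρ B δ σ (blockL N x M) (blockR N x) e₁ e₂ V)
    {X Y : Finset ℤ} (hXY : Dual (block x M) T (e₁ * e₂) X Y) (hv : v ∈ Icc 0 V) :
    ratio X Y (((N : ℝ) : ℂ) * curve σ (blockL N x M) (blockR N x) e₁ e₂ v) ≤
      Real.exp (-decay D B * (N * v)) * ratio X Y (((N : ℝ) : ℂ) * σ) := by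
  obtain ⟨G, hG1, hG2, hG3, hG4⟩ := h.exists_good
  have hN := h.N_pos
  have hD := h.one_lt
  have hK := geoK_ge_one hD
  have hc := Bulk.cutoff_pos D
  have hB := Real.sqrt_nonneg B
  have hY : ∀ u ∈ Icc 0 v, 0 < curveImSq σ (blockL N x M) (blockR N x) e₁ e₂ u :=
    fun u hu => hr.im_pos ⟨hu.1, hu.2.trans hv.2⟩
  have hcrit := h.crit_sdiff
  have hcrit' : ∑ k ∈ block x M \ T, 1 / (((N : ℝ) : ℂ) * σ - k) =
      ∑ k ∈ T \ block x M, 1 / (((N : ℝ) : ℂ) * σ - k) := by exact_mod_cast hcrit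
  have key := log_ratio_curve_le (d := (√B + geoK D + cutoff D) ^ 2) (m := 1 / (2 * D))
    (η := (1 / (16 * D)) ^ 2) hN hr.geo hr.sign₁ hr.sign₂ hcrit' hv.1 hY
    (fun k hk => h.sign_block hk) (fun k hk => h.sign_sdiff hk) hG1 hG3 (by positivity)
    (by positivity) (by
      intro k hk u hu
      have hu' : u ∈ Icc 0 V := ⟨hu.1, hu.2.trans hv.2⟩
      rw [Complex.normSq_eq_norm_sq]
      refine pow_le_pow_left₀ (norm_nonneg _) ?_ 2
      have h1 : ‖curve σ (blockL N x M) (blockR N x) e₁ e₂ u - blockL N x M‖ ≤ √B := by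
        refine Real.le_sqrt_of_sq_le ?_
        rw [← Complex.normSq_eq_norm_sq, normSq_curve_sub_left hr.geo.lt (hY u hu).le]
        exact (hr.left u hu').2
      have h2 : ‖((blockL N x M : ℝ) : ℂ) - ((k / N : ℝ) : ℂ)‖ ≤ geoK D + cutoff D := by
        refine (norm_sub_le _ _).trans ?_
        rw [Complex.norm_real, Complex.norm_real]
        exact add_le_add hr.geo.left (hG2 k hk)
      have := norm_add_le (curve σ (blockL N x M) (blockR N x) e₁ e₂ u - blockL N x M)
        (((blockL N x M : ℝ) : ℂ) - ((k / N : ℝ) : ℂ))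
      rw [sub_add_sub_cancel] at this
      linarith) hG4
  change _ ≤ -decay D B * (N * v) at key
  have hz : (((N : ℝ) : ℂ) * curve σ (blockL N x M) (blockR N x) e₁ e₂ v).im ≠ 0 := by
    rw [Complex.im_ofReal_mul, curve_im]
    exact (mul_pos hN (Real.sqrt_pos.2 (hr.im_pos hv))).ne'
  have hz₀ : (((N : ℝ) : ℂ) * σ).im ≠ 0 := by
    rw [Complex.im_ofReal_mul]; exact (mul_pos hN h.im_pos).ne'
  have p1 := ratio_pos (A := block x M \ T) (B := T \ block x M) hz
  have p2 := ratio_pos (A := block x M \ T) (B := T \ block x M) hz₀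
  rcases hXY with ⟨hs, rfl, rfl⟩ | ⟨hs, rfl, rfl⟩
  · rw [hs, one_mul] at key
    rw [← div_le_iff₀ p2, ← Real.log_le_iff_le_exp (div_pos p1 p2)]
    exact key
  · rw [hs, neg_one_mul, ← Real.log_inv, inv_div] at key
    rw [← ratio_inv (block x M \ T), ← ratio_inv (block x M \ T), ← div_eq_mul_inv,
      le_div_iff₀ p2, mul_comm, ← div_eq_mul_inv, ← Real.log_le_iff_le_exp (div_pos p2 p1)]
    exact key

end Decay

lemma exp_neg_le_rpow {y : ℝ} (hy : 0 < y) : Real.exp (-y) ≤ y ^ (-(1 / 8) : ℝ) := by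
  rw [Real.rpow_def_of_pos hy]
  refine Real.exp_le_exp.2 ?_
  have := Real.log_le_sub_one_of_pos hy
  nlinarith

lemma weight_identity {N g κ v : ℝ} (hN : 0 < N) (hg : 0 < g) (hκ : 0 < κ) (hv : 0 < v) :
    √(N * (g * √v)) * (κ ^ (-(1 / 8) : ℝ) * g ^ (-(1 / 2) : ℝ) * N ^ (3 / 8 : ℝ) *
      v ^ (-(7 / 8) : ℝ)) = N * v ^ (-(1 / 2) : ℝ) * (κ * (N * v)) ^ (-(1 / 8) : ℝ) := by
  have hs := Real.sqrt_pos.2 hv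
  refine Real.log_injOn_pos (mem_Ioi.2 (by positivity)) (mem_Ioi.2 (by positivity)) ?_
  have l1 : Real.log √(N * (g * √v)) = (Real.log N + (Real.log g + Real.log v / 2)) / 2 := by
    rw [Real.log_sqrt (by positivity), Real.log_mul hN.ne' (by positivity),
      Real.log_mul hg.ne' hs.ne', Real.log_sqrt hv.le]
  rw [Real.log_mul (by positivity) (by positivity), l1,
    Real.log_mul (by positivity) (by positivity), Real.log_mul (by positivity) (by positivity),
    Real.log_mul (by positivity) (by positivity), Real.log_mul (by positivity) (by positivity),
    Real.log_mul (by positivity) (by positivity), Real.log_rpow hκ, Real.log_rpow hg,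
    Real.log_rpow hN, Real.log_rpow hv, Real.log_rpow hv, Real.log_rpow (by positivity),
    Real.log_mul hκ.ne' (by positivity), Real.log_mul hN.ne' hv.ne']
  ring

lemma integral_weight {V : ℝ} :
    ∫ v in (0 : ℝ)..V, v ^ (-(7 / 8) : ℝ) = 8 * V ^ (1 / 8 : ℝ) := by
  rw [integral_rpow (Or.inl (by norm_num))]
  norm_num
  ring

/-- Control along the portion of a level curve. -/
lemma arcCtl_curve {K ρ B δ κ Φ E : ℝ} {σ : ℂ} {a b e₁ e₂ V N : ℝ}
    (hr : CurveReg K ρ B δ σ a b e₁ e₂ V) (hN : 0 < N) (hκ : 0 < κ) {F : ℂ → ℂ}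
    (hΦ : 0 ≤ Φ * E)
    (hF : ∀ v ∈ Ioo 0 V, ‖F (N * curve σ a b e₁ e₂ v)‖ ≤ Φ * (Real.exp (-κ * (N * v)) * E) ∧
      ‖F (conj (N * curve σ a b e₁ e₂ v))‖ ≤ Φ * (Real.exp (-κ * (N * v)) * E)) :
    ArcCtl (N * σ) (N * a) (N * b) e₁ e₂ F (hr.arc N)
      (speed K B δ * κ ^ (-(1 / 8) : ℝ) * margin K ρ B ^ (-(1 / 2) : ℝ) * (8 * V ^ (1 / 8 : ℝ)) *
        (Φ * E * N ^ (3 / 8 : ℝ))) := by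
  have hg := hr.margin_pos
  have hsp := hr.speed_nonneg
  set C := speed K B δ * (Φ * E) * (κ ^ (-(1 / 8) : ℝ) * margin K ρ B ^ (-(1 / 2) : ℝ) *
    N ^ (3 / 8 : ℝ)) with hC
  refine ⟨fun v => C * v ^ (-(7 / 8) : ℝ), fun v => N * (margin K ρ B * √v), ?_, ?_, ?_⟩
  · exact (intervalIntegral.intervalIntegrable_rpow' (by norm_num)).const_mul _
  · change ∫ v in (0 : ℝ)..V, C * v ^ (-(7 / 8) : ℝ) ≤ _
    rw [intervalIntegral.integral_const_mul, integral_weight, hC]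
    exact le_of_eq (by ring)
  · intro v hv
    have hv : v ∈ Ioo 0 V := hv
    have hv0 := hv.1
    have hs := Real.sqrt_pos.2 hv0
    refine ⟨by positivity, (hr.sided ⟨hv.1.le, hv.2.le⟩).scale hN.le, ?_⟩
    have hd : ‖(hr.arc N).dfn v‖ ≤ N * (speed K B δ * v ^ (-(1 / 2) : ℝ)) := by
      change ‖(N : ℂ) * curveDeriv σ a b e₁ e₂ v‖ ≤ _
      rw [norm_mul, Complex.norm_real, Real.norm_of_nonneg hN.le]
      gcongr
      exact hr.norm_curveDeriv_le ⟨hv.1, hv.2.le⟩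
    have hfin : Φ * (Real.exp (-κ * (N * v)) * E) * (N * (speed K B δ * v ^ (-(1 / 2) : ℝ))) ≤
        √(N * (margin K ρ B * √v)) * (C * v ^ (-(7 / 8) : ℝ)) := by
      have h1 := weight_identity hN hg hκ hv0
      have h2 := exp_neg_le_rpow (y := κ * (N * v)) (by positivity)
      calc Φ * (Real.exp (-κ * (N * v)) * E) * (N * (speed K B δ * v ^ (-(1 / 2) : ℝ))) =
            (Φ * E) * speed K B δ * (N * v ^ (-(1 / 2) : ℝ) * Real.exp (-(κ * (N * v)))) := by
            rw [neg_mul]; ring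
        _ ≤ (Φ * E) * speed K B δ * (N * v ^ (-(1 / 2) : ℝ) *
            (κ * (N * v)) ^ (-(1 / 8) : ℝ)) := by gcongr
        _ = _ := by rw [← h1, hC]; ring
    have hF' := hF v hv
    constructor
    · refine le_trans (mul_le_mul hF'.1 hd (norm_nonneg _) ?_) hfin
      exact (norm_nonneg _).trans hF'.1
    · refine le_trans (mul_le_mul hF'.2 hd (norm_nonneg _) ?_) hfin
      exact (norm_nonneg _).trans hF'.2

end GTBulk

end

noncomputable section

namespace GTBulk

open MeasureTheory Set
open scoped BigOperators ComplexConjugate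

/-- The point `z` has distance comparable to `N` from both end points. -/
def Near (R N a b : ℝ) (z : ℂ) : Prop :=
  (N / R ≤ ‖z - a‖ ∧ ‖z - a‖ ≤ N * R) ∧ (N / R ≤ ‖z - b‖ ∧ ‖z - b‖ ≤ N * R)

lemma Near.star {R N a b : ℝ} {z : ℂ} (h : Near R N a b z) : Near R N a b (conj z) := by
  unfold Near
  rw [Sided.norm_conj_sub, Sided.norm_conj_sub]
  exact h

lemma ArcCtl.mono {τ : ℂ} {a b e₁ e₂ β β' : ℝ} {F : ℂ → ℂ} {A : Arc}
    (h : ArcCtl τ a b e₁ e₂ F A β) (hβ : β ≤ β') : ArcCtl τ a b e₁ e₂ F A β' := by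
  obtain ⟨m, s, h1, h2, h3⟩ := h
  exact ⟨m, s, h1, h2.trans hβ, h3⟩

lemma not_int_of_im {z : ℂ} (h : z.im ≠ 0) (k : ℤ) : z ≠ k := by
  rintro rfl
  simp at h

lemma halfInt_ne (k j : ℤ) : (((k : ℝ) + 1 / 2 : ℝ) : ℂ) ≠ j := by
  intro h
  have h1 := congrArg Complex.re h
  simp only [Complex.ofReal_re, Complex.intCast_re] at h1
  have h2 : (2 * k + 1 : ℤ) = 2 * j := by
    have : (2 * (k : ℝ) + 1) = 2 * j := by linarith
    exact_mod_cast this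
  omega

/-- Control along a segment on which `F` is exponentially small. -/
lemma arcCtl_seg {τ z₀ z₁ : ℂ} {a b e₁ e₂ N Φ g κ : ℝ} {F : ℂ → ℂ} (hN : 0 < N) (hg : 0 < g)
    (hκ : 0 < κ) (hΦ : 0 ≤ Φ) (hlen : ‖z₁ - z₀‖ ≤ N)
    (hs : ∀ z ∈ (Arc.seg z₀ z₁).support, Sided τ a b e₁ e₂ (N * g) z)
    (hF : ∀ v ∈ Ioo (0 : ℝ) 1, ‖F ((Arc.seg z₀ z₁).fn v)‖ ≤ Φ * Real.exp (-κ * N) ∧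
      ‖F (conj ((Arc.seg z₀ z₁).fn v))‖ ≤ Φ * Real.exp (-κ * N)) :
    ArcCtl τ a b e₁ e₂ F (Arc.seg z₀ z₁)
      (κ ^ (-(1 / 8) : ℝ) * g ^ (-(1 / 2) : ℝ) * (Φ * N ^ (3 / 8 : ℝ))) := by
  refine ⟨fun _ => κ ^ (-(1 / 8) : ℝ) * g ^ (-(1 / 2) : ℝ) * (Φ * N ^ (3 / 8 : ℝ)),
    fun _ => N * g, by simp, ?_, ?_⟩
  · change ∫ _ in (0 : ℝ)..1, _ ≤ _
    simp
  · intro v hv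
    have hv : v ∈ Ioo (0 : ℝ) 1 := hv
    refine ⟨by positivity, hs _ ⟨v, Ioo_subset_Icc_self hv, rfl⟩, ?_⟩
    have h1 := weight_identity hN hg hκ one_pos
    have h2 := exp_neg_le_rpow (y := κ * N) (by positivity)
    rw [Real.sqrt_one, Real.one_rpow, Real.one_rpow, mul_one, mul_one, mul_one] at h1
    have hfin : Φ * Real.exp (-κ * N) * N ≤ √(N * g) *
        (κ ^ (-(1 / 8) : ℝ) * g ^ (-(1 / 2) : ℝ) * (Φ * N ^ (3 / 8 : ℝ))) := by
      calc Φ * Real.exp (-κ * N) * N = Φ * (N * Real.exp (-(κ * N))) := by rw [neg_mul]; ring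
        _ ≤ Φ * (N * (κ * N) ^ (-(1 / 8) : ℝ)) := by gcongr
        _ = _ := by rw [← h1]; ring
    have hF' := hF v hv
    exact ⟨(mul_le_mul hF'.1 hlen (norm_nonneg _) (by positivity)).trans hfin,
      (mul_le_mul hF'.2 hlen (norm_nonneg _) (by positivity)).trans hfin⟩

lemma Bulk.card_le {D : ℝ} {N : ℕ} {T : Finset ℤ} {x : ℤ} {M : ℕ} {σ : ℂ}
    (h : Bulk D N T x M σ) {s : ℝ} {X Y : Finset ℤ} (hXY : Dual (block x M) T s X Y) :
    (X.card : ℝ) ≤ N ∧ (Y.card : ℝ) ≤ N := by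
  have h1 : ((block x M \ T).card : ℝ) ≤ N := by
    have h2 := Finset.card_le_card (Finset.sdiff_subset (s := block x M) (t := T))
    rw [card_block] at h2
    have h3 : ((block x M \ T).card : ℝ) ≤ M := by exact_mod_cast h2
    have h4 := h.le
    have h5 := h.N_pos
    have h6 : 0 ≤ (N : ℝ) / D := by have := h.one_lt; positivity
    linarith
  have h2 : ((T \ block x M).card : ℝ) ≤ N := by
    have h2 := Finset.card_le_card (Finset.sdiff_subset (s := T) (t := block x M))
    rw [h.card] at h2
    exact_mod_cast h2
  rcases hXY with ⟨-, rfl, rfl⟩ | ⟨-, rfl, rfl⟩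
  · exact ⟨h1, h2⟩
  · exact ⟨h2, h1⟩

/-- The end point of the level curve is far from the zeros of the denominator. -/
lemma Bulk.far_of_location {D : ℝ} {N : ℕ} {T : Finset ℤ} {x : ℤ} {M : ℕ} {σ : ℂ}
    (h : Bulk D N T x M σ) {e₁ e₂ X r : ℝ} {U Y : Finset ℤ}
    (hXY : Dual (block x M) T (e₁ * e₂) U Y)
    (ha : r ≤ |X - blockL N x M|) (hb : r ≤ |X - blockR N x|)
    (hloc : (e₁ = -1 ∧ e₂ = -1 ∧ blockL N x M < X ∧ X < blockR N x) ∨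
      (e₁ = -1 ∧ e₂ = 1 ∧ X < blockL N x M) ∨ (e₁ = 1 ∧ e₂ = -1 ∧ blockR N x < X))
    {k : ℤ} (hk : k ∈ Y) : N * r ≤ |N * X - k| := by
  have hN := h.N_pos
  have hL : (N : ℝ) * blockL N x M = x - M - 1 / 2 := by unfold blockL; field_simp
  have hR : (N : ℝ) * blockR N x = x - 1 / 2 := by unfold blockR; field_simp
  have hM : (0 : ℝ) ≤ M := Nat.cast_nonneg M
  rcases hloc with ⟨rfl, rfl, h1, h2⟩ | ⟨rfl, rfl, h1⟩ | ⟨rfl, rfl, h1⟩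
  · rw [abs_of_pos (by linarith)] at ha
    rw [abs_of_neg (by linarith)] at hb
    rcases hXY with ⟨-, rfl, rfl⟩ | ⟨h0, -⟩
    · rw [Finset.mem_sdiff] at hk
      rcases Bulk.notMem_block hk.2 with h3 | h3
      · refine le_trans ?_ (le_abs_self _)
        nlinarith
      · refine le_trans ?_ (neg_le_abs _)
        nlinarith
    · norm_num at h0
  · rw [abs_of_neg (by linarith)] at ha
    rcases hXY with ⟨h0, -⟩ | ⟨-, rfl, rfl⟩
    · norm_num at h0
    · rw [Finset.mem_sdiff, mem_block] at hk
      have h3 : (x : ℝ) - M ≤ k := by exact_mod_cast hk.1.1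
      refine le_trans ?_ (neg_le_abs _)
      nlinarith
  · rw [abs_of_pos (by linarith)] at hb
    rcases hXY with ⟨h0, -⟩ | ⟨-, rfl, rfl⟩
    · norm_num at h0
    · rw [Finset.mem_sdiff, mem_block] at hk
      have h3 : (k : ℝ) ≤ x - 1 := by exact_mod_cast hk.1.2
      refine le_trans ?_ (le_abs_self _)
      nlinarith

section Seg

variable {z₀ : ℂ} {c s : ℝ}

lemma seg_re : ((Arc.seg z₀ c).fn s).re = z₀.re + s * (c - z₀.re) := by
  simp [Arc.seg]

lemma seg_im : ((Arc.seg z₀ c).fn s).im = (1 - s) * z₀.im := by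
  simp [Arc.seg]; ring

lemma seg_not_int {k : ℤ} (h0 : 0 < z₀.im) (hc : c = k + 1 / 2) {z : ℂ}
    (hz : z ∈ (Arc.seg z₀ c).support) (j : ℤ) : z ≠ j := by
  obtain ⟨s, hs, rfl⟩ := hz
  have hs : s ∈ Icc (0 : ℝ) 1 := hs
  rcases hs.2.lt_or_eq with h | h
  · refine not_int_of_im ?_ j
    rw [seg_im]
    exact (mul_pos (by linarith) h0).ne'
  · have : (Arc.seg z₀ c).fn s = (((k : ℝ) + 1 / 2 : ℝ) : ℂ) := by
      rw [h, ← hc]; simp [Arc.seg]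
    rw [this]
    exact halfInt_ne k j

lemma seg_im_nonneg (h0 : 0 ≤ z₀.im) {z : ℂ} (hz : z ∈ (Arc.seg z₀ c).support) : 0 ≤ z.im := by
  obtain ⟨s, hs, rfl⟩ := hz
  have hs : s ∈ Icc (0 : ℝ) 1 := hs
  rw [seg_im]
  exact mul_nonneg (by linarith [hs.2]) h0

lemma isPreconnected_support (A : Arc) : IsPreconnected A.support :=
  isPreconnected_Icc.image _ A.cont

end Seg

namespace CurveReg

variable {K ρ B δ : ℝ} {τ : ℂ} {a b e₁ e₂ V : ℝ}

lemma arc_im_pos (hr : CurveReg K ρ B δ τ a b e₁ e₂ V) {N : ℝ} (hN : 0 < N) {z : ℂ}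
    (hz : z ∈ (hr.arc N).support) : 0 < z.im := by
  obtain ⟨v, hv, rfl⟩ := hz
  change 0 < ((N : ℂ) * curve τ a b e₁ e₂ v).im
  rw [Complex.im_ofReal_mul, curve_im]
  exact mul_pos hN (Real.sqrt_pos.2 (hr.im_pos hv))

lemma arc_lo (hr : CurveReg K ρ B δ τ a b e₁ e₂ V) (N : ℝ) :
    (hr.arc N).fn (hr.arc N).lo = N * τ := by
  change (N : ℂ) * curve τ a b e₁ e₂ 0 = _
  rw [curve_zero hr.geo.lt hr.geo.im_pos.le]

lemma arc_sided (hr : CurveReg K ρ B δ τ a b e₁ e₂ V) {N : ℝ} (hN : 0 < N) {v : ℝ}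
    (hv : v ∈ Icc 0 V) :
    Sided (N * τ) (N * a) (N * b) e₁ e₂ (N * (margin K ρ B * √v)) ((hr.arc N).fn v) :=
  (hr.sided hv).scale hN.le

lemma arc_closed (hr : CurveReg K ρ B δ τ a b e₁ e₂ V) {N : ℝ} (hN : 0 < N) {z : ℂ}
    (hz : z ∈ (hr.arc N).support) : Sided (N * τ) (N * a) (N * b) e₁ e₂ 0 z := by
  obtain ⟨v, hv, rfl⟩ := hz
  have := hr.margin_pos
  exact (hr.arc_sided hN hv).mono (by positivity)

/-- The points of the curve different from the starting point. -/
lemma arc_open (hr : CurveReg K ρ B δ τ a b e₁ e₂ V) {N : ℝ} (hN : 0 < N) :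
    IsPreconnected ((hr.arc N).fn '' Ioc 0 V) ∧
    ∀ z ∈ (hr.arc N).fn '' Ioc 0 V, ∃ s, 0 < s ∧ Sided (N * τ) (N * a) (N * b) e₁ e₂ s z := by
  refine ⟨isPreconnected_Ioc.image _ ((hr.arc N).cont.mono Ioc_subset_Icc_self), ?_⟩
  rintro _ ⟨v, hv, rfl⟩
  have := hr.margin_pos
  have := Real.sqrt_pos.2 hv.1
  exact ⟨_, by positivity, hr.arc_sided hN ⟨hv.1.le, hv.2⟩⟩

/-- The distances from the end points along the dilated curve. -/
lemma arc_near (hr : CurveReg K ρ B δ τ a b e₁ e₂ V) {N R : ℝ} (hN : 0 < N)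
    (hR : 1 / R ≤ √ρ) (hR' : √B ≤ R) {v : ℝ} (hv : v ∈ Icc 0 V) :
    Near R N (N * a) (N * b) (N * curve τ a b e₁ e₂ v) := by
  have aux : ∀ c : ℝ, ‖(N : ℂ) * curve τ a b e₁ e₂ v - (N * c : ℝ)‖ =
      N * √(Complex.normSq (curve τ a b e₁ e₂ v - c)) := by
    intro c
    rw [Complex.ofReal_mul, ← mul_sub, norm_mul, Complex.norm_real, Real.norm_of_nonneg hN.le,
      Complex.normSq_eq_norm_sq, Real.sqrt_sq (norm_nonneg _)]
  have h0 := (hr.im_pos hv).le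
  have fin : ∀ p : ℝ, ρ ≤ p → p ≤ B → N / R ≤ N * √p ∧ N * √p ≤ N * R := by
    intro p h1 h2
    have h3 := Real.sqrt_le_sqrt h1
    have h4 := Real.sqrt_le_sqrt h2
    constructor
    · rw [div_eq_mul_one_div]; gcongr; linarith
    · gcongr; linarith
  unfold Near
  rw [aux, aux, normSq_curve_sub_left hr.geo.lt h0, normSq_curve_sub_right hr.geo.lt h0]
  exact ⟨fin _ (hr.left v hv).1 (hr.left v hv).2, fin _ (hr.right v hv).1 (hr.right v hv).2⟩

end CurveReg

end GTBulk

end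

noncomputable section

namespace GTBulk

open MeasureTheory Set
open scoped BigOperators ComplexConjugate

/-- A level curve whose end is so close to the real axis that it can be closed by a segment. -/
structure CurveTail (D : ℝ) (N : ℕ) (T : Finset ℤ) (x : ℤ) (M : ℕ) (σ : ℂ)
    (e₁ e₂ ρ B δ V v₀ : ℝ) : Prop where
  bulk : Bulk D N T x M σ
  reg : CurveReg (geoK D) ρ B δ σ (blockL N x M) (blockR N x) e₁ e₂ V
  height : curveImSq σ (blockL N x M) (blockR N x) e₁ e₂ V = δ ^ 2
  time_pos : 0 < v₀
  time_le : v₀ ≤ V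
  le_sqrt : δ ≤ √ρ / 2
  le_margin : δ ≤ margin (geoK D) ρ B * √v₀ / 4
  le_decay : δ ≤ √ρ / 4 * √(decay D B * v₀ / 2)
  le_half : δ ≤ 1 / 2
  one_le : 1 ≤ δ * N
  four_le : 4 ≤ √ρ * N
  loc : (e₁ = -1 ∧ e₂ = -1 ∧ blockL N x M < curveRe σ (blockL N x M) (blockR N x) e₁ e₂ V ∧
      curveRe σ (blockL N x M) (blockR N x) e₁ e₂ V < blockR N x) ∨
    (e₁ = -1 ∧ e₂ = 1 ∧ curveRe σ (blockL N x M) (blockR N x) e₁ e₂ V < blockL N x M) ∨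
    (e₁ = 1 ∧ e₂ = -1 ∧ blockR N x < curveRe σ (blockL N x M) (blockR N x) e₁ e₂ V)

/-- The constant comparing distances with `N`. -/
def tailR (ρ B : ℝ) : ℝ := 4 / √ρ + √B + 1

lemma tailR_pos {ρ B : ℝ} : 0 < tailR ρ B := by unfold tailR; positivity

lemma one_div_tailR_le {ρ B : ℝ} (hρ : 0 < √ρ) : 1 / tailR ρ B ≤ √ρ / 4 := by
  rw [div_le_iff₀ tailR_pos, tailR]
  have : √ρ / 4 * (4 / √ρ + √B + 1) = 1 + √ρ / 4 * (√B + 1) := by field_simp; ring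
  rw [this]
  have : 0 ≤ √ρ / 4 * (√B + 1) := by positivity
  linarith

namespace Bulk

variable {D : ℝ} {N : ℕ} {T : Finset ℤ} {x : ℤ} {M : ℕ} {σ : ℂ} {e₁ e₂ ρ B δ V : ℝ}
  {X Y : Finset ℤ} {F : ℂ → ℂ} {Φ V₁ : ℝ}

lemma arc_near (h : Bulk D N T x M σ)
    (hr : CurveReg (geoK D) ρ B δ σ (blockL N x M) (blockR N x) e₁ e₂ V) {v : ℝ}
    (hv : v ∈ Icc 0 V) : Near (tailR ρ B) N (N * blockL N x M)
    (N * blockR N x) ((hr.arc N).fn v) := by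
  have hρ := Real.sqrt_pos.2 hr.rho
  refine hr.arc_near h.N_pos ?_ ?_ hv
  · have := one_div_tailR_le (B := B) hρ
    linarith
  · rw [tailR]
    have : 0 < 4 / √ρ := by positivity
    linarith

/-- The constant for the level curve. -/
def arcConst (D ρ B δ V₁ : ℝ) : ℝ := speed (geoK D) B δ * decay D B ^ (-(1 / 8) : ℝ) *
  margin (geoK D) ρ B ^ (-(1 / 2) : ℝ) * (8 * V₁ ^ (1 / 8 : ℝ))

lemma arc_ctl (h : Bulk D N T x M σ)
    (hr : CurveReg (geoK D) ρ B δ σ (blockL N x M) (blockR N x) e₁ e₂ V) (hV₁ : V ≤ V₁)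
    (hXY : Dual (block x M) T (e₁ * e₂) X Y) (hΦ : 0 ≤ Φ)
    (hF : ∀ z : ℂ, (∀ k : ℤ, z ≠ k) → Near (tailR ρ B) N (N * blockL N x M) (N * blockR N x) z →
      ‖F z‖ ≤ Φ * ratio X Y z) :
    ArcCtl (((N : ℝ) : ℂ) * σ) (N * blockL N x M) (N * blockR N x) e₁ e₂ F (hr.arc N)
      (arcConst D ρ B δ V₁ * (Φ * ratio X Y (((N : ℝ) : ℂ) * σ) * (N : ℝ) ^ (3 / 8 : ℝ))) := by
  have hN := h.N_pos
  have hκ := decay_pos (B := B) h.one_lt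
  have hE := ratio_nonneg X Y (((N : ℝ) : ℂ) * σ)
  have hA1 := arcCtl_curve (F := F) (Φ := Φ) (E := ratio X Y (((N : ℝ) : ℂ) * σ))
      (κ := decay D B) hr hN hκ (mul_nonneg hΦ hE) (by
    intro v hv
    have hv' : v ∈ Icc 0 V := Ioo_subset_Icc_self hv
    have h1 := mul_le_mul_of_nonneg_left (h.ratio_curve_le hr hXY hv') hΦ
    have him : 0 < (((N : ℝ) : ℂ) * curve σ (blockL N x M) (blockR N x) e₁ e₂ v).im :=
      hr.arc_im_pos hN ⟨v, hv', rfl⟩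
    have hn := h.arc_near hr hv'
    constructor
    · exact (hF _ (not_int_of_im him.ne') hn).trans h1
    · refine (hF _ (not_int_of_im ?_) hn.star).trans ?_
      · rw [Complex.conj_im]; exact (neg_neg_of_pos him).ne
      · rw [ratio_conj]; exact h1)
  refine hA1.mono ?_
  have h1 : V ^ (1 / 8 : ℝ) ≤ V₁ ^ (1 / 8 : ℝ) :=
    Real.rpow_le_rpow hr.len.le hV₁ (by norm_num)
  have h2 := hr.speed_nonneg
  have h3 := hr.margin_pos
  rw [arcConst]
  refine mul_le_mul_of_nonneg_right ?_ (by positivity)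
  refine mul_le_mul_of_nonneg_left ?_ (by positivity)
  linarith

end Bulk

namespace CurveTail

variable {D : ℝ} {N : ℕ} {T : Finset ℤ} {x : ℤ} {M : ℕ} {σ : ℂ} {e₁ e₂ ρ B δ V v₀ : ℝ}

/-- The real part of the end of the level curve. -/
def endRe (_ : CurveTail D N T x M σ e₁ e₂ ρ B δ V v₀) : ℝ :=
  curveRe σ (blockL N x M) (blockR N x) e₁ e₂ V

/-- The end of the dilated level curve. -/
def endPt (_ : CurveTail D N T x M σ e₁ e₂ ρ B δ V v₀) : ℂ :=
  ((N : ℝ) : ℂ) * curve σ (blockL N x M) (blockR N x) e₁ e₂ V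

/-- The integer part of the real part of the end point. -/
def endInt (h : CurveTail D N T x M σ e₁ e₂ ρ B δ V v₀) : ℤ := ⌊N * h.endRe⌋

/-- The half-integer next to the end point. -/
def endHalf (h : CurveTail D N T x M σ e₁ e₂ ρ B δ V v₀) : ℝ := (h.endInt : ℝ) + 1 / 2

variable (h : CurveTail D N T x M σ e₁ e₂ ρ B δ V v₀)
lemma endPt_re (h : CurveTail D N T x M σ e₁ e₂ ρ B δ V v₀) : h.endPt.re = N * h.endRe := by
  rw [endPt, Complex.re_ofReal_mul]; rfl

lemma endPt_im : h.endPt.im = δ * N := by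
  rw [endPt, Complex.im_ofReal_mul, curve_im, h.height, Real.sqrt_sq h.reg.del.le, mul_comm]

lemma endPt_im_pos : 0 < h.endPt.im := by
  rw [h.endPt_im]; exact mul_pos h.reg.del h.bulk.N_pos

lemma sqrt_pos (h : CurveTail D N T x M σ e₁ e₂ ρ B δ V v₀) : 0 < √ρ := Real.sqrt_pos.2 h.reg.rho

lemma mem_Icc (h : CurveTail D N T x M σ e₁ e₂ ρ B δ V v₀) : V ∈ Icc 0 V := ⟨h.reg.len.le, le_rfl⟩

lemma dist_aux {c p : ℝ} (h1 : ρ ≤ p) (h2 : δ ^ 2 = p - (h.endRe - c) ^ 2) :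
    √ρ / 2 ≤ |h.endRe - c| := by
  refine le_of_sq_le_sq ?_ (abs_nonneg _)
  have h3 : (h.endRe - c) ^ 2 = p - δ ^ 2 := by linarith
  have h4 : δ ^ 2 ≤ (√ρ / 2) ^ 2 := pow_le_pow_left₀ h.reg.del.le h.le_sqrt 2
  rw [sq_abs, h3]
  have h5 := Real.sq_sqrt h.reg.rho.le
  have h6 := h.reg.rho
  nlinarith

lemma dist_left : √ρ / 2 ≤ |h.endRe - blockL N x M| :=
  h.dist_aux (h.reg.left V h.mem_Icc).1 (by rw [← h.height]; rfl)

lemma dist_right : √ρ / 2 ≤ |h.endRe - blockR N x| :=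
  h.dist_aux (h.reg.right V h.mem_Icc).1 (by
    rw [← h.height]; exact ptImSq_eq_right h.reg.geo.lt)

lemma endHalf_sub : |h.endHalf - N * h.endRe| ≤ 1 / 2 := by
  have h1 := Int.floor_le (N * h.endRe)
  have h2 := Int.lt_floor_add_one (N * h.endRe)
  rw [endHalf, endInt, abs_le]; constructor <;> linarith

/-- The segment closing the level curve. -/
def seg (h : CurveTail D N T x M σ e₁ e₂ ρ B δ V v₀) : Arc := Arc.seg h.endPt h.endHalf

lemma seg_len : ‖((h.endHalf : ℝ) : ℂ) - h.endPt‖ ≤ 2 * δ * N := by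
  have hN := h.bulk.N_pos
  have hδ := h.reg.del
  refine (Complex.norm_le_abs_re_add_abs_im _).trans ?_
  simp only [Complex.sub_re, Complex.ofReal_re, Complex.sub_im, Complex.ofReal_im, zero_sub,
    abs_neg]
  rw [h.endPt_re, h.endPt_im, abs_of_pos (a := δ * N) (by positivity)]
  linarith [h.endHalf_sub, h.one_le]

variable {s : ℝ}

lemma seg_sub_re (hs : s ∈ Icc (0 : ℝ) 1) : |(h.seg.fn s).re - h.endPt.re| ≤ 1 / 2 := by
  rw [seg, seg_re, add_sub_cancel_left, abs_mul, abs_of_nonneg hs.1, h.endPt_re]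
  calc s * |h.endHalf - N * h.endRe| ≤ 1 * (1 / 2) :=
        mul_le_mul hs.2 h.endHalf_sub (abs_nonneg _) zero_le_one
    _ = 1 / 2 := one_mul _

lemma seg_sub (hs : s ∈ Icc (0 : ℝ) 1) : ‖h.seg.fn s - h.endPt‖ ≤ 2 * δ * N := by
  have h1 : h.seg.fn s - h.endPt = s * ((h.endHalf : ℂ) - h.endPt) := by simp [seg, Arc.seg]
  rw [h1, norm_mul, Complex.norm_real, Real.norm_of_nonneg hs.1]
  calc s * ‖(h.endHalf : ℂ) - h.endPt‖ ≤ 1 * ‖(h.endHalf : ℂ) - h.endPt‖ := by gcongr; exact hs.2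
    _ ≤ _ := by rw [one_mul]; exact h.seg_len

lemma seg_sided {z : ℂ} (hz : z ∈ h.seg.support) :
    Sided (((N : ℝ) : ℂ) * σ) (N * blockL N x M) (N * blockR N x) e₁ e₂
      (N * (margin (geoK D) ρ B * √v₀ / 2)) z := by
  obtain ⟨s, hs, rfl⟩ := hz
  have h1 := (h.reg.arc_sided h.bulk.N_pos h.mem_Icc).near h.reg.sign₁ h.reg.sign₂ (h.seg_sub hs)
  refine h1.mono ?_
  have hN := h.bulk.N_pos
  have h2 : √v₀ ≤ √V := Real.sqrt_le_sqrt h.time_le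
  have h3 := mul_le_mul_of_nonneg_left h2 h.reg.margin_pos.le
  have h5 := h.le_margin
  have h4 : N * (margin (geoK D) ρ B * √v₀ / 2) + 2 * δ * N ≤
      N * (margin (geoK D) ρ B * √V) := by
    nlinarith
  linarith

lemma seg_dist_real {q r : ℝ} (hq : r ≤ |N * h.endRe - q|) (hs : s ∈ Icc (0 : ℝ) 1) :
    r - 1 / 2 ≤ |(h.seg.fn s).re - q| := by
  have h3 := h.seg_sub_re hs
  rw [h.endPt_re] at h3
  have h4 := abs_add_le ((h.seg.fn s).re - q) (N * h.endRe - (h.seg.fn s).re)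
  rw [abs_sub_comm (N * h.endRe), add_comm ((h.seg.fn s).re - q), sub_add_sub_cancel] at h4
  linarith

lemma seg_near (hs : s ∈ Icc (0 : ℝ) 1) :
    Near (tailR ρ B) N (N * blockL N x M) (N * blockR N x) (h.seg.fn s) := by
  have hN := h.bulk.N_pos
  have h1 : N / tailR ρ B ≤ N * (√ρ / 4) := by
    rw [div_eq_mul_one_div (N : ℝ)]
    exact mul_le_mul_of_nonneg_left (one_div_tailR_le h.sqrt_pos) hN.le
  have hup : ∀ q : ℝ, ‖h.endPt - (N * q : ℝ)‖ ≤ N * √B →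
      ‖h.seg.fn s - (N * q : ℝ)‖ ≤ N * tailR ρ B := by
    intro q hq
    have h2 := norm_add_le (h.seg.fn s - h.endPt) (h.endPt - (N * q : ℝ))
    rw [sub_add_sub_cancel] at h2
    have h3 := h.seg_sub hs
    have h5 := h.sqrt_pos
    have h4 : (0 : ℝ) ≤ N * (4 / √ρ) := by positivity
    have h6 : δ * N ≤ 1 / 2 * N := mul_le_mul_of_nonneg_right h.le_half hN.le
    rw [tailR, mul_add, mul_add]
    linarith
  have hlo : ∀ q : ℝ, √ρ / 2 ≤ |h.endRe - q| →
      N / tailR ρ B ≤ ‖h.seg.fn s - (N * q : ℝ)‖ := by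
    intro q hq
    refine h1.trans ?_
    have h2 := Complex.abs_re_le_norm (h.seg.fn s - (N * q : ℝ))
    rw [Complex.sub_re, Complex.ofReal_re] at h2
    refine le_trans ?_ h2
    have h3 : (N : ℝ) * (√ρ / 2) ≤ |N * h.endRe - N * q| := by
      rw [← mul_sub, abs_mul, abs_of_pos hN]; gcongr
    have h4 := h.seg_dist_real h3 hs
    have h5 := h.four_le
    linarith
  have hsq : ∀ q p : ℝ,
      Complex.normSq (curve σ (blockL N x M) (blockR N x) e₁ e₂ V - q) = p → p ≤ B →
      ‖h.endPt - (N * q : ℝ)‖ ≤ N * √B := by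
    intro q p h2 h3
    rw [endPt, Complex.ofReal_mul, ← mul_sub, norm_mul, Complex.norm_real,
      Real.norm_of_nonneg hN.le]
    refine mul_le_mul_of_nonneg_left (Real.le_sqrt_of_sq_le ?_) hN.le
    rw [← Complex.normSq_eq_norm_sq, h2]
    exact h3
  have h0' := (h.reg.im_pos h.mem_Icc).le
  exact ⟨⟨hlo _ h.dist_left, hup _ (hsq _ _ (normSq_curve_sub_left h.reg.geo.lt h0')
      (h.reg.left V h.mem_Icc).2)⟩,
    ⟨hlo _ h.dist_right, hup _ (hsq _ _ (normSq_curve_sub_right h.reg.geo.lt h0')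
      (h.reg.right V h.mem_Icc).2)⟩⟩

lemma seg_ratio_le {X Y : Finset ℤ} (hXY : Dual (block x M) T (e₁ * e₂) X Y)
    (hs : s ∈ Icc (0 : ℝ) 1) : ratio X Y (h.seg.fn s) ≤
      Real.exp (1 / δ + 2 / (√ρ / 4)) * ratio X Y (((N : ℝ) : ℂ) * σ) *
        Real.exp (-(decay D B * v₀ / 2) * N) := by
  have hN := h.bulk.N_pos
  have hδ := h.reg.del
  have hρ := h.sqrt_pos
  have hκ := decay_pos (B := B) h.bulk.one_lt
  have hv₀ := h.time_pos
  have h1 := h.bulk.ratio_curve_le h.reg hXY h.mem_Icc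
  have h4 := h.four_le
  have h1N := h.one_le
  have hp := h.endPt_im_pos
  have h2 := ratio_tail_le (A := X) (B := Y) (z := h.seg.fn s) (z₀ := h.endPt) (h := δ * N)
    (c := √ρ / 4 * N) (h.seg_sub_re hs)
    (by rw [seg, seg_im]; exact mul_nonneg (by linarith [hs.2]) hp.le)
    (by rw [seg, seg_im, h.endPt_im]
        have : 0 ≤ s * (δ * N) := mul_nonneg hs.1 (by positivity)
        linarith) h.endPt_im h1N (by linarith) (by
      intro j hj
      have h3 := h.bulk.far_of_location (X := h.endRe) hXY h.dist_left h.dist_right h.loc hj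
      have h5 := h.seg_dist_real h3 hs
      linarith)
  obtain ⟨hX, hYc⟩ := h.bulk.card_le hXY
  have hδ3' : δ ^ 2 ≤ (√ρ / 4) ^ 2 * (decay D B * v₀ / 2) := by
    have := pow_le_pow_left₀ hδ.le h.le_decay 2
    rwa [mul_pow, Real.sq_sqrt (by positivity)] at this
  have hexp : (X.card : ℝ) / (δ * N) + Y.card * (2 / (√ρ / 4 * N) +
      (δ * N) ^ 2 / (√ρ / 4 * N) ^ 2) ≤
      1 / δ + 2 / (√ρ / 4) + decay D B * v₀ / 2 * N := by
    have e1 : (X.card : ℝ) / (δ * N) ≤ N / (δ * N) :=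
      div_le_div_of_nonneg_right hX (by positivity)
    have e2 : (N : ℝ) / (δ * N) = 1 / δ := by field_simp
    have e3 : (Y.card : ℝ) * (2 / (√ρ / 4 * N) + (δ * N) ^ 2 / (√ρ / 4 * N) ^ 2) ≤
        N * (2 / (√ρ / 4 * N) + (δ * N) ^ 2 / (√ρ / 4 * N) ^ 2) :=
      mul_le_mul_of_nonneg_right hYc (by positivity)
    have e4 : (N : ℝ) * (2 / (√ρ / 4 * N) + (δ * N) ^ 2 / (√ρ / 4 * N) ^ 2) =
        2 / (√ρ / 4) + N * (δ ^ 2 / (√ρ / 4) ^ 2) := by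
      rw [mul_pow, mul_pow, mul_div_mul_right _ _ (by positivity : ((N : ℝ) ^ 2) ≠ 0)]
      field_simp
    have e5 : δ ^ 2 / (√ρ / 4) ^ 2 ≤ decay D B * v₀ / 2 := by
      rw [div_le_iff₀ (by positivity), mul_comm]; exact hδ3'
    have e6 := mul_le_mul_of_nonneg_left e5 hN.le
    linarith
  have h6 : -decay D B * (N * V) ≤ -(decay D B * v₀) * N := by
    have := mul_le_mul_of_nonneg_left h.time_le (mul_pos hκ hN).le
    linarith
  calc _ ≤ _ := h2
    _ ≤ Real.exp (1 / δ + 2 / (√ρ / 4) + decay D B * v₀ / 2 * N) *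
        (Real.exp (-(decay D B * v₀) * N) * ratio X Y (((N : ℝ) : ℂ) * σ)) := by
      refine mul_le_mul (Real.exp_le_exp.2 hexp) (h1.trans ?_) (ratio_nonneg _ _ _)
        (Real.exp_pos _).le
      exact mul_le_mul_of_nonneg_right (Real.exp_le_exp.2 h6) (ratio_nonneg _ _ _)
    _ = _ := by
      have : Real.exp (1 / δ + 2 / (√ρ / 4) + decay D B * v₀ / 2 * N) *
          Real.exp (-(decay D B * v₀) * N) =
          Real.exp (1 / δ + 2 / (√ρ / 4)) * Real.exp (-(decay D B * v₀ / 2) * N) := by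
        rw [← Real.exp_add, ← Real.exp_add]; congr 1; ring
      rw [← mul_assoc, this]; ring

/-- The level curve followed by the segment. -/
def path : UPath (((N : ℝ) : ℂ) * σ) ((h.endInt : ℝ) + 1 / 2) where
  arcs := [h.reg.arc N, h.seg]
  chain := by
    intro G
    have hz₀0 : h.endPt = h.seg.fn 0 := by simp [seg, Arc.seg]
    have hc1 : (h.endHalf : ℂ) = h.seg.fn 1 := by simp [seg, Arc.seg]
    simp only [List.map_cons, List.map_nil, List.sum_cons, List.sum_nil, add_zero]
    rw [h.reg.arc_lo]
    change G h.endPt - _ + (G (h.seg.fn 1) - G (h.seg.fn 0)) = _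
    rw [← hz₀0, ← hc1, endHalf]
    push_cast
    ring
  im_nonneg := by
    simp only [List.mem_cons, List.not_mem_nil, or_false, forall_eq_or_imp, forall_eq]
    exact ⟨fun z hz => (h.reg.arc_im_pos h.bulk.N_pos hz).le,
      fun z hz => seg_im_nonneg h.endPt_im_pos.le hz⟩
  not_int := by
    simp only [List.mem_cons, List.not_mem_nil, or_false, forall_eq_or_imp, forall_eq]
    exact ⟨fun z hz => not_int_of_im (h.reg.arc_im_pos h.bulk.N_pos hz).ne',
      fun z hz j => seg_not_int h.endPt_im_pos rfl hz j⟩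

/-- The constant for the segment. -/
def segConst (D ρ B δ v₀ : ℝ) : ℝ := (decay D B * v₀ / 2) ^ (-(1 / 8) : ℝ) *
  (margin (geoK D) ρ B * √v₀ / 2) ^ (-(1 / 2) : ℝ) * Real.exp (1 / δ + 2 / (√ρ / 4))

variable {X Y : Finset ℤ} {F : ℂ → ℂ} {Φ V₁ : ℝ}

lemma seg_ctl (hXY : Dual (block x M) T (e₁ * e₂) X Y) (hΦ : 0 ≤ Φ)
    (hF : ∀ z : ℂ, (∀ k : ℤ, z ≠ k) → Near (tailR ρ B) N (N * blockL N x M) (N * blockR N x) z →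
      ‖F z‖ ≤ Φ * ratio X Y z) :
    ArcCtl (((N : ℝ) : ℂ) * σ) (N * blockL N x M) (N * blockR N x) e₁ e₂ F h.seg
      (segConst D ρ B δ v₀ * (Φ * ratio X Y (((N : ℝ) : ℂ) * σ) * (N : ℝ) ^ (3 / 8 : ℝ))) := by
  have hN := h.bulk.N_pos
  have hκ := decay_pos (B := B) h.bulk.one_lt
  have hv₀ := h.time_pos
  have hsv := Real.sqrt_pos.2 hv₀
  have hmg := h.reg.margin_pos
  have hE := ratio_nonneg X Y (((N : ℝ) : ℂ) * σ)
  have hlen : ‖((h.endHalf : ℝ) : ℂ) - h.endPt‖ ≤ N := by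
    have := mul_le_mul_of_nonneg_right h.le_half hN.le
    linarith [h.seg_len]
  have hA2 := arcCtl_seg (F := F) (e₁ := e₁) (e₂ := e₂) (τ := ((N : ℝ) : ℂ) * σ)
      (a := N * blockL N x M) (b := N * blockR N x)
      (Φ := Φ * (Real.exp (1 / δ + 2 / (√ρ / 4)) * ratio X Y (((N : ℝ) : ℂ) * σ)))
      (κ := decay D B * v₀ / 2) (g := margin (geoK D) ρ B * √v₀ / 2) hN (by positivity)
      (by positivity) (by positivity) hlen (fun z hz => h.seg_sided hz) (by
    intro s hs
    have hs' : s ∈ Icc (0 : ℝ) 1 := Ioo_subset_Icc_self hs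
    have him : 0 < (h.seg.fn s).im := by
      rw [seg, seg_im]; exact mul_pos (by linarith [hs.2]) h.endPt_im_pos
    have h1 := mul_le_mul_of_nonneg_left (h.seg_ratio_le hXY hs') hΦ
    rw [← mul_assoc] at h1
    constructor
    · exact (hF _ (not_int_of_im him.ne') (h.seg_near hs')).trans h1
    · refine (hF _ (not_int_of_im ?_) (h.seg_near hs').star).trans ?_
      · rw [Complex.conj_im]; exact (neg_neg_of_pos him).ne
      · rw [ratio_conj]; exact h1)
  refine hA2.mono (le_of_eq ?_)
  rw [segConst]; ring

lemma path_ctl (hV₁ : V ≤ V₁) (hXY : Dual (block x M) T (e₁ * e₂) X Y) (hΦ : 0 ≤ Φ)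
    (hF : ∀ z : ℂ, (∀ k : ℤ, z ≠ k) → Near (tailR ρ B) N (N * blockL N x M) (N * blockR N x) z →
      ‖F z‖ ≤ Φ * ratio X Y z) :
    PathCtl (((N : ℝ) : ℂ) * σ) (N * blockL N x M) (N * blockR N x) e₁ e₂ F
      (2 * ((Bulk.arcConst D ρ B δ V₁ + segConst D ρ B δ v₀) *
        (Φ * ratio X Y (((N : ℝ) : ℂ) * σ) * (N : ℝ) ^ (3 / 8 : ℝ)))) h.path := by
  have hN := h.bulk.N_pos
  have hv₀ := h.time_pos
  have hsv := Real.sqrt_pos.2 hv₀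
  have hmg := h.reg.margin_pos
  have hz₀0 : h.endPt = h.seg.fn 0 := by simp [seg, Arc.seg]
  have hc1 : (h.endHalf : ℂ) = h.seg.fn 1 := by simp [seg, Arc.seg]
  have hB1 := h.bulk.arc_ctl h.reg hV₁ hXY hΦ hF
  have hB2 := h.seg_ctl hXY hΦ hF
  have h0 : 0 ≤ Φ * ratio X Y (((N : ℝ) : ℂ) * σ) * (N : ℝ) ^ (3 / 8 : ℝ) := by
    have := ratio_nonneg X Y (((N : ℝ) : ℂ) * σ)
    positivity
  have hκ := decay_pos (B := B) h.bulk.one_lt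
  have hV₁0 : 0 ≤ V₁ := h.reg.len.le.trans hV₁
  have h2 := h.reg.speed_nonneg
  have hc₁ : 0 ≤ Bulk.arcConst D ρ B δ V₁ := by unfold Bulk.arcConst; positivity
  have hc₂ : 0 ≤ segConst D ρ B δ v₀ := by unfold segConst; positivity
  set β := (Bulk.arcConst D ρ B δ V₁ + segConst D ρ B δ v₀) *
    (Φ * ratio X Y (((N : ℝ) : ℂ) * σ) * (N : ℝ) ^ (3 / 8 : ℝ)) with hβ
  have hB1' := hB1.mono (β' := β) (mul_le_mul_of_nonneg_right (by linarith) h0)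
  have hB2' := hB2.mono (β' := β) (mul_le_mul_of_nonneg_right (by linarith) h0)
  refine ⟨h.reg.sign₁, ⟨fun _ => β, ?_, ?_⟩, ?_,
    (h.reg.arc N).fn '' Ioc 0 V ∪ h.seg.support, ?_, ?_, ?_, ?_⟩
  · simp only [path, List.mem_cons, List.not_mem_nil, or_false, forall_eq_or_imp, forall_eq]
    exact ⟨hB1', hB2'⟩
  · simp only [path, List.map_cons, List.map_nil, List.sum_cons, List.sum_nil, add_zero]
    exact le_of_eq (by ring)
  · simp only [path, List.mem_cons, List.not_mem_nil, or_false, forall_eq_or_imp, forall_eq]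
    exact ⟨fun z hz => h.reg.arc_closed hN hz, fun z hz => (h.seg_sided hz).mono (by positivity)⟩
  · exact IsPreconnected.union h.endPt ⟨V, ⟨h.reg.len, le_rfl⟩, rfl⟩
      ⟨0, by simp [seg, Arc.seg], hz₀0.symm⟩
      (h.reg.arc_open hN).1 (isPreconnected_support _)
  · refine Or.inr ⟨1, by simp [seg, Arc.seg], ?_⟩
    rw [← hc1, endHalf]
  · simp only [path, List.mem_cons, List.not_mem_nil, or_false, forall_eq_or_imp, forall_eq]
    exact ⟨fun v hv => Or.inl ⟨v, ⟨hv.1, hv.2.le⟩, rfl⟩,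
      fun v hv => Or.inr ⟨v, Ioo_subset_Icc_self hv, rfl⟩⟩
  · rintro z (hz | hz)
    · exact (h.reg.arc_open hN).2 z hz
    · exact ⟨_, by positivity, h.seg_sided hz⟩

end CurveTail

end GTBulk

end

noncomputable section

namespace GTBulk

open MeasureTheory Set
open scoped BigOperators ComplexConjugate

namespace CurveTail

variable {D : ℝ} {N : ℕ} {T : Finset ℤ} {x : ℤ} {M : ℕ} {σ : ℂ} {ρ B δ V v₀ : ℝ}

lemma endHalf_mid (h : CurveTail D N T x M σ (-1) (-1) ρ B δ V v₀) :
    (x : ℝ) - M + (√ρ / 2 * N - 1) ≤ h.endHalf ∧ h.endHalf ≤ x - (√ρ / 2 * N) := by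
  have hN := h.bulk.N_pos
  have hL : (N : ℝ) * blockL N x M = x - M - 1 / 2 := by unfold blockL; field_simp
  have hR : (N : ℝ) * blockR N x = x - 1 / 2 := by unfold blockR; field_simp
  have h1 := h.dist_left
  have h2 := h.dist_right
  have h3 := abs_le.1 h.endHalf_sub
  obtain ⟨-, -, h4, h5⟩ | ⟨-, h0, -⟩ | ⟨h0, -⟩ := h.loc
  · change blockL N x M < h.endRe at h4
    change h.endRe < blockR N x at h5
    rw [abs_of_pos (by linarith)] at h1
    rw [abs_of_neg (by linarith)] at h2
    constructor <;> nlinarith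
  · norm_num at h0
  · norm_num at h0

lemma endHalf_left (h : CurveTail D N T x M σ (-1) 1 ρ B δ V v₀) :
    h.endHalf ≤ x - M - (√ρ / 2 * N) := by
  have hN := h.bulk.N_pos
  have hL : (N : ℝ) * blockL N x M = x - M - 1 / 2 := by unfold blockL; field_simp
  have h1 := h.dist_left
  have h3 := abs_le.1 h.endHalf_sub
  obtain ⟨-, h0, -⟩ | ⟨-, -, h4⟩ | ⟨h0, -⟩ := h.loc
  · norm_num at h0
  · change h.endRe < blockL N x M at h4
    rw [abs_of_neg (by linarith)] at h1
    nlinarith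
  · norm_num at h0

lemma endHalf_right (h : CurveTail D N T x M σ 1 (-1) ρ B δ V v₀) :
    (x : ℝ) + (√ρ / 2 * N - 1) ≤ h.endHalf := by
  have hN := h.bulk.N_pos
  have hR : (N : ℝ) * blockR N x = x - 1 / 2 := by unfold blockR; field_simp
  have h2 := h.dist_right
  have h3 := abs_le.1 h.endHalf_sub
  obtain ⟨h0, -⟩ | ⟨h0, -⟩ | ⟨-, -, h4⟩ := h.loc
  · norm_num at h0
  · norm_num at h0
  · change blockR N x < h.endRe at h4
    rw [abs_of_pos (by linarith)] at h2
    nlinarith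

end CurveTail

/-- Level curves with a negative sign end near the real axis, uniformly. -/
theorem exists_curveTail {D : ℝ} (hD : 1 < D) : ∃ ρ B δ v₀ V₁ N₀ : ℝ, 0 < ρ ∧ 0 < δ ∧
    ∀ (N : ℕ) (T : Finset ℤ) (x : ℤ) (M : ℕ) (σ : ℂ), N₀ ≤ N → Bulk D N T x M σ →
    ∀ e₁ e₂ : ℝ, (e₁ = -1 ∧ e₂ = -1 ∨ e₁ = -1 ∧ e₂ = 1 ∨ e₁ = 1 ∧ e₂ = -1) →
      ∃ V, CurveTail D N T x M σ e₁ e₂ ρ B δ V v₀ ∧ V ≤ V₁ := by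
  have hK := geoK_ge_one hD
  set K := geoK D with hKd
  have hρ := minDist_pos hK
  have hρ' := Real.sqrt_pos.2 hρ
  have hK0 : 0 < K := by linarith
  obtain ⟨δ₁, hδ₁, hloc⟩ := exists_location_height K
  set B : ℝ := 16 * K ^ 2
  set v₀ : ℝ := 1 / (10000 * K ^ 10)
  have hv₀ : 0 < v₀ := by positivity
  have hmg : 0 < margin K (minDist K) B := by unfold margin; positivity
  have hκ := decay_pos (B := B) hD
  have hv₀' := Real.sqrt_pos.2 hv₀
  obtain ⟨δ, hδ, h1, h2, h3, h4, h5, h6⟩ : ∃ δ : ℝ, 0 < δ ∧ δ < δ₁ ∧ δ ≤ 1 / (2 * K) ∧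
      δ ≤ √(minDist K) / 2 ∧ δ ≤ margin K (minDist K) B * √v₀ / 4 ∧
      δ ≤ √(minDist K) / 4 * √(decay D B * v₀ / 2) ∧ δ ≤ 1 / 2 := by
    have := Real.sqrt_pos.2 (show 0 < decay D B * v₀ / 2 by positivity)
    refine ⟨min (δ₁ / 2) (min (1 / (2 * K)) (min (√(minDist K) / 2)
      (min (margin K (minDist K) B * √v₀ / 4) (min (√(minDist K) / 4 * √(decay D B * v₀ / 2))
        (1 / 2))))), by positivity, ?_, ?_, ?_, ?_, ?_, ?_⟩
    · exact (min_le_left _ _).trans_lt (by linarith)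
    all_goals simp
  refine ⟨minDist K, B, δ, v₀, 64 * K ^ 6, max (1 / δ) (4 / √(minDist K)), hρ, hδ, ?_⟩
  intro N T x M σ hN h e₁ e₂ he
  have hg : Geo K σ (blockL N x M) (blockR N x) := h.geo
  have he₁ : e₁ = 1 ∨ e₁ = -1 := by tauto
  have he₂ : e₂ = 1 ∨ e₂ = -1 := by tauto
  have hm : e₁ = -1 ∨ e₂ = -1 := by tauto
  have hδK : δ < 1 / K := h2.trans_lt (one_div_lt_one_div_of_lt hK0 (by linarith))
  obtain ⟨V, hV, hY, hh⟩ := exists_curve_end hg hm hδ hδK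
  have hb := curve_minus_bounds hg he₁ he₂ hm hV.le (by rw [hY]; positivity)
  refine ⟨V, ⟨h, curveReg_minus hg he₁ he₂ hm hδ hV hh, hY, hv₀,
    time_lower hg he₁ he₂ hm hV hδ.le h2 hY, h3, h4, h5, h6, ?_, ?_, ?_⟩, hb.1⟩
  · have := (le_max_left _ _).trans hN
    rwa [div_le_iff₀ hδ, mul_comm] at this
  · have := (le_max_right _ _).trans hN
    rwa [div_le_iff₀ hρ', mul_comm] at this
  · have hY0 : 0 ≤ curveImSq σ (blockL N x M) (blockR N x) e₁ e₂ V := by rw [hY]; positivity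
    have hY1 : curveImSq σ (blockL N x M) (blockR N x) e₁ e₂ V < δ₁ ^ 2 := by
      rw [hY]; exact pow_lt_pow_left₀ h1 hδ.le (by norm_num)
    obtain ⟨g1, g2, g3⟩ := hloc _ _ _ V hg hV.le
    rcases he with ⟨e1, e2⟩ | ⟨e1, e2⟩ | ⟨e1, e2⟩
    · exact Or.inl ⟨e1, e2, g1 e1 e2 hY0 hY1⟩
    · exact Or.inr (Or.inl ⟨e1, e2, g2 e1 e2 hY0 hY1⟩)
    · exact Or.inr (Or.inr ⟨e1, e2, g3 e1 e2 hY0 hY1⟩)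

end GTBulk

end

noncomputable section

namespace GTBulk

open MeasureTheory Set
open scoped BigOperators ComplexConjugate

/-- The quotient of the products over the block and over the top row. -/
def blockQuot (T : Finset ℤ) (x : ℤ) (M : ℕ) (z : ℂ) : ℂ :=
  (∏ k ∈ block x M, (z - k)) / ∏ k ∈ T, (z - k)

lemma norm_blockQuot {T : Finset ℤ} {x : ℤ} {M : ℕ} {z : ℂ} (hz : ∀ k : ℤ, z ≠ k) :
    ‖blockQuot T x M z‖ = ratio (block x M \ T) (T \ block x M) z := by
  have h0 : ∀ S : Finset ℤ, ∏ k ∈ S, ‖z - (k : ℂ)‖ ≠ 0 := fun S =>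
    Finset.prod_ne_zero_iff.2 fun k _ => norm_ne_zero_iff.2 (sub_ne_zero.2 (hz k))
  have h1 := Finset.prod_inter_mul_prod_sdiff (block x M) T (fun k : ℤ => ‖z - (k : ℂ)‖)
  have h2 := Finset.prod_inter_mul_prod_sdiff T (block x M) (fun k : ℤ => ‖z - (k : ℂ)‖)
  rw [Finset.inter_comm] at h2
  rw [blockQuot, norm_div, norm_prod, norm_prod, ← h1, ← h2, ratio,
    mul_div_mul_left _ _ (h0 _)]

lemma blockQuot_ne_zero {T : Finset ℤ} {x : ℤ} {M : ℕ} {z : ℂ} (hz : ∀ k : ℤ, z ≠ k) :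
    blockQuot T x M z ≠ 0 :=
  div_ne_zero (Finset.prod_ne_zero_iff.2 fun k _ => sub_ne_zero.2 (hz k))
    (Finset.prod_ne_zero_iff.2 fun k _ => sub_ne_zero.2 (hz k))

lemma ratio_swap_eq_inv {A B : Finset ℤ} {z : ℂ} : ratio B A z = (ratio A B z)⁻¹ := by
  unfold ratio; rw [inv_div]

section Factors

variable {N : ℕ} {t : TopRow N} {x₁ x₂ : ℤ} {n₁ n₂ : ℕ} {z : ℂ}

lemma wFactor_eq (ht : StrictAnti t) :
    wFactor N t x₁ n₁ z = (blockQuot (rowSet t) x₁ (N - n₁) z)⁻¹ * (z - x₁)⁻¹ := by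
  have h : pochRoots x₁ (N - n₁ + 1) = insert x₁ (block x₁ (N - n₁)) := by
    ext k; simp only [pochRoots, block, Finset.mem_Ioc, Finset.mem_insert]; omega
  rw [wFactor, prod_rowSet ht, poch_eq_prod, h, Finset.prod_insert (by simp [block, pochRoots]),
    blockQuot, inv_div, mul_comm (z - (x₁ : ℂ)), div_mul_eq_div_mul_one_div, one_div]

/-- The first factor in terms of the block of the first point. -/
lemma exists_zFactor_eq (ht : StrictAnti t) {d : ℕ} {R : ℝ} (hR : 0 < R) (hN : 0 < N)
    (hz : ∀ k : ℤ, z ≠ k)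
    (he : |x₂ - x₁| ≤ d) (hg : |x₂ - x₁ + (N - n₁ : ℕ) - (N - n₂ - 1 : ℕ)| ≤ d)
    (hM : d ≤ N - n₁) (hdN : 8 * (d + 1) ^ 2 * R ≤ N)
    (h₁ : N / R ≤ ‖z - x₁‖) (h₂ : N / R ≤ ‖z - x₁ + (N - n₁ : ℕ)‖) :
    ∃ θ : ℂ, ‖θ‖ ≤ 16 * (d + 1) ^ 2 * R / N ∧ zFactor N t x₂ n₂ z =
      blockQuot (rowSet t) x₁ (N - n₁) z * ((z - x₁) ^ (x₂ - x₁) *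
        ((z - x₁ + (N - n₁ : ℕ)) ^ (x₂ - x₁ + (N - n₁ : ℕ) - (N - n₂ - 1 : ℕ)))⁻¹) * (1 + θ) := by
  set M := N - n₁
  set M₂ := N - n₂ - 1
  have hN' : (0 : ℝ) < N := by exact_mod_cast hN
  set ε : ℝ := (d + 1) * R / N with hε
  have hε0 : 0 ≤ ε := by positivity
  have hdε : 8 * (d + 1) * ε ≤ 1 := by
    rw [hε, ← mul_div_assoc, div_le_one hN']; linarith
  have hdε2 : 2 * (d + 1) * ε ≤ 1 := by
    have : (0 : ℝ) ≤ (d + 1) * ε := by positivity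
    linarith
  have hy : z - x₁ ≠ 0 := sub_ne_zero.2 (hz x₁)
  have hy2 : z - x₁ + (M : ℕ) ≠ 0 := by
    have := sub_ne_zero.2 (hz (x₁ - M))
    push_cast at this
    rwa [sub_sub_eq_add_sub, add_sub_right_comm] at this
  have hd1 : ∀ {y : ℂ}, N / R ≤ ‖y‖ → (d + 1 : ℝ) ≤ ε * ‖y‖ := by
    intro y h
    calc (d + 1 : ℝ) = ε * (N / R) := by rw [hε]; field_simp
      _ ≤ _ := by gcongr
  obtain ⟨θ₁, a1, b1⟩ := signedProd_approx (f := fun k : ℤ => z - k) (u := x₁ - 1) (v := x₂ - 1)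
    (d := d) (ε := ε) hy (by rw [sub_sub_sub_cancel_right]; exact he) hε0 hdε2 (by
      intro k hk
      refine le_trans ?_ (hd1 h₁)
      have h1 : (z - k) - (z - x₁) = ((x₁ - k : ℤ) : ℂ) := by push_cast; ring
      rw [h1, Complex.norm_intCast]
      have h2 : |x₁ - k| ≤ d + 1 := by rw [abs_le] at hk ⊢; omega
      exact_mod_cast h2)
  obtain ⟨θ₂, a2, b2⟩ := signedProd_approx (f := fun k : ℤ => z - k) (u := x₁ - 1 - M)
    (v := x₂ - 1 - M₂) (d := d) (ε := ε) hy2 (by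
      rw [abs_le] at hg ⊢; omega) hε0 hdε2 (by
      intro k hk
      refine le_trans ?_ (hd1 h₂)
      have h1 : (z - k) - (z - x₁ + M) = ((x₁ - M - k : ℤ) : ℂ) := by push_cast; ring
      rw [h1, Complex.norm_intCast]
      have h2 : |x₁ - M - k| ≤ d + 1 := by rw [abs_le] at hk ⊢; omega
      exact_mod_cast h2)
  have e1 : x₂ - 1 - (x₁ - 1) = x₂ - x₁ := by ring
  have e2 : x₂ - 1 - M₂ - (x₁ - 1 - M) = x₂ - x₁ + M - M₂ := by ring
  rw [e1] at b1
  rw [e2] at b2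
  have hd' : (0 : ℝ) ≤ d := Nat.cast_nonneg d
  have c2 : ‖θ₂‖ ≤ 1 / 2 := by nlinarith
  have hθ2 : (1 + θ₂) ≠ 0 := by
    intro h
    have : θ₂ = -1 := by linear_combination h
    rw [this] at c2
    norm_num at c2
  have c3 : 1 / 2 ≤ ‖1 + θ₂‖ := by
    have := norm_sub_norm_le (1 : ℂ) (-θ₂)
    rw [norm_one, norm_neg, sub_neg_eq_add] at this
    linarith
  refine ⟨(θ₁ - θ₂) / (1 + θ₂), ?_, ?_⟩
  · rw [norm_div, div_le_iff₀ (norm_pos_iff.2 hθ2)]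
    have h3 : 16 * (d + 1) ^ 2 * R / N = 16 * (d + 1) * ε := by rw [hε]; ring
    rw [h3]
    calc ‖θ₁ - θ₂‖ ≤ ‖θ₁‖ + ‖θ₂‖ := norm_sub_le _ _
      _ ≤ 16 * (d + 1) * ε * (1 / 2) := by nlinarith
      _ ≤ _ := by gcongr
  · have hz0 : ∀ k ∈ Finset.Ioc (x₂ - 1) (x₁ - 1), z - (k : ℂ) ≠ 0 := fun k _ =>
      sub_ne_zero.2 (hz k)
    have key := prod_Ioc_eq_signedProd (f := fun k : ℤ => z - k) (l₁ := x₁ - 1 - M)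
      (l₂ := x₂ - 1 - M₂) (u₁ := x₁ - 1) (u₂ := x₂ - 1)
      (m := max (x₁ - 1 - M) (x₂ - 1 - M₂)) (le_max_left _ _) (le_max_right _ _)
      (by rw [abs_le] at hg; omega) (by rw [abs_le] at he hg; omega) hz0
      (fun k _ => sub_ne_zero.2 (hz k))
    have hpoch : poch (z - (x₂ : ℂ) + 1) M₂ = ∏ k ∈ Finset.Ioc (x₂ - 1 - M₂) (x₂ - 1), (z - k) := by
      rw [← pochRoots, ← poch_eq_prod]
      push_cast
      rw [sub_sub_eq_add_sub, add_sub_right_comm]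
    rw [zFactor, hpoch, key, b1, b2, prod_rowSet ht, blockQuot, block, pochRoots]
    have h1θ : 1 + (θ₁ - θ₂) / (1 + θ₂) = (1 + θ₁) * (1 + θ₂)⁻¹ := by
      field_simp; ring
    rw [h1θ, mul_inv]
    ring

lemma zpow_le_of_between {a b R : ℝ} {k : ℤ} {d : ℕ} (hb : 0 < b) (hR : 1 ≤ R)
    (h1 : b / R ≤ a) (h2 : a ≤ b * R) (hk : |k| ≤ d) : a ^ k ≤ R ^ d * b ^ k := by
  have ha : 0 < a := lt_of_lt_of_le (by positivity) h1
  obtain ⟨n, rfl | rfl⟩ := k.eq_nat_or_neg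
  · rw [zpow_natCast, zpow_natCast]
    rw [Nat.abs_cast] at hk
    calc a ^ n ≤ (b * R) ^ n := pow_le_pow_left₀ ha.le h2 n
      _ = R ^ n * b ^ n := by rw [mul_pow, mul_comm]
      _ ≤ _ := by gcongr; exact_mod_cast hk
  · rw [zpow_neg, zpow_neg, zpow_natCast, zpow_natCast]
    rw [abs_neg, Nat.abs_cast] at hk
    rw [div_le_iff₀ (by positivity)] at h1
    have h3 : b ^ n ≤ R ^ d * a ^ n := by
      calc b ^ n ≤ (a * R) ^ n := pow_le_pow_left₀ hb.le h1 n
        _ = R ^ n * a ^ n := by rw [mul_pow, mul_comm]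
        _ ≤ _ := by gcongr; exact_mod_cast hk
    rw [inv_le_iff_one_le_mul₀ (by positivity), mul_comm _ (a ^ n), ← mul_assoc,
      ← div_eq_mul_inv, le_div_iff₀ (by positivity), one_mul, mul_comm (a ^ n)]
    exact h3

/-- Bound for the first factor. -/
lemma norm_zFactor_le (ht : StrictAnti t) {d : ℕ} {R R' : ℝ} (hR : 0 < R) (hR' : R ≤ R')
    (hR1 : 1 ≤ R') (hN : 0 < N) (hz : ∀ k : ℤ, z ≠ k)
    (he : |x₂ - x₁| ≤ d) (hg : |x₂ - x₁ + (N - n₁ : ℕ) - (N - n₂ - 1 : ℕ)| ≤ d)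
    (hM : d ≤ N - n₁) (hdN : 8 * (d + 1) ^ 2 * R ≤ N)
    (h₁ : N / R ≤ ‖z - x₁‖) (h₂ : N / R ≤ ‖z - x₁ + (N - n₁ : ℕ)‖)
    (h₃ : ‖z - x₁‖ ≤ N * R') (h₄ : ‖z - x₁ + (N - n₁ : ℕ)‖ ≤ N * R') :
    ‖zFactor N t x₂ n₂ z‖ ≤ 3 * R' ^ (2 * d) * (N : ℝ) ^ ((N - n₂ - 1 : ℕ) - (N - n₁ : ℕ) : ℤ) *
      ratio (block x₁ (N - n₁) \ rowSet t) (rowSet t \ block x₁ (N - n₁)) z := by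
  obtain ⟨θ, h5, h6⟩ := exists_zFactor_eq ht hR hN hz he hg hM hdN h₁ h₂
  have hN' : (0 : ℝ) < N := by exact_mod_cast hN
  have h7 : ‖1 + θ‖ ≤ 3 := by
    have h8 : 16 * (d + 1) ^ 2 * R / N ≤ 2 := by rw [div_le_iff₀ hN']; linarith
    have := norm_add_le (1 : ℂ) θ
    rw [norm_one] at this
    linarith
  have hRR : N / R' ≤ N / R := by gcongr
  have h8 := zpow_le_of_between hN' hR1 (hRR.trans h₁) h₃ he
  have h9 := zpow_le_of_between hN' hR1 (hRR.trans h₂) h₄ (by rwa [← abs_neg] at hg)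
  have hr := ratio_nonneg (block x₁ (N - n₁) \ rowSet t) (rowSet t \ block x₁ (N - n₁)) z
  rw [h6, norm_mul, norm_mul, norm_blockQuot hz, norm_mul, norm_inv, norm_zpow, norm_zpow,
    ← zpow_neg]
  calc _ ≤ ratio (block x₁ (N - n₁) \ rowSet t) (rowSet t \ block x₁ (N - n₁)) z *
      ((R' ^ d * (N : ℝ) ^ (x₂ - x₁)) *
        (R' ^ d * (N : ℝ) ^ (-(x₂ - x₁ + (N - n₁ : ℕ) - (N - n₂ - 1 : ℕ))))) * 3 := by
        refine mul_le_mul ?_ h7 (norm_nonneg _) (by positivity)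
        refine mul_le_mul_of_nonneg_left ?_ hr
        exact mul_le_mul h8 h9 (by positivity) (by positivity)
    _ = 3 * (R' ^ d * R' ^ d) * ((N : ℝ) ^ (x₂ - x₁) *
        (N : ℝ) ^ (-(x₂ - x₁ + (N - n₁ : ℕ) - (N - n₂ - 1 : ℕ)))) *
          ratio (block x₁ (N - n₁) \ rowSet t) (rowSet t \ block x₁ (N - n₁)) z := by ring
    _ = _ := by
      rw [← zpow_add₀ hN'.ne', ← pow_add, ← two_mul]
      congr 3
      ring

/-- Bound for the second factor. -/
lemma norm_wFactor_le (ht : StrictAnti t) {R : ℝ} (hR : 0 < R) (hN : 0 < N) (hz : ∀ k : ℤ, z ≠ k)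
    (h₁ : N / R ≤ ‖z - x₁‖) : ‖wFactor N t x₁ n₁ z‖ ≤ R / N *
      ratio (rowSet t \ block x₁ (N - n₁)) (block x₁ (N - n₁) \ rowSet t) z := by
  have hN' : (0 : ℝ) < N := by exact_mod_cast hN
  rw [wFactor_eq ht, norm_mul, norm_inv, norm_inv, norm_blockQuot hz, ← ratio_swap_eq_inv, mul_comm]
  refine mul_le_mul_of_nonneg_right ?_ (ratio_nonneg _ _ _)
  rw [← inv_div]
  exact inv_anti₀ (by positivity) h₁

end Factors

/-- The point `z` has distance at least comparable to `N` from both end points. -/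
def Far (R R' N a b : ℝ) (z : ℂ) : Prop :=
  (N / R ≤ ‖z - a‖ ∧ ‖z - a‖ ≤ N * R') ∧ (N / R ≤ ‖z - b‖ ∧ ‖z - b‖ ≤ N * R')

lemma Far.star {R R' N a b : ℝ} {z : ℂ} (h : Far R R' N a b z) : Far R R' N a b (conj z) := by
  unfold Far
  rw [Sided.norm_conj_sub, Sided.norm_conj_sub]
  exact h

lemma Far.base {D : ℝ} {N : ℕ} {T : Finset ℤ} {x : ℤ} {M : ℕ} {σ : ℂ}
    (h : Bulk D N T x M σ) {R R' : ℝ} (hR : 0 < R) (hN : R ≤ N) (hN' : 1 ≤ N * R') {z : ℂ}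
    (hz : Far R R' N (N * blockL N x M) (N * blockR N x) z) :
    (N / (2 * R) ≤ ‖z - x‖ ∧ N / (2 * R) ≤ ‖z - x + M‖) ∧
      ‖z - x‖ ≤ N * (2 * R') ∧ ‖z - x + M‖ ≤ N * (2 * R') := by
  have hN0 := h.N_pos
  have hL : (N : ℝ) * blockL N x M = x - M - 1 / 2 := by unfold blockL; field_simp
  have hRr : (N : ℝ) * blockR N x = x - 1 / 2 := by unfold blockR; field_simp
  obtain ⟨⟨h1, h2⟩, h3, h4⟩ := hz
  rw [hL] at h1 h2
  rw [hRr] at h3 h4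
  have hhalf : 1 / 2 ≤ N / (2 * R) := by
    rw [div_le_div_iff₀ (by norm_num) (by positivity)]; linarith
  have hsplit : (N : ℝ) / R = N / (2 * R) + N / (2 * R) := by field_simp; ring
  have aux : ∀ u v : ℂ, ‖u - v‖ = 1 / 2 → |‖u‖ - ‖v‖| ≤ 1 / 2 := fun u v huv =>
    (abs_norm_sub_norm_le u v).trans huv.le
  have e1 := abs_le.1 (aux (z - x) (z - ((x - 1 / 2 : ℝ) : ℂ)) (by
    have : z - x - (z - ((x - 1 / 2 : ℝ) : ℂ)) = -(1 / 2) := by push_cast; ring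
    rw [this, norm_neg]; norm_num))
  have e2 := abs_le.1 (aux (z - x + M) (z - ((x - M - 1 / 2 : ℝ) : ℂ)) (by
    have : z - x + M - (z - ((x - M - 1 / 2 : ℝ) : ℂ)) = -(1 / 2) := by push_cast; ring
    rw [this, norm_neg]; norm_num))
  refine ⟨⟨?_, ?_⟩, ?_, ?_⟩ <;> linarith [e1.1, e1.2, e2.1, e2.2]

end GTBulk

end

noncomputable section

namespace GTBulk

open MeasureTheory Set
open scoped BigOperators ComplexConjugate

/-- The vertical ray above `z₀`, up to the height `l * z₀.im`. -/
def rayArc (z₀ : ℂ) (l : ℝ) (hl : 1 ≤ l) : Arc where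
  lo := 1
  hi := l
  le := hl
  fn y := z₀.re + (y : ℂ) * (z₀.im * Complex.I)
  dfn _ := z₀.im * Complex.I
  cont := by fun_prop
  der v _ := by
    have h : HasDerivAt (fun s : ℝ => (s : ℂ)) 1 v := by
      simpa using (hasDerivAt_id v).ofReal_comp
    simpa using (h.mul_const (z₀.im * Complex.I)).const_add (z₀.re : ℂ)
  int := by simp

section Ray

variable {z₀ : ℂ} {l : ℝ} {hl : 1 ≤ l} {y : ℝ}

lemma rayArc_re : ((rayArc z₀ l hl).fn y).re = z₀.re := by simp [rayArc]

lemma rayArc_im : ((rayArc z₀ l hl).fn y).im = y * z₀.im := by simp [rayArc]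

lemma rayArc_one : (rayArc z₀ l hl).fn 1 = z₀ := by
  apply Complex.ext
  · rw [rayArc_re]
  · rw [rayArc_im, one_mul]

lemma norm_sub_real_sq (z : ℂ) (q : ℝ) : ‖z - q‖ ^ 2 = (z.re - q) ^ 2 + z.im ^ 2 := by
  rw [← Complex.normSq_eq_norm_sq, Complex.normSq_apply]
  simp; ring

lemma le_norm_rayArc_sub (hy : 1 ≤ y) (q : ℝ) :
    ‖z₀ - q‖ ≤ ‖(rayArc z₀ l hl).fn y - q‖ := by
  refine le_of_sq_le_sq ?_ (norm_nonneg _)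
  rw [norm_sub_real_sq, norm_sub_real_sq, rayArc_re, rayArc_im]
  nlinarith [sq_nonneg z₀.im, mul_le_mul hy hy zero_le_one (by linarith)]

lemma norm_rayArc_sub_le (hy : 1 ≤ y) (q : ℝ) :
    ‖(rayArc z₀ l hl).fn y - q‖ ≤ ‖z₀ - q‖ * y := by
  refine le_of_sq_le_sq ?_ (by positivity)
  rw [mul_pow, norm_sub_real_sq, norm_sub_real_sq, rayArc_re, rayArc_im]
  nlinarith [sq_nonneg (z₀.re - q), mul_le_mul hy hy zero_le_one (by linarith)]

lemma Sided.rayArc {τ : ℂ} {a b s : ℝ} (h : Sided τ a b 1 1 s z₀) (hy : 1 ≤ y) :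
    Sided τ a b 1 1 s ((rayArc z₀ l hl).fn y) := by
  have h1 := le_norm_rayArc_sub (z₀ := z₀) (l := l) (hl := hl) hy a
  have h2 := le_norm_rayArc_sub (z₀ := z₀) (l := l) (hl := hl) hy b
  obtain ⟨h3, h4⟩ := h
  exact ⟨by linarith, by linarith⟩

end Ray

/-- The level curve with positive signs, up to a time at which it lies above most of the
row. -/
structure CurveRay (D : ℝ) (N : ℕ) (T : Finset ℤ) (x : ℤ) (M : ℕ) (σ : ℂ)
    (ρ B δ V : ℝ) : Prop where
  bulk : Bulk D N T x M σ
  reg : CurveReg (geoK D) ρ B δ σ (blockL N x M) (blockR N x) 1 1 V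
  far : |curveRe σ (blockL N x M) (blockR N x) 1 1 V| + cutoff D ≤
    1 / √(2 * D) * √(curveImSq σ (blockL N x M) (blockR N x) 1 1 V)

namespace CurveRay

variable {D : ℝ} {N : ℕ} {T : Finset ℤ} {x : ℤ} {M : ℕ} {σ : ℂ} {ρ B δ V : ℝ}

/-- The end of the dilated level curve. -/
def endPt (_ : CurveRay D N T x M σ ρ B δ V) : ℂ :=
  ((N : ℝ) : ℂ) * curve σ (blockL N x M) (blockR N x) 1 1 V

variable (h : CurveRay D N T x M σ ρ B δ V)

lemma mem_Icc (h : CurveRay D N T x M σ ρ B δ V) : V ∈ Icc 0 V := ⟨h.reg.len.le, le_rfl⟩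

lemma endPt_mem : h.endPt ∈ (h.reg.arc N).support := ⟨V, h.mem_Icc, rfl⟩

lemma endPt_im_pos : 0 < h.endPt.im := h.reg.arc_im_pos h.bulk.N_pos h.endPt_mem

lemma endPt_sided : Sided (((N : ℝ) : ℂ) * σ) (N * blockL N x M) (N * blockR N x) 1 1
    (N * (margin (geoK D) ρ B * √V)) h.endPt := h.reg.arc_sided h.bulk.N_pos h.mem_Icc

lemma endPt_im_le : h.endPt.im ≤ N * √B := by
  have hN := h.bulk.N_pos
  have h0 := (h.reg.im_pos h.mem_Icc).le
  rw [endPt, Complex.im_ofReal_mul]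
  refine mul_le_mul_of_nonneg_left ?_ hN.le
  have h1 := Complex.abs_im_le_norm (curve σ (blockL N x M) (blockR N x) 1 1 V - blockL N x M)
  rw [Complex.sub_im, Complex.ofReal_im, sub_zero] at h1
  refine (le_abs_self _).trans (h1.trans (Real.le_sqrt_of_sq_le ?_))
  rw [← Complex.normSq_eq_norm_sq, normSq_curve_sub_left h.reg.geo.lt h0]
  exact (h.reg.left V h.mem_Icc).2

lemma endPt_far {k : ℤ} (hk : |(k : ℝ)| ≤ cutoff D * N) :
    |h.endPt.re - k| ≤ 1 / √(2 * D) * h.endPt.im := by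
  have hN := h.bulk.N_pos
  have h1 := h.far
  have h2 : h.endPt.re = N * curveRe σ (blockL N x M) (blockR N x) 1 1 V := by
    rw [endPt, Complex.re_ofReal_mul]; rfl
  have h3 : h.endPt.im = N * √(curveImSq σ (blockL N x M) (blockR N x) 1 1 V) := by
    rw [endPt, Complex.im_ofReal_mul, curve_im]
  have h4 := abs_sub h.endPt.re k
  rw [h2, abs_mul, abs_of_pos hN] at h4
  rw [h2, h3]
  have := mul_le_mul_of_nonneg_left h1 hN.le
  linarith

variable {l y : ℝ} {hl : 1 ≤ l}

lemma ray_ratio_le (hy : 1 ≤ y) : ratio (block x M \ T) (T \ block x M) ((rayArc h.endPt l hl).fn y) ≤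
    y ^ (-((N : ℝ) / (4 * D))) * (Real.exp (-(decay D B * V) * N) *
      ratio (block x M \ T) (T \ block x M) (((N : ℝ) : ℂ) * σ)) := by
  have hD := h.bulk.one_lt
  have hη : (1 / √(2 * D)) ^ 2 = 1 / (2 * D) := by
    rw [div_pow, Real.sq_sqrt (by linarith), one_pow]
  have h1 := ratio_ray_le (A := block x M \ T) (B := T \ block x M)
    (G := Bulk.outer T x M (cutoff D * N)) (z := (rayArc h.endPt l hl).fn y) (z₀ := h.endPt)
    (η := 1 / √(2 * D)) rayArc_re h.endPt_im_pos rayArc_im hy (Finset.filter_subset _ _)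
    (fun k hk => h.endPt_far (Finset.mem_filter.1 hk).2) (h.bulk.ray_exponent hη.le)
  refine h1.trans (mul_le_mul_of_nonneg_left ?_ (by positivity))
  have h2 := h.bulk.ratio_curve_le h.reg (X := block x M \ T) (Y := T \ block x M)
    (Or.inl ⟨by norm_num, rfl, rfl⟩) h.mem_Icc
  rwa [show -decay D B * (N * V) = -(decay D B * V) * N by ring] at h2

lemma ray_far (hy : 1 ≤ y) : Far (tailR ρ B) (tailR ρ B * y) N (N * blockL N x M)
    (N * blockR N x) ((rayArc h.endPt l hl).fn y) := by
  obtain ⟨⟨h1, h2⟩, h3, h4⟩ := h.bulk.arc_near h.reg h.mem_Icc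
  have e : ∀ q : ℝ, ‖h.endPt - q‖ ≤ N * tailR ρ B →
      ‖(rayArc h.endPt l hl).fn y - q‖ ≤ N * (tailR ρ B * y) := fun q hq =>
    (norm_rayArc_sub_le hy q).trans (by
      rw [← mul_assoc]; exact mul_le_mul_of_nonneg_right hq (by linarith))
  exact ⟨⟨h1.trans (le_norm_rayArc_sub hy _), e _ h2⟩,
    ⟨h3.trans (le_norm_rayArc_sub hy _), e _ h4⟩⟩

/-- The constant for the ray. -/
def rayConst (D ρ B V : ℝ) : ℝ :=
  (decay D B * V) ^ (-(1 / 8) : ℝ) * (margin (geoK D) ρ B * √V) ^ (-(1 / 2) : ℝ) * √B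

variable {F : ℂ → ℂ} {Φ : ℝ} {d : ℕ}

lemma ray_ctl (hΦ : 0 ≤ Φ) (hd : 4 * D * (2 * d + 2) ≤ N)
    (hF : ∀ (z : ℂ) (y : ℝ), 1 ≤ y → (∀ k : ℤ, z ≠ k) →
      Far (tailR ρ B) (tailR ρ B * y) N (N * blockL N x M) (N * blockR N x) z →
      ‖F z‖ ≤ Φ * y ^ (2 * d) * ratio (block x M \ T) (T \ block x M) z) :
    ArcCtl (((N : ℝ) : ℂ) * σ) (N * blockL N x M) (N * blockR N x) 1 1 F (rayArc h.endPt l hl)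
      (rayConst D ρ B V * (Φ * ratio (block x M \ T) (T \ block x M) (((N : ℝ) : ℂ) * σ) *
        (N : ℝ) ^ (3 / 8 : ℝ))) := by
  have hN := h.bulk.N_pos
  have hD := h.bulk.one_lt
  have hκ := decay_pos (B := B) hD
  have hmg := h.reg.margin_pos
  have hV := h.reg.len
  have hsV := Real.sqrt_pos.2 hV
  set E := ratio (block x M \ T) (T \ block x M) (((N : ℝ) : ℂ) * σ) with hE
  have hE0 : 0 ≤ E := ratio_nonneg _ _ _
  set C := rayConst D ρ B V * (Φ * E * (N : ℝ) ^ (3 / 8 : ℝ)) with hC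
  have hC0 : 0 ≤ C := by
    rw [hC, rayConst]; positivity
  have hcont : ContinuousOn (fun y : ℝ => C * y ^ (-2 : ℝ)) (Icc 1 l) := by
    refine continuousOn_const.mul (ContinuousOn.rpow_const continuousOn_id fun y hy => Or.inl ?_)
    have : (1 : ℝ) ≤ y := hy.1
    change y ≠ 0
    linarith
  refine ⟨fun y => C * y ^ (-2 : ℝ), fun _ => N * (margin (geoK D) ρ B * √V), ?_, ?_, ?_⟩
  · exact ContinuousOn.intervalIntegrable (by rw [uIcc_of_le (rayArc h.endPt l hl).le]; exact hcont)
  · change ∫ y in (1 : ℝ)..l, C * y ^ (-2 : ℝ) ≤ C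
    rw [intervalIntegral.integral_const_mul, integral_rpow (Or.inr ⟨by norm_num, by
      rw [uIcc_of_le hl]; exact fun h0 => by linarith [h0.1]⟩)]
    have : 0 ≤ l ^ (-2 + 1 : ℝ) := Real.rpow_nonneg (by linarith) _
    rw [Real.one_rpow]
    have h2 : (l ^ (-2 + 1 : ℝ) - 1) / (-2 + 1) ≤ 1 := by
      rw [div_le_iff_of_neg (by norm_num)]; linarith
    calc C * _ ≤ C * 1 := mul_le_mul_of_nonneg_left h2 hC0
      _ = C := mul_one C
  · intro y hy
    have hy : y ∈ Ioo 1 l := hy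
    have hy1 : 1 ≤ y := hy.1.le
    have hy0 : 0 < y := by linarith
    have him : 0 < ((rayArc h.endPt l hl).fn y).im := by
      rw [rayArc_im]; exact mul_pos hy0 h.endPt_im_pos
    refine ⟨by positivity, h.endPt_sided.rayArc hy1, ?_⟩
    have hdf : ‖(rayArc h.endPt l hl).dfn y‖ ≤ N * √B := by
      change ‖(h.endPt.im : ℂ) * Complex.I‖ ≤ _
      rw [norm_mul, Complex.norm_I, mul_one, Complex.norm_real, Real.norm_of_nonneg h.endPt_im_pos.le]
      exact h.endPt_im_le
    have hpow : y ^ (2 * d) * y ^ (-((N : ℝ) / (4 * D))) ≤ y ^ (-2 : ℝ) := by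
      rw [← Real.rpow_natCast, ← Real.rpow_add hy0]
      refine Real.rpow_le_rpow_of_exponent_le hy1 ?_
      have : (2 * d + 2 : ℝ) ≤ N / (4 * D) := by
        rw [le_div_iff₀ (by positivity)]; linarith
      push_cast; linarith
    have hG : Φ * y ^ (2 * d) * ratio (block x M \ T) (T \ block x M)
        ((rayArc h.endPt l hl).fn y) ≤
        Φ * E * y ^ (-2 : ℝ) * Real.exp (-(decay D B * V * N)) := by
      calc _ ≤ Φ * y ^ (2 * d) * (y ^ (-((N : ℝ) / (4 * D))) *
            (Real.exp (-(decay D B * V) * N) * E)) :=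
            mul_le_mul_of_nonneg_left (h.ray_ratio_le hy1) (by positivity)
        _ = Φ * E * (y ^ (2 * d) * y ^ (-((N : ℝ) / (4 * D)))) *
            Real.exp (-(decay D B * V * N)) := by rw [neg_mul]; ring
        _ ≤ _ := by gcongr
    have hfin : Φ * E * y ^ (-2 : ℝ) * Real.exp (-(decay D B * V * N)) * (N * √B) ≤
        √(N * (margin (geoK D) ρ B * √V)) * (C * y ^ (-2 : ℝ)) := by
      have h1 := weight_identity hN (g := margin (geoK D) ρ B * √V) (κ := decay D B * V)
        (by positivity) (by positivity) one_pos
      have h2 := exp_neg_le_rpow (y := decay D B * V * N) (by positivity)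
      rw [Real.sqrt_one, Real.one_rpow, Real.one_rpow, mul_one, mul_one, mul_one] at h1
      calc _ = Φ * E * y ^ (-2 : ℝ) * √B * (N * Real.exp (-(decay D B * V * N))) := by ring
        _ ≤ Φ * E * y ^ (-2 : ℝ) * √B * (N * (decay D B * V * N) ^ (-(1 / 8) : ℝ)) := by gcongr
        _ = _ := by rw [← h1, hC, rayConst]; ring
    have hb : 0 ≤ Φ * E * y ^ (-2 : ℝ) * Real.exp (-(decay D B * V * N)) := by positivity
    constructor
    · exact (mul_le_mul ((hF _ y hy1 (not_int_of_im him.ne') (h.ray_far hy1)).trans hG) hdf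
        (norm_nonneg _) hb).trans hfin
    · refine (mul_le_mul ((hF _ y hy1 (not_int_of_im ?_) (h.ray_far hy1).star).trans ?_) hdf
        (norm_nonneg _) hb).trans hfin
      · rw [Complex.conj_im]; exact (neg_neg_of_pos him).ne
      · rw [ratio_conj]; exact hG

end CurveRay

end GTBulk

end

noncomputable section

namespace GTBulk

open MeasureTheory Set
open scoped BigOperators ComplexConjugate

section FarSegment

variable {z₁ : ℂ} {L s : ℝ}

/-- The points of the final segment are far away. -/
lemma le_norm_seg (hz : z₁.im = L) {c : ℝ} (hc : |c - (z₁.re + L)| ≤ 1 / 2)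
    (hL1 : 1 ≤ L) (hL : 8 * |z₁.re| ≤ L) (hs : s ∈ Icc (0 : ℝ) 1) :
    L / 8 ≤ ‖(Arc.seg z₁ c).fn s‖ := by
  obtain ⟨h1, h2⟩ := abs_le.1 hc
  have h3 := (le_abs_self _).trans (Complex.abs_re_le_norm ((Arc.seg z₁ c).fn s))
  have h4 := (le_abs_self _).trans (Complex.abs_im_le_norm ((Arc.seg z₁ c).fn s))
  rw [seg_re] at h3
  rw [seg_im, hz] at h4
  have h5 := neg_abs_le z₁.re
  nlinarith [hs.1, hs.2, mul_le_mul_of_nonneg_left h1 hs.1]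

lemma norm_seg_le (hz : z₁.im = L) {c : ℝ} (hc : |c - (z₁.re + L)| ≤ 1 / 2) (hL1 : 1 ≤ L) :
    ‖(c : ℂ) - z₁‖ ≤ 3 * L := by
  obtain ⟨h1, h2⟩ := abs_le.1 hc
  refine (Complex.norm_le_abs_re_add_abs_im _).trans ?_
  simp only [Complex.sub_re, Complex.ofReal_re, Complex.sub_im, Complex.ofReal_im, zero_sub,
    abs_neg]
  rw [hz, abs_of_pos (a := L) (by linarith), abs_of_pos (a := c - z₁.re) (by linarith)]
  linarith

/-- Control along the final segment. -/
lemma arcCtl_far_seg {τ : ℂ} {a b A r β c : ℝ} {F : ℂ → ℂ} (hz : z₁.im = L)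
    (hc : |c - (z₁.re + L)| ≤ 1 / 2) (hL1 : 1 ≤ L) (hL : 8 * |z₁.re| ≤ L) (hβ : 0 < β)
    (hA : 0 ≤ A) (hF : ∀ z : ℂ, r ≤ ‖z‖ → ‖F z‖ ≤ A / ‖z‖ ^ 2) (hr : 8 * r ≤ L)
    (hLβ : 192 * A / β ≤ L) (ha : 8 * (1 + |a| + ‖τ - a‖) ≤ L)
    (hb : 8 * (1 + |b| + ‖τ - b‖) ≤ L) :
    (∀ s ∈ Icc (0 : ℝ) 1, Sided τ a b 1 1 1 ((Arc.seg z₁ c).fn s)) ∧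
      ArcCtl τ a b 1 1 F (Arc.seg z₁ c) β := by
  have hfar : ∀ s ∈ Icc (0 : ℝ) 1, L / 8 ≤ ‖(Arc.seg z₁ c).fn s‖ := fun s hs =>
    le_norm_seg hz hc hL1 hL hs
  have hsid : ∀ s ∈ Icc (0 : ℝ) 1, Sided τ a b 1 1 1 ((Arc.seg z₁ c).fn s) := by
    intro s hs
    have h1 := hfar s hs
    have h2 : ∀ q : ℝ, ‖(Arc.seg z₁ c).fn s‖ - |q| ≤ ‖(Arc.seg z₁ c).fn s - q‖ := by
      intro q
      have := norm_sub_norm_le ((Arc.seg z₁ c).fn s) q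
      rwa [Complex.norm_real] at this
    have h3 := h2 a
    have h4 := h2 b
    constructor <;> linarith
  refine ⟨hsid, fun _ => β, fun _ => 1, by simp, ?_, ?_⟩
  · change ∫ _ in (0 : ℝ)..1, β ≤ β
    simp
  · intro s hs
    have hs : s ∈ Icc (0 : ℝ) 1 := Ioo_subset_Icc_self hs
    refine ⟨one_pos, hsid s hs, ?_⟩
    have hd : ‖(Arc.seg z₁ c).dfn s‖ ≤ 3 * L := norm_seg_le hz hc hL1
    have key : ∀ z : ℂ, L / 8 ≤ ‖z‖ → ‖F z‖ * ‖(Arc.seg z₁ c).dfn s‖ ≤ √1 * β := by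
      intro z h
      have h1 : ‖F z‖ ≤ A / (L / 8) ^ 2 := (hF z (by linarith)).trans (by gcongr)
      calc _ ≤ A / (L / 8) ^ 2 * (3 * L) := mul_le_mul h1 hd (norm_nonneg _) (by positivity)
        _ = 192 * A / L := by field_simp; ring
        _ ≤ β := by
          rw [div_le_iff₀ hβ] at hLβ
          rw [div_le_iff₀ (by linarith)]; linarith
        _ = _ := by simp
    exact ⟨key _ (hfar s hs), key _ (by rw [Complex.norm_conj]; exact hfar s hs)⟩

end FarSegment

namespace CurveRay

variable {D : ℝ} {N : ℕ} {T : Finset ℤ} {x : ℤ} {M : ℕ} {σ : ℂ} {ρ B δ V : ℝ}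

/-- The level curve followed by a ray and a segment far away. -/
lemma exists_path (h : CurveRay D N T x M σ ρ B δ V) {F : ℂ → ℂ} {Φ : ℝ} {d : ℕ} (hΦ : 0 < Φ)
    (hd : 4 * D * (2 * d + 2) ≤ N)
    (hF : ∀ (z : ℂ) (y : ℝ), 1 ≤ y → (∀ k : ℤ, z ≠ k) →
      Far (tailR ρ B) (tailR ρ B * y) N (N * blockL N x M) (N * blockR N x) z →
      ‖F z‖ ≤ Φ * y ^ (2 * d) * ratio (block x M \ T) (T \ block x M) z)
    {A r : ℝ} (hA : 0 ≤ A) (hFd : ∀ z : ℂ, r ≤ ‖z‖ → ‖F z‖ ≤ A / ‖z‖ ^ 2) (Q : ℝ) :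
    ∃ (k : ℤ) (P : UPath (((N : ℝ) : ℂ) * σ) ((k : ℝ) + 1 / 2)),
      PathCtl (((N : ℝ) : ℂ) * σ) (N * blockL N x M) (N * blockR N x) 1 1 F
        (3 * ((Bulk.arcConst D ρ B δ V + rayConst D ρ B V) *
          (Φ * ratio (block x M \ T) (T \ block x M) (((N : ℝ) : ℂ) * σ) *
            (N : ℝ) ^ (3 / 8 : ℝ)))) P ∧ Q ≤ (k : ℝ) + 1 / 2 := by
  have hN := h.bulk.N_pos
  have hκ := decay_pos (B := B) h.bulk.one_lt
  have hmg := h.reg.margin_pos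
  have hV := h.reg.len
  have hsV := Real.sqrt_pos.2 hV
  have hB : 0 < B := h.reg.rho.trans_le ((h.reg.left V h.mem_Icc).1.trans (h.reg.left V h.mem_Icc).2)
  have hsB := Real.sqrt_pos.2 hB
  have hE : 0 < ratio (block x M \ T) (T \ block x M) (((N : ℝ) : ℂ) * σ) :=
    ratio_pos (by rw [Complex.im_ofReal_mul]; exact (mul_pos hN h.bulk.im_pos).ne')
  have hsp := h.reg.speed_nonneg
  have hc₁ : 0 ≤ Bulk.arcConst D ρ B δ V := by unfold Bulk.arcConst; positivity
  have hc₂ : 0 < rayConst D ρ B V := by unfold rayConst; positivity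
  set E := ratio (block x M \ T) (T \ block x M) (((N : ℝ) : ℂ) * σ)
  have hW : 0 < Φ * E * (N : ℝ) ^ (3 / 8 : ℝ) := by positivity
  set β := (Bulk.arcConst D ρ B δ V + rayConst D ρ B V) * (Φ * E * (N : ℝ) ^ (3 / 8 : ℝ))
  have hβ : 0 < β := by positivity
  set z₀ := h.endPt with hz₀
  have hY := h.endPt_im_pos
  set τ := ((N : ℝ) : ℂ) * σ
  set a := (N : ℝ) * blockL N x M with ha
  set b := (N : ℝ) * blockR N x with hb
  obtain ⟨L₀, hL₀, l1, l2, l3, l4, l5, l6, l7⟩ : ∃ L₀ : ℝ, 0 ≤ L₀ ∧ 1 ≤ L₀ ∧ 8 * |z₀.re| ≤ L₀ ∧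
      8 * r ≤ L₀ ∧ 192 * A / β ≤ L₀ ∧ 8 * (1 + |a| + ‖τ - a‖) ≤ L₀ ∧
      8 * (1 + |b| + ‖τ - b‖) ≤ L₀ ∧ Q - z₀.re + 1 ≤ L₀ := by
    refine ⟨1 + 8 * |z₀.re| + 8 * |r| + 192 * A / β + 8 * (1 + |a| + ‖τ - a‖) +
      8 * (1 + |b| + ‖τ - b‖) + |Q - z₀.re + 1|, ?_⟩
    have e1 := abs_nonneg z₀.re
    have e2 := abs_nonneg r
    have e3 : 0 ≤ 192 * A / β := by positivity
    have e4 : 0 ≤ 8 * (1 + |a| + ‖τ - a‖) := by positivity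
    have e5 : 0 ≤ 8 * (1 + |b| + ‖τ - b‖) := by positivity
    have e6 := abs_nonneg (Q - z₀.re + 1)
    have e7 := le_abs_self (Q - z₀.re + 1)
    have e8 := le_abs_self r
    refine ⟨?_, ?_, ?_, ?_, ?_, ?_, ?_, ?_⟩ <;> linarith
  set l := 1 + L₀ / z₀.im with hl
  have hl1 : 1 ≤ l := by
    have : 0 ≤ L₀ / z₀.im := by positivity
    linarith
  set z₁ := (rayArc z₀ l hl1).fn l with hz₁
  have hz₁re : z₁.re = z₀.re := rayArc_re
  have hz₁im : z₁.im = z₀.im + L₀ := by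
    rw [hz₁, rayArc_im, hl, add_mul, one_mul, div_mul_cancel₀ _ hY.ne']
  set L := z₀.im + L₀ with hL
  set k := ⌊z₁.re + L⌋ with hk
  set c : ℝ := (k : ℝ) + 1 / 2 with hc
  have hcL : |c - (z₁.re + L)| ≤ 1 / 2 := by
    have h1 := Int.floor_le (z₁.re + L)
    have h2 := Int.lt_floor_add_one (z₁.re + L)
    rw [hc, abs_le]; constructor <;> linarith
  obtain ⟨hS, hB3⟩ := arcCtl_far_seg (τ := τ) (a := a) (b := b) hz₁im hcL (by linarith)
    (by rw [hz₁re]; linarith) hβ hA hFd (by linarith) (by linarith) (by linarith) (by linarith)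
  have hF1 : ∀ z : ℂ, (∀ k : ℤ, z ≠ k) → Near (tailR ρ B) N a b z →
      ‖F z‖ ≤ Φ * ratio (block x M \ T) (T \ block x M) z := by
    intro z hz hn
    have := hF z 1 le_rfl hz (by rw [mul_one]; exact hn)
    rwa [one_pow, mul_one] at this
  have hB1 : ArcCtl τ a b 1 1 F (h.reg.arc N) β :=
    (h.bulk.arc_ctl h.reg le_rfl (Or.inl ⟨by norm_num, rfl, rfl⟩) hΦ.le hF1).mono
      (mul_le_mul_of_nonneg_right (by linarith) hW.le)
  have hB2 : ArcCtl τ a b 1 1 F (rayArc z₀ l hl1) β :=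
    (h.ray_ctl hΦ.le hd hF).mono (mul_le_mul_of_nonneg_right (by linarith) hW.le)
  have hz₁0 : z₁ = (Arc.seg z₁ c).fn 0 := by simp [Arc.seg]
  have hc1 : (c : ℂ) = (Arc.seg z₁ c).fn 1 := by simp [Arc.seg]
  have hz₁pos : 0 < z₁.im := by rw [hz₁im]; linarith
  have hray_im : ∀ z ∈ (rayArc z₀ l hl1).support, 0 < z.im := by
    rintro _ ⟨y, hy, rfl⟩
    have hy : y ∈ Icc 1 l := hy
    rw [rayArc_im]
    exact mul_pos (by linarith [hy.1]) hY
  have hsr : 0 < N * (margin (geoK D) ρ B * √V) := by positivity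
  have hray_sided : ∀ z ∈ (rayArc z₀ l hl1).support,
      Sided τ a b 1 1 (N * (margin (geoK D) ρ B * √V)) z := by
    rintro _ ⟨y, hy, rfl⟩
    exact h.endPt_sided.rayArc hy.1
  refine ⟨k, ⟨[h.reg.arc N, rayArc z₀ l hl1, Arc.seg z₁ c], ?_, ?_, ?_⟩,
    ⟨Or.inl rfl, ⟨fun _ => β, ?_, ?_⟩, ?_,
    ((h.reg.arc N).fn '' Ioc 0 V ∪ (rayArc z₀ l hl1).support) ∪ (Arc.seg z₁ c).support,
      ?_, ?_, ?_, ?_⟩, ?_⟩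
  · intro G
    simp only [List.map_cons, List.map_nil, List.sum_cons, List.sum_nil, add_zero]
    rw [h.reg.arc_lo]
    change G z₀ - _ + (G z₁ - G ((rayArc z₀ l hl1).fn 1) +
      (G ((Arc.seg z₁ c).fn 1) - G ((Arc.seg z₁ c).fn 0))) = _
    rw [← hz₁0, ← hc1, rayArc_one]
    ring
  · simp only [List.mem_cons, List.not_mem_nil, or_false, forall_eq_or_imp, forall_eq]
    exact ⟨fun z hz => (h.reg.arc_im_pos hN hz).le, fun z hz => (hray_im z hz).le,
      fun z hz => seg_im_nonneg hz₁pos.le hz⟩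
  · simp only [List.mem_cons, List.not_mem_nil, or_false, forall_eq_or_imp, forall_eq]
    exact ⟨fun z hz => not_int_of_im (h.reg.arc_im_pos hN hz).ne',
      fun z hz => not_int_of_im (hray_im z hz).ne', fun z hz j => seg_not_int hz₁pos hc hz j⟩
  · simp only [List.mem_cons, List.not_mem_nil, or_false, forall_eq_or_imp, forall_eq]
    exact ⟨hB1, hB2, hB3⟩
  · simp only [List.map_cons, List.map_nil, List.sum_cons, List.sum_nil, add_zero]
    exact le_of_eq (by ring)
  · simp only [List.mem_cons, List.not_mem_nil, or_false, forall_eq_or_imp, forall_eq]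
    refine ⟨fun z hz => h.reg.arc_closed hN hz, fun z hz => (hray_sided z hz).mono hsr.le, ?_⟩
    rintro _ ⟨s, hs, rfl⟩
    exact (hS s hs).mono zero_le_one
  · refine IsPreconnected.union z₁ (Or.inr ⟨l, ⟨hl1, le_rfl⟩, rfl⟩)
      ⟨0, by simp [Arc.seg], hz₁0.symm⟩ ?_ (isPreconnected_support _)
    exact IsPreconnected.union z₀ ⟨V, ⟨hV, le_rfl⟩, rfl⟩ ⟨1, ⟨le_rfl, hl1⟩, rayArc_one⟩
      (h.reg.arc_open hN).1 (isPreconnected_support _)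
  · exact Or.inr ⟨1, by simp [Arc.seg], hc1.symm⟩
  · simp only [List.mem_cons, List.not_mem_nil, or_false, forall_eq_or_imp, forall_eq]
    exact ⟨fun v hv => Or.inl (Or.inl ⟨v, ⟨hv.1, hv.2.le⟩, rfl⟩),
      fun v hv => Or.inl (Or.inr ⟨v, Ioo_subset_Icc_self hv, rfl⟩),
      fun v hv => Or.inr ⟨v, Ioo_subset_Icc_self hv, rfl⟩⟩
  · rintro z ((hz | hz) | ⟨s, hs, rfl⟩)
    · exact (h.reg.arc_open hN).2 z hz
    · exact ⟨_, hsr, hray_sided z hz⟩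
    · exact ⟨1, one_pos, hS s hs⟩
  · have := (abs_le.1 hcL).1
    rw [hz₁re] at this
    linarith

end CurveRay

/-- Level curves with positive signs, uniformly. -/
theorem exists_curveRay {D : ℝ} (hD : 1 < D) : ∃ ρ B δ V : ℝ, 0 < ρ ∧
    ∀ (N : ℕ) (T : Finset ℤ) (x : ℤ) (M : ℕ) (σ : ℂ), Bulk D N T x M σ →
      CurveRay D N T x M σ ρ B δ V := by
  have hK := geoK_ge_one hD
  have hK0 : 0 < geoK D := by linarith
  obtain ⟨V, hV, hfar⟩ := exists_far_time (geoK D) (cutoff D) (1 / √(2 * D)) hK (by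
    have := Real.sqrt_pos.2 (show 0 < 2 * D by linarith); positivity)
  obtain ⟨δ, hδ, hh⟩ := exists_plus_height (geoK D) V
  exact ⟨1 / geoK D ^ 2, 2 * (4 * geoK D ^ 2 + V), δ, V, by positivity, fun N T x M σ h =>
    ⟨h, curveReg_plus h.geo hδ hV fun v hv => hh _ _ _ v h.geo hv.1 hv.2, hfar _ _ _ h.geo⟩⟩

end GTBulk

end

noncomputable section

namespace GTBulk

open MeasureTheory Set
open scoped BigOperators ComplexConjugate

/-- The first factor decays quadratically at infinity. -/
lemma exists_zFactor_decay {N : ℕ} {t : TopRow N} (ht : StrictAnti t) (x₂ : ℤ) {n₂ : ℕ}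
    (hn : 1 ≤ n₂) (hn' : n₂ < N) :
    ∃ A r : ℝ, 0 ≤ A ∧ ∀ z : ℂ, r ≤ ‖z‖ → ‖zFactor N t x₂ n₂ z‖ ≤ A / ‖z‖ ^ 2 := by
  set M := N - n₂ - 1 with hM
  set S := pochRoots (x₂ - 1) M ∪ rowSet t with hS
  set r : ℝ := 1 + 2 * ∑ k ∈ S, |(k : ℝ)| with hr
  have hsum : 0 ≤ ∑ k ∈ S, |(k : ℝ)| := Finset.sum_nonneg fun k _ => abs_nonneg _
  have hk : ∀ k ∈ S, 2 * |(k : ℝ)| ≤ r := by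
    intro k hk
    have := Finset.single_le_sum (f := fun k : ℤ => |(k : ℝ)|) (fun k _ => abs_nonneg _) hk
    linarith
  refine ⟨2 ^ M * 2 ^ N, r, by positivity, fun z hz => ?_⟩
  have hz1 : 1 ≤ ‖z‖ := by linarith
  have hpoch : poch (z - (x₂ : ℂ) + 1) M = ∏ k ∈ pochRoots (x₂ - 1) M, (z - k) := by
    rw [← poch_eq_prod]
    push_cast
    rw [sub_sub_eq_add_sub, add_sub_right_comm]
  have h1 : ∏ k ∈ pochRoots (x₂ - 1) M, ‖z - (k : ℂ)‖ ≤ (2 * ‖z‖) ^ M := by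
    have : (pochRoots (x₂ - 1) M).card = M := by simp [pochRoots]
    conv_rhs => rw [← this]
    rw [← Finset.prod_const]
    refine Finset.prod_le_prod (fun _ _ => norm_nonneg _) fun k hk' => ?_
    have h2 := hk k (Finset.mem_union_left _ hk')
    have h3 := norm_sub_le z (k : ℂ)
    rw [Complex.norm_intCast] at h3
    linarith
  have h2 : (‖z‖ / 2) ^ N ≤ ∏ k ∈ rowSet t, ‖z - (k : ℂ)‖ := by
    have : (rowSet t).card = N := by
      rw [rowSet, Finset.card_image_of_injective _ ht.injective]; simp
    conv_lhs => rw [← this]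
    rw [← Finset.prod_const]
    refine Finset.prod_le_prod (fun _ _ => by positivity) fun k hk' => ?_
    have h2 := hk k (Finset.mem_union_right _ hk')
    have h3 := norm_sub_norm_le z (k : ℂ)
    rw [Complex.norm_intCast] at h3
    linarith
  rw [zFactor, hpoch, prod_rowSet ht, norm_div, norm_prod, norm_prod]
  have hz0 : 0 < ‖z‖ := by linarith
  calc _ ≤ (2 * ‖z‖) ^ M / (‖z‖ / 2) ^ N := by gcongr
    _ = 2 ^ M * 2 ^ N * (‖z‖ ^ M / ‖z‖ ^ N) := by rw [mul_pow, div_pow]; field_simp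
    _ ≤ 2 ^ M * 2 ^ N * (1 / ‖z‖ ^ 2) := by
      refine mul_le_mul_of_nonneg_left ?_ (by positivity)
      rw [div_le_div_iff₀ (by positivity) (by positivity), one_mul, ← pow_add]
      exact pow_le_pow_right₀ hz1 (by omega)
    _ = _ := by ring

/-- The data of the theorem, in scaled form. -/
structure Setting (D : ℝ) (d N : ℕ) (t : TopRow N) (x₁ x₂ : ℤ) (n₁ n₂ : ℕ) (σ : ℂ) : Prop where
  anti : StrictAnti t
  bulk : Bulk D N (rowSet t) x₁ (N - n₁) σ
  one_le : 1 ≤ n₂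
  lt : n₂ < N
  dx : |x₂ - x₁| ≤ d
  dl : |x₂ - x₁ + (N - n₁ : ℕ) - (N - n₂ - 1 : ℕ)| ≤ d
  dm : |((N - n₁ : ℕ) : ℤ) - (N - n₂ - 1 : ℕ)| ≤ d

/-- The constant comparing the size of the block with `N`. -/
def blockConst (D : ℝ) : ℝ := 2 * D ^ 2 * (D + cutoff D) ^ 2

namespace Setting

variable {D : ℝ} {d N : ℕ} {t : TopRow N} {x₁ x₂ : ℤ} {n₁ n₂ : ℕ} {σ : ℂ}

lemma one_le_blockConst (hD : 1 < D) : 1 ≤ blockConst D := by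
  have := Bulk.cutoff_pos D
  have h1 : 1 ≤ (D + cutoff D) ^ 2 := one_le_pow₀ (by linarith)
  have h2 : 1 ≤ D ^ 2 := one_le_pow₀ hD.le
  unfold blockConst
  nlinarith

lemma block_between (h : Setting D d N t x₁ x₂ n₁ n₂ σ) :
    N / blockConst D ≤ (N - n₁ : ℕ) ∧ ((N - n₁ : ℕ) : ℝ) ≤ N * blockConst D := by
  have h1 := h.bulk.le_M
  have h2 := h.bulk.le
  have hN := h.bulk.N_pos
  have h3 := one_le_blockConst h.bulk.one_lt
  have h4 : 0 ≤ (N : ℝ) / D := by have := h.bulk.one_lt; positivity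
  constructor
  · rw [div_eq_mul_one_div, mul_comm]; exact h1
  · nlinarith

lemma norm_factorial_ratio_le (h : Setting D d N t x₁ x₂ n₁ n₂ σ)
    (hN : blockConst D * (4 * (d + 1) ^ 2) ≤ N) :
    ‖((N - n₁).factorial : ℂ) / ((N - n₂ - 1).factorial : ℂ)‖ ≤
      9 * blockConst D ^ d * (N : ℝ) ^ (((N - n₁ : ℕ) : ℤ) - (N - n₂ - 1 : ℕ)) := by
  obtain ⟨h1, h2⟩ := h.block_between
  have h3 := one_le_blockConst h.bulk.one_lt
  have hN0 := h.bulk.N_pos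
  have h4 : (4 * (d + 1) ^ 2 : ℝ) ≤ (N - n₁ : ℕ) := by
    refine le_trans ?_ h1
    rw [le_div_iff₀ (by linarith)]; linarith
  have hd0 : (0 : ℝ) ≤ d := Nat.cast_nonneg d
  have hm : (0 : ℝ) < (N - n₁ : ℕ) := lt_of_lt_of_le (by positivity) h4
  obtain ⟨θ, h5, h6⟩ := factorial_ratio_approx (m := N - n₁) (m₂ := N - n₂ - 1) (d := d)
    (by exact_mod_cast hm) h.dm (by
      have : (2 * (d + 1) * (2 * d) : ℝ) ≤ (N - n₁ : ℕ) := by nlinarith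
      exact_mod_cast this)
  have h7 : ‖1 + θ‖ ≤ 9 := by
    have h8 : (8 * d ^ 2 / (N - n₁ : ℕ) : ℝ) ≤ 8 := by
      rw [div_le_iff₀ hm]
      nlinarith
    have := norm_add_le (1 : ℂ) θ
    rw [norm_one] at this
    linarith
  have h8 := zpow_le_of_between hN0 h3 h1 h2 h.dm
  rw [h6, norm_mul, norm_zpow, Complex.norm_natCast, mul_comm, mul_assoc]
  exact mul_le_mul h7 h8 (by positivity) (by norm_num)

end Setting

lemma CurveTail.const_nonneg {D : ℝ} {N : ℕ} {T : Finset ℤ} {x : ℤ} {M : ℕ} {σ : ℂ}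
    {e₁ e₂ ρ B δ V v₀ V₁ : ℝ} (h : CurveTail D N T x M σ e₁ e₂ ρ B δ V v₀) (hV₁ : V ≤ V₁) :
    0 ≤ 2 * (Bulk.arcConst D ρ B δ V₁ + CurveTail.segConst D ρ B δ v₀) := by
  have hκ := decay_pos (B := B) h.bulk.one_lt
  have hV₁0 : 0 ≤ V₁ := h.reg.len.le.trans hV₁
  have h2 := h.reg.speed_nonneg
  have hv₀ := h.time_pos
  have hmg := h.reg.margin_pos
  unfold Bulk.arcConst CurveTail.segConst
  positivity

namespace Setting

variable {D : ℝ} {d N : ℕ} {t : TopRow N} {x₁ x₂ : ℤ} {n₁ n₂ : ℕ} {σ : ℂ}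

lemma le_block (h : Setting D d N t x₁ x₂ n₁ n₂ σ)
    (hN : blockConst D * (4 * (d + 1) ^ 2) ≤ N) : d ≤ N - n₁ := by
  have h1 := h.block_between.1
  have h3 := one_le_blockConst h.bulk.one_lt
  have h4 : (4 * (d + 1) ^ 2 : ℝ) ≤ (N - n₁ : ℕ) := by
    refine le_trans ?_ h1
    rw [le_div_iff₀ (by linarith)]; linarith
  have hd0 : (0 : ℝ) ≤ d := Nat.cast_nonneg d
  have : (d : ℝ) ≤ (N - n₁ : ℕ) := by nlinarith
  exact_mod_cast this

lemma norm_zFactor_le_of_far (h : Setting D d N t x₁ x₂ n₁ n₂ σ) {R y : ℝ} (hR : 1 ≤ R) (hy : 1 ≤ y)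
    (hRN : R ≤ N) (hdN : 8 * (d + 1) ^ 2 * (2 * R) ≤ N)
    (hN : blockConst D * (4 * (d + 1) ^ 2) ≤ N) {z : ℂ} (hz : ∀ k : ℤ, z ≠ k)
    (hf : Far R (R * y) N (N * blockL N x₁ (N - n₁)) (N * blockR N x₁) z) :
    ‖zFactor N t x₂ n₂ z‖ ≤ 3 * (2 * R) ^ (2 * d) *
      (N : ℝ) ^ ((N - n₂ - 1 : ℕ) - (N - n₁ : ℕ) : ℤ) * y ^ (2 * d) *
      ratio (block x₁ (N - n₁) \ rowSet t) (rowSet t \ block x₁ (N - n₁)) z := by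
  have hN0 := h.bulk.N_pos
  have hRy : R ≤ R * y := le_mul_of_one_le_right (by linarith) hy
  have hN1 : (1 : ℝ) ≤ N := hR.trans hRN
  obtain ⟨⟨h1, h2⟩, h3, h4⟩ := hf.base h.bulk (by linarith) hRN (by nlinarith)
  have h5 := norm_zFactor_le h.anti (R := 2 * R) (R' := 2 * (R * y)) (by linarith) (by linarith)
    (by linarith) (by exact_mod_cast hN0) hz h.dx h.dl (h.le_block hN) hdN h1 h2 h3 h4
  refine h5.trans (le_of_eq ?_)
  rw [← mul_assoc 2, mul_pow (2 * R)]
  ring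

lemma norm_wFactor_le_of_near (h : Setting D d N t x₁ x₂ n₁ n₂ σ) {R : ℝ} (hR : 1 ≤ R)
    (hRN : R ≤ N) {z : ℂ} (hz : ∀ k : ℤ, z ≠ k)
    (hf : Near R N (N * blockL N x₁ (N - n₁)) (N * blockR N x₁) z) :
    ‖wFactor N t x₁ n₁ z‖ ≤ 2 * R / N *
      ratio (rowSet t \ block x₁ (N - n₁)) (block x₁ (N - n₁) \ rowSet t) z := by
  have hN0 := h.bulk.N_pos
  have hf' : Far R R N (N * blockL N x₁ (N - n₁)) (N * blockR N x₁) z := hf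
  exact norm_wFactor_le h.anti (by linarith) (by exact_mod_cast hN0) hz
    (hf'.base h.bulk (by linarith) hRN (by nlinarith)).1.1

end Setting

/-- The double integral is a single integral up to a small error. -/
theorem exists_doubleIntegral_estimate {D : ℝ} (hD : 1 < D) (d : ℕ) : ∃ C N₀ : ℝ,
    ∀ (N : ℕ) [NeZero N] (t : TopRow N) (x₁ x₂ : ℤ) (n₁ n₂ : ℕ) (σ : ℂ), N₀ ≤ N →
    Setting D d N t x₁ x₂ n₁ n₂ σ → ∀ R : ℝ, IsLargeRadius N t x₁ n₁ x₂ R →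
    ∃ (k : ℤ) (P : UPath (((N : ℝ) : ℂ) * σ) ((k : ℝ) + 1 / 2)), x₁ ≤ k ∧
      ‖((N - n₁).factorial : ℂ) / ((N - n₂ - 1).factorial : ℂ) *
        ((∮ z in C(((zCenter t x₂ : ℝ) : ℂ), zRadius t x₂), ∮ w in C((0 : ℂ), R),
          kernelIntegrand N t x₁ n₁ x₂ n₂ z w) -
        2 * Real.pi * Complex.I *
          P.cross (fun z => zFactor N t x₂ n₂ z * wFactor N t x₁ n₁ z))‖ ≤
        C * (N : ℝ) ^ (-(1 / 4) : ℝ) := by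
  obtain ⟨ρ, B, δ, v₀, V₁, N₁, hρ, hδ, hcurve⟩ := exists_curveTail hD
  obtain ⟨ρ', B', δ', V', hρ', hray⟩ := exists_curveRay hD
  set R₁ := tailR ρ B
  set R₂ := tailR ρ' B'
  have hR₁ : 1 ≤ R₁ := by
    have := Real.sqrt_pos.2 hρ
    have h1 : 0 < 4 / √ρ := by positivity
    have := Real.sqrt_nonneg B
    simp only [R₁, tailR]; linarith
  have hR₂ : 1 ≤ R₂ := by
    have := Real.sqrt_pos.2 hρ'
    have h1 : 0 < 4 / √ρ' := by positivity
    have := Real.sqrt_nonneg B'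
    simp only [R₂, tailR]; linarith
  set C₁ := 2 * (Bulk.arcConst D ρ B δ V₁ + CurveTail.segConst D ρ B δ v₀)
  set C₂ := 3 * (Bulk.arcConst D ρ' B' δ' V' + CurveRay.rayConst D ρ' B' V')
  set Z₁ := 3 * (2 * R₁) ^ (2 * d)
  set Z₂ := 3 * (2 * R₂) ^ (2 * d)
  have hsq := Real.sqrt_pos.2 hρ
  refine ⟨9 * blockConst D ^ d * (2 * ((C₂ * Z₂ + C₁ * Z₁) * (2 * (C₁ * (2 * R₁))))),
    |N₁| + R₁ + R₂ + 8 * (d + 1) ^ 2 * (2 * R₁) + 8 * (d + 1) ^ 2 * (2 * R₂) +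
      4 * D * (2 * d + 2) + blockConst D * (4 * (d + 1) ^ 2) + (d + 2) / (√ρ / 2), ?_⟩
  intro N _ t x₁ x₂ n₁ n₂ σ hNN h R hR
  have hQ := Setting.one_le_blockConst hD
  have hN0 := h.bulk.N_pos
  obtain ⟨a1, a2, a3, a4, a5, a6, a7, a8⟩ : N₁ ≤ N ∧ R₁ ≤ N ∧ R₂ ≤ N ∧
      8 * (d + 1) ^ 2 * (2 * R₁) ≤ N ∧ 8 * (d + 1) ^ 2 * (2 * R₂) ≤ N ∧
      4 * D * (2 * d + 2) ≤ N ∧ blockConst D * (4 * (d + 1) ^ 2) ≤ N ∧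
      (d + 2) / (√ρ / 2) ≤ N := by
    have e1 := le_abs_self N₁
    have e2 := abs_nonneg N₁
    have e3 : 0 ≤ 8 * ((d : ℝ) + 1) ^ 2 * (2 * R₁) := by positivity
    have e4 : 0 ≤ 8 * ((d : ℝ) + 1) ^ 2 * (2 * R₂) := by positivity
    have e5 : 0 ≤ 4 * D * (2 * (d : ℝ) + 2) := by positivity
    have e6 : 0 ≤ blockConst D * (4 * ((d : ℝ) + 1) ^ 2) := by positivity
    have e7 : 0 ≤ ((d : ℝ) + 2) / (√ρ / 2) := by positivity
    refine ⟨?_, ?_, ?_, ?_, ?_, ?_, ?_, ?_⟩ <;> linarith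
  rw [div_le_iff₀ (by positivity), mul_comm] at a8
  obtain ⟨V0, h0, hV0⟩ := hcurve N _ _ _ _ a1 h.bulk (-1) (-1) (Or.inl ⟨rfl, rfl⟩)
  obtain ⟨VL, hL, hVL⟩ := hcurve N _ _ _ _ a1 h.bulk (-1) 1 (Or.inr (Or.inl ⟨rfl, rfl⟩))
  obtain ⟨VR, hRt, hVR⟩ := hcurve N _ _ _ _ a1 h.bulk 1 (-1) (Or.inr (Or.inr ⟨rfl, rfl⟩))
  have hT := hray N _ _ _ _ h.bulk
  set m : ℤ := ((N - n₂ - 1 : ℕ) : ℤ) - (N - n₁ : ℕ) with hm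
  set X := block x₁ (N - n₁) \ rowSet t with hX
  set Y := rowSet t \ block x₁ (N - n₁) with hY
  set E := ratio X Y (((N : ℝ) : ℂ) * σ) with hE
  have hE0 : 0 < E :=
    ratio_pos (by rw [Complex.im_ofReal_mul]; exact (mul_pos hN0 h.bulk.im_pos).ne')
  have hE' : ratio Y X (((N : ℝ) : ℂ) * σ) = E⁻¹ := ratio_swap_eq_inv
  have hNm : 0 < (N : ℝ) ^ m := zpow_pos hN0 _
  have hC₁ := h0.const_nonneg hV0
  have c0 := h0.path_ctl (X := X) (Y := Y) (F := zFactor N t x₂ n₂) (Φ := Z₁ * (N : ℝ) ^ m) hV0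
    (Or.inl ⟨by norm_num, rfl, rfl⟩) (by positivity) (fun z hz hn => by
      have := h.norm_zFactor_le_of_far hR₁ le_rfl a2 a4 a7 hz (by rw [mul_one]; exact hn)
      rwa [one_pow, mul_one] at this)
  have cL := hL.path_ctl (X := Y) (Y := X) (F := wFactor N t x₁ n₁) (Φ := 2 * R₁ / N) hVL
    (Or.inr ⟨by norm_num, rfl, rfl⟩) (by positivity)
    (fun z hz hn => h.norm_wFactor_le_of_near hR₁ a2 hz hn)
  have cR := hRt.path_ctl (X := Y) (Y := X) (F := wFactor N t x₁ n₁) (Φ := 2 * R₁ / N) hVR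
    (Or.inr ⟨by norm_num, rfl, rfl⟩) (by positivity)
    (fun z hz hn => h.norm_wFactor_le_of_near hR₁ a2 hz hn)
  obtain ⟨A, r, hA, hdec⟩ := exists_zFactor_decay h.anti x₂ h.one_le h.lt
  obtain ⟨kT, PT, cT, hkT⟩ := hT.exists_path (Φ := Z₂ * (N : ℝ) ^ m) (by positivity) a6
    (fun z y hy hz hn => h.norm_zFactor_le_of_far hR₂ hy a3 a5 a7 hz hn) hA hdec
    (|(t 0 : ℝ)| + |(x₁ : ℝ)| + |hRt.endHalf| + 2)
  have l0 := h0.endHalf_mid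
  have lL := hL.endHalf_left
  have lR := hRt.endHalf_right
  have q1 := le_abs_self (t 0 : ℝ)
  have q2 := le_abs_self (x₁ : ℝ)
  have q3 := le_abs_self hRt.endHalf
  have q1' := abs_nonneg (t 0 : ℝ)
  have q2' := abs_nonneg (x₁ : ℝ)
  have q3' := abs_nonneg hRt.endHalf
  have hd0 : (0 : ℝ) ≤ d := Nat.cast_nonneg d
  have hMnn : (0 : ℝ) ≤ (N - n₁ : ℕ) := Nat.cast_nonneg _
  have hdx := h.dx
  have hdl := h.dl
  rw [abs_le] at hdx hdl
  have hdx1 : (x₁ : ℝ) - d ≤ x₂ := by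
    have : x₁ - d ≤ x₂ := by omega
    exact_mod_cast this
  have hdl1 : (x₂ : ℝ) - (N - n₂ - 1 : ℕ) ≤ x₁ - (N - n₁ : ℕ) + d := by
    have : x₂ - (N - n₂ - 1 : ℕ) ≤ x₁ - (N - n₁ : ℕ) + d := by omega
    exact_mod_cast this
  refine ⟨kT, PT, ?_, ?_⟩
  · have : (x₁ : ℝ) ≤ kT := by linarith
    exact_mod_cast this
  have hb : (((N : ℝ) : ℂ) * σ).im ≠ 0 := by
    rw [Complex.im_ofReal_mul]; exact (mul_pos hN0 h.bulk.im_pos).ne'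
  obtain ⟨wT1, wT2, wT3⟩ := cT.wind_eq cR cL (by norm_num) (by norm_num) (by norm_num)
  obtain ⟨w01, w02, w03⟩ := c0.wind_eq cR cL (by norm_num) (by norm_num) (by norm_num)
  have hLR : hL.endHalf ≤ hRt.endHalf := by linarith
  have eT : UPath.wind hRt.path hL.path (((kT : ℝ) + 1 / 2 : ℝ) : ℂ) = 0 := by
    have := UPath.loop_inv_sub hRt.path hL.path hLR wT1 wT2
      (by change hL.endHalf ≠ _; intro e; linarith) (by change hRt.endHalf ≠ _; intro e; linarith)
    rw [if_neg (by change ¬(hL.endHalf < _ ∧ _ < hRt.endHalf); rintro ⟨-, e⟩; linarith)] at this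
    exact this
  have e0 : UPath.wind hRt.path hL.path ((h0.endHalf : ℝ) : ℂ) = 2 * Real.pi * Complex.I := by
    have := UPath.loop_inv_sub hRt.path hL.path hLR w01 w02
      (by change hL.endHalf ≠ h0.endHalf; intro e; linarith)
      (by change hRt.endHalf ≠ h0.endHalf; intro e; linarith)
    rw [if_pos (by
      change hL.endHalf < h0.endHalf ∧ h0.endHalf < hRt.endHalf; constructor <;> linarith)] at this
    exact this
  have key := doubleIntegral_deform h.anti x₁ n₁ x₂ n₂ hR hb PT h0.path hRt.path hL.path
    (by linarith) (by change h0.endHalf ≤ _; linarith) (by change h0.endHalf < _; linarith)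
    (by change _ < h0.endHalf; linarith) (by change hL.endHalf < _; linarith)
    (by change _ < hRt.endHalf; linarith)
    (fun A hA v hv => by
      obtain ⟨u1, u2, u3⟩ := wT3 A hA v hv
      exact ⟨u1, u2.trans eT, u3.trans eT⟩)
    (fun A hA v hv => by
      obtain ⟨u1, u2, u3⟩ := w03 A hA v hv
      exact ⟨u1, u2.trans e0, u3.trans e0⟩)
  rw [key, add_sub_cancel_right, norm_mul]
  set βw := C₁ * (2 * R₁ / N * E⁻¹ * (N : ℝ) ^ (3 / 8 : ℝ)) with hβw
  have hβ : βw = 2 * ((Bulk.arcConst D ρ B δ V₁ + CurveTail.segConst D ρ B δ v₀) *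
      (2 * R₁ / N * ratio Y X (((N : ℝ) : ℂ) * σ) * (N : ℝ) ^ (3 / 8 : ℝ))) := by
    rw [hE', hβw, mul_assoc]
  have hβw0 : 0 ≤ βw := mul_nonneg hC₁ (by positivity)
  rw [← hβ] at cL cR
  have b1 := cT.norm_cross_loop_le cR cL (by norm_num) (by norm_num) (by norm_num) (by linarith)
  have b2 := c0.norm_cross_loop_le cR cL (by norm_num) (by norm_num) (by norm_num) (by linarith)
  have b3 := (norm_sub_le _ _).trans (add_le_add b1 b2)
  have b4 := h.norm_factorial_ratio_le a7
  have hm' : (((N - n₁ : ℕ) : ℤ) - (N - n₂ - 1 : ℕ)) = -m := by rw [hm]; ring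
  rw [hm'] at b4
  refine (mul_le_mul b4 b3 (norm_nonneg _) (by positivity)).trans (le_of_eq ?_)
  have hpow : (N : ℝ) ^ (3 / 8 : ℝ) * (N : ℝ) ^ (3 / 8 : ℝ) = N * (N : ℝ) ^ (-(1 / 4) : ℝ) := by
    rw [← Real.rpow_add hN0, ← Real.rpow_one_add' hN0.le (by norm_num)]
    norm_num
  have hNN' : (N : ℝ) ^ (-m) = ((N : ℝ) ^ m)⁻¹ := zpow_neg _ _
  rw [hNN', hβw]
  calc _ = 9 * blockConst D ^ d * (2 * ((C₂ * Z₂ + C₁ * Z₁) * (2 * (C₁ * (2 * R₁))))) *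
      ((((N : ℝ) ^ m)⁻¹ * (N : ℝ) ^ m) * (E * E⁻¹) *
        ((N : ℝ) ^ (3 / 8 : ℝ) * (N : ℝ) ^ (3 / 8 : ℝ) * (N : ℝ)⁻¹)) := by
        simp only [C₁, C₂]; ring
    _ = _ := by
      rw [inv_mul_cancel₀ hNm.ne', mul_inv_cancel₀ hE0.ne', hpow, one_mul, one_mul,
        mul_comm (N : ℝ) (_ ^ _), mul_inv_cancel_right₀ hN0.ne']

end GTBulk

end

noncomputable section

namespace GTBulk

open MeasureTheory Set
open scoped BigOperators ComplexConjugate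

/-- The open upper half-plane together with a part of the real axis. -/
def upperWith (J : Set ℝ) : Set ℂ := {z | 0 < z.im ∨ z.im = 0 ∧ z.re ∈ J}

/-- The open lower half-plane together with a part of the real axis. -/
def lowerWith (J : Set ℝ) : Set ℂ := {z | conj z ∈ upperWith J}

lemma convex_upperWith {J : Set ℝ} (hJ : Convex ℝ J) : Convex ℝ (upperWith J) := by
  intro z hz w hw a b ha hb hab
  have him : (a • z + b • w).im = a * z.im + b * w.im := by simp
  have hre : (a • z + b • w).re = a * z.re + b * w.re := by simp
  change 0 < (a • z + b • w).im ∨ (a • z + b • w).im = 0 ∧ (a • z + b • w).re ∈ J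
  rw [him, hre]
  rcases ha.eq_or_lt with rfl | ha
  · have hb1 : b = 1 := by linarith
    subst hb1
    simpa [upperWith] using hw
  rcases hb.eq_or_lt with rfl | hb
  · have ha1 : a = 1 := by linarith
    subst ha1
    simpa [upperWith] using hz
  rcases hz with hz | ⟨hz, hz'⟩
  · rcases hw with hw | ⟨hw, -⟩
    · left; positivity
    · left; rw [hw]; have := mul_pos ha hz; linarith
  · rcases hw with hw | ⟨hw, hw'⟩
    · left; rw [hz]; have := mul_pos hb hw; linarith
    · right
      exact ⟨by rw [hz, hw]; ring, hJ hz' hw' ha.le hb.le hab⟩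

lemma convex_lowerWith {J : Set ℝ} (hJ : Convex ℝ J) : Convex ℝ (lowerWith J) := by
  intro z hz w hw a b ha hb hab
  have := convex_upperWith hJ hz hw ha hb hab
  change conj (a • z + b • w) ∈ upperWith J
  simpa using this

lemma ofReal_mem_upperWith {J : Set ℝ} {c : ℝ} (hc : c ∈ J) : (c : ℂ) ∈ upperWith J :=
  Or.inr ⟨by simp, by simpa⟩

lemma ofReal_mem_lowerWith {J : Set ℝ} {c : ℝ} (hc : c ∈ J) : (c : ℂ) ∈ lowerWith J := by
  change conj (c : ℂ) ∈ upperWith J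
  rw [Complex.conj_ofReal]
  exact ofReal_mem_upperWith hc

lemma segmentIntegral_eq_sub {S : Set ℂ} (hS : Convex ℝ S) {f F : ℂ → ℂ} {a b : ℂ} (ha : a ∈ S)
    (hb : b ∈ S) (hf : ContinuousOn f S) (hF : ∀ z ∈ S, HasDerivWithinAt F (f z) S z) :
    segmentIntegral f a b = F b - F a := by
  set γ : ℝ → ℂ := fun s => a + (s : ℂ) * (b - a) with hγ
  have hγS : MapsTo γ (Icc 0 1) S := by
    intro s hs
    have := hS ha hb (by linarith [hs.2] : (0 : ℝ) ≤ 1 - s) hs.1 (by ring)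
    have h2 : (1 - s) • a + s • b = γ s := by
      simp only [hγ, Complex.real_smul]; push_cast; ring
    rwa [h2] at this
  have hγd : ∀ s, HasDerivAt γ (b - a) s := fun s => by
    have h : HasDerivAt (fun s : ℝ => (s : ℂ)) 1 s := by
      simpa using (hasDerivAt_id s).ofReal_comp
    change HasDerivAt (fun s : ℝ => a + (s : ℂ) * (b - a)) (b - a) s
    have h2 := (h.mul_const (b - a)).const_add a
    rwa [one_mul] at h2
  have hγc : Continuous γ := continuous_iff_continuousAt.2 fun s => (hγd s).continuousAt
  have hd : ∀ s ∈ Icc (0 : ℝ) 1,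
      HasDerivWithinAt (fun s => F (γ s)) (f (γ s) * (b - a)) (Icc 0 1) s := fun s hs =>
    (hF (γ s) (hγS hs)).comp s (hγd s).hasDerivWithinAt hγS
  have key := intervalIntegral.integral_eq_sub_of_hasDerivAt_of_le (f := fun s => F (γ s))
    (f' := fun s => f (γ s) * (b - a)) zero_le_one
    (fun s hs => (hd s hs).continuousWithinAt)
    (fun s hs => (hd s (Ioo_subset_Icc_self hs)).hasDerivAt (Icc_mem_nhds hs.1 hs.2))
    (ContinuousOn.intervalIntegrable (by
      rw [uIcc_of_le zero_le_one]
      exact (hf.comp hγc.continuousOn hγS).mul continuousOn_const))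
  have e1 : γ 1 = b := by simp [hγ]
  have e0 : γ 0 = a := by simp [hγ]
  rw [e1, e0] at key
  exact key

/-- A function holomorphic off the real axis and at the points of `J`. -/
structure HoloAcross (J : Set ℝ) (f : ℂ → ℂ) : Prop where
  convex : Convex ℝ J
  upper : DifferentiableOn ℂ f (upperWith J)
  lower : DifferentiableOn ℂ f (lowerWith J)

namespace HoloAcross

variable {J : Set ℝ} {f : ℂ → ℂ}

lemma crossingIntegral_eq_sub (h : HoloAcross J f) {F G : ℂ → ℂ}
    (hF : ∀ z ∈ upperWith J, HasDerivWithinAt F (f z) (upperWith J) z)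
    (hG : ∀ z ∈ lowerWith J, HasDerivWithinAt G (f z) (lowerWith J) z) {b : ℂ} (hb : 0 < b.im)
    {c : ℝ} (hc : c ∈ J) : crossingIntegral f b c = (G c - G (conj b)) + (F b - F c) := by
  have hbU : b ∈ upperWith J := Or.inl hb
  have hbL : conj b ∈ lowerWith J := by
    change conj (conj b) ∈ upperWith J
    rw [Complex.conj_conj]; exact hbU
  rw [crossingIntegral,
    segmentIntegral_eq_sub (convex_lowerWith h.convex) hbL (ofReal_mem_lowerWith hc)
      h.lower.continuousOn hG,
    segmentIntegral_eq_sub (convex_upperWith h.convex) (ofReal_mem_upperWith hc) hbU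
      h.upper.continuousOn hF]

/-- The crossing point can be moved. -/
lemma crossingIntegral_eq (h : HoloAcross J f) {b : ℂ} (hb : 0 < b.im) {c c' : ℝ} (hc : c ∈ J)
    (hc' : c' ∈ J) : crossingIntegral f b c = crossingIntegral f b c' := by
  obtain ⟨F, hF⟩ := (convex_upperWith h.convex).exists_forall_hasDerivWithinAt h.upper
  obtain ⟨G, hG⟩ := (convex_lowerWith h.convex).exists_forall_hasDerivWithinAt h.lower
  have h1 := segmentIntegral_eq_sub (convex_lowerWith h.convex) (ofReal_mem_lowerWith hc)
    (ofReal_mem_lowerWith hc') h.lower.continuousOn hG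
  have h2 := segmentIntegral_eq_sub (convex_upperWith h.convex) (ofReal_mem_upperWith hc)
    (ofReal_mem_upperWith hc') h.upper.continuousOn hF
  rw [h.crossingIntegral_eq_sub hF hG hb hc, h.crossingIntegral_eq_sub hF hG hb hc']
  linear_combination h1 - h2

/-- Change of variables. -/
lemma crossingIntegral_comp {J' : Set ℝ} {g φ φ' : ℂ → ℂ} (h : HoloAcross J f)
    (hg : HoloAcross J' g) (hφ : ∀ z ∈ upperWith J' ∪ lowerWith J', HasDerivAt φ (φ' z) z)
    (hu : MapsTo φ (upperWith J') (upperWith J)) (hconj : ∀ z, φ (conj z) = conj (φ z))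
    (heq : ∀ z ∈ upperWith J' ∪ lowerWith J', g z = f (φ z) * φ' z) {b : ℂ} (hb : 0 < b.im)
    {c c' : ℝ} (hc' : c' ∈ J') (hcc : φ c' = c) (hφb : 0 < (φ b).im) :
    crossingIntegral g b c' = crossingIntegral f (φ b) c := by
  have hl : MapsTo φ (lowerWith J') (lowerWith J) := by
    intro z hz
    have := hu hz
    rwa [hconj] at this
  have hc : c ∈ J := by
    rcases hu (ofReal_mem_upperWith hc') with h1 | ⟨-, h1⟩
    · rw [hcc] at h1; simp at h1
    · rw [hcc] at h1; simpa using h1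
  obtain ⟨F, hF⟩ := (convex_upperWith h.convex).exists_forall_hasDerivWithinAt h.upper
  obtain ⟨G, hG⟩ := (convex_lowerWith h.convex).exists_forall_hasDerivWithinAt h.lower
  rw [h.crossingIntegral_eq_sub hF hG hφb hc,
    hg.crossingIntegral_eq_sub (F := fun z => F (φ z)) (G := fun z => G (φ z)) ?_ ?_ hb hc',
    hcc, hconj]
  · intro z hz
    rw [heq z (Or.inl hz)]
    exact (hF _ (hu hz)).comp z (hφ z (Or.inl hz)).hasDerivWithinAt hu
  · intro z hz
    rw [heq z (Or.inr hz)]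
    exact (hG _ (hl hz)).comp z (hφ z (Or.inr hz)).hasDerivWithinAt hl

end HoloAcross

lemma segmentIntegral_symm (f : ℂ → ℂ) (a b : ℂ) :
    segmentIntegral f b a = -segmentIntegral f a b := by
  unfold segmentIntegral
  have h := intervalIntegral.integral_comp_sub_left (a := 0) (b := 1)
    (fun s : ℝ => f (a + (s : ℂ) * (b - a)) * (b - a)) 1
  rw [sub_self, sub_zero] at h
  rw [← h, ← intervalIntegral.integral_neg]
  refine intervalIntegral.integral_congr fun s _ => ?_
  have : a + ((1 - s : ℝ) : ℂ) * (b - a) = b + (s : ℂ) * (a - b) := by push_cast; ring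
  simp only [this]
  ring

/-- The straight path. -/
def straight (b : ℂ) (hb : 0 < b.im) (k : ℤ) : UPath b ((k : ℝ) + 1 / 2) where
  arcs := [Arc.seg b ((k : ℝ) + 1 / 2 : ℝ)]
  chain := by
    intro G
    simp [Arc.seg]
  im_nonneg := by
    simp only [List.mem_cons, List.not_mem_nil, or_false, forall_eq]
    exact fun z hz => seg_im_nonneg hb.le hz
  not_int := by
    simp only [List.mem_cons, List.not_mem_nil, or_false, forall_eq]
    exact fun z hz j => seg_not_int hb rfl hz j

lemma straight_cross (b : ℂ) (hb : 0 < b.im) (k : ℤ) (f : ℂ → ℂ) :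
    (straight b hb k).cross f = crossingIntegral f b ((k : ℝ) + 1 / 2) := by
  have h1 : (straight b hb k).cross f = (Arc.seg b ((k : ℝ) + 1 / 2 : ℝ)).bar.integral f -
      (Arc.seg b ((k : ℝ) + 1 / 2 : ℝ)).integral f := by
    simp [UPath.cross, straight]
  rw [h1, crossingIntegral, segmentIntegral_symm f b, sub_eq_add_neg]
  congr 1
  unfold Arc.integral segmentIntegral
  generalize (k : ℝ) + 1 / 2 = c
  refine intervalIntegral.integral_congr fun s _ => ?_
  simp [Arc.bar, Arc.seg]

/-- Scaling of the variable. -/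
lemma crossingIntegral_scale (f : ℂ → ℂ) (b : ℂ) (c : ℝ) {N : ℝ} :
    crossingIntegral f (b / N) (c / N) = crossingIntegral (fun z => f (z / N) / N) b c := by
  have h : ∀ p q : ℂ, segmentIntegral f (p / N) (q / N) =
      segmentIntegral (fun z => f (z / N) / N) p q := by
    intro p q
    unfold segmentIntegral
    refine intervalIntegral.integral_congr fun s _ => ?_
    have : p / N + (s : ℂ) * (q / N - p / N) = (p + (s : ℂ) * (q - p)) / N := by ring
    simp only [this]
    ring
  rw [crossingIntegral, crossingIntegral, ← h, ← h]
  simp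

end GTBulk

end

noncomputable section

namespace GTBulk

open MeasureTheory Set
open scoped BigOperators ComplexConjugate

lemma poch_succ_sub (y : ℂ) (m : ℕ) :
    poch (y + 1) (m + 1) - poch y (m + 1) = (m + 1) * poch (y + 1) m := by
  have h1 : poch (y + 1) (m + 1) = poch (y + 1) m * (y + 1 + m) := by
    rw [poch, Finset.prod_range_succ, ← poch]
  have h2 : poch y (m + 1) = y * poch (y + 1) m := by
    rw [poch, Finset.prod_range_succ', poch, mul_comm]
    congr 1
    · simp
    · refine Finset.prod_congr rfl fun i _ => ?_
      push_cast; ring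
  rw [h1, h2]; ring

/-- The falling binomial coefficient as a polynomial. -/
def pochBinom (m : ℕ) (y : ℂ) : ℂ := poch (y + 1) m / (m.factorial : ℂ)

lemma pochBinom_sub (m : ℕ) (y : ℂ) :
    pochBinom (m + 1) y - pochBinom (m + 1) (y - 1) = pochBinom m y := by
  have h := poch_succ_sub y m
  have h1 : ((m.factorial : ℕ) : ℂ) ≠ 0 := by exact_mod_cast m.factorial_ne_zero
  have h2 : ((m : ℂ) + 1) ≠ 0 := by exact_mod_cast m.succ_ne_zero
  unfold pochBinom
  rw [sub_add_cancel, Nat.factorial_succ]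
  push_cast
  field_simp
  linear_combination h

/-- Iterated backward differences of binomial polynomials. -/
lemma sum_choose_pochBinom (M : ℕ) : ∀ (m : ℕ) (y : ℂ),
    ∑ j ∈ Finset.range (M + 1), (-1 : ℂ) ^ j * (M.choose j : ℂ) * pochBinom (M + m) (y - j) =
      pochBinom m y := by
  induction M with
  | zero => intro m y; simp
  | succ M ih =>
    intro m y
    have h1 := ih (m + 1) y
    have h2 := ih (m + 1) (y - 1)
    rw [← pochBinom_sub m y, ← h1, ← h2, Finset.sum_range_succ' _ (M + 1)]
    have h3 : ∀ j : ℕ, ((M + 1).choose (j + 1) : ℂ) = M.choose j + M.choose (j + 1) := by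
      intro j; rw [Nat.choose_succ_succ]; push_cast; ring
    have h4 : ∑ j ∈ Finset.range (M + 1), (-1 : ℂ) ^ (j + 1) * (M.choose (j + 1) : ℂ) *
        pochBinom (M + (m + 1)) (y - (j + 1 : ℕ)) =
        ∑ j ∈ Finset.range M, (-1 : ℂ) ^ (j + 1) * (M.choose (j + 1) : ℂ) *
        pochBinom (M + (m + 1)) (y - (j + 1 : ℕ)) := by
      rw [Finset.sum_range_succ, Nat.choose_succ_self]; simp
    have h5 : M + 1 + m = M + (m + 1) := by ring
    have h7 := Finset.sum_range_succ' (fun j : ℕ => (-1 : ℂ) ^ j * (M.choose j : ℂ) *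
      pochBinom (M + (m + 1)) (y - j)) M
    rw [h5, h7, ← h4]
    simp only [h3, Nat.choose_zero_right]
    rw [add_sub_right_comm, ← Finset.sum_sub_distrib]
    congr 1
    refine Finset.sum_congr rfl fun j _ => ?_
    have h6 : y - ((j + 1 : ℕ) : ℂ) = y - 1 - j := by push_cast; ring
    rw [h6, pow_succ]
    ring

lemma prod_erase_sub (x : ℤ) {M j : ℕ} (hj : j ≤ M) :
    ∏ i ∈ (pochRoots x (M + 1)).erase (x - j), (((x - j : ℤ) : ℂ) - (i : ℂ)) =
      (-1) ^ j * (j.factorial : ℂ) * ((M - j).factorial : ℂ) := by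
  have hs : (pochRoots x (M + 1)).erase (x - j) =
      Finset.Ioc (x - j) x ∪ Finset.Ico (x - M) (x - j) := by
    ext k; simp only [pochRoots, Finset.mem_erase, Finset.mem_Ioc, Finset.mem_union,
      Finset.mem_Ico]; push_cast; omega
  have hd : Disjoint (Finset.Ioc (x - j) x) (Finset.Ico (x - M) (x - j)) := by
    rw [Finset.disjoint_left]; intro k; simp only [Finset.mem_Ioc, Finset.mem_Ico]; omega
  rw [hs, Finset.prod_union hd]
  congr 1
  · have : ((j.factorial : ℕ) : ℂ) = ∏ k ∈ Finset.Ioc (0 : ℤ) j, (k : ℂ) := factorial_eq_prod j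
    rw [this]
    have hc : (-1 : ℂ) ^ j = ∏ _k ∈ Finset.Ioc (0 : ℤ) j, (-1 : ℂ) := by simp
    rw [hc, ← Finset.prod_mul_distrib]
    refine Finset.prod_bij (fun k _ => k - (x - j)) ?_ ?_ ?_ ?_
    · intro k hk; simp at hk ⊢; omega
    · intro a _ b _ h; simpa using h
    · intro b hb; simp at hb; exact ⟨b + (x - j), by simp; omega, by ring⟩
    · intro k _; push_cast; ring
  · rw [factorial_eq_prod]
    refine Finset.prod_bij (fun k _ => (x - j) - k) ?_ ?_ ?_ ?_
    · intro k hk; simp at hk ⊢; omega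
    · intro a _ b _ h; simpa using h
    · intro b hb; simp at hb; exact ⟨(x - j) - b, by simp; omega, by ring⟩
    · intro k _; push_cast; ring

/-- The product of the two factors. -/
def diagFactor (N : ℕ) (x₁ : ℤ) (n₁ : ℕ) (x₂ : ℤ) (n₂ : ℕ) (z : ℂ) : ℂ :=
  poch (z - (x₂ : ℂ) + 1) (N - n₂ - 1) / poch (z - (x₁ : ℂ)) (N - n₁ + 1)

lemma zFactor_mul_wFactor {N : ℕ} {t : TopRow N} {x₁ x₂ : ℤ} {n₁ n₂ : ℕ} {z : ℂ}
    (hz : ∀ k : ℤ, z ≠ k) :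
    zFactor N t x₂ n₂ z * wFactor N t x₁ n₁ z = diagFactor N x₁ n₁ x₂ n₂ z := by
  have : ∏ r : Fin N, (z - (t r : ℂ)) ≠ 0 :=
    Finset.prod_ne_zero_iff.2 fun r _ => sub_ne_zero.2 (hz _)
  rw [zFactor, wFactor, diagFactor]
  field_simp

/-- The residues of the product of the two factors. -/
def diagRes (N : ℕ) (x₁ : ℤ) (n₁ : ℕ) (x₂ : ℤ) (n₂ : ℕ) (k : ℤ) : ℂ :=
  poch ((k : ℂ) - (x₂ : ℂ) + 1) (N - n₂ - 1) /
    ∏ j ∈ (pochRoots x₁ (N - n₁ + 1)).erase k, ((k : ℂ) - j)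

lemma poch_int_eq_zero {k x : ℤ} {m : ℕ} (h1 : x - m ≤ k) (h2 : k < x) :
    poch ((k : ℂ) - (x : ℂ) + 1) m = 0 := by
  have := poch_eq_prod (x - 1) m k
  push_cast at this
  rw [sub_sub_eq_add_sub, add_sub_right_comm] at this
  rw [this]
  refine Finset.prod_eq_zero (i := k) ?_ (sub_self _)
  simp only [pochRoots, Finset.mem_Ioc]; omega

lemma diagRes_eq_zero {N : ℕ} {x₁ x₂ : ℤ} {n₁ n₂ : ℕ} {k : ℤ} (h1 : x₂ - (N - n₂ - 1 : ℕ) ≤ k)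
    (h2 : k < x₂) : diagRes N x₁ n₁ x₂ n₂ k = 0 := by
  rw [diagRes, poch_int_eq_zero h1 h2, zero_div]

lemma diagFactor_partial_fractions (N : ℕ) (x₁ : ℤ) (n₁ : ℕ) (x₂ : ℤ) (n₂ : ℕ) :
    ∃ p : Polynomial ℂ, ∀ z : ℂ, (∀ k ∈ pochRoots x₁ (N - n₁ + 1), z ≠ k) →
      diagFactor N x₁ n₁ x₂ n₂ z = p.eval z +
        ∑ k ∈ pochRoots x₁ (N - n₁ + 1), diagRes N x₁ n₁ x₂ n₂ k * (1 / (z - k)) := by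
  obtain ⟨p, hp⟩ := partial_fractions (pochPoly (x₂ - 1) (N - n₂ - 1)) (pochRoots x₁ (N - n₁ + 1))
  refine ⟨p, fun z hz => ?_⟩
  have h : ∀ z : ℂ, (pochPoly (x₂ - 1) (N - n₂ - 1)).eval z =
      poch (z - (x₂ : ℂ) + 1) (N - n₂ - 1) := by
    intro z
    rw [eval_pochPoly]
    push_cast
    rw [sub_sub_eq_add_sub, add_sub_right_comm]
  have := hp z hz
  simp only [h] at this
  rw [diagFactor, poch_eq_prod, this]
  rfl

/-- The sum of all residues. -/
lemma sum_diagRes {N : ℕ} {x₁ x₂ : ℤ} {n₁ n₂ : ℕ} (h₁ : n₁ < N) (hn : n₂ < n₁) :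
    ((N - n₁).factorial : ℂ) / ((N - n₂ - 1).factorial : ℂ) *
      ∑ k ∈ pochRoots x₁ (N - n₁ + 1), diagRes N x₁ n₁ x₂ n₂ k =
      poch ((x₁ : ℂ) - (x₂ : ℂ) + 1) (n₁ - n₂ - 1) / ((n₁ - n₂ - 1).factorial : ℂ) := by
  set M := N - n₁ with hM
  have hM2 : N - n₂ - 1 = M + (n₁ - n₂ - 1) := by omega
  have key := sum_choose_pochBinom M (n₁ - n₂ - 1) ((x₁ : ℂ) - x₂)
  rw [← hM2] at key
  change _ = pochBinom (n₁ - n₂ - 1) ((x₁ : ℂ) - x₂)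
  rw [← key, Finset.mul_sum]
  symm
  refine Finset.sum_bij (fun j _ => x₁ - (j : ℤ)) ?_ ?_ ?_ ?_
  · intro j hj; simp [pochRoots] at hj ⊢; omega
  · intro a _ b _ h; simpa using h
  · intro k hk
    simp [pochRoots] at hk
    exact ⟨(x₁ - k).toNat, by simp; omega, by simp; omega⟩
  · intro j hj
    have hj' : j ≤ M := by simpa [Nat.lt_succ_iff] using hj
    have e1 : ((x₁ - (j : ℤ) : ℤ) : ℂ) - x₂ + 1 = (x₁ : ℂ) - x₂ - j + 1 := by push_cast; ring
    rw [diagRes, ← hM, prod_erase_sub x₁ hj', pochBinom, e1,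
      Nat.cast_choose ℂ hj']
    have f1 : ((j.factorial : ℕ) : ℂ) ≠ 0 := by exact_mod_cast j.factorial_ne_zero
    have f2 : (((M - j).factorial : ℕ) : ℂ) ≠ 0 := by exact_mod_cast (M - j).factorial_ne_zero
    have f3 : (((N - n₂ - 1).factorial : ℕ) : ℂ) ≠ 0 := by
      exact_mod_cast (N - n₂ - 1).factorial_ne_zero
    have f4 : ((-1 : ℂ) ^ j) * (-1) ^ j = 1 := by rw [← mul_pow]; simp
    have f5 : ((-1 : ℂ) ^ j) ≠ 0 := pow_ne_zero _ (by norm_num)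
    field_simp
    rw [pow_two, f4, one_mul]

/-- The contribution of the residues to the right of the crossing point. -/
lemma sum_diagRes_right {N : ℕ} {x₁ x₂ : ℤ} {n₁ n₂ : ℕ} (h₁ : n₁ < N) (hn : n₂ < n₁) {c : ℝ}
    (hc₂ : c < x₂) (hc₂' : (x₂ : ℝ) - (N - n₂ - 1 : ℕ) ≤ c) :
    ((N - n₁).factorial : ℂ) / ((N - n₂ - 1).factorial : ℂ) *
      ∑ k ∈ pochRoots x₁ (N - n₁ + 1) with c < ((k : ℤ) : ℝ), diagRes N x₁ n₁ x₂ n₂ k =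
      if n₂ < n₁ ∧ x₂ ≤ x₁ then
        poch ((x₁ : ℂ) - (x₂ : ℂ) + 1) (n₁ - n₂ - 1) / ((n₁ - n₂ - 1).factorial : ℂ) else 0 := by
  by_cases hx : x₂ ≤ x₁
  · rw [if_pos ⟨hn, hx⟩, ← sum_diagRes h₁ hn]
    congr 1
    rw [Finset.sum_filter]
    refine Finset.sum_congr rfl fun k hk => ?_
    split_ifs with hck
    · rfl
    · symm
      refine diagRes_eq_zero ?_ ?_
      · simp only [pochRoots, Finset.mem_Ioc] at hk
        omega
      · have : (k : ℝ) < x₂ := lt_of_le_of_lt (not_lt.1 hck) hc₂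
        exact_mod_cast this
  · rw [if_neg (fun h => hx h.2), Finset.sum_eq_zero, mul_zero]
    intro k hk
    rw [Finset.mem_filter] at hk
    refine diagRes_eq_zero ?_ ?_
    · have : (x₂ : ℝ) - (N - n₂ - 1 : ℕ) ≤ k := hc₂'.trans hk.2.le
      exact_mod_cast this
    · have := hk.1
      simp only [pochRoots, Finset.mem_Ioc] at this
      omega

end GTBulk

end

noncomputable section

namespace GTBulk

open MeasureTheory Set
open scoped BigOperators ComplexConjugate

/-- Distances along a segment ending on the real axis. -/
lemma seg_between {b : ℂ} {c q N D g U κ : ℝ} (hN : 0 < N) (hD : 0 < D) (hg : 0 < g)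
    (hb : N / D ≤ b.im) (hbq : ‖b - q‖ ≤ N * U) (hcq : |c - q| ≤ N * U) (hcg : N * g ≤ |c - q|)
    (hκ1 : κ ≤ 1 / (2 * D)) (hκ2 : κ * (1 + D * U) ≤ g / 2) (hκ : 0 < κ) {s : ℝ}
    (hs : s ∈ Icc (0 : ℝ) 1) :
    N * κ ≤ ‖(Arc.seg b c).fn s - q‖ ∧ ‖(Arc.seg b c).fn s - q‖ ≤ N * U := by
  have e : (Arc.seg b c).fn s - q = ((1 - s : ℝ) : ℂ) * (b - q) + (s : ℂ) * ((c - q : ℝ) : ℂ) := by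
    simp [Arc.seg]; ring
  have hs1 : 0 ≤ 1 - s := by linarith [hs.2]
  have n1 : ‖((1 - s : ℝ) : ℂ) * (b - q)‖ = (1 - s) * ‖b - q‖ := by
    rw [norm_mul, Complex.norm_real, Real.norm_of_nonneg hs1]
  have n2 : ‖(s : ℂ) * ((c - q : ℝ) : ℂ)‖ = s * |c - q| := by
    rw [norm_mul, Complex.norm_real, Complex.norm_real, Real.norm_of_nonneg hs.1, Real.norm_eq_abs]
  constructor
  · by_contra hlt
    rw [not_le] at hlt
    have h1 := Complex.abs_im_le_norm ((Arc.seg b c).fn s - q)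
    rw [Complex.sub_im, Complex.ofReal_im, sub_zero, seg_im] at h1
    have h2 := (le_abs_self _).trans h1
    have h3 : (1 - s) * (N / D) < N * κ :=
      (mul_le_mul_of_nonneg_left hb hs1).trans_lt (h2.trans_lt hlt)
    have h4 : 1 - s < κ * D := by
      rw [mul_div_assoc', div_lt_iff₀ hD] at h3
      nlinarith
    have h5 : κ * D ≤ 1 / 2 := by
      rw [le_div_iff₀ (by positivity)] at hκ1; linarith
    have h6 := norm_sub_le ((Arc.seg b c).fn s - q) (((1 - s : ℝ) : ℂ) * (b - q))
    rw [e, add_sub_cancel_left, n2, ← e, n1] at h6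
    have h7 : (1 - s) * ‖b - q‖ ≤ κ * D * (N * U) :=
      mul_le_mul h4.le hbq (norm_nonneg _) (by positivity)
    have h8 : 1 / 2 * (N * g) ≤ s * |c - q| := mul_le_mul (by linarith) hcg (by positivity) hs.1
    have h9 : N * (κ * (1 + D * U)) ≤ N * (g / 2) := mul_le_mul_of_nonneg_left hκ2 hN.le
    nlinarith
  · rw [e]
    refine (norm_add_le _ _).trans ?_
    rw [n1, n2]
    nlinarith [mul_le_mul_of_nonneg_left hbq hs1, mul_le_mul_of_nonneg_left hcq hs.1]

/-- The integrand of the leading term. -/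
def bulkIntegrand (N : ℕ) (x₁ : ℤ) (n₁ : ℕ) (x₂ : ℤ) (n₂ : ℕ) (u : ℂ) : ℂ :=
  (u - (x₁ : ℂ) / (N : ℂ)) ^ (x₂ - x₁ - 1) /
    (u - (x₁ : ℂ) / (N : ℂ) + 1 - (n₁ : ℂ) / (N : ℂ)) ^ (x₂ - x₁ + (n₂ : ℤ) - (n₁ : ℤ) + 1)

lemma bulkIntegrand_scale {N n₁ n₂ : ℕ} {x₁ x₂ : ℤ} (hN : 0 < N) (h₁ : n₁ < N) (h₂ : n₂ < N) (z : ℂ)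
    (hz : z - x₁ ≠ 0) :
    (1 - (n₁ : ℂ) / (N : ℂ)) ^ (1 + (n₂ : ℤ) - (n₁ : ℤ)) *
      (bulkIntegrand N x₁ n₁ x₂ n₂ (z / N) / N) =
    (((N - n₁ : ℕ) : ℂ) ^ (((N - n₁ : ℕ) : ℤ) - (N - n₂ - 1 : ℕ))) *
      ((z - x₁) ^ (x₂ - x₁) *
        ((z - x₁ + (N - n₁ : ℕ)) ^ (x₂ - x₁ + (N - n₁ : ℕ) - (N - n₂ - 1 : ℕ)))⁻¹) *
          (z - x₁)⁻¹ := by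
  have hNc : (N : ℂ) ≠ 0 := by exact_mod_cast hN.ne'
  have hM : ((N - n₁ : ℕ) : ℂ) = N - n₁ := by rw [Nat.cast_sub h₁.le]
  have e1 : (1 - (n₁ : ℂ) / N) = ((N - n₁ : ℕ) : ℂ) / N := by rw [hM]; field_simp
  have e2 : z / N - (x₁ : ℂ) / N = (z - x₁) / N := by ring
  have e3 : z / N - (x₁ : ℂ) / N + 1 - (n₁ : ℂ) / N = (z - x₁ + (N - n₁ : ℕ)) / N := by
    rw [hM]; field_simp; ring
  have i1 : ((N - n₁ : ℕ) : ℤ) - (N - n₂ - 1 : ℕ) = 1 + (n₂ : ℤ) - n₁ := by omega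
  have i2 : x₂ - x₁ + ((N - n₁ : ℕ) : ℤ) - (N - n₂ - 1 : ℕ) = x₂ - x₁ + (n₂ : ℤ) - n₁ + 1 := by
    omega
  rw [bulkIntegrand, e3, e2, e1, i1, i2, div_zpow, div_zpow, div_zpow, zpow_sub_one₀ hz]
  have hp : (N : ℂ) ^ (x₂ - x₁ + (n₂ : ℤ) - n₁ + 1) =
      N ^ (1 + (n₂ : ℤ) - n₁) * N ^ (x₂ - x₁ - 1) * N := by
    rw [← zpow_add₀ hNc, ← zpow_add_one₀ hNc]; congr 1; ring
  have p1 : (N : ℂ) ^ (1 + (n₂ : ℤ) - n₁) ≠ 0 := zpow_ne_zero _ hNc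
  have p2 : (N : ℂ) ^ (x₂ - x₁ - 1) ≠ 0 := zpow_ne_zero _ hNc
  rw [hp]
  field_simp

namespace Setting

variable {D : ℝ} {d N : ℕ} {t : TopRow N} {x₁ x₂ : ℤ} {n₁ n₂ : ℕ} {σ : ℂ}

/-- The integrand of the leading term approximates the exact one. -/
lemma norm_diagFactor_sub_le (h : Setting D d N t x₁ x₂ n₁ n₂ σ) (h₁ : n₁ < N) {R : ℝ} (hR : 1 ≤ R)
    (hN : blockConst D * (4 * (d + 1) ^ 2) ≤ N) (hdN : 8 * (d + 1) ^ 2 * R ≤ N) {z : ℂ}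
    (hz : ∀ k : ℤ, z ≠ k) (ha : N / R ≤ ‖z - x₁‖) (ha' : ‖z - x₁‖ ≤ N * R)
    (hb : N / R ≤ ‖z - x₁ + (N - n₁ : ℕ)‖) (hb' : ‖z - x₁ + (N - n₁ : ℕ)‖ ≤ N * R) :
    ‖((N - n₁).factorial : ℂ) / ((N - n₂ - 1).factorial : ℂ) * diagFactor N x₁ n₁ x₂ n₂ z -
      (1 - (n₁ : ℂ) / (N : ℂ)) ^ (1 + (n₂ : ℤ) - (n₁ : ℤ)) *
        (bulkIntegrand N x₁ n₁ x₂ n₂ (z / N) / N)‖ ≤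
      blockConst D ^ d * R ^ (2 * d + 1) *
        (3 * (8 * d ^ 2 * blockConst D) + 16 * (d + 1) ^ 2 * R) / N ^ 2 := by
  have hN0 := h.bulk.N_pos
  have hNn : 0 < N := by exact_mod_cast hN0
  have hQ := one_le_blockConst h.bulk.one_lt
  have hR0 : 0 < R := by linarith
  obtain ⟨m1, m2⟩ := h.block_between
  have hd0 : (0 : ℝ) ≤ d := Nat.cast_nonneg d
  have h4 : (4 * (d + 1) ^ 2 : ℝ) ≤ (N - n₁ : ℕ) := by
    refine le_trans ?_ m1
    rw [le_div_iff₀ (by linarith)]; linarith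
  have hm : (0 : ℝ) < (N - n₁ : ℕ) := lt_of_lt_of_le (by positivity) h4
  obtain ⟨θ, t1, t2⟩ := factorial_ratio_approx (m := N - n₁) (m₂ := N - n₂ - 1) (d := d)
    (by exact_mod_cast hm) h.dm (by
      have : (2 * (d + 1) * (2 * d) : ℝ) ≤ (N - n₁ : ℕ) := by nlinarith
      exact_mod_cast this)
  obtain ⟨θ', u1, u2⟩ := exists_zFactor_eq h.anti hR0 hNn hz h.dx h.dl (h.le_block hN) hdN ha hb
  have hz0 : z - x₁ ≠ 0 := sub_ne_zero.2 (hz x₁)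
  have hq := blockQuot_ne_zero (T := rowSet t) (x := x₁) (M := N - n₁) hz
  rw [← zFactor_mul_wFactor (t := t) hz, u2, wFactor_eq h.anti, t2,
    bulkIntegrand_scale hNn h₁ h.lt z hz0]
  set A := (((N - n₁ : ℕ) : ℂ) ^ (((N - n₁ : ℕ) : ℤ) - (N - n₂ - 1 : ℕ))) with hA
  set B := (z - x₁) ^ (x₂ - x₁) *
    ((z - x₁ + (N - n₁ : ℕ)) ^ (x₂ - x₁ + (N - n₁ : ℕ) - (N - n₂ - 1 : ℕ)))⁻¹ with hB
  have e : A * (1 + θ) * (blockQuot (rowSet t) x₁ (N - n₁) z * B * (1 + θ') *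
      ((blockQuot (rowSet t) x₁ (N - n₁) z)⁻¹ * (z - x₁)⁻¹)) - A * B * (z - x₁)⁻¹ =
      A * B * (z - x₁)⁻¹ * (θ * (1 + θ') + θ') := by
    field_simp; ring
  rw [e, norm_mul]
  have b1 : ‖A * B * (z - x₁)⁻¹‖ ≤ blockConst D ^ d * R ^ (2 * d + 1) / N := by
    have c1 := zpow_le_of_between hN0 hQ m1 m2 h.dm
    have c2 := zpow_le_of_between hN0 hR ha ha' h.dx
    have c3 := zpow_le_of_between hN0 hR hb hb' (by have := h.dl; rwa [← abs_neg] at this)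
    have c4 : ‖z - x₁‖⁻¹ ≤ R / N := by
      rw [← inv_div]; exact inv_anti₀ (by positivity) ha
    rw [norm_mul, norm_mul, norm_inv, hA, hB, norm_mul, norm_inv, norm_zpow, norm_zpow, norm_zpow,
      Complex.norm_natCast, ← zpow_neg]
    calc _ ≤ blockConst D ^ d * (N : ℝ) ^ (((N - n₁ : ℕ) : ℤ) - (N - n₂ - 1 : ℕ)) *
        (R ^ d * (N : ℝ) ^ (x₂ - x₁) *
          (R ^ d * (N : ℝ) ^ (-(x₂ - x₁ + (N - n₁ : ℕ) - (N - n₂ - 1 : ℕ))))) * (R / N) := by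
          gcongr
      _ = blockConst D ^ d * (R ^ d * R ^ d * R) *
        ((N : ℝ) ^ (((N - n₁ : ℕ) : ℤ) - (N - n₂ - 1 : ℕ)) * (N : ℝ) ^ (x₂ - x₁) *
          (N : ℝ) ^ (-(x₂ - x₁ + (N - n₁ : ℕ) - (N - n₂ - 1 : ℕ)))) / N := by ring
      _ = _ := by
        have : ((N - n₁ : ℕ) : ℤ) - (N - n₂ - 1 : ℕ) + (x₂ - x₁) +
          -(x₂ - x₁ + (N - n₁ : ℕ) - (N - n₂ - 1 : ℕ)) = 0 := by ring
        rw [← zpow_add₀ hN0.ne', ← zpow_add₀ hN0.ne', this, zpow_zero, mul_one]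
        ring
  have b2 : ‖θ * (1 + θ') + θ'‖ ≤
      (3 * (8 * d ^ 2 * blockConst D) + 16 * (d + 1) ^ 2 * R) / N := by
    have d1 : ‖θ‖ ≤ 8 * d ^ 2 * blockConst D / N := by
      refine t1.trans ?_
      rw [div_le_div_iff₀ hm hN0]
      rw [div_le_iff₀ (by linarith)] at m1
      have : (0 : ℝ) ≤ 8 * d ^ 2 := by positivity
      nlinarith
    have d2 : ‖1 + θ'‖ ≤ 3 := by
      have h8 : 16 * (d + 1) ^ 2 * R / N ≤ 2 := by rw [div_le_iff₀ hN0]; linarith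
      have := norm_add_le (1 : ℂ) θ'
      rw [norm_one] at this
      linarith
    refine (norm_add_le _ _).trans ?_
    rw [norm_mul]
    calc ‖θ‖ * ‖1 + θ'‖ + ‖θ'‖ ≤ 8 * d ^ 2 * blockConst D / N * 3 + 16 * (d + 1) ^ 2 * R / N := by
          gcongr
      _ = _ := by ring
  calc _ ≤ blockConst D ^ d * R ^ (2 * d + 1) / N *
        ((3 * (8 * d ^ 2 * blockConst D) + 16 * (d + 1) ^ 2 * R) / N) :=
        mul_le_mul b1 b2 (norm_nonneg _) (by positivity)
    _ = _ := by rw [div_mul_div_comm, pow_two (N : ℝ)]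

end Setting

lemma norm_crossingIntegral_le {f : ℂ → ℂ} {b : ℂ} {c L : ℝ} {C : ℝ} (hL : ‖(c : ℂ) - b‖ ≤ L)
    (hC : 0 ≤ C)
    (h : ∀ s ∈ Ioo (0 : ℝ) 1, ‖f ((Arc.seg b c).fn s)‖ ≤ C ∧ ‖f (conj ((Arc.seg b c).fn s))‖ ≤ C)
    (hb : 0 < b.im) {k : ℤ} (hc : c = k + 1 / 2) : ‖(straight b hb k).cross f‖ ≤ 2 * (C * L) := by
  subst hc
  have h1 : (straight b hb k).cross f = (Arc.seg b ((k : ℝ) + 1 / 2 : ℝ)).bar.integral f -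
      (Arc.seg b ((k : ℝ) + 1 / 2 : ℝ)).integral f := by
    simp [UPath.cross, straight]
  have aux : ∀ A : Arc, A.lo = 0 → A.hi = 1 →
      (∀ v ∈ Ioo A.lo A.hi, ‖f (A.fn v)‖ * ‖A.dfn v‖ ≤ C * L) → ‖A.integral f‖ ≤ C * L := by
    intro A h0 h1 hA
    refine (A.norm_integral_le (m := fun _ => C * L) (by simp) hA).trans ?_
    rw [h0, h1]; simp
  rw [h1]
  refine (norm_sub_le _ _).trans ?_
  have a1 := aux (Arc.seg b ((k : ℝ) + 1 / 2 : ℝ)).bar rfl rfl (fun v hv => by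
    refine mul_le_mul (h v hv).2 ?_ (norm_nonneg _) hC
    change ‖conj (((((k : ℝ) + 1 / 2 : ℝ)) : ℂ) - b)‖ ≤ L
    rwa [Complex.norm_conj])
  have a2 := aux (Arc.seg b ((k : ℝ) + 1 / 2 : ℝ)) rfl rfl (fun v hv =>
    mul_le_mul (h v hv).1 hL (norm_nonneg _) hC)
  linarith

end GTBulk

end

noncomputable section

namespace GTBulk

open MeasureTheory Set
open scoped BigOperators ComplexConjugate

lemma crossingIntegral_const_mul (a : ℂ) (f : ℂ → ℂ) (b : ℂ) (c : ℝ) :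
    crossingIntegral (fun z => a * f z) b c = a * crossingIntegral f b c := by
  simp only [crossingIntegral, segmentIntegral, mul_assoc, intervalIntegral.integral_const_mul,
    mul_add]

lemma differentiableAt_bulkIntegrand {N n₁ n₂ : ℕ} {x₁ x₂ : ℤ} {u : ℂ}
    (h1 : u - (x₁ : ℂ) / (N : ℂ) ≠ 0) (h2 : u - (x₁ : ℂ) / (N : ℂ) + 1 - (n₁ : ℂ) / (N : ℂ) ≠ 0) :
    DifferentiableAt ℂ (bulkIntegrand N x₁ n₁ x₂ n₂) u := by
  unfold bulkIntegrand
  refine DifferentiableAt.div ?_ ?_ (zpow_ne_zero _ h2)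
  · exact DifferentiableAt.zpow (by fun_prop) (Or.inl h1)
  · exact DifferentiableAt.zpow (by fun_prop) (Or.inl h2)

lemma not_mem_upperWith {J : Set ℝ} {q : ℝ} (hq : q ∉ J) {z : ℂ}
    (hz : z ∈ upperWith J ∪ lowerWith J) : z ≠ q := by
  rintro rfl
  have h : (q : ℂ) ∈ upperWith J := by
    rcases hz with h | h
    · exact h
    · change conj (q : ℂ) ∈ upperWith J at h
      rwa [Complex.conj_ofReal] at h
  rcases h with h | ⟨-, h⟩
  · simp at h
  · exact hq (by simpa using h)

lemma holoAcross_of_differentiableAt {J : Set ℝ} (hJ : Convex ℝ J) {f : ℂ → ℂ}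
    (h : ∀ z ∈ upperWith J ∪ lowerWith J, DifferentiableAt ℂ f z) : HoloAcross J f :=
  ⟨hJ, fun z hz => (h z (Or.inl hz)).differentiableWithinAt,
    fun z hz => (h z (Or.inr hz)).differentiableWithinAt⟩

/-- The admissible crossing points for the leading term. -/
def crossSet (N : ℕ) (x₁ : ℤ) (n₁ n₂ : ℕ) : Set ℝ :=
  {c | (n₁ ≤ n₂ → (x₁ : ℝ) / (N : ℝ) < c) ∧
    (n₂ < n₁ → c ∈ Ioo (((x₁ : ℝ) + (n₁ : ℝ) - (N : ℝ)) / (N : ℝ)) ((x₁ : ℝ) / (N : ℝ)))}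

/-- The admissible crossing points for the incomplete Beta kernel. -/
def betaSet (n₁ n₂ : ℕ) : Set ℝ :=
  {c | (n₁ ≤ n₂ → c ∈ Ioo (0 : ℝ) 1) ∧ (n₂ < n₁ → c < 0)}

lemma convex_crossSet (N : ℕ) (x₁ : ℤ) (n₁ n₂ : ℕ) : Convex ℝ (crossSet N x₁ n₁ n₂) := by
  rcases le_or_gt n₁ n₂ with h | h
  · have : crossSet N x₁ n₁ n₂ = Ioi ((x₁ : ℝ) / N) := by
      ext c; simp [crossSet, h, h.not_gt]
    rw [this]; exact convex_Ioi _
  · have : crossSet N x₁ n₁ n₂ = Ioo (((x₁ : ℝ) + n₁ - N) / N) ((x₁ : ℝ) / N) := by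
      ext c; simp [crossSet, h, h.not_ge]
    rw [this]; exact convex_Ioo _ _

lemma convex_betaSet (n₁ n₂ : ℕ) : Convex ℝ (betaSet n₁ n₂) := by
  rcases le_or_gt n₁ n₂ with h | h
  · have : betaSet n₁ n₂ = Ioo 0 1 := by ext c; simp [betaSet, h, h.not_gt]
    rw [this]; exact convex_Ioo _ _
  · have : betaSet n₁ n₂ = Iio 0 := by ext c; simp [betaSet, h, h.not_ge]
    rw [this]; exact convex_Iio _

section Slope

variable {N n₁ n₂ : ℕ} {x₁ x₂ : ℤ}

lemma left_lt (hN : 0 < N) (h₁ : n₁ < N) : ((x₁ : ℝ) + n₁ - N) / N < x₁ / N := by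
  have : (0 : ℝ) < N := by exact_mod_cast hN
  have h2 : (n₁ : ℝ) < N := by exact_mod_cast h₁
  gcongr; linarith

lemma base_ne_zero (hN : 0 < N) (h₁ : n₁ < N) {z : ℂ}
    (hz : z ∈ upperWith (crossSet N x₁ n₁ n₂) ∪ lowerWith (crossSet N x₁ n₁ n₂)) :
    z - (x₁ : ℂ) / (N : ℂ) ≠ 0 ∧ z - (x₁ : ℂ) / (N : ℂ) + 1 - (n₁ : ℂ) / (N : ℂ) ≠ 0 := by
  have hNc : (N : ℂ) ≠ 0 := by exact_mod_cast hN.ne'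
  have hlt := left_lt (x₁ := x₁) hN h₁
  constructor
  · have := not_mem_upperWith (q := (x₁ : ℝ) / N) (by
      rintro ⟨h1, h2⟩
      rcases le_or_gt n₁ n₂ with h | h
      · exact lt_irrefl _ (h1 h)
      · exact lt_irrefl _ (h2 h).2) hz
    push_cast at this
    exact sub_ne_zero.2 this
  · have := not_mem_upperWith (q := ((x₁ : ℝ) + n₁ - N) / N) (by
      rintro ⟨h1, h2⟩
      rcases le_or_gt n₁ n₂ with h | h
      · exact lt_irrefl _ ((h1 h).trans hlt)
      · exact lt_irrefl _ (h2 h).1) hz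
    push_cast at this
    intro h0
    apply this
    field_simp at h0 ⊢
    linear_combination h0

lemma holoAcross_bulkIntegrand (hN : 0 < N) (h₁ : n₁ < N) :
    HoloAcross (crossSet N x₁ n₁ n₂) (bulkIntegrand N x₁ n₁ x₂ n₂) :=
  holoAcross_of_differentiableAt (convex_crossSet _ _ _ _) fun _ hz =>
    differentiableAt_bulkIntegrand (base_ne_zero hN h₁ hz).1 (base_ne_zero hN h₁ hz).2

/-- The integrand of the incomplete Beta kernel. -/
def betaIntegrand (x₁ : ℤ) (n₁ : ℕ) (x₂ : ℤ) (n₂ : ℕ) (w : ℂ) : ℂ :=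
  w ^ (x₂ - x₁ - 1) * (1 - w) ^ ((n₂ : ℤ) - (n₁ : ℤ))

lemma holoAcross_betaIntegrand : HoloAcross (betaSet n₁ n₂) (betaIntegrand x₁ n₁ x₂ n₂) := by
  refine holoAcross_of_differentiableAt (convex_betaSet _ _) fun w hw => ?_
  have h0 : w ≠ 0 := by
    have := not_mem_upperWith (q := 0) (by
      rintro ⟨h1, h2⟩
      rcases le_or_gt n₁ n₂ with h | h
      · exact lt_irrefl _ (h1 h).1
      · exact lt_irrefl _ (h2 h)) hw
    simpa using this
  have h1 : 1 - w ≠ 0 := by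
    have := not_mem_upperWith (q := 1) (by
      rintro ⟨h1, h2⟩
      rcases le_or_gt n₁ n₂ with h | h
      · exact lt_irrefl _ (h1 h).2
      · have := h2 h; norm_num at this) hw
    rw [Complex.ofReal_one] at this
    exact sub_ne_zero.2 this.symm
  unfold betaIntegrand
  exact (DifferentiableAt.zpow (by fun_prop) (Or.inl h0)).mul
    (DifferentiableAt.zpow (by fun_prop) (Or.inl h1))

/-- The change of variables between the two forms of the leading term. -/
def slopeMap (N : ℕ) (x₁ : ℤ) (n₁ : ℕ) (u : ℂ) : ℂ :=
  (u - (x₁ : ℂ) / (N : ℂ)) / (u - (x₁ : ℂ) / (N : ℂ) + 1 - (n₁ : ℂ) / (N : ℂ))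

lemma slopeMap_conj (u : ℂ) : slopeMap N x₁ n₁ (conj u) = conj (slopeMap N x₁ n₁ u) := by
  simp [slopeMap]

lemma slopeMap_eq {u : ℂ} (h : u - (x₁ : ℂ) / (N : ℂ) + 1 - (n₁ : ℂ) / (N : ℂ) ≠ 0) :
    slopeMap N x₁ n₁ u = 1 - ((1 - n₁ / N : ℝ) : ℂ) *
      (u - (x₁ : ℂ) / (N : ℂ) + 1 - (n₁ : ℂ) / (N : ℂ))⁻¹ := by
  rw [slopeMap, eq_sub_iff_add_eq, ← div_eq_mul_inv, ← add_div, div_eq_one_iff_eq h]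
  push_cast; ring

lemma one_sub_pos (hN : 0 < N) (h₁ : n₁ < N) : (0 : ℝ) < 1 - n₁ / N := by
  have : (0 : ℝ) < N := by exact_mod_cast hN
  have h2 : (n₁ : ℝ) < N := by exact_mod_cast h₁
  rw [sub_pos, div_lt_one this]; exact h2

lemma slopeMap_im_pos (hN : 0 < N) (h₁ : n₁ < N) {u : ℂ} (hu : 0 < u.im) :
    0 < (slopeMap N x₁ n₁ u).im := by
  have him : (u - (x₁ : ℂ) / (N : ℂ) + 1 - (n₁ : ℂ) / (N : ℂ)).im = u.im := by
    have h1 : ((x₁ : ℂ) / (N : ℂ)) = ((x₁ / N : ℝ) : ℂ) := by push_cast; ring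
    have h2 : ((n₁ : ℂ) / (N : ℂ)) = ((n₁ / N : ℝ) : ℂ) := by push_cast; ring
    rw [h1, h2]; simp
  have hne : u - (x₁ : ℂ) / (N : ℂ) + 1 - (n₁ : ℂ) / (N : ℂ) ≠ 0 := by
    intro h0; rw [h0] at him; simp at him; linarith
  have hp := one_sub_pos hN h₁
  rw [slopeMap_eq hne, Complex.sub_im, Complex.im_ofReal_mul, Complex.inv_im, him, Complex.one_im]
  have := Complex.normSq_pos.2 hne
  rw [zero_sub, neg_div, mul_neg, neg_neg]
  positivity

lemma slopeMap_ofReal (u : ℝ) : slopeMap N x₁ n₁ u = ((u - x₁ / N) / (u - x₁ / N + 1 - n₁ / N) : ℝ) := by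
  unfold slopeMap; push_cast; rfl

lemma slopeMap_mem (hN : 0 < N) (h₁ : n₁ < N) {u : ℝ} (hu : u ∈ crossSet N x₁ n₁ n₂) :
    (u - x₁ / N) / (u - x₁ / N + 1 - n₁ / N) ∈ betaSet n₁ n₂ := by
  have hp := one_sub_pos hN h₁
  have hN' : (0 : ℝ) < N := by exact_mod_cast hN
  have e : ((x₁ : ℝ) + n₁ - N) / N = x₁ / N - (1 - n₁ / N) := by field_simp; ring
  obtain ⟨h1, h2⟩ := hu
  refine ⟨fun h => ?_, fun h => ?_⟩
  · have h3 := h1 h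
    constructor
    · exact div_pos (by linarith) (by linarith)
    · rw [div_lt_one (by linarith)]; linarith
  · have h3 := h2 h
    rw [e] at h3
    exact div_neg_of_neg_of_pos (by linarith [h3.2]) (by linarith [h3.1])

lemma mapsTo_slopeMap (hN : 0 < N) (h₁ : n₁ < N) :
    MapsTo (slopeMap N x₁ n₁) (upperWith (crossSet N x₁ n₁ n₂)) (upperWith (betaSet n₁ n₂)) := by
  rintro u (hu | ⟨hu, hu'⟩)
  · exact Or.inl (slopeMap_im_pos hN h₁ hu)
  · have : u = (u.re : ℂ) := by apply Complex.ext <;> simp [hu]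
    rw [this, slopeMap_ofReal]
    exact ofReal_mem_upperWith (slopeMap_mem hN h₁ hu')

/-- The two forms of the leading term. -/
lemma bulk_eq_beta (hN : 0 < N) (h₁ : n₁ < N) {b : ℂ} (hb : 0 < b.im) {c c' : ℝ}
    (hc' : c' ∈ crossSet N x₁ n₁ n₂) (hcc : slopeMap N x₁ n₁ c' = c) :
    (1 - (n₁ : ℂ) / (N : ℂ)) ^ (1 + (n₂ : ℤ) - (n₁ : ℤ)) *
      crossingIntegral (bulkIntegrand N x₁ n₁ x₂ n₂) b c' =
      crossingIntegral (betaIntegrand x₁ n₁ x₂ n₂) (slopeMap N x₁ n₁ b) c := by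
  have hp := one_sub_pos hN h₁
  have hpc : (1 - (n₁ : ℂ) / (N : ℂ)) ≠ 0 := by
    have : ((1 - n₁ / N : ℝ) : ℂ) ≠ 0 := by exact_mod_cast hp.ne'
    push_cast at this
    exact this
  rw [← crossingIntegral_const_mul]
  refine (holoAcross_betaIntegrand (x₁ := x₁) (x₂ := x₂) (n₁ := n₁) (n₂ := n₂)).crossingIntegral_comp
    (φ' := fun u => (1 - (n₁ : ℂ) / (N : ℂ)) /
      (u - (x₁ : ℂ) / (N : ℂ) + 1 - (n₁ : ℂ) / (N : ℂ)) ^ 2)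
    (J' := crossSet N x₁ n₁ n₂) ?_ ?_ (mapsTo_slopeMap hN h₁) (fun z => slopeMap_conj z) ?_ hb hc' hcc
    (slopeMap_im_pos hN h₁ hb)
  · exact ⟨convex_crossSet _ _ _ _, (holoAcross_bulkIntegrand hN h₁).upper.const_mul _,
      (holoAcross_bulkIntegrand hN h₁).lower.const_mul _⟩
  · intro u hu
    obtain ⟨h1, h2⟩ := base_ne_zero hN h₁ hu
    have d1 : HasDerivAt (fun u : ℂ => u - (x₁ : ℂ) / (N : ℂ)) 1 u := (hasDerivAt_id' u).sub_const _
    have d2 : HasDerivAt (fun u : ℂ => u - (x₁ : ℂ) / (N : ℂ) + 1 - (n₁ : ℂ) / (N : ℂ)) 1 u :=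
      (d1.add_const _).sub_const _
    refine (d1.div d2 h2).congr_deriv ?_
    congr 1; ring
  · intro u hu
    obtain ⟨h1, h2⟩ := base_ne_zero hN h₁ hu
    set p := u - (x₁ : ℂ) / (N : ℂ) with hpd
    set q := p + 1 - (n₁ : ℂ) / (N : ℂ) with hq
    set β := 1 - (n₁ : ℂ) / (N : ℂ) with hβ
    have hqp : 1 - p / q = β / q := by
      rw [eq_div_iff h2, sub_mul, div_mul_cancel₀ _ h2, hq, hβ]; ring
    have e1 : bulkIntegrand N x₁ n₁ x₂ n₂ u = p ^ (x₂ - x₁ - 1) /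
      q ^ (x₂ - x₁ + (n₂ : ℤ) - (n₁ : ℤ) + 1) := rfl
    have e2 : betaIntegrand x₁ n₁ x₂ n₂ (slopeMap N x₁ n₁ u) =
      (p / q) ^ (x₂ - x₁ - 1) * (1 - p / q) ^ ((n₂ : ℤ) - (n₁ : ℤ)) := rfl
    rw [e1, e2, hqp, div_zpow, div_zpow]
    have e3 : q ^ (x₂ - x₁ + (n₂ : ℤ) - (n₁ : ℤ) + 1) =
        q ^ (x₂ - x₁ - 1) * q ^ ((n₂ : ℤ) - (n₁ : ℤ)) * q ^ 2 := by
      rw [← zpow_add₀ h2, ← zpow_natCast, ← zpow_add₀ h2]; congr 1; push_cast; ring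
    have e4 : β ^ (1 + (n₂ : ℤ) - (n₁ : ℤ)) = β * β ^ ((n₂ : ℤ) - (n₁ : ℤ)) := by
      rw [add_sub_assoc, zpow_one_add₀ hpc]
    rw [e3, e4]
    have z1 := zpow_ne_zero (x₂ - x₁ - 1) h2
    have z2 := zpow_ne_zero ((n₂ : ℤ) - (n₁ : ℤ)) h2
    field_simp

/-- Every crossing point of the incomplete Beta kernel comes from one of the leading term. -/
lemma exists_cross_of_beta (hN : 0 < N) (h₁ : n₁ < N) {c : ℝ} (hc : c ∈ betaSet n₁ n₂) :
    ∃ c' ∈ crossSet N x₁ n₁ n₂, slopeMap N x₁ n₁ c' = (c : ℂ) := by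
  have hp := one_sub_pos hN h₁
  have hN' : (0 : ℝ) < N := by exact_mod_cast hN
  have e : ((x₁ : ℝ) + n₁ - N) / N = x₁ / N - (1 - n₁ / N) := by field_simp; ring
  have hc1 : 0 < 1 - c := by
    rcases le_or_gt n₁ n₂ with h | h
    · have := (hc.1 h).2; linarith
    · have := hc.2 h; linarith
  refine ⟨x₁ / N + (1 - n₁ / N) * (c / (1 - c)), ⟨fun h => ?_, fun h => ?_⟩, ?_⟩
  · have h3 := (hc.1 h).1
    have : 0 < (1 - (n₁ : ℝ) / N) * (c / (1 - c)) := by positivity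
    linarith
  · have h3 := hc.2 h
    rw [e]
    have h4 : c / (1 - c) < 0 := div_neg_of_neg_of_pos h3 hc1
    have h5 : -1 < c / (1 - c) := by rw [lt_div_iff₀ hc1]; linarith
    constructor <;> nlinarith
  · rw [slopeMap_ofReal]
    congr 1
    have h6 : (x₁ : ℝ) / N + (1 - n₁ / N) * (c / (1 - c)) - x₁ / N = (1 - n₁ / N) * (c / (1 - c)) := by
      ring
    rw [h6]
    have h7 : (1 - (n₁ : ℝ) / N) * (c / (1 - c)) + 1 - n₁ / N = (1 - n₁ / N) / (1 - c) := by
      field_simp; ring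
    rw [h7]
    generalize 1 - (n₁ : ℝ) / N = β at hp ⊢
    field_simp

end Slope

end GTBulk

end

noncomputable section

namespace GTBulk

open MeasureTheory Set Filter
open scoped BigOperators ComplexConjugate

lemma continuous_poch (m : ℕ) : Continuous fun y : ℂ => poch y m := by
  unfold poch; fun_prop

/-- The two points at which the straight paths end. -/
def IsEndpoint (N : ℕ) (x₁ : ℤ) (n₁ : ℕ) (k : ℤ) : Prop :=
  k = x₁ + N ∨ k = x₁ - ((N - n₁) / 2 : ℕ) - 1

lemma Setting.endpoint_between {D : ℝ} {d N : ℕ} {t : TopRow N} {x₁ x₂ : ℤ} {n₁ n₂ : ℕ} {σ : ℂ}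
    (h : Setting D d N t x₁ x₂ n₁ n₂ σ) (a1 : blockConst D * (4 * (d + 1) ^ 2) ≤ N) {k : ℤ}
    (hk : IsEndpoint N x₁ n₁ k) {g : ℝ} (hg : g = 1 / (4 * blockConst D)) {c : ℝ}
    (hc : c = (k : ℝ) + 1 / 2) :
    N * g ≤ |c - x₁| ∧ |c - x₁| ≤ 2 * N ∧ N * g ≤ |c - (x₁ - (N - n₁ : ℕ) : ℝ)| ∧
      |c - (x₁ - (N - n₁ : ℕ) : ℝ)| ≤ 3 * N := by
  have hQ := Setting.one_le_blockConst h.bulk.one_lt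
  set Q := blockConst D with hQd
  have hN0 := h.bulk.N_pos
  have hNn : 0 < N := by exact_mod_cast hN0
  have hN1 : (1 : ℝ) ≤ N := by exact_mod_cast hNn
  obtain ⟨m1, m2⟩ := h.block_between
  have hMN : ((N - n₁ : ℕ) : ℝ) ≤ N := by exact_mod_cast Nat.sub_le _ _
  have hM2 : (2 : ℝ) ≤ (N - n₁ : ℕ) := by
    refine le_trans ?_ m1
    rw [le_div_iff₀ (by linarith)]
    have h1 : (1 : ℝ) ≤ (d + 1) ^ 2 := one_le_pow₀ (by linarith [Nat.cast_nonneg (α := ℝ) d])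
    have : Q * 4 ≤ Q * (4 * (d + 1) ^ 2) := by
      refine mul_le_mul_of_nonneg_left ?_ (by linarith); linarith
    linarith
  have hg4 : N * g ≤ (N - n₁ : ℕ) / 4 := by
    rw [hg]
    calc (N : ℝ) * (1 / (4 * Q)) = N / Q / 4 := by field_simp
      _ ≤ _ := by
        refine div_le_div_of_nonneg_right m1 (by norm_num)
  have hg1 : N * g ≤ N := hg4.trans (by linarith)
  have hfl : ((N - n₁ : ℕ) : ℝ) / 2 - 1 / 2 ≤ (((N - n₁) / 2 : ℕ) : ℝ) ∧
      (((N - n₁) / 2 : ℕ) : ℝ) ≤ ((N - n₁ : ℕ) : ℝ) / 2 := by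
    have h1 : (N - n₁) ≤ 2 * ((N - n₁) / 2) + 1 := by omega
    have h2 : 2 * ((N - n₁) / 2) ≤ N - n₁ := by omega
    have h1' : ((N - n₁ : ℕ) : ℝ) ≤ 2 * (((N - n₁) / 2 : ℕ) : ℝ) + 1 := by exact_mod_cast h1
    have h2' : 2 * (((N - n₁) / 2 : ℕ) : ℝ) ≤ ((N - n₁ : ℕ) : ℝ) := by exact_mod_cast h2
    constructor <;> linarith
  rcases hk with rfl | rfl
  · have e : c = x₁ + N + 1 / 2 := by rw [hc, Int.cast_add, Int.cast_natCast]
    rw [e, abs_of_pos (by linarith), abs_of_pos (by linarith)]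
    refine ⟨?_, ?_, ?_, ?_⟩ <;> linarith
  · have e : c = x₁ - (((N - n₁) / 2 : ℕ) : ℝ) - 1 / 2 := by
      rw [hc, Int.cast_sub, Int.cast_sub, Int.cast_natCast, Int.cast_one]; ring
    rw [e, abs_of_neg (by linarith), abs_of_pos (by linarith)]
    refine ⟨?_, ?_, ?_, ?_⟩ <;> linarith

/-- Distances along the straight paths. -/
lemma exists_straight_between {D : ℝ} (hD : 1 < D) (d : ℕ) : ∃ R U : ℝ, 1 ≤ R ∧ 0 < U ∧
    ∀ (N : ℕ) (t : TopRow N) (x₁ x₂ : ℤ) (n₁ n₂ : ℕ) (σ : ℂ) (k : ℤ) (c : ℝ),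
    Setting D d N t x₁ x₂ n₁ n₂ σ → blockConst D * (4 * (d + 1) ^ 2) ≤ N →
    IsEndpoint N x₁ n₁ k → c = (k : ℝ) + 1 / 2 → ‖(c : ℂ) - ((N : ℝ) : ℂ) * σ‖ ≤ 2 * (N * U) ∧
    ∀ s ∈ Icc (0 : ℝ) 1, (N / R ≤ ‖(Arc.seg (((N : ℝ) : ℂ) * σ) c).fn s - x₁‖ ∧
      ‖(Arc.seg (((N : ℝ) : ℂ) * σ) c).fn s - x₁‖ ≤ N * R) ∧
      (N / R ≤ ‖(Arc.seg (((N : ℝ) : ℂ) * σ) c).fn s - x₁ + (N - n₁ : ℕ)‖ ∧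
      ‖(Arc.seg (((N : ℝ) : ℂ) * σ) c).fn s - x₁ + (N - n₁ : ℕ)‖ ≤ N * R) := by
  have hK := geoK_ge_one hD
  set K := geoK D with hKd
  have hQ := Setting.one_le_blockConst hD
  set Q := blockConst D with hQd
  set U := D + K + 3 with hU
  set g := 1 / (4 * Q) with hg
  have hg0 : 0 < g := by positivity
  have hU0 : 0 < U := by positivity
  set κ := min (1 / (2 * D)) (g / (2 * (1 + D * U))) with hκ
  have hκ0 : 0 < κ := by positivity
  have hκ1 : κ ≤ 1 / (2 * D) := min_le_left _ _
  have hκ2 : κ * (1 + D * U) ≤ g / 2 := by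
    have : κ ≤ g / (2 * (1 + D * U)) := min_le_right _ _
    rw [le_div_iff₀ (by positivity)] at this
    linarith
  set R := 1 / κ + U with hR
  have hR1 : 1 ≤ R := by
    have : 0 < 1 / κ := by positivity
    linarith
  have hRκ : 1 / R ≤ κ := by
    rw [div_le_iff₀ (by linarith), hR, mul_add, mul_one_div_cancel hκ0.ne']
    have := mul_pos hκ0 hU0
    linarith
  have hUR : U ≤ R := by
    have : 0 < 1 / κ := by positivity
    linarith
  refine ⟨R, U, hR1, hU0, ?_⟩
  intro N t x₁ x₂ n₁ n₂ σ k c h a1 hk hc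
  have hN0 := h.bulk.N_pos
  have hNn : 0 < N := by exact_mod_cast hN0
  have hN1 : (1 : ℝ) ≤ N := by exact_mod_cast hNn
  obtain ⟨c1, c2, c3, c4⟩ := h.endpoint_between a1 hk hg hc
  clear_value g κ
  have hbR : |((x₁ : ℝ))| ≤ N * (K + 1) := by
    have h1 := h.bulk.geo.right
    unfold blockR at h1
    rw [abs_div, abs_of_pos hN0, div_le_iff₀ hN0] at h1
    have h2 := abs_sub_abs_le_abs_sub (x₁ : ℝ) (1 / 2)
    rw [abs_of_pos (show (0 : ℝ) < 1 / 2 by norm_num)] at h2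
    change _ ≤ K * N at h1
    linarith
  have hbL : |((x₁ - (N - n₁ : ℕ) : ℝ))| ≤ N * (K + 1) := by
    have h1 := h.bulk.geo.left
    unfold blockL at h1
    rw [abs_div, abs_of_pos hN0, div_le_iff₀ hN0] at h1
    have h2 := abs_sub_abs_le_abs_sub (x₁ - (N - n₁ : ℕ) : ℝ) (1 / 2)
    rw [abs_of_pos (show (0 : ℝ) < 1 / 2 by norm_num)] at h2
    change _ ≤ K * N at h1
    linarith
  have hbn : ‖((N : ℝ) : ℂ) * σ‖ ≤ N * D := by
    rw [norm_mul, Complex.norm_real, Real.norm_of_nonneg hN0.le]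
    exact mul_le_mul_of_nonneg_left h.bulk.norm.le hN0.le
  have hbim : N / D ≤ (((N : ℝ) : ℂ) * σ).im := by
    rw [Complex.im_ofReal_mul, div_eq_mul_one_div]
    exact mul_le_mul_of_nonneg_left h.bulk.im.le hN0.le
  have hbq : ∀ q : ℝ, |q| ≤ N * (K + 1) → ‖((N : ℝ) : ℂ) * σ - q‖ ≤ N * U := by
    intro q hq
    refine (norm_sub_le _ _).trans ?_
    rw [Complex.norm_real, Real.norm_eq_abs, hU]
    nlinarith
  have h3U : 3 * (N : ℝ) ≤ N * U := by rw [hU]; nlinarith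
  have hlen : ‖(c : ℂ) - ((N : ℝ) : ℂ) * σ‖ ≤ 2 * (N * U) := by
    have h2 := hbq x₁ hbR
    rw [norm_sub_rev] at h2
    have h3 := norm_add_le (((c : ℝ) : ℂ) - ((x₁ : ℝ) : ℂ)) (((x₁ : ℝ) : ℂ) - ((N : ℝ) : ℂ) * σ)
    rw [sub_add_sub_cancel, ← Complex.ofReal_sub, Complex.norm_real, Real.norm_eq_abs] at h3
    linarith
  refine ⟨hlen, ?_⟩
  intro s hs
  have e1 := seg_between hN0 (by linarith) hg0 hbim (hbq _ hbR) (c2.trans (by linarith)) c1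
    hκ1 hκ2 hκ0 hs
  have e2 := seg_between hN0 (by linarith) hg0 hbim (hbq _ hbL) (c4.trans h3U) c3
    hκ1 hκ2 hκ0 hs
  have f1 : (N : ℝ) / R ≤ N * κ := by
    rw [div_eq_mul_one_div (N : ℝ)]; exact mul_le_mul_of_nonneg_left hRκ hN0.le
  have f2 : (N : ℝ) * U ≤ N * R := mul_le_mul_of_nonneg_left hUR hN0.le
  have f3 : ∀ z : ℂ, z - ((x₁ - (N - n₁ : ℕ) : ℝ) : ℂ) = z - x₁ + (N - n₁ : ℕ) := by
    intro z; push_cast; ring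
  rw [f3] at e2
  have f4 : ∀ z : ℂ, z - ((x₁ : ℝ) : ℂ) = z - x₁ := by intro z; push_cast; ring
  rw [f4] at e1
  exact ⟨⟨f1.trans e1.1, e1.2.trans f2⟩, f1.trans e2.1, e2.2.trans f2⟩
lemma straight_cross_sub {N n₁ n₂ : ℕ} (hN : 0 < N) (x₁ x₂ : ℤ) {σ : ℂ}
    (hb : 0 < (((N : ℝ) : ℂ) * σ).im) (k : ℤ) (A B : ℂ) :
    A * (straight _ hb k).cross (diagFactor N x₁ n₁ x₂ n₂) -
      B * crossingIntegral (bulkIntegrand N x₁ n₁ x₂ n₂) σ (((k : ℝ) + 1 / 2) / N) =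
    (straight _ hb k).cross (fun z => A * diagFactor N x₁ n₁ x₂ n₂ z -
        B * (bulkIntegrand N x₁ n₁ x₂ n₂ (z / N) / N)) := by
  set b := ((N : ℝ) : ℂ) * σ with hbd
  set S := straight b hb k with hS
  have hNc : (N : ℂ) ≠ 0 := by exact_mod_cast hN.ne'
  have hσ : σ = b / ((N : ℝ) : ℂ) := by rw [hbd]; push_cast; field_simp
  have e1 : crossingIntegral (bulkIntegrand N x₁ n₁ x₂ n₂) σ (((k : ℝ) + 1 / 2) / N) =
      S.cross (fun z => bulkIntegrand N x₁ n₁ x₂ n₂ (z / N) / N) := by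
    rw [hS, straight_cross, hσ, crossingIntegral_scale]
    push_cast; rfl
  have hni : ∀ z ∈ S.support, ∀ j : ℤ, z ≠ j := fun z hz j => S.not_int_support hz j
  have c1 : ContinuousOn (fun z => A * diagFactor N x₁ n₁ x₂ n₂ z) S.support := by
    refine continuousOn_const.mul (ContinuousOn.div ?_ ?_ ?_)
    · exact ((continuous_poch _).comp (by fun_prop :
        Continuous fun z : ℂ => z - (x₂ : ℂ) + 1)).continuousOn
    · exact ((continuous_poch _).comp (by fun_prop :
        Continuous fun z : ℂ => z - (x₁ : ℂ))).continuousOn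
    · intro z hz
      rw [poch_eq_prod]
      exact Finset.prod_ne_zero_iff.2 fun j _ => sub_ne_zero.2 (hni z hz j)
  have c2 : ContinuousOn (fun z => -B * (bulkIntegrand N x₁ n₁ x₂ n₂ (z / N) / N)) S.support := by
    refine continuousOn_const.mul (ContinuousOn.div_const (fun z hz => ?_) _)
    have g1 : z / N - (x₁ : ℂ) / N ≠ 0 := by
      rw [← sub_div]; exact div_ne_zero (sub_ne_zero.2 (hni z hz _)) hNc
    have g2 : z / N - (x₁ : ℂ) / N + 1 - (n₁ : ℂ) / N ≠ 0 := by
      have : z / N - (x₁ : ℂ) / N + 1 - (n₁ : ℂ) / N = (z - ((x₁ + n₁ - N : ℤ) : ℂ)) / N := by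
        push_cast; field_simp; ring
      rw [this]; exact div_ne_zero (sub_ne_zero.2 (hni z hz _)) hNc
    have h1 : ContinuousAt (fun z : ℂ => z / N) z := by fun_prop
    exact (ContinuousAt.comp (g := bulkIntegrand N x₁ n₁ x₂ n₂) (f := fun z : ℂ => z / N)
      (differentiableAt_bulkIntegrand g1 g2).continuousAt h1).continuousWithinAt
  have e2 : (fun z => A * diagFactor N x₁ n₁ x₂ n₂ z -
      B * (bulkIntegrand N x₁ n₁ x₂ n₂ (z / N) / N)) = fun z => A * diagFactor N x₁ n₁ x₂ n₂ z +
        -B * (bulkIntegrand N x₁ n₁ x₂ n₂ (z / N) / N) := by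
    funext z; ring
  rw [e1, e2, S.cross_add c1 c2, S.cross_const_mul, S.cross_const_mul]; ring

/-- The integral along a straight path, uniformly. -/
theorem exists_straight_estimate {D : ℝ} (hD : 1 < D) (d : ℕ) : ∃ C N₀ : ℝ,
    ∀ (N : ℕ) (t : TopRow N) (x₁ x₂ : ℤ) (n₁ n₂ : ℕ) (σ : ℂ), N₀ ≤ N →
    Setting D d N t x₁ x₂ n₁ n₂ σ → n₁ < N → ∀ (hb : 0 < (((N : ℝ) : ℂ) * σ).im) (k : ℤ),
    IsEndpoint N x₁ n₁ k →
      ‖((N - n₁).factorial : ℂ) / ((N - n₂ - 1).factorial : ℂ) *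
          (straight _ hb k).cross (diagFactor N x₁ n₁ x₂ n₂) -
        (1 - (n₁ : ℂ) / (N : ℂ)) ^ (1 + (n₂ : ℤ) - (n₁ : ℤ)) *
          crossingIntegral (bulkIntegrand N x₁ n₁ x₂ n₂) σ (((k : ℝ) + 1 / 2) / N)‖ ≤ C / N := by
  obtain ⟨R, U, hR1, hU0, sb⟩ := exists_straight_between hD d
  have hQ := Setting.one_le_blockConst hD
  set C₀ := blockConst D ^ d * R ^ (2 * d + 1) *
        (3 * (8 * d ^ 2 * blockConst D) + 16 * (d + 1) ^ 2 * R) with hC₀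
  have hC₀0 : 0 ≤ C₀ := by positivity
  refine ⟨2 * (C₀ * (2 * U)), blockConst D * (4 * (d + 1) ^ 2) + 8 * (d + 1) ^ 2 * R, ?_⟩
  intro N t x₁ x₂ n₁ n₂ σ hNN h h₁ hb k hk
  have hN0 := h.bulk.N_pos
  have hNn : 0 < N := by exact_mod_cast hN0
  have a1 : blockConst D * (4 * (d + 1) ^ 2) ≤ N := by
    have : 0 ≤ 8 * ((d : ℝ) + 1) ^ 2 * R := by positivity
    linarith
  have a2 : 8 * (d + 1) ^ 2 * R ≤ N := by
    have : 0 ≤ blockConst D * (4 * ((d : ℝ) + 1) ^ 2) := by positivity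
    linarith
  obtain ⟨hlen, sb⟩ := sb N t x₁ x₂ n₁ n₂ σ k _ h a1 hk rfl
  rw [straight_cross_sub hNn]
  have key := norm_crossingIntegral_le (f := fun z =>
      ((N - n₁).factorial : ℂ) / ((N - n₂ - 1).factorial : ℂ) * diagFactor N x₁ n₁ x₂ n₂ z -
      (1 - (n₁ : ℂ) / (N : ℂ)) ^ (1 + (n₂ : ℤ) - (n₁ : ℤ)) *
        (bulkIntegrand N x₁ n₁ x₂ n₂ (z / N) / N)) (C := C₀ / N ^ 2) hlen (by positivity) (by
    intro s hs
    have hs' : s ∈ Icc (0 : ℝ) 1 := Ioo_subset_Icc_self hs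
    obtain ⟨⟨s1, s2⟩, s3, s4⟩ := sb s hs'
    have him : 0 < ((Arc.seg (((N : ℝ) : ℂ) * σ) ((k : ℝ) + 1 / 2 : ℝ)).fn s).im := by
      rw [seg_im]; exact mul_pos (by linarith [hs.2]) hb
    have n1 : ‖conj ((Arc.seg (((N : ℝ) : ℂ) * σ) ((k : ℝ) + 1 / 2 : ℝ)).fn s) - x₁‖ = ‖(Arc.seg (((N : ℝ) : ℂ) * σ) ((k : ℝ) + 1 / 2 : ℝ)).fn s - x₁‖ := by
      have := Sided.norm_conj_sub ((Arc.seg (((N : ℝ) : ℂ) * σ) ((k : ℝ) + 1 / 2 : ℝ)).fn s) (x₁ : ℝ)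
      simpa using this
    have n2 : ‖conj ((Arc.seg (((N : ℝ) : ℂ) * σ) ((k : ℝ) + 1 / 2 : ℝ)).fn s) - x₁ + (N - n₁ : ℕ)‖ =
        ‖(Arc.seg (((N : ℝ) : ℂ) * σ) ((k : ℝ) + 1 / 2 : ℝ)).fn s - x₁ + (N - n₁ : ℕ)‖ := by
      have := Sided.norm_conj_sub ((Arc.seg (((N : ℝ) : ℂ) * σ) ((k : ℝ) + 1 / 2 : ℝ)).fn s) (x₁ - (N - n₁ : ℕ) : ℝ)
      have f3 : ∀ z : ℂ, z - ((x₁ - (N - n₁ : ℕ) : ℝ) : ℂ) = z - x₁ + (N - n₁ : ℕ) := by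
        intro z; push_cast; ring
      rwa [f3, f3] at this
    constructor
    · have := h.norm_diagFactor_sub_le h₁ hR1 a1 a2 (not_int_of_im him.ne') s1 s2 s3 s4
      exact this
    · have := h.norm_diagFactor_sub_le h₁ hR1 a1 a2 (z := conj ((Arc.seg (((N : ℝ) : ℂ) * σ) ((k : ℝ) + 1 / 2 : ℝ)).fn s))
        (not_int_of_im (by rw [Complex.conj_im]; exact (neg_neg_of_pos him).ne))
        (by rw [n1]; exact s1) (by rw [n1]; exact s2) (by rw [n2]; exact s3) (by rw [n2]; exact s4)
      exact this) hb rfl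
  refine key.trans (le_of_eq ?_)
  field_simp

end GTBulk

end

noncomputable section

namespace GTBulk

open MeasureTheory Set Filter
open scoped BigOperators ComplexConjugate

/-- The endpoint of the straight path. -/
def endpoint (N : ℕ) (x₁ : ℤ) (n₁ n₂ : ℕ) : ℤ :=
  if n₁ ≤ n₂ then x₁ + N else x₁ - ((N - n₁) / 2 : ℕ) - 1

lemma isEndpoint_endpoint (N : ℕ) (x₁ : ℤ) (n₁ n₂ : ℕ) :
    IsEndpoint N x₁ n₁ (endpoint N x₁ n₁ n₂) := by
  unfold endpoint
  split_ifs
  · exact Or.inl rfl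
  · exact Or.inr rfl

lemma endpoint_mem_crossSet {N n₁ n₂ : ℕ} (hN : 0 < N) (x₁ : ℤ) (h₁ : n₁ + 4 ≤ N) :
    ((endpoint N x₁ n₁ n₂ : ℝ) + 1 / 2) / N ∈ crossSet N x₁ n₁ n₂ := by
  have hN' : (0 : ℝ) < N := by exact_mod_cast hN
  unfold endpoint
  refine ⟨fun h => ?_, fun h => ?_⟩
  · rw [if_pos h, div_lt_div_iff_of_pos_right hN', Int.cast_add, Int.cast_natCast]
    linarith
  · rw [if_neg (not_le.2 h), mem_Ioo, div_lt_div_iff_of_pos_right hN',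
      div_lt_div_iff_of_pos_right hN', Int.cast_sub, Int.cast_sub, Int.cast_natCast, Int.cast_one]
    have h2 : n₁ + ((N - n₁) / 2 + 1) < N := by omega
    have h2' : (n₁ : ℝ) + ((((N - n₁) / 2 : ℕ) : ℝ) + 1) < N := by exact_mod_cast h2
    have h3 : (0 : ℝ) ≤ (((N - n₁) / 2 : ℕ) : ℝ) := Nat.cast_nonneg _
    constructor <;> linarith

/-- The indicator term of the kernel. -/
def indicatorTerm (x₁ x₂ : ℤ) (n₁ n₂ : ℕ) : ℂ :=
  if n₂ < n₁ ∧ x₂ ≤ x₁ then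
    poch ((x₁ : ℂ) - (x₂ : ℂ) + 1) (n₁ - n₂ - 1) / ((n₁ - n₂ - 1).factorial : ℂ) else 0

/-- Moving the path to the straight one produces the indicator term. -/
lemma cross_eq_straight_add {N n₁ n₂ d : ℕ} {x₁ x₂ k : ℤ} (h₁ : n₁ < N)
    (hd : n₁ + 4 * (d + 1) ≤ N) (dx : |x₂ - x₁| ≤ d)
    (dl : |x₂ - x₁ + (N - n₁ : ℕ) - (N - n₂ - 1 : ℕ)| ≤ d) (hk : x₁ ≤ k) {b : ℂ} (hb : 0 < b.im)
    (P : UPath b ((k : ℝ) + 1 / 2)) :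
    ((N - n₁).factorial : ℂ) / ((N - n₂ - 1).factorial : ℂ) *
      P.cross (diagFactor N x₁ n₁ x₂ n₂) =
    ((N - n₁).factorial : ℂ) / ((N - n₂ - 1).factorial : ℂ) *
      (straight b hb (endpoint N x₁ n₁ n₂)).cross (diagFactor N x₁ n₁ x₂ n₂) +
      2 * Real.pi * Complex.I * indicatorTerm x₁ x₂ n₁ n₂ := by
  set S := straight b hb (endpoint N x₁ n₁ n₂) with hS
  obtain ⟨p, hp⟩ := diagFactor_partial_fractions N x₁ n₁ x₂ n₂
  rw [abs_le] at dx dl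
  rcases le_or_gt n₁ n₂ with hn | hn
  · have he : endpoint N x₁ n₁ n₂ = x₁ + N := if_pos hn
    have hi : indicatorTerm x₁ x₂ n₁ n₂ = 0 := if_neg fun h => (not_lt.2 hn) h.1
    have hno : ∀ (c₁ c₂ : ℝ), (x₁ : ℝ) < c₁ → (pochRoots x₁ (N - n₁ + 1)).filter
        (fun j : ℤ => c₁ < (j : ℝ) ∧ (j : ℝ) < c₂) = ∅ := by
      intro c₁ c₂ hc
      refine Finset.filter_eq_empty_iff.2 fun j hj hj' => ?_
      simp only [pochRoots, Finset.mem_Ioc] at hj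
      have : (j : ℝ) ≤ x₁ := by exact_mod_cast hj.2
      linarith [hj'.1]
    have hkR : (x₁ : ℝ) ≤ k := by exact_mod_cast hk
    have hxe : (x₁ : ℝ) < (endpoint N x₁ n₁ n₂ : ℝ) + 1 / 2 := by
      rw [he, Int.cast_add, Int.cast_natCast]
      have : (0 : ℝ) ≤ N := Nat.cast_nonneg _
      linarith
    have : P.cross (diagFactor N x₁ n₁ x₂ n₂) = S.cross (diagFactor N x₁ n₁ x₂ n₂) := by
      rcases le_total ((endpoint N x₁ n₁ n₂ : ℝ) + 1 / 2) ((k : ℝ) + 1 / 2) with hle | hle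
      · have := UPath.loop_rational P S hle hb.ne' _ _ p.differentiable hp
        rw [hno _ _ hxe, Finset.sum_empty, mul_zero] at this
        exact sub_eq_zero.1 this
      · have := UPath.loop_rational S P hle hb.ne' _ _ p.differentiable hp
        rw [hno _ _ (by linarith), Finset.sum_empty, mul_zero] at this
        exact (sub_eq_zero.1 this).symm
    rw [this, hi, mul_zero, add_zero]
  · have he : endpoint N x₁ n₁ n₂ = x₁ - ((N - n₁) / 2 : ℕ) - 1 := if_neg (not_le.2 hn)
    have hlt : endpoint N x₁ n₁ n₂ < k := by rw [he]; omega
    have hle : (endpoint N x₁ n₁ n₂ : ℝ) + 1 / 2 ≤ (k : ℝ) + 1 / 2 := by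
      have : (endpoint N x₁ n₁ n₂ : ℝ) < k := by exact_mod_cast hlt
      linarith
    have h2 : endpoint N x₁ n₁ n₂ + 1 ≤ x₂ := by rw [he]; omega
    have h3 : x₂ - (N - n₂ - 1 : ℕ) ≤ endpoint N x₁ n₁ n₂ := by rw [he]; omega
    have h2' : (endpoint N x₁ n₁ n₂ : ℝ) + 1 ≤ x₂ := by exact_mod_cast h2
    have h3' : (x₂ : ℝ) - (N - n₂ - 1 : ℕ) ≤ endpoint N x₁ n₁ n₂ := by exact_mod_cast h3
    have hres := sum_diagRes_right (x₁ := x₁) h₁ hn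
      (show (endpoint N x₁ n₁ n₂ : ℝ) + 1 / 2 < x₂ by linarith) (by linarith)
    have hloop := UPath.loop_rational P S hle hb.ne' _ _ p.differentiable hp
    have hfil : (pochRoots x₁ (N - n₁ + 1)).filter (fun j : ℤ =>
        (endpoint N x₁ n₁ n₂ : ℝ) + 1 / 2 < (j : ℝ) ∧ (j : ℝ) < (k : ℝ) + 1 / 2) =
        (pochRoots x₁ (N - n₁ + 1)).filter (fun j : ℤ =>
          (endpoint N x₁ n₁ n₂ : ℝ) + 1 / 2 < (j : ℝ)) := by
      refine Finset.filter_congr fun j hj => and_iff_left ?_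
      simp only [pochRoots, Finset.mem_Ioc] at hj
      have : (j : ℝ) ≤ k := by exact_mod_cast hj.2.trans hk
      linarith
    rw [hfil] at hloop
    rw [indicatorTerm, ← hres, eq_add_of_sub_eq hloop]
    ring

lemma norm_inv_two_pi_I_le : ‖1 / (2 * (Real.pi : ℂ) * Complex.I)‖ ≤ 1 := by
  have := Real.pi_gt_three
  rw [norm_div, norm_one, norm_mul, norm_mul, Complex.norm_I, Complex.norm_real, Complex.norm_two,
    Real.norm_of_nonneg Real.pi_pos.le]
  rw [div_le_one (by positivity)]
  linarith

/-- The kernel is close to its leading term for one crossing point. -/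
theorem exists_kernel_estimate {D : ℝ} (hD : 1 < D) (d : ℕ) {ε : ℝ} (hε : 0 < ε) : ∃ N₀ : ℕ,
    ∀ (N : ℕ) [NeZero N] (t : TopRow N) (x₁ x₂ : ℤ) (n₁ n₂ : ℕ) (σ : ℂ), N₀ ≤ N →
    Setting D d N t x₁ x₂ n₁ n₂ σ → n₁ < N → ∀ R : ℝ, IsLargeRadius N t x₁ n₁ x₂ R →
    n₁ + 4 ≤ N ∧ ‖petrovKernel N t x₁ n₁ x₂ n₂ R - bulkTerm N x₁ n₁ x₂ n₂ (((N : ℝ) : ℂ) * σ)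
      (((endpoint N x₁ n₁ n₂ : ℝ) + 1 / 2) / N)‖ < ε := by
  obtain ⟨C, A, hC⟩ := exists_doubleIntegral_estimate hD d
  obtain ⟨C', A', hC'⟩ := exists_straight_estimate hD d
  have l1 : Tendsto (fun N : ℕ => C * (N : ℝ) ^ (-(1 / 4) : ℝ) + C' / N) atTop (nhds (C * 0 + 0)) :=
    (((tendsto_rpow_neg_atTop (by norm_num : (0 : ℝ) < 1 / 4)).comp
      tendsto_natCast_atTop_atTop).const_mul C).add (tendsto_const_div_atTop_nhds_zero_nat C')
  have l2 := l1.eventually_lt_const (show C * 0 + 0 < ε by simpa using hε)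
  have l3 : ∀ B : ℝ, ∀ᶠ N : ℕ in atTop, B ≤ N := fun B =>
    tendsto_natCast_atTop_atTop.eventually_ge_atTop B
  obtain ⟨N₀, hN₀⟩ := eventually_atTop.1 (l2.and ((l3 A).and ((l3 A').and
    (l3 (blockConst D * (4 * (d + 1) ^ 2))))))
  refine ⟨N₀, ?_⟩
  intro N _ t x₁ x₂ n₁ n₂ σ hN h h₁ R hR
  obtain ⟨e1, e2, e3, e4⟩ := hN₀ N hN
  have hN0 := h.bulk.N_pos
  have hbig : n₁ + 4 * (d + 1) ≤ N := by
    have h5 := h.block_between.1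
    have hQ := Setting.one_le_blockConst hD
    have h6 : (4 * (d + 1) ^ 2 : ℝ) ≤ (N - n₁ : ℕ) := by
      refine le_trans ?_ h5
      rw [le_div_iff₀ (by linarith)]; linarith
    have h7 : 4 * (d + 1) ^ 2 ≤ N - n₁ := by exact_mod_cast h6
    nlinarith [Nat.sub_add_cancel h₁.le]
  refine ⟨by omega, ?_⟩
  have hb : 0 < (((N : ℝ) : ℂ) * σ).im := by
    rw [Complex.im_ofReal_mul]; exact mul_pos hN0 h.bulk.im_pos
  obtain ⟨k, P, hk, hP⟩ := hC N t x₁ x₂ n₁ n₂ σ e2 h R hR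
  have hS := hC' N t x₁ x₂ n₁ n₂ σ e3 h h₁ hb _ (isEndpoint_endpoint N x₁ n₁ n₂)
  rw [P.cross_congr_support (fun z hz => zFactor_mul_wFactor (P.not_int_support hz)), mul_sub,
    mul_left_comm, cross_eq_straight_add h₁ hbig h.dx h.dl hk hb P] at hP
  have hNc : (N : ℂ) ≠ 0 := by exact_mod_cast hN0.ne'
  have hσ : ((N : ℝ) : ℂ) * σ / N = σ := by rw [Complex.ofReal_natCast]; field_simp
  have hpi : (2 * (Real.pi : ℂ) * Complex.I) ≠ 0 := Complex.two_pi_I_ne_zero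
  set q := 2 * (Real.pi : ℂ) * Complex.I with hq
  set X := ∮ z in C(((zCenter t x₂ : ℝ) : ℂ), zRadius t x₂), ∮ w in C((0 : ℂ), R),
          kernelIntegrand N t x₁ n₁ x₂ n₂ z w with hX
  set F := ((N - n₁).factorial : ℂ) / ((N - n₂ - 1).factorial : ℂ) with hF
  set Y := (straight _ hb (endpoint N x₁ n₁ n₂)).cross (diagFactor N x₁ n₁ x₂ n₂) with hY
  have hbt : bulkTerm N x₁ n₁ x₂ n₂ (((N : ℝ) : ℂ) * σ)
      (((endpoint N x₁ n₁ n₂ : ℝ) + 1 / 2) / N) = 1 / q *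
      ((1 - (n₁ : ℂ) / (N : ℂ)) ^ (1 + (n₂ : ℤ) - (n₁ : ℤ)) *
        crossingIntegral (bulkIntegrand N x₁ n₁ x₂ n₂) σ
          (((endpoint N x₁ n₁ n₂ : ℝ) + 1 / 2) / N)) := by
    unfold bulkTerm
    rw [hσ, div_mul_eq_mul_div, one_div_mul_eq_div]
    rfl
  have hpk : petrovKernel N t x₁ n₁ x₂ n₂ R =
      -indicatorTerm x₁ x₂ n₁ n₂ + F * (1 / q ^ 2 * X) := rfl
  rw [hbt, hpk]
  set Z := (1 - (n₁ : ℂ) / (N : ℂ)) ^ (1 + (n₂ : ℤ) - (n₁ : ℤ)) *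
        crossingIntegral (bulkIntegrand N x₁ n₁ x₂ n₂) σ
          (((endpoint N x₁ n₁ n₂ : ℝ) + 1 / 2) / N)
  have key : -indicatorTerm x₁ x₂ n₁ n₂ + F * (1 / q ^ 2 * X) - 1 / q * Z =
      1 / q * (1 / q * (F * X - q * (F * Y + q * indicatorTerm x₁ x₂ n₁ n₂))) +
        1 / q * (F * Y - Z) := by
    field_simp; ring
  rw [key]
  have hq1 : ‖1 / q‖ ≤ 1 := norm_inv_two_pi_I_le
  have hmul : ∀ y : ℂ, ‖1 / q * y‖ ≤ ‖y‖ := fun y => by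
    rw [norm_mul]; exact mul_le_of_le_one_left (norm_nonneg _) hq1
  calc _ ≤ C * (N : ℝ) ^ (-(1 / 4) : ℝ) + C' / N :=
        (norm_add_le _ _).trans (add_le_add ((hmul _).trans ((hmul _).trans hP)) ((hmul _).trans hS))
    _ < ε := e1

/-- The hypotheses of the theorem in scaled form. -/
lemma setting_of_hypotheses {D : ℝ} (hD : 1 < D) {N : ℕ} (hN : 32 * D ≤ N) {t : TopRow N}
    (ht : StrictAnti t)
    (hlog : ∑ i : Fin N, Real.log (1 + |(t i : ℝ)| / (N : ℝ)) ^ (1 + 1 / D) < D * (N : ℝ))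
    {x₁ x₂ : ℤ} {n₁ n₂ : ℕ} (h₁ : n₁ < N) (h₂ : 1 ≤ n₂) (h₂' : n₂ < N)
    (hn : (N : ℝ) / D < n₁) (hd : |(x₁ : ℝ) - (x₂ : ℝ)| + |(n₁ : ℝ) - (n₂ : ℝ)| < D) {τ : ℂ}
    (hτ : IsUpperCriticalPoint N t x₁ n₁ τ) (him : (N : ℝ) / D < τ.im) (hnorm : ‖τ‖ < D * N) :
    Setting D (⌈D⌉₊ + 1) N t x₁ x₂ n₁ n₂ (τ / ((N : ℝ) : ℂ)) := by
  have hN0 : (0 : ℝ) < N := by linarith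
  have hNn : 0 < N := by exact_mod_cast hN0
  have hNc : ((N : ℝ) : ℂ) ≠ 0 := by exact_mod_cast hN0.ne'
  have hsum : |x₁ - x₂| + |(n₁ : ℤ) - n₂| ≤ ⌈D⌉₊ := by
    have : ((|x₁ - x₂| + |(n₁ : ℤ) - n₂| : ℤ) : ℝ) ≤ ((⌈D⌉₊ : ℤ) : ℝ) := by
      push_cast
      exact hd.le.trans (Nat.le_ceil D)
    exact_mod_cast this
  have ha := abs_le.1 (le_refl |x₁ - x₂|)
  have hb := abs_le.1 (le_refl |(n₁ : ℤ) - n₂|)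
  refine ⟨ht, ⟨hD, hN, ?_, card_filter_cutoff_le hD hNn ht hlog, ?_, ?_, ?_, ?_⟩, h₂, h₂', ?_, ?_, ?_⟩
  · rw [rowSet, Finset.card_image_of_injective _ ht.injective]; simp
  · rw [Nat.cast_sub h₁.le]; linarith
  · have e : (N : ℂ) * (τ / ((N : ℝ) : ℂ)) = τ := by
      rw [Complex.ofReal_natCast] at hNc ⊢; field_simp
    rw [e, rowSet, Finset.sum_image fun a _ b _ h => ht.injective h, ← hτ.2]
    symm
    refine Finset.sum_bij (fun a _ => x₁ - (a : ℤ)) ?_ ?_ ?_ ?_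
    · intro a ha; rw [Finset.mem_Icc] at ha; rw [mem_block]; omega
    · intro a _ b _ h; simpa using h
    · intro k hk
      rw [mem_block] at hk
      exact ⟨(x₁ - k).toNat, by rw [Finset.mem_Icc]; omega, by omega⟩
    · intro a _; push_cast; rw [← sub_add]
  · rw [Complex.div_ofReal_im, lt_div_iff₀ hN0]; linarith [one_div_mul_eq_div D (N : ℝ)]
  · rw [norm_div, Complex.norm_real, Real.norm_of_nonneg hN0.le, div_lt_iff₀ hN0]; exact hnorm
  all_goals rw [abs_le]; push_cast; omega

end GTBulk

end

theorem mainTheorem2 (D : ℝ) (hD : 0 < D) :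
    ∀ ε : ℝ, 0 < ε → ∃ N₀ : ℕ, ∀ (N : ℕ) [NeZero N], N₀ ≤ N →
      ∀ (t : GTBulk.TopRow N), StrictAnti t →
      ∑ i : Fin N, Real.log (1 + |(t i : ℝ)| / (N : ℝ)) ^ (1 + 1 / D) < D * (N : ℝ) →
      ∀ (x₁ x₂ : ℤ) (n₁ n₂ : ℕ), 1 ≤ n₁ → n₁ < N → 1 ≤ n₂ → n₂ < N →
      (N : ℝ) / D < (n₁ : ℝ) →
      |(x₁ : ℝ) - (x₂ : ℝ)| + |(n₁ : ℝ) - (n₂ : ℝ)| < D →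
      ∀ (τ₁ τ₂ : ℂ),
      GTBulk.IsUpperCriticalPoint N t x₁ n₁ τ₁ → GTBulk.IsUpperCriticalPoint N t x₂ n₂ τ₂ →
      (N : ℝ) / D < τ₁.im → (N : ℝ) / D < τ₂.im →
      ‖τ₁‖ < D * (N : ℝ) → ‖τ₂‖ < D * (N : ℝ) →
      ∀ (R : ℝ), GTBulk.IsLargeRadius N t x₁ n₁ x₂ R →
        (∀ c : ℝ,
          (n₁ ≤ n₂ → (x₁ : ℝ) / (N : ℝ) < c) →
          (n₂ < n₁ → c ∈ Set.Ioo (((x₁ : ℝ) + (n₁ : ℝ) - (N : ℝ)) / (N : ℝ))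
            ((x₁ : ℝ) / (N : ℝ))) →
          ‖GTBulk.petrovKernel N t x₁ n₁ x₂ n₂ R - GTBulk.bulkTerm N x₁ n₁ x₂ n₂ τ₁ c‖ < ε) ∧
        (∀ c : ℝ,
          (n₁ ≤ n₂ → c ∈ Set.Ioo (0 : ℝ) 1) →
          (n₂ < n₁ → c < 0) →
          ‖GTBulk.petrovKernel N t x₁ n₁ x₂ n₂ R -
            GTBulk.incompleteBeta (GTBulk.complexSlope N x₁ n₁ τ₁) x₁ n₁ x₂ n₂ c‖ < ε) := by
  intro ε hε
  by_cases hD1 : 1 < D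
  · obtain ⟨N₀, hN₀⟩ := GTBulk.exists_kernel_estimate hD1 (⌈D⌉₊ + 1) hε
    refine ⟨max N₀ ⌈32 * D⌉₊, ?_⟩
    intro N _ hN t ht hlog x₁ x₂ n₁ n₂ _ h₁ h₂ h₂' hn hd τ₁ τ₂ hτ _ him _ hnorm _ R hR
    have hN32 : 32 * D ≤ N := Nat.ceil_le.1 ((le_max_right _ _).trans hN)
    have hNn : 0 < N := Nat.pos_of_ne_zero (NeZero.ne N)
    have hN0 : (0 : ℝ) < N := by exact_mod_cast hNn
    have hNc : ((N : ℝ) : ℂ) ≠ 0 := by exact_mod_cast hN0.ne'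
    have hS := GTBulk.setting_of_hypotheses hD1 hN32 ht hlog h₁ h₂ h₂' hn hd hτ him hnorm
    obtain ⟨hn4, hest⟩ := hN₀ N t x₁ x₂ n₁ n₂ _ ((le_max_left _ _).trans hN) hS h₁ R hR
    rw [mul_div_cancel₀ _ hNc] at hest
    have hb : 0 < (τ₁ / (N : ℂ)).im := by
      have := hS.bulk.im_pos
      rwa [Complex.ofReal_natCast] at this
    have hbulk : ∀ c ∈ GTBulk.crossSet N x₁ n₁ n₂,
        ‖GTBulk.petrovKernel N t x₁ n₁ x₂ n₂ R - GTBulk.bulkTerm N x₁ n₁ x₂ n₂ τ₁ c‖ < ε := by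
      intro c hc
      have e : GTBulk.bulkTerm N x₁ n₁ x₂ n₂ τ₁ c = GTBulk.bulkTerm N x₁ n₁ x₂ n₂ τ₁
          (((GTBulk.endpoint N x₁ n₁ n₂ : ℝ) + 1 / 2) / N) :=
        congrArg (_ / (2 * (Real.pi : ℂ) * Complex.I) * ·)
          ((GTBulk.holoAcross_bulkIntegrand hNn h₁).crossingIntegral_eq hb hc
            (GTBulk.endpoint_mem_crossSet hNn x₁ hn4))
      rwa [e]
    refine ⟨fun c c1 c2 => hbulk c ⟨c1, c2⟩, fun c c1 c2 => ?_⟩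
    obtain ⟨c', hc', hcc⟩ := GTBulk.exists_cross_of_beta (x₁ := x₁) hNn h₁
      (show c ∈ GTBulk.betaSet n₁ n₂ from ⟨c1, c2⟩)
    have e : GTBulk.bulkTerm N x₁ n₁ x₂ n₂ τ₁ c' =
        GTBulk.incompleteBeta (GTBulk.complexSlope N x₁ n₁ τ₁) x₁ n₁ x₂ n₂ c := by
      have := GTBulk.bulk_eq_beta (x₂ := x₂) hNn h₁ hb hc' hcc
      unfold GTBulk.bulkTerm GTBulk.incompleteBeta
      rw [div_mul_eq_mul_div, one_div_mul_eq_div]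
      exact congrArg (· / _) this
    rw [← e]
    exact hbulk c' hc'
  · refine ⟨0, ?_⟩
    intro N _ _ t _ _ x₁ x₂ n₁ n₂ _ h₁ _ _ hn
    exfalso
    have h1 : (n₁ : ℝ) < N := by exact_mod_cast h₁
    have h2 : (N : ℝ) ≤ N / D := by
      rw [le_div_iff₀ hD]
      nlinarith [Nat.cast_nonneg (α := ℝ) N, not_lt.1 hD1]
    linarith
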